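/- Let $X$ be a real or complex Banach space of cotype $r$ for some $2\le r<\infty$, i.e. there is a constant $C$ such that $\bigl(\sum_{i=1}^n\|x_i\|^r\bigr)^{1/r}\le C\,2^{-n}\sum_{\varepsilon\in\{-1,1\}^n}\bigl\|\sum_{i=1}^n\varepsilon_i x_i\bigr\|$ for all $n$ and all $x_1,\dots,x_n\in X$. A basis of a Banach space is called $1$-unconditional if it is unconditional and $\bigl\|\sum_j\varepsilon_j t_je_j\bigr\|\le\bigl\|\sum_j t_je_j\bigr\|$ for all convergent sums $\sum_j t_je_j$ and all signs $\varepsilon_j=\pm1$. A Banach space $Y$ has local unconditional structure if there is $C\ge1$ such that for every finite-dimensional subspace $Y_0\subset Y$ there are a Banach space $F$ with a (finite or countably infinite) $1$-unconditional basis and bounded linear operators $u:Y_0\to F$ and $w:F\to Y$ with $wu(y)=y$ for all $y\in Y_0$ and $\|u\|\,\|w\|\le C$. (1) If $X$ has an (infinite) unconditional basis and contains no subspace isomorphic to $\ell_2$, then $X$ has a closed subspace $Y$ that has a Schauder basis but does not have local unconditional structure. (2) In particular, if $X$ is infinite-dimensional (and not assumed to have an unconditional basis), then $X$ contains either a subspace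 isomorphic to $\ell_2$ or an infinite-dimensional closed subspace without an unconditional basis. -/

import Mathlib

universe u v

/-- The Banach space `X` has (Rademacher) cotype `r`: for some constant `C`, all `n` and all
`x₁, …, xₙ ∈ X` one has `(∑ ‖xᵢ‖ ^ r) ^ (1 / r) ≤ C * ∫₀¹ ‖∑ rᵢ(t) xᵢ‖ dt`. The integral of the
Rademacher sum is written as the average over all choices of signs. -/
def HasCotype (X : Type u) [NormedAddCommGroup X] (r : ℝ) : Prop :=
  ∃ C : ℝ, ∀ (n : ℕ) (x : Fin n → X),
    (∑ i, ‖x i‖ ^ r) ^ (1 / r) ≤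
      C * (((2 : ℝ) ^ n)⁻¹ * ∑ ε : Fin n → ℤˣ, ‖∑ i, ε i • x i‖)

/-- `X` has an unconditional basis `e₀, e₁, e₂, …` (an infinite sequence). -/
def HasUnconditionalBasis (𝕜 : Type v) [RCLike 𝕜] (X : Type u) [NormedAddCommGroup X]
    [NormedSpace 𝕜 X] : Prop :=
  Nonempty (UnconditionalSchauderBasis ℕ 𝕜 X)

/-- An unconditional basis is `1`-unconditional: changing the signs of the coordinates of a vector
does not increase its norm. -/
def IsOneUnconditional {𝕜 : Type v} [RCLike 𝕜] {F : Type u} [NormedAddCommGroup F]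
    [NormedSpace 𝕜 F] {β : Type} (b : UnconditionalSchauderBasis β 𝕜 F) : Prop :=
  ∀ (ε : β → ℤˣ) (x : F), ∃ y : F,
    HasSum (fun j => ε j • (b.coord j x • b j)) y ∧ ‖y‖ ≤ ‖x‖

/-- `X` has local unconditional structure: for some `C ≥ 1` the inclusion of every
finite-dimensional subspace `X₀` into `X` factors as `w ∘ u` with `‖u‖ * ‖w‖ ≤ C` through a Banach
space `F` with a (finite or countably infinite) `1`-unconditional basis. -/
def HasLocalUnconditionalStructure (𝕜 : Type v) [RCLike 𝕜] (X : Type u) [NormedAddCommGroup X]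
    [NormedSpace 𝕜 X] : Prop :=
  ∃ C : ℝ, 1 ≤ C ∧ ∀ X₀ : Submodule 𝕜 X, FiniteDimensional 𝕜 X₀ →
    ∃ (F : Type u) (_ : NormedAddCommGroup F) (_ : NormedSpace 𝕜 F) (_ : CompleteSpace F)
      (β : Type) (_ : Countable β) (b : UnconditionalSchauderBasis β 𝕜 F)
      (u : X₀ →L[𝕜] F) (w : F →L[𝕜] X),
      IsOneUnconditional b ∧ (∀ x : X₀, w (u x) = x) ∧ ‖u‖ * ‖w‖ ≤ C

/-- `X` contains a subspace isomorphic (linearly homeomorphic) to `ℓ₂`. -/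
def ContainsEllTwo (𝕜 : Type v) [RCLike 𝕜] (X : Type u) [NormedAddCommGroup X]
    [NormedSpace 𝕜 X] : Prop :=
  ∃ Z : Submodule 𝕜 X, Nonempty (Z ≃L[𝕜] lp (fun _ : ℕ => 𝕜) 2)

/-!
The proof rests on one criterion: a space of finite cotype that contains an unconditional family of
three sequences `F 0`, `F 1`, `F 2` which are incomparable under every colouring of the indices with
three colours (`IsViolatingFamily`) has a subspace `Y` with a Schauder basis and without local
unconditional structure.

The subspace is spanned by the blocks `x k = F 0 k + F 2 k`, `y k = F 1 k + F 2 k`. If `Y` had local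
unconditional structure, its inclusion of a finite-dimensional subspace would factor through a
`1`-unconditional basis, and one could insert in the `k`-th block a change of signs `M k` of that
basis. By Maurey's inequality for spaces of finite cotype (`CotypeWith.sum_norm_signs_le`) the block
diagonal operator whose `k`-th block is the compression of `w ∘ M k ∘ u` is bounded uniformly, and
the signs can be chosen so that no `2 × 2` block is close to a scalar matrix
(`HasLocalUnconditionalStructure.exists_blockDiagonal`). But a block which is not scalar moves one of
`y k`, `x k`, `x k - y k` out of its line, into the sequence `F 0`, `F 1` or `F 2` respectively that
it does not involve; colouring the indices accordingly contradicts the incomparability of the three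
sequences (`IsViolatingFamily.exists_subspace`).

It remains to find such a family in a space `X` with an unconditional basis which does not contain
`ℓ_2`. The question is transferred to lattice norms on finitely supported sequences (`LNorm`,
`Violates`), the norm of `X` becoming `latticeLNorm`. Suppose that a norm admits no incomparable
families. Then

* among the spreading norms represented in it there is a minimal one, because a strictly decreasing
  chain of length four would give incomparable families (`exists_minimal_of_not_violates`);
* some block sequence is equivalent to such a spreading norm (`exists_spread_embBy`): a subsequence is
  dominated by its spreading model, and six subsequences together dominate it;
* the minimal norm `e` is multiplicative, up to constants: `e (b ⊗ x) ≈ e b * e x`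
  (`exists_multiplicative`);
* a multiplicative spreading norm with values at indicators growing like a power, which is a
  consequence of cotype, is equivalent to the norm of some `ℓ_p`, by comparison on high tensor powers
  (`exists_equiv_psum`).

So `X` contains a block sequence equivalent to the unit vector basis of `ℓ_p`
(`exists_subspace_or_isEllSeq`), with `p ≠ 2`. In `ℓ_p` Rademacher functions span copies of `ℓ_2`
(`IsEllSeq.exists_mixedNorm`). Take the points of a three-dimensional grid as indices and let the
vectors of the `i`-th sequence share a copy of `ℓ_2` according to the `i`-th coordinate if `p < 2`,
and according to the other two if `p > 2`. Every colouring of a large grid by the three directions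
has a line with many points whose colour is the direction of the line (`exists_line_of_colouring`),
and on this line the `n ^ (1 / p)` and `n ^ (1 / 2)` behaviour of the sequences differs
(`IsEllSeq.exists_subspace`).

The second part follows: a complete space with an unconditional basis has local unconditional
structure, since it can be renormed to make the basis `1`-unconditional
(`HasUnconditionalBasis.hasLocalUnconditionalStructure`), so either `X` itself has no unconditional
basis or the first part gives a subspace without one.
-/

open Finset Filter Topology

/-! ### Random signs -/

theorem signs_norm_smul {E : Type*} [SeminormedAddCommGroup E] (s : ℤˣ) (x : E) :
    ‖s • x‖ = ‖x‖ := by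
  rcases Int.units_eq_one_or s with h | h <;> simp [h]

theorem signs_sum_norm_sq {𝕜 : Type*} [RCLike 𝕜] {ι : Type*} [Fintype ι] [DecidableEq ι]
    (a : ι → 𝕜) :
    ∑ ε : ι → ℤˣ, ‖∑ l, ε l • a l‖ ^ 2 = Fintype.card (ι → ℤˣ) * ∑ l, ‖a l‖ ^ 2 := by
  suffices H : ∀ s : Finset ι, ∑ ε : ι → ℤˣ, ‖∑ l ∈ s, ε l • a l‖ ^ 2 =
      Fintype.card (ι → ℤˣ) * ∑ l ∈ s, ‖a l‖ ^ 2 from H univ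
  intro s
  induction s using Finset.induction_on with
  | empty => simp
  | insert l s hl ih =>
    have flip : ∑ ε : ι → ℤˣ, ‖∑ m ∈ insert l s, ε m • a m‖ ^ 2 =
        ∑ ε : ι → ℤˣ, ‖-(ε l • a l) + ∑ m ∈ s, ε m • a m‖ ^ 2 := by
      rw [← Equiv.sum_comp (Equiv.mulRight (Pi.mulSingle l (-1) : ι → ℤˣ))]
      refine sum_congr rfl fun ε _ => ?_
      rw [sum_insert hl]
      congr 3
      · simp
      · refine sum_congr rfl fun m hm => ?_
        have : m ≠ l := fun h => hl (h ▸ hm)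
        simp [this]
    have key : ∀ ε : ι → ℤˣ, ‖∑ m ∈ insert l s, ε m • a m‖ ^ 2 +
        ‖-(ε l • a l) + ∑ m ∈ s, ε m • a m‖ ^ 2 =
        2 * ‖a l‖ ^ 2 + 2 * ‖∑ m ∈ s, ε m • a m‖ ^ 2 := by
      intro ε
      rw [sum_insert hl]
      have := parallelogram_law_with_norm 𝕜 (∑ m ∈ s, ε m • a m) (ε l • a l)
      rw [signs_norm_smul] at this
      have e1 : ε l • a l + ∑ m ∈ s, ε m • a m = ∑ m ∈ s, ε m • a m + ε l • a l := add_comm _ _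
      have e2 : -(ε l • a l) + ∑ m ∈ s, ε m • a m = ∑ m ∈ s, ε m • a m - ε l • a l := by abel
      rw [e1, e2]
      nlinarith [this]
    have h2 := sum_congr rfl fun ε (_ : ε ∈ (univ : Finset (ι → ℤˣ))) => key ε
    rw [sum_add_distrib, ← flip, sum_add_distrib, ← mul_sum _ _ (2 : ℝ), ← mul_sum _ _ (2 : ℝ), ih] at h2
    rw [sum_insert hl]
    simp only [sum_const, card_univ, nsmul_eq_mul] at h2
    linarith

theorem signs_sum_exp {ι : Type*} [Fintype ι] [DecidableEq ι] (a : ι → ℝ) (ha : ∑ l, a l ^ 2 ≤ 1) :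
    ∑ ε : ι → ℤˣ, Real.exp (∑ l, ε l • a l) ≤ Fintype.card (ι → ℤˣ) * Real.exp 1 := by
  have h1 : ∀ ε : ι → ℤˣ, Real.exp (∑ l, ε l • a l) = ∏ l, Real.exp (ε l • a l) :=
    fun ε => Real.exp_sum _ _
  simp_rw [h1]
  have h2 := Finset.prod_univ_sum (fun _ : ι => (univ : Finset ℤˣ))
    (fun l s => Real.exp (s • a l))
  rw [Fintype.piFinset_univ] at h2
  rw [← h2]
  have h3 : ∀ l, ∑ s : ℤˣ, Real.exp (s • a l) ≤ 2 * Real.exp (a l ^ 2 / 2) := by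
    intro l
    have := Real.cosh_le_exp_half_sq (a l)
    rw [Real.cosh_eq] at this
    simp [UnitsInt.univ]
    linarith
  calc ∏ l, ∑ s : ℤˣ, Real.exp (s • a l) ≤ ∏ l, (2 * Real.exp (a l ^ 2 / 2)) :=
        prod_le_prod (fun l _ => sum_nonneg fun s _ => (Real.exp_pos _).le) fun l _ => h3 l
    _ = 2 ^ Fintype.card ι * Real.exp (∑ l, a l ^ 2 / 2) := by
        rw [prod_mul_distrib, Real.exp_sum]; simp
    _ ≤ Fintype.card (ι → ℤˣ) * Real.exp 1 := by
        rw [← sum_div]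
        have : (Fintype.card (ι → ℤˣ) : ℝ) = 2 ^ Fintype.card ι := by
          rw [Fintype.card_fun]; simp
        rw [this]
        gcongr
        linarith

/-- Moments of a real Rademacher sum, from `|x| ^ n ≤ n! (e ^ x + e ^ (-x))` and the
subgaussian bound for the exponential moments. -/
theorem signs_moment_real {ι : Type*} [Fintype ι] [DecidableEq ι] (a : ι → ℝ)
    (ha : ∑ l, a l ^ 2 ≤ 1) (n : ℕ) :
    ∑ ε : ι → ℤˣ, |∑ l, ε l • a l| ^ n ≤
      Fintype.card (ι → ℤˣ) * (n.factorial * (2 * Real.exp 1)) := by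
  have h0 : ∀ x : ℝ, |x| ^ n ≤ n.factorial * (Real.exp x + Real.exp (-x)) := by
    intro x
    have h := Real.pow_div_factorial_le_exp |x| (abs_nonneg x) n
    rw [div_le_iff₀ (by positivity)] at h
    have : Real.exp |x| ≤ Real.exp x + Real.exp (-x) := by
      rcases abs_cases x with ⟨h, _⟩ | ⟨h, _⟩ <;> rw [h] <;>
        linarith [Real.exp_pos x, Real.exp_pos (-x)]
    nlinarith [h, (Nat.cast_pos (α := ℝ)).2 n.factorial_pos]
  have h1 := signs_sum_exp a ha
  have h2 := signs_sum_exp (fun l => -a l) (by simpa using ha)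
  simp only [smul_neg, sum_neg_distrib] at h2
  calc ∑ ε : ι → ℤˣ, |∑ l, ε l • a l| ^ n
      ≤ ∑ ε : ι → ℤˣ, (n.factorial * (Real.exp (∑ l, ε l • a l) + Real.exp (-∑ l, ε l • a l)) : ℝ) :=
        sum_le_sum fun ε _ => h0 _
    _ = n.factorial * (∑ ε : ι → ℤˣ, Real.exp (∑ l, ε l • a l) +
          ∑ ε : ι → ℤˣ, Real.exp (-∑ l, ε l • a l)) := by
        rw [← mul_sum, sum_add_distrib]
    _ ≤ n.factorial * (Fintype.card (ι → ℤˣ) * Real.exp 1 +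
          Fintype.card (ι → ℤˣ) * Real.exp 1) := by gcongr
    _ = _ := by ring

/-- A bound for the `n`-th moment of a Rademacher sum `∑ ε l • a l` with `∑ ‖a l‖ ^ 2 ≤ 1`. -/
noncomputable def momentConst (n : ℕ) : ℝ := 2 ^ n * 2 * (n.factorial * (2 * Real.exp 1))

theorem momentConst_pos (n : ℕ) : 0 < momentConst n := by
  unfold momentConst; positivity

theorem signs_moment {𝕜 : Type*} [RCLike 𝕜] {ι : Type*} [Fintype ι] [DecidableEq ι] (a : ι → 𝕜)
    (ha : ∑ l, ‖a l‖ ^ 2 ≤ 1) (n : ℕ) :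
    ∑ ε : ι → ℤˣ, ‖∑ l, ε l • a l‖ ^ n ≤ Fintype.card (ι → ℤˣ) * momentConst n := by
  have hre : ∀ ε : ι → ℤˣ, RCLike.re (∑ l, ε l • a l) = ∑ l, ε l • RCLike.re (a l) := by
    intro ε
    rw [map_sum]
    refine sum_congr rfl fun l _ => ?_
    rcases Int.units_eq_one_or (ε l) with h | h <;> simp [h]
  have him : ∀ ε : ι → ℤˣ, RCLike.im (∑ l, ε l • a l) = ∑ l, ε l • RCLike.im (a l) := by
    intro ε
    rw [map_sum]
    refine sum_congr rfl fun l _ => ?_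
    rcases Int.units_eq_one_or (ε l) with h | h <;> simp [h]
  have hr := signs_moment_real (fun l => RCLike.re (a l)) ((sum_le_sum fun l _ => by
    have := RCLike.abs_re_le_norm (a l)
    nlinarith [abs_nonneg (RCLike.re (a l)), sq_abs (RCLike.re (a l))]).trans ha) n
  have hi := signs_moment_real (fun l => RCLike.im (a l)) ((sum_le_sum fun l _ => by
    have := RCLike.abs_im_le_norm (a l)
    nlinarith [abs_nonneg (RCLike.im (a l)), sq_abs (RCLike.im (a l))]).trans ha) n
  have key : ∀ ε : ι → ℤˣ, ‖∑ l, ε l • a l‖ ^ n ≤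
      2 ^ n * (|∑ l, ε l • RCLike.re (a l)| ^ n + |∑ l, ε l • RCLike.im (a l)| ^ n) := by
    intro ε
    rw [← hre, ← him]
    set z := ∑ l, ε l • a l
    have h1 : ‖z‖ ≤ 2 * max |RCLike.re z| |RCLike.im z| := by
      have : ‖z‖ ≤ |RCLike.re z| + |RCLike.im z| := by
        conv_lhs => rw [← RCLike.re_add_im z]
        refine (norm_add_le _ _).trans ?_
        simp only [RCLike.norm_ofReal, norm_mul]
        gcongr
        exact mul_le_of_le_one_right (abs_nonneg _)
          (by rw [RCLike.norm_I]; split_ifs <;> norm_num)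
      linarith [le_max_left |RCLike.re z| |RCLike.im z|, le_max_right |RCLike.re z| |RCLike.im z|]
    calc ‖z‖ ^ n ≤ (2 * max |RCLike.re z| |RCLike.im z|) ^ n := by gcongr
      _ = 2 ^ n * (max |RCLike.re z| |RCLike.im z|) ^ n := mul_pow _ _ _
      _ ≤ _ := by
        gcongr
        rcases max_cases |RCLike.re z| |RCLike.im z| with ⟨h, _⟩ | ⟨h, _⟩ <;> rw [h]
        · linarith [pow_nonneg (abs_nonneg (RCLike.im z)) n]
        · linarith [pow_nonneg (abs_nonneg (RCLike.re z)) n]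
  calc ∑ ε : ι → ℤˣ, ‖∑ l, ε l • a l‖ ^ n ≤ ∑ ε : ι → ℤˣ, (2 ^ n *
      (|∑ l, ε l • RCLike.re (a l)| ^ n + |∑ l, ε l • RCLike.im (a l)| ^ n)) :=
        sum_le_sum fun ε _ => key ε
    _ = 2 ^ n * (∑ ε : ι → ℤˣ, |∑ l, ε l • RCLike.re (a l)| ^ n +
        ∑ ε : ι → ℤˣ, |∑ l, ε l • RCLike.im (a l)| ^ n) := by rw [← mul_sum, sum_add_distrib]
    _ ≤ 2 ^ n * (Fintype.card (ι → ℤˣ) * (n.factorial * (2 * Real.exp 1)) +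
        Fintype.card (ι → ℤˣ) * (n.factorial * (2 * Real.exp 1))) := by gcongr
    _ = _ := by unfold momentConst; ring

/-- The constant in the `L¹`–`L²` Khintchine inequality. -/
noncomputable def khintchineConst : ℝ := 2 * Real.sqrt (2 * momentConst 4)

theorem khintchineConst_pos : 0 < khintchineConst := by
  have := momentConst_pos 4
  unfold khintchineConst; positivity

/-- Khintchine's inequality, from the fourth moment and the elementary inequality
`x ^ 2 / T - x ^ 4 / T ^ 3 ≤ x`. -/
theorem khintchine_L1 {𝕜 : Type*} [RCLike 𝕜] {ι : Type*} [Fintype ι] [DecidableEq ι] (a : ι → 𝕜) :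
    Fintype.card (ι → ℤˣ) * Real.sqrt (∑ l, ‖a l‖ ^ 2) ≤
      khintchineConst * ∑ ε : ι → ℤˣ, ‖∑ l, ε l • a l‖ := by
  set σ := Real.sqrt (∑ l, ‖a l‖ ^ 2) with hσ
  have hσ0 : 0 ≤ σ := Real.sqrt_nonneg _
  rcases hσ0.eq_or_lt with h0 | hpos
  · rw [← h0, mul_zero]
    exact mul_nonneg khintchineConst_pos.le (sum_nonneg fun ε _ => norm_nonneg _)
  have hσ2 : σ ^ 2 = ∑ l, ‖a l‖ ^ 2 := Real.sq_sqrt (sum_nonneg fun l _ => by positivity)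
  set c : ι → 𝕜 := fun l => ((σ⁻¹ : ℝ) : 𝕜) * a l with hc
  have hcn : ∀ l, ‖c l‖ = σ⁻¹ * ‖a l‖ := fun l => by
    rw [hc]; simp [abs_of_pos hpos]
  have hcs : ∑ l, ‖c l‖ ^ 2 = 1 := by
    simp_rw [hcn, mul_pow]
    rw [← mul_sum, ← hσ2]
    field_simp
  have hS : ∀ ε : ι → ℤˣ, ‖∑ l, ε l • c l‖ = σ⁻¹ * ‖∑ l, ε l • a l‖ := by
    intro ε
    have : ∑ l, ε l • c l = ((σ⁻¹ : ℝ) : 𝕜) * ∑ l, ε l • a l := by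
      rw [mul_sum]
      exact sum_congr rfl fun l _ => by rw [hc]; simp [mul_smul_comm]
    rw [this, norm_mul]; simp [abs_of_pos hpos]
  have h4 := signs_moment c hcs.le 4
  have h2 := signs_sum_norm_sq c
  rw [hcs, mul_one] at h2
  set T := Real.sqrt (2 * momentConst 4) with hT
  have hTpos : 0 < T := Real.sqrt_pos.2 (by have := momentConst_pos 4; positivity)
  have hT2 : T ^ 2 = 2 * momentConst 4 := Real.sq_sqrt (by have := momentConst_pos 4; positivity)
  have hel : ∀ x : ℝ, 0 ≤ x → x ^ 2 * T ^ 2 - x ^ 4 ≤ x * T ^ 3 := by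
    intro x hx
    rcases le_total x T with h | h
    · have : x ^ 2 * T ^ 2 ≤ x * T ^ 3 := by
        have : x ^ 2 * T ^ 2 = x * T ^ 2 * x := by ring
        rw [this]
        have : x * T ^ 3 = x * T ^ 2 * T := by ring
        rw [this]
        gcongr
      nlinarith [pow_nonneg hx 4]
    · have : x ^ 2 * T ^ 2 ≤ x ^ 4 := by
        have : x ^ 4 = x ^ 2 * x ^ 2 := by ring
        rw [this]; gcongr
      nlinarith [pow_pos hTpos 3, mul_nonneg hx (pow_pos hTpos 3).le]
  have hsum := sum_le_sum fun ε (_ : ε ∈ (univ : Finset (ι → ℤˣ))) =>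
    hel ‖∑ l, ε l • c l‖ (norm_nonneg _)
  rw [sum_sub_distrib, ← sum_mul, ← sum_mul, h2] at hsum
  simp_rw [hS] at hsum h4
  rw [← mul_sum] at hsum
  set A := ∑ ε : ι → ℤˣ, ‖∑ l, ε l • a l‖
  set K : ℝ := (Fintype.card (ι → ℤˣ) : ℝ)
  have hfin : K * momentConst 4 ≤ σ⁻¹ * A * T ^ 3 := by
    rw [hT2] at hsum
    linarith
  have hm : momentConst 4 = T ^ 2 / 2 := by linarith
  rw [hm] at hfin
  have h5 : K ≤ 2 * T * (σ⁻¹ * A) := by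
    have hT2p : 0 < T ^ 2 := by positivity
    have : K * T ^ 2 ≤ (2 * T * (σ⁻¹ * A)) * T ^ 2 := by nlinarith
    exact le_of_mul_le_mul_right this hT2p
  have : K * σ ≤ 2 * T * (σ⁻¹ * A) * σ := by gcongr
  calc K * σ ≤ 2 * T * (σ⁻¹ * A) * σ := this
    _ = khintchineConst * A := by
      unfold khintchineConst
      rw [← hT]; field_simp

/-! ### Operators from finite-dimensional sup-norm spaces into spaces of finite cotype -/

/-- `C` is an admissible constant in the definition of cotype `r`. -/
def CotypeWith (X : Type*) [NormedAddCommGroup X] (r C : ℝ) : Prop :=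
  ∀ (n : ℕ) (x : Fin n → X),
    (∑ i, ‖x i‖ ^ r) ^ (1 / r) ≤
      C * (((2 : ℝ) ^ n)⁻¹ * ∑ ε : Fin n → ℤˣ, ‖∑ i, ε i • x i‖)

theorem CotypeWith.mono {X : Type*} [NormedAddCommGroup X] {r C C' : ℝ} (h : CotypeWith X r C)
    (hC : C ≤ C') : CotypeWith X r C' := fun n x =>
  (h n x).trans (mul_le_mul_of_nonneg_right hC (by positivity))

theorem HasCotype.exists_one_le {X : Type*} [NormedAddCommGroup X] {r : ℝ} (h : HasCotype X r) :
    ∃ C, 1 ≤ C ∧ CotypeWith X r C := by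
  obtain ⟨C, hC⟩ := h
  exact ⟨max 1 C, le_max_left _ _, CotypeWith.mono (C := C) hC (le_max_right _ _)⟩

section Cotype

variable {𝕜 : Type*} [RCLike 𝕜] {X : Type*} [NormedAddCommGroup X] [NormedSpace 𝕜 X]
  {r C : ℝ} {J : Type*} {V : (J → 𝕜) →ₗ[𝕜] X} {B : ℝ}

theorem CotypeWith.sum_norm_le (hX : CotypeWith X r C) (hr : 1 ≤ r) (hC : 0 ≤ C)
    (hV : ∀ φ : J → 𝕜, ∀ t : ℝ, 0 ≤ t → (∀ j, ‖φ j‖ ≤ t) → ‖V φ‖ ≤ B * t)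
    {n : ℕ} (hn : 0 < n) (h : Fin n → J → 𝕜) {t : ℝ} (ht : 0 ≤ t) (hh : ∀ j, ∑ i, ‖h i j‖ ≤ t) :
    ∑ i, ‖V (h i)‖ ≤ n * (C * (B * t) * (n : ℝ)⁻¹ ^ (1 / r)) := by
  have hr0 : 0 < r := by linarith
  have h1 : (∑ i, ‖V (h i)‖ ^ r) ^ (1 / r) ≤ C * (B * t) := by
    refine (hX n fun i => V (h i)).trans (mul_le_mul_of_nonneg_left ?_ hC)
    have : ∑ ε : Fin n → ℤˣ, ‖∑ i, ε i • V (h i)‖ ≤ ∑ ε : Fin n → ℤˣ, B * t := by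
      refine sum_le_sum fun ε _ => ?_
      have e : ∑ i, ε i • V (h i) = V (∑ i, ε i • h i) := by
        rw [map_sum]
        refine sum_congr rfl fun i _ => ?_
        rcases Int.units_eq_one_or (ε i) with h | h <;> simp [h]
      rw [e]
      refine hV _ t ht fun j => ?_
      rw [Finset.sum_apply]
      refine (norm_sum_le _ _).trans ((sum_le_sum fun i _ => ?_).trans (hh j))
      rw [Pi.smul_apply, signs_norm_smul]
    refine (mul_le_mul_of_nonneg_left this (by positivity)).trans_eq ?_
    simp
  have h2 := Real.arith_mean_le_rpow_mean (univ : Finset (Fin n)) (fun _ => (n : ℝ)⁻¹)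
    (fun i => ‖V (h i)‖) (fun _ _ => by positivity) (by simp; field_simp)
    (fun _ _ => norm_nonneg _) hr
  rw [← mul_sum, ← mul_sum, Real.mul_rpow (by positivity) (sum_nonneg fun i _ => by positivity)] at h2
  have h3 : (n : ℝ)⁻¹ * ∑ i, ‖V (h i)‖ ≤ (n : ℝ)⁻¹ ^ (1 / r) * (C * (B * t)) :=
    h2.trans (mul_le_mul_of_nonneg_left h1 (by positivity))
  have hn' : (0 : ℝ) < n := by exact_mod_cast hn
  rw [inv_mul_le_iff₀ hn'] at h3
  linarith

/-- The step of the iteration in `CotypeWith.sum_norm_le_rpow`: for `n ≈ 1 / δ` independent copies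
`g (ω 0), …, g (ω (n - 1))`, the parts where the preceding copies have sum at most `2` are handled
by the cotype inequality, and the remaining parts have mean at most `δ / 2`. -/
theorem CotypeWith.sum_norm_step (hX : CotypeWith X r C) (hr : 1 ≤ r) (hC : 0 ≤ C) (hB : 0 ≤ B)
    (hV : ∀ φ : J → 𝕜, ∀ t : ℝ, 0 ≤ t → (∀ j, ‖φ j‖ ≤ t) → ‖V φ‖ ≤ B * t)
    {Ω : Type} [Fintype Ω] [Nonempty Ω] (g : Ω → J → 𝕜) {δ : ℝ} (hδ : 0 < δ) (hδ1 : δ ≤ 1)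
    (hg : ∀ ω j, ‖g ω j‖ ≤ 1) (hm : ∀ j, ∑ ω, ‖g ω j‖ ≤ Fintype.card Ω * δ) :
    ∃ (Ω' : Type) (_ : Fintype Ω') (_ : Nonempty Ω') (g' : Ω' → J → 𝕜),
      (∀ ω j, ‖g' ω j‖ ≤ 1) ∧ (∀ j, ∑ ω, ‖g' ω j‖ ≤ Fintype.card Ω' * (δ / 2)) ∧
      (Fintype.card Ω : ℝ)⁻¹ * ∑ ω, ‖V (g ω)‖ ≤ 3 * C * B * (2 * δ) ^ (1 / r) +
        (Fintype.card Ω' : ℝ)⁻¹ * ∑ ω, ‖V (g' ω)‖ := by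
  classical
  have hr0 : 0 < r := by linarith
  set n : ℕ := ⌊1 / δ⌋₊ with hndef
  have h1d : 1 ≤ 1 / δ := by rw [le_div_iff₀ hδ]; linarith
  have hn : 0 < n := Nat.floor_pos.2 h1d
  have hn1 : (n : ℝ) ≤ 1 / δ := Nat.floor_le (by positivity)
  have hn2 : 1 / δ < n + 1 := Nat.lt_floor_add_one _
  have hn' : (0 : ℝ) < n := by exact_mod_cast hn
  have hn1' : (1 : ℝ) ≤ n := by exact_mod_cast hn
  have hnδ : n * δ ≤ 1 := by rwa [le_div_iff₀ hδ] at hn1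
  have hninv : (n : ℝ)⁻¹ ≤ 2 * δ := by
    rw [inv_le_iff_one_le_mul₀ hn']
    rw [div_lt_iff₀ hδ] at hn2
    nlinarith
  have : Nonempty (Fin n) := ⟨⟨0, hn⟩⟩
  set S : (Fin n → Ω) → Fin n → J → ℝ := fun ω i j =>
    ∑ i' ∈ univ.filter (· < i), ‖g (ω i') j‖ with hS
  set G' : Fin n × (Fin n → Ω) → J → 𝕜 := fun p j =>
    if S p.2 p.1 j ≤ 2 then 0 else g (p.2 p.1) j with hG'
  set H : (Fin n → Ω) → Fin n → J → 𝕜 := fun ω i j =>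
    if S ω i j ≤ 2 then g (ω i) j else 0 with hH
  set K : ℝ := (Fintype.card Ω : ℝ) with hK
  have hKpos : 0 < K := by rw [hK]; exact_mod_cast Fintype.card_pos
  set KN : ℝ := (Fintype.card (Fin n → Ω) : ℝ) with hKN
  have hKNpos : 0 < KN := by rw [hKN]; exact_mod_cast Fintype.card_pos
  -- averaging a function of one coordinate
  have marg : ∀ (i : Fin n) (f : Ω → ℝ), K * ∑ ω : Fin n → Ω, f (ω i) = KN * ∑ ω, f ω := by
    intro i f
    rw [← Equiv.sum_comp (Equiv.funSplitAt i Ω).symm, Fintype.sum_prod_type]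
    have : ∀ x : Ω, ∀ y : {j // j ≠ i} → Ω, f ((Equiv.funSplitAt i Ω).symm (x, y) i) = f x := by
      intro x y; simp [Equiv.funSplitAt, Equiv.piSplitAt]
    simp_rw [this]
    simp only [sum_const, nsmul_eq_mul, ← mul_sum, card_univ]
    rw [← mul_assoc]
    congr 1
    rw [hKN, hK, ← Nat.cast_mul, ← Fintype.card_prod, Fintype.card_congr (Equiv.funSplitAt i Ω)]
  have hH3 : ∀ ω j, ∑ i, ‖H ω i j‖ ≤ 3 := by
    intro ω j
    -- partial sums up to the last index with `S ≤ 2`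
    by_cases hne : (univ.filter fun i : Fin n => S ω i j ≤ 2).Nonempty
    · set m := (univ.filter fun i : Fin n => S ω i j ≤ 2).max' hne with hmdef
      have hmm : S ω m j ≤ 2 := (mem_filter.1 (max'_mem _ hne)).2
      have h0 : ∑ i, ‖H ω i j‖ ≤ ∑ i ∈ univ.filter (· < m), ‖g (ω i) j‖ + ‖g (ω m) j‖ := by
        have : ∑ i, ‖H ω i j‖ ≤ ∑ i ∈ insert m (univ.filter (· < m)), ‖g (ω i) j‖ := by
          rw [← sum_subset (subset_univ (insert m (univ.filter (· < m))))]
          · refine sum_le_sum fun i _ => ?_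
            simp only [hH]; split_ifs <;> simp
          · intro i _ hi
            simp only [mem_insert, mem_filter, mem_univ, true_and, not_or, not_lt] at hi
            simp only [hH]
            rw [if_neg, norm_zero]
            intro hc
            have hi' : i ∈ univ.filter fun i : Fin n => S ω i j ≤ 2 := by
              rw [mem_filter]; exact ⟨mem_univ _, hc⟩
            have := le_max' _ i hi'
            exact hi.1 (le_antisymm this hi.2)
        rw [sum_insert (by simp)] at this
        linarith
      have := hg (ω m) j
      have h2 : ∑ i ∈ univ.filter (· < m), ‖g (ω i) j‖ ≤ 2 := hmm
      linarith
    · rw [not_nonempty_iff_eq_empty, filter_eq_empty_iff] at hne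
      have : ∑ i, ‖H ω i j‖ = 0 := sum_eq_zero fun i _ => by
        simp only [hH]; rw [if_neg (hne (mem_univ i)), norm_zero]
      linarith
  refine ⟨Fin n × (Fin n → Ω), inferInstance, inferInstance, G', ?_, ?_, ?_⟩
  · intro p j
    simp only [hG']
    split_ifs
    · simp
    · exact hg _ _
  · intro j
    rw [Fintype.sum_prod_type]
    have hi : ∀ i : Fin n, ∑ ω : Fin n → Ω, ‖G' (i, ω) j‖ ≤ KN * (δ / 2) := by
      intro i
      -- `2 * ‖G'‖ ≤ ‖g (ω i) j‖ * S ω i j`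
      have hp : ∀ ω : Fin n → Ω, 2 * ‖G' (i, ω) j‖ ≤ ∑ i' ∈ univ.filter (· < i),
          ‖g (ω i) j‖ * ‖g (ω i') j‖ := by
        intro ω
        rw [← mul_sum]
        simp only [hG']
        split_ifs with h
        · simp only [norm_zero, mul_zero]
          exact mul_nonneg (norm_nonneg _) (sum_nonneg fun _ _ => norm_nonneg _)
        · have : 2 < ∑ i' ∈ univ.filter (· < i), ‖g (ω i') j‖ := not_le.1 h
          nlinarith [norm_nonneg (g (ω i) j)]
      -- independence of two coordinates
      have hind : ∀ i' : Fin n, i' < i → ∑ ω : Fin n → Ω, ‖g (ω i) j‖ * ‖g (ω i') j‖ ≤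
          KN * (δ * δ) := by
        intro i' hi'
        have hne : i' ≠ i := hi'.ne
        have e1 : ∑ ω : Fin n → Ω, ‖g (ω i) j‖ * ‖g (ω i') j‖ =
            ∑ x : Ω, ‖g x j‖ * ∑ y : {k // k ≠ i} → Ω, ‖g (y ⟨i', hne⟩) j‖ := by
          rw [← Equiv.sum_comp (Equiv.funSplitAt i Ω).symm, Fintype.sum_prod_type]
          refine sum_congr rfl fun x _ => ?_
          rw [mul_sum]
          refine sum_congr rfl fun y _ => ?_
          simp [Equiv.funSplitAt, Equiv.piSplitAt, hne]
        have e2 : K * ∑ y : {k // k ≠ i} → Ω, ‖g (y ⟨i', hne⟩) j‖ =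
            ∑ ω : Fin n → Ω, ‖g (ω i') j‖ := by
          rw [← Equiv.sum_comp (Equiv.funSplitAt i Ω).symm, Fintype.sum_prod_type]
          rw [hK, ← nsmul_eq_mul, ← card_univ, ← sum_const]
          refine sum_congr rfl fun x _ => ?_
          refine sum_congr rfl fun y _ => ?_
          simp [Equiv.funSplitAt, Equiv.piSplitAt, hne]
        rw [e1, ← sum_mul]
        have e3 := marg i' fun x => ‖g x j‖
        have hb := hm j
        have hb0 : 0 ≤ ∑ ω, ‖g ω j‖ := sum_nonneg fun _ _ => norm_nonneg _
        set a := ∑ ω, ‖g ω j‖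
        set y := ∑ y : {k // k ≠ i} → Ω, ‖g (y ⟨i', hne⟩) j‖
        have e4 : K * (K * y) = KN * a := by rw [e2]; exact e3
        have e5 : K * K * (a * y) ≤ K * K * (KN * (δ * δ)) := by
          have : K * K * (a * y) = KN * (a * a) := by nlinarith [e4]
          rw [this]
          have : a * a ≤ (K * δ) * (K * δ) := mul_le_mul hb hb hb0 (by positivity)
          nlinarith
        exact le_of_mul_le_mul_left e5 (by positivity)
      have hs := sum_le_sum fun ω (_ : ω ∈ (univ : Finset (Fin n → Ω))) => hp ω
      rw [← mul_sum, sum_comm] at hs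
      have hs2 : ∑ i' ∈ univ.filter (· < i), ∑ ω : Fin n → Ω, ‖g (ω i) j‖ * ‖g (ω i') j‖ ≤
          ∑ i' ∈ univ.filter (· < i), KN * (δ * δ) :=
        sum_le_sum fun i' hi' => hind i' (mem_filter.1 hi').2
      rw [sum_const, nsmul_eq_mul] at hs2
      have hcard : ((univ.filter (· < i)).card : ℝ) ≤ n := by
        have := card_le_univ (univ.filter (· < i))
        rw [Fintype.card_fin] at this
        exact_mod_cast this
      have : ((univ.filter (· < i)).card : ℝ) * (KN * (δ * δ)) ≤ KN * δ := by
        calc ((univ.filter (· < i)).card : ℝ) * (KN * (δ * δ)) ≤ n * (KN * (δ * δ)) := by gcongr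
          _ = (KN * δ) * (n * δ) := by ring
          _ ≤ (KN * δ) * 1 := by gcongr
          _ = _ := mul_one _
      linarith
    refine (sum_le_sum fun i _ => hi i).trans_eq ?_
    rw [sum_const, Fintype.card_prod, card_univ, nsmul_eq_mul]
    push_cast
    rw [hKN]; ring
  · have hsplit : ∀ ω i, ‖V (g (ω i))‖ ≤ ‖V (H ω i)‖ + ‖V (G' (i, ω))‖ := by
      intro ω i
      have : g (ω i) = H ω i + G' (i, ω) := by
        ext j
        simp only [hH, hG', Pi.add_apply]
        split_ifs <;> simp
      conv_lhs => rw [this, map_add]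
      exact norm_add_le _ _
    have hHs : ∀ ω, ∑ i, ‖V (H ω i)‖ ≤ n * (3 * C * B * (2 * δ) ^ (1 / r)) := by
      intro ω
      refine (hX.sum_norm_le hr hC hV hn (H ω) (t := 3) (by norm_num) (hH3 ω)).trans ?_
      have : (n : ℝ)⁻¹ ^ (1 / r) ≤ (2 * δ) ^ (1 / r) :=
        Real.rpow_le_rpow (by positivity) hninv (by positivity)
      have h3 : C * (B * 3) * (n : ℝ)⁻¹ ^ (1 / r) ≤ C * (B * 3) * (2 * δ) ^ (1 / r) :=
        mul_le_mul_of_nonneg_left this (by positivity)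
      refine mul_le_mul_of_nonneg_left (h3.trans_eq (by ring)) hn'.le
    have e1 : ∑ i : Fin n, ∑ ω : Fin n → Ω, ‖V (g (ω i))‖ * K = n * (KN * ∑ ω, ‖V (g ω)‖) := by
      simp_rw [← sum_mul]
      have : ∀ i : Fin n, (∑ ω : Fin n → Ω, ‖V (g (ω i))‖) * K = KN * ∑ ω, ‖V (g ω)‖ := by
        intro i
        rw [mul_comm]; exact marg i fun x => ‖V (g x)‖
      simp_rw [sum_mul] at this ⊢
      simp_rw [this]
      simp
    have e2 : ∑ i : Fin n, ∑ ω : Fin n → Ω, ‖V (g (ω i))‖ ≤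
        KN * (n * (3 * C * B * (2 * δ) ^ (1 / r))) + ∑ p, ‖V (G' p)‖ := by
      rw [Fintype.sum_prod_type]
      calc ∑ i : Fin n, ∑ ω : Fin n → Ω, ‖V (g (ω i))‖
          ≤ ∑ i : Fin n, ∑ ω : Fin n → Ω, (‖V (H ω i)‖ + ‖V (G' (i, ω))‖) :=
            sum_le_sum fun i _ => sum_le_sum fun ω _ => hsplit ω i
        _ = ∑ ω : Fin n → Ω, ∑ i, ‖V (H ω i)‖ + ∑ i, ∑ ω : Fin n → Ω, ‖V (G' (i, ω))‖ := by
            simp_rw [sum_add_distrib]; rw [sum_comm]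
        _ ≤ _ := by
            gcongr
            refine (sum_le_sum fun ω _ => hHs ω).trans_eq ?_
            rw [sum_const, card_univ, nsmul_eq_mul]
    rw [Fintype.card_prod, Fintype.card_fin]
    push_cast
    simp_rw [← sum_mul] at e1
    rw [← hKN]
    set a := ∑ ω, ‖V (g ω)‖
    set y := ∑ p, ‖V (G' p)‖
    set q := 3 * C * B * (2 * δ) ^ (1 / r)
    set z := ∑ i : Fin n, ∑ ω : Fin n → Ω, ‖V (g (ω i))‖
    have e3 : z * K = n * (KN * a) := by
      rw [← e1]
    have e4 : K⁻¹ * a = ((n : ℝ) * KN)⁻¹ * z := by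
      field_simp
      linarith
    rw [e4]
    calc ((n : ℝ) * KN)⁻¹ * z ≤ ((n : ℝ) * KN)⁻¹ * (KN * (n * q) + y) := by gcongr
      _ = q + ((n : ℝ) * KN)⁻¹ * y := by field_simp

end Cotype

section Cotype

variable {𝕜 : Type*} [RCLike 𝕜] {X : Type*} [NormedAddCommGroup X] [NormedSpace 𝕜 X]
  {r C : ℝ} {J : Type*} [Fintype J] {V : (J → 𝕜) →ₗ[𝕜] X} {B : ℝ}

theorem CotypeWith.sum_norm_iterate [DecidableEq J]
    (hX : CotypeWith X r C) (hr : 1 ≤ r) (hC : 0 ≤ C) (hB : 0 ≤ B)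
    (hV : ∀ φ : J → 𝕜, ∀ t : ℝ, 0 ≤ t → (∀ j, ‖φ j‖ ≤ t) → ‖V φ‖ ≤ B * t) (m : ℕ) :
    ∀ (Ω : Type) [Fintype Ω] [Nonempty Ω] (g : Ω → J → 𝕜) (δ : ℝ), 0 < δ → δ ≤ 1 →
      (∀ ω j, ‖g ω j‖ ≤ 1) → (∀ j, ∑ ω, ‖g ω j‖ ≤ Fintype.card Ω * δ) →
      (Fintype.card Ω : ℝ)⁻¹ * ∑ ω, ‖V (g ω)‖ ≤
        (∑ i ∈ range m, ((1 / 2 : ℝ) ^ (1 / r)) ^ i) * (3 * C * B * (2 * δ) ^ (1 / r)) +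
          (1 / 2) ^ m * (B * Fintype.card J * δ) := by
  have hr0 : 0 < r := by linarith
  induction m with
  | zero =>
    intro Ω _ _ g δ hδ hδ1 hg hm
    have hK : (0 : ℝ) < Fintype.card Ω := by exact_mod_cast Fintype.card_pos
    have h1 : ∀ ω, ‖V (g ω)‖ ≤ ∑ j, B * ‖g ω j‖ := by
      intro ω
      have : g ω = ∑ j, Pi.single j (g ω j) := by simp [Finset.univ_sum_single]
      conv_lhs => rw [this, map_sum]
      refine (norm_sum_le _ _).trans (sum_le_sum fun j _ => ?_)
      refine hV _ _ (norm_nonneg _) fun i => ?_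
      rcases eq_or_ne i j with rfl | h
      · simp
      · simp [h]
    have h2 : ∑ ω, ‖V (g ω)‖ ≤ Fintype.card J * (B * (Fintype.card Ω * δ)) := by
      refine (sum_le_sum fun ω _ => h1 ω).trans ?_
      rw [sum_comm]
      have h3 : ∀ j, ∑ ω, B * ‖g ω j‖ ≤ B * (Fintype.card Ω * δ) := fun j => by
        rw [← mul_sum]; exact mul_le_mul_of_nonneg_left (hm j) hB
      refine (sum_le_sum fun j _ => h3 j).trans_eq (by simp)
    simp only [range_zero, sum_empty, zero_mul, pow_zero, one_mul, zero_add]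
    rw [inv_mul_le_iff₀ hK]
    exact h2.trans_eq (by ring)
  | succ m ih =>
    intro Ω _ _ g δ hδ hδ1 hg hm
    obtain ⟨Ω', _, _, g', hg', hm', h⟩ := hX.sum_norm_step hr hC hB hV g hδ hδ1 hg hm
    refine h.trans ?_
    have h3 := ih Ω' g' (δ / 2) (by linarith) (by linarith) hg' hm'
    refine (add_le_add_right h3 _).trans ?_
    have e : (2 * (δ / 2)) ^ (1 / r) = (1 / 2 : ℝ) ^ (1 / r) * (2 * δ) ^ (1 / r) := by
      rw [← Real.mul_rpow (by norm_num) (by positivity)]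
      congr 1; ring
    rw [e, sum_range_succ']
    simp_rw [pow_succ]
    rw [← sum_mul]
    refine le_of_eq ?_
    ring

/-- The constant in `CotypeWith.sum_norm_le_rpow`. -/
noncomputable def smallMeanConst (r C : ℝ) : ℝ :=
  (1 - (1 / 2 : ℝ) ^ (1 / r))⁻¹ * (3 * C * 2 ^ (1 / r))

theorem half_rpow_lt_one {r : ℝ} (hr : 1 ≤ r) : (1 / 2 : ℝ) ^ (1 / r) < 1 :=
  Real.rpow_lt_one (by norm_num) (by norm_num) (by positivity)

theorem smallMeanConst_one_le (hr : 1 ≤ r) (hC : 1 ≤ C) : 1 ≤ smallMeanConst r C := by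
  have h1 := half_rpow_lt_one hr
  have h2 : (0 : ℝ) < (1 / 2 : ℝ) ^ (1 / r) := by positivity
  have h3 : (1 : ℝ) ≤ (1 - (1 / 2 : ℝ) ^ (1 / r))⁻¹ := by
    rw [one_le_inv₀ (by linarith)]; linarith
  have h4 : (1 : ℝ) ≤ 2 ^ (1 / r) := Real.one_le_rpow (by norm_num) (by positivity)
  have h5 : 1 ≤ 3 * C * 2 ^ (1 / r) := by nlinarith
  unfold smallMeanConst
  nlinarith

/-- If an operator on `ℓ_∞(J)` has norm at most `B` and takes values in a space of cotype `r`, then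
the mean of `‖V g‖` over functions `g` bounded by `1` with pointwise mean at most `δ` is
`O(B δ ^ (1 / r))`, uniformly in `J`. -/
theorem CotypeWith.sum_norm_le_rpow (hX : CotypeWith X r C) (hr : 1 ≤ r) (hC : 1 ≤ C) (hB : 0 ≤ B)
    (hV : ∀ φ : J → 𝕜, ∀ t : ℝ, 0 ≤ t → (∀ j, ‖φ j‖ ≤ t) → ‖V φ‖ ≤ B * t)
    {Ω : Type} [Fintype Ω] [Nonempty Ω] (g : Ω → J → 𝕜) {δ : ℝ} (hδ : 0 < δ)
    (hg : ∀ ω j, ‖g ω j‖ ≤ 1) (hm : ∀ j, ∑ ω, ‖g ω j‖ ≤ Fintype.card Ω * δ) :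
    ∑ ω, ‖V (g ω)‖ ≤ Fintype.card Ω * (smallMeanConst r C * B * δ ^ (1 / r)) := by
  classical
  have hK : (0 : ℝ) < Fintype.card Ω := by exact_mod_cast Fintype.card_pos
  rcases le_or_gt δ 1 with hδ1 | hδ1
  · rw [← inv_mul_le_iff₀ hK]
    have hlim : Tendsto (fun m : ℕ => (1 - (1 / 2 : ℝ) ^ (1 / r))⁻¹ *
        (3 * C * B * (2 * δ) ^ (1 / r)) + (1 / 2 : ℝ) ^ m * (B * Fintype.card J * δ)) atTop
        (𝓝 ((1 - (1 / 2 : ℝ) ^ (1 / r))⁻¹ *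
        (3 * C * B * (2 * δ) ^ (1 / r)) + 0 * (B * Fintype.card J * δ))) := by
      refine tendsto_const_nhds.add (Tendsto.mul_const _ ?_)
      exact tendsto_pow_atTop_nhds_zero_of_lt_one (by norm_num) (by norm_num)
    have := ge_of_tendsto' (b := (Fintype.card Ω : ℝ)⁻¹ * ∑ ω, ‖V (g ω)‖) hlim fun m => by
      refine (hX.sum_norm_iterate hr (by linarith) hB hV m Ω g δ hδ hδ1 hg hm).trans ?_
      gcongr
      have h0 : (0 : ℝ) ≤ (1 / 2 : ℝ) ^ (1 / r) := by positivity
      have h1 := half_rpow_lt_one hr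
      rw [← tsum_geometric_of_lt_one h0 h1]
      exact (summable_geometric_of_lt_one h0 h1).sum_le_tsum _ fun i _ => by positivity
    refine this.trans_eq ?_
    rw [Real.mul_rpow (by norm_num) hδ.le]
    unfold smallMeanConst
    ring
  · have h1 : ∀ ω, ‖V (g ω)‖ ≤ smallMeanConst r C * B * δ ^ (1 / r) := by
      intro ω
      refine (hV _ 1 zero_le_one (hg ω)).trans ?_
      have h2 := smallMeanConst_one_le hr hC
      have h3 : 1 ≤ δ ^ (1 / r) := Real.one_le_rpow hδ1.le (by positivity)
      have : B ≤ smallMeanConst r C * B := by nlinarith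
      nlinarith [mul_nonneg (zero_le_one.trans h2) hB]
    refine (sum_le_sum fun ω _ => h1 ω).trans_eq ?_
    simp

/-- The constant in `CotypeWith.sum_norm_signs_le`. -/
noncomputable def maureyConst (r C : ℝ) : ℝ :=
  1 + 4 * smallMeanConst r C * (momentConst ⌈2 * r⌉₊) ^ (1 / r)

theorem maureyConst_pos (hr : 1 ≤ r) (hC : 1 ≤ C) : 0 < maureyConst r C := by
  have := smallMeanConst_one_le hr hC
  have := momentConst_pos ⌈2 * r⌉₊
  unfold maureyConst; positivity

/-- Maurey's inequality: the Rademacher average of `V (∑ θ l • φ l)` is controlled by the square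
function of the `φ l`. The Rademacher sum is cut at the dyadic levels of its modulus; the part at
height `2 ^ m` has, after division by `2 ^ m`, a mean that decays faster than any power. -/
theorem CotypeWith.sum_norm_signs_le (hX : CotypeWith X r C) (hr : 1 ≤ r) (hC : 1 ≤ C) (hB : 0 ≤ B)
    (hV : ∀ φ : J → 𝕜, ∀ t : ℝ, 0 ≤ t → (∀ j, ‖φ j‖ ≤ t) → ‖V φ‖ ≤ B * t)
    {L : Type} [Fintype L] [DecidableEq L] (φ : L → J → 𝕜) (hφ : ∀ j, ∑ l, ‖φ l j‖ ^ 2 ≤ 1) :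
    ∑ θ : L → ℤˣ, ‖V (∑ l, θ l • φ l)‖ ≤ Fintype.card (L → ℤˣ) * (maureyConst r C * B) := by
  classical
  have hr0 : 0 < r := by linarith
  set n := ⌈2 * r⌉₊ with hn
  have hnr : 2 * r ≤ n := Nat.le_ceil _
  set D := momentConst n with hD
  have hDpos : 0 < D := momentConst_pos n
  set f : (L → ℤˣ) → J → 𝕜 := fun θ => ∑ l, θ l • φ l with hf
  have hfj : ∀ θ j, f θ j = ∑ l, θ l • φ l j := fun θ j => by simp [hf]
  have hmom : ∀ j, ∑ θ, ‖f θ j‖ ^ n ≤ Fintype.card (L → ℤˣ) * D := fun j => by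
    simp_rw [hfj]; exact signs_moment _ (hφ j) n
  -- a uniform upper bound `2 ^ M` for all the sums
  obtain ⟨M, hM⟩ : ∃ M : ℕ, ∀ θ j, ‖f θ j‖ < 2 ^ M := by
    have hb : ∀ θ j, ‖f θ j‖ ≤ Fintype.card L := by
      intro θ j
      rw [hfj]
      refine (norm_sum_le _ _).trans ?_
      have : ∀ l, ‖θ l • φ l j‖ ≤ 1 := by
        intro l
        rw [signs_norm_smul]
        have h1 : ‖φ l j‖ ^ 2 ≤ 1 :=
          (single_le_sum (f := fun l => ‖φ l j‖ ^ 2) (fun _ _ => by positivity) (mem_univ l)).trans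
            (hφ j)
        nlinarith [norm_nonneg (φ l j)]
      refine (sum_le_sum fun l _ => this l).trans_eq (by simp)
    obtain ⟨M, hM⟩ := pow_unbounded_of_one_lt (Fintype.card L : ℝ) (by norm_num : (1 : ℝ) < 2)
    exact ⟨M, fun θ j => (hb θ j).trans_lt hM⟩
  set g : ℕ → (L → ℤˣ) → J → 𝕜 := fun m θ j =>
    if 2 ^ m ≤ ‖f θ j‖ ∧ ‖f θ j‖ < 2 ^ (m + 1) then ((2 ^ (m + 1) : ℝ) : 𝕜)⁻¹ * f θ j else 0 with hg
  set g0 : (L → ℤˣ) → J → 𝕜 := fun θ j => if ‖f θ j‖ < 1 then f θ j else 0 with hg0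
  have hdec : ∀ θ, f θ = g0 θ + ∑ m ∈ range M, ((2 ^ (m + 1) : ℝ) : 𝕜) • g m θ := by
    intro θ
    ext j
    rw [Pi.add_apply, Finset.sum_apply]
    have hsm : ∀ m, (((2 ^ (m + 1) : ℝ) : 𝕜) • g m θ) j =
        if 2 ^ m ≤ ‖f θ j‖ ∧ ‖f θ j‖ < 2 ^ (m + 1) then f θ j else 0 := by
      intro m
      rw [Pi.smul_apply]
      simp only [hg]
      split_ifs with h
      · rw [smul_eq_mul, ← mul_assoc, mul_inv_cancel₀, one_mul]
        exact_mod_cast (by positivity : (2 ^ (m + 1) : ℝ) ≠ 0)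
      · simp
    simp_rw [hsm]
    simp only [hg0]
    suffices H : ∀ k : ℕ, (if ‖f θ j‖ < 1 then f θ j else 0) + ∑ m ∈ range k,
        (if 2 ^ m ≤ ‖f θ j‖ ∧ ‖f θ j‖ < 2 ^ (m + 1) then f θ j else 0) =
        if ‖f θ j‖ < 2 ^ k then f θ j else 0 by
      rw [H M, if_pos (hM θ j)]
    intro k
    induction k with
    | zero => simp
    | succ k ih =>
      rw [sum_range_succ, ← add_assoc, ih]
      have hk : (2 : ℝ) ^ k ≤ 2 ^ (k + 1) := by gcongr <;> norm_num
      by_cases h1 : ‖f θ j‖ < 2 ^ k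
      · rw [if_pos h1, if_neg (by rintro ⟨h, _⟩; linarith), if_pos (by linarith), add_zero]
      · rw [if_neg h1, zero_add]
        rw [not_lt] at h1
        by_cases h2 : ‖f θ j‖ < 2 ^ (k + 1)
        · rw [if_pos ⟨h1, h2⟩, if_pos h2]
        · rw [if_neg (by tauto), if_neg h2]
  have hgm : ∀ m θ j, ‖g m θ j‖ ≤ 1 ∧ ‖g m θ j‖ ≤ ‖f θ j‖ ^ n * ((1 / 2 : ℝ) ^ n) ^ m := by
    intro m θ j
    simp only [hg]
    split_ifs with h
    · rw [norm_mul, norm_inv, RCLike.norm_ofReal, abs_of_pos (by positivity)]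
      have h1 : (2 ^ (m + 1) : ℝ)⁻¹ * ‖f θ j‖ ≤ 1 := by
        rw [inv_mul_le_iff₀ (by positivity)]; linarith [h.2]
      refine ⟨h1, h1.trans ?_⟩
      have e : ‖f θ j‖ ^ n * ((1 / 2 : ℝ) ^ n) ^ m = (‖f θ j‖ / 2 ^ m) ^ n := by
        rw [← pow_mul, mul_comm n m, pow_mul, ← mul_pow, one_div_pow, mul_one_div]
      rw [e]
      exact one_le_pow₀ (by rw [le_div_iff₀ (by positivity)]; linarith [h.1])
    · simp only [norm_zero]
      exact ⟨zero_le_one, by positivity⟩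
  have hlev : ∀ m, ∑ θ, ‖V (((2 ^ (m + 1) : ℝ) : 𝕜) • g m θ)‖ ≤
      Fintype.card (L → ℤˣ) * (2 * (smallMeanConst r C * B * D ^ (1 / r)) * (1 / 2) ^ m) := by
    intro m
    have hmean : ∀ j, ∑ θ, ‖g m θ j‖ ≤ Fintype.card (L → ℤˣ) * (D * ((1 / 2 : ℝ) ^ n) ^ m) := by
      intro j
      refine (sum_le_sum fun θ _ => (hgm m θ j).2).trans ?_
      rw [← sum_mul, ← mul_assoc]
      exact mul_le_mul_of_nonneg_right (hmom j) (by positivity)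
    have h1 := hX.sum_norm_le_rpow hr hC hB hV (g m) (δ := D * ((1 / 2 : ℝ) ^ n) ^ m)
      (by positivity) (fun θ j => (hgm m θ j).1) hmean
    simp_rw [map_smul, norm_smul, RCLike.norm_ofReal]
    rw [← mul_sum, abs_of_pos (by positivity)]
    refine (mul_le_mul_of_nonneg_left h1 (by positivity)).trans ?_
    rw [Real.mul_rpow hDpos.le (by positivity)]
    have h2 : (((1 / 2 : ℝ) ^ n) ^ m) ^ (1 / r) ≤ (1 / 4) ^ m := by
      rw [← pow_mul, ← Real.rpow_natCast, ← Real.rpow_mul (by norm_num)]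
      have : (1 / 4 : ℝ) ^ m = (1 / 2 : ℝ) ^ ((2 * m : ℕ) : ℝ) := by
        rw [Real.rpow_natCast, pow_mul]; norm_num
      rw [this]
      refine Real.rpow_le_rpow_of_exponent_ge (by norm_num) (by norm_num) ?_
      push_cast
      rw [mul_one_div, le_div_iff₀ hr0]
      nlinarith [(Nat.cast_nonneg m : (0 : ℝ) ≤ m)]
    have h3 : (2 : ℝ) ^ (m + 1) * (1 / 4) ^ m = 2 * (1 / 2) ^ m := by
      rw [pow_succ, mul_comm ((2 : ℝ) ^ m), mul_assoc, ← mul_pow]; norm_num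
    have hs := smallMeanConst_one_le hr hC
    calc (2 : ℝ) ^ (m + 1) * (Fintype.card (L → ℤˣ) * (smallMeanConst r C * B *
          (D ^ (1 / r) * (((1 / 2 : ℝ) ^ n) ^ m) ^ (1 / r))))
        ≤ (2 : ℝ) ^ (m + 1) * (Fintype.card (L → ℤˣ) * (smallMeanConst r C * B *
          (D ^ (1 / r) * (1 / 4) ^ m))) := by gcongr
      _ = Fintype.card (L → ℤˣ) * (smallMeanConst r C * B * D ^ (1 / r)) *
          ((2 : ℝ) ^ (m + 1) * (1 / 4) ^ m) := by ring
      _ = _ := by rw [h3]; ring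
  have h0 : ∑ θ, ‖V (g0 θ)‖ ≤ Fintype.card (L → ℤˣ) * B := by
    have : ∀ θ, ‖V (g0 θ)‖ ≤ B * 1 := fun θ => hV _ 1 zero_le_one fun j => by
      simp only [hg0]; split_ifs with h
      · exact h.le
      · simp
    refine (sum_le_sum fun θ _ => this θ).trans_eq (by simp)
  calc ∑ θ : L → ℤˣ, ‖V (f θ)‖
      ≤ ∑ θ : L → ℤˣ, (‖V (g0 θ)‖ + ∑ m ∈ range M, ‖V (((2 ^ (m + 1) : ℝ) : 𝕜) • g m θ)‖) := by
        refine sum_le_sum fun θ _ => ?_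
        conv_lhs => rw [hdec θ, map_add, map_sum]
        exact (norm_add_le _ _).trans (by gcongr; exact norm_sum_le _ _)
    _ = ∑ θ : L → ℤˣ, ‖V (g0 θ)‖ +
          ∑ m ∈ range M, ∑ θ : L → ℤˣ, ‖V (((2 ^ (m + 1) : ℝ) : 𝕜) • g m θ)‖ := by
        rw [sum_add_distrib]; congr 1; rw [sum_comm]
    _ ≤ Fintype.card (L → ℤˣ) * B + ∑ m ∈ range M, Fintype.card (L → ℤˣ) *
          (2 * (smallMeanConst r C * B * D ^ (1 / r)) * (1 / 2) ^ m) := by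
        gcongr with m _; exact hlev m
    _ = Fintype.card (L → ℤˣ) * (B + 2 * (smallMeanConst r C * B * D ^ (1 / r)) *
          ∑ m ∈ range M, (1 / 2 : ℝ) ^ m) := by
        rw [mul_add, ← mul_sum, ← mul_sum]
    _ ≤ Fintype.card (L → ℤˣ) * (B + 2 * (smallMeanConst r C * B * D ^ (1 / r)) * 2) := by
        have hs := smallMeanConst_one_le hr hC
        gcongr
        exact sum_geometric_two_le M
    _ = _ := by unfold maureyConst; ring

end Cotype

section LatticeAverages

variable {𝕜 : Type*} [RCLike 𝕜]

theorem signs_smul_eq_mul {E : Type*} [NormedAddCommGroup E] [NormedSpace 𝕜 E] (s : ℤˣ) (x : E) :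
    s • x = ((s : ℤ) : 𝕜) • x := by
  rcases Int.units_eq_one_or s with h | h <;> simp [h]

theorem exists_signs_abs_sum {J : Type*} (s : Finset J) (a : J → ℝ) :
    ∃ ε : J → ℤˣ, ∑ j ∈ s, ε j • a j = ∑ j ∈ s, |a j| := by
  refine ⟨fun j => if 0 ≤ a j then 1 else -1, sum_congr rfl fun j _ => ?_⟩
  dsimp only
  split_ifs with h
  · simp [abs_of_nonneg h]
  · simp [abs_of_neg (not_le.mp h), Units.smul_def]

theorem re_signs_sum {J : Type*} (s : Finset J) (ε : J → ℤˣ) (z : J → 𝕜) :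
    RCLike.re (∑ j ∈ s, ε j • z j) = ∑ j ∈ s, ε j • RCLike.re (z j) := by
  rw [map_sum]
  refine sum_congr rfl fun l _ => ?_
  rcases Int.units_eq_one_or (ε l) with h | h <;> simp [h]

theorem im_signs_sum {J : Type*} (s : Finset J) (ε : J → ℤˣ) (z : J → 𝕜) :
    RCLike.im (∑ j ∈ s, ε j • z j) = ∑ j ∈ s, ε j • RCLike.im (z j) := by
  rw [map_sum]
  refine sum_congr rfl fun l _ => ?_
  rcases Int.units_eq_one_or (ε l) with h | h <;> simp [h]

theorem exists_signs_norm_sum {J : Type*} (s : Finset J) (z : J → 𝕜) :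
    ∃ ε : J → ℤˣ, ∑ j ∈ s, ‖z j‖ ≤ 2 * ‖∑ j ∈ s, ε j • z j‖ := by
  obtain ⟨ε, hε⟩ := exists_signs_abs_sum s fun j => RCLike.re (z j)
  obtain ⟨δ, hδ⟩ := exists_signs_abs_sum s fun j => RCLike.im (z j)
  have h1 : ∑ j ∈ s, |RCLike.re (z j)| ≤ ‖∑ j ∈ s, ε j • z j‖ := by
    rw [← hε, ← re_signs_sum]; exact (le_abs_self _).trans (RCLike.abs_re_le_norm _)
  have h2 : ∑ j ∈ s, |RCLike.im (z j)| ≤ ‖∑ j ∈ s, δ j • z j‖ := by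
    rw [← hδ, ← im_signs_sum]; exact (le_abs_self _).trans (RCLike.abs_im_le_norm _)
  have h3 : ∑ j ∈ s, ‖z j‖ ≤ ∑ j ∈ s, |RCLike.re (z j)| + ∑ j ∈ s, |RCLike.im (z j)| := by
    rw [← sum_add_distrib]
    refine sum_le_sum fun j _ => abs_le_of_sq_le_sq' ?_ (by positivity) |>.2
    have := RCLike.norm_sq_eq_def (z := z j)
    nlinarith [abs_nonneg (RCLike.re (z j)), abs_nonneg (RCLike.im (z j)),
      sq_abs (RCLike.re (z j)), sq_abs (RCLike.im (z j))]
  rcases le_total ‖∑ j ∈ s, ε j • z j‖ ‖∑ j ∈ s, δ j • z j‖ with h | h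
  · exact ⟨δ, by linarith⟩
  · exact ⟨ε, by linarith⟩

variable {E : Type*} [NormedAddCommGroup E] [NormedSpace 𝕜 E] {J : Type*} [Fintype J] {e : J → E}

theorem sum_norm_functional_le
    (he : ∀ (ε : J → ℤˣ) (a : J → 𝕜), ‖∑ j, ε j • (a j • e j)‖ ≤ ‖∑ j, a j • e j‖)
    (a : J → 𝕜) (g : StrongDual 𝕜 E) (hg : ‖g‖ ≤ 1) :
    ∑ j, ‖a j‖ * ‖g (e j)‖ ≤ 2 * ‖∑ j, a j • e j‖ := by
  obtain ⟨ε, hε⟩ := exists_signs_norm_sum univ fun j => g (a j • e j)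
  have h1 : ∑ j, ε j • g (a j • e j) = g (∑ j, ε j • (a j • e j)) := by
    rw [map_sum]
    refine sum_congr rfl fun j _ => ?_
    rcases Int.units_eq_one_or (ε j) with h | h <;> simp [h]
  have h2 : ∑ j, ‖a j‖ * ‖g (e j)‖ = ∑ j, ‖g (a j • e j)‖ := by simp [norm_mul]
  rw [h2]
  refine hε.trans (mul_le_mul_of_nonneg_left ?_ zero_le_two)
  rw [h1]
  refine (g.le_opNorm _).trans ?_
  calc ‖g‖ * ‖∑ j, ε j • (a j • e j)‖ ≤ 1 * ‖∑ j, ε j • (a j • e j)‖ := by gcongr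
    _ ≤ _ := by rw [one_mul]; exact he ε a

theorem exists_functional_norm_eq (x : E) : ∃ g : StrongDual 𝕜 E, ‖g‖ ≤ 1 ∧ ‖x‖ = ‖g x‖ := by
  obtain ⟨g, hg, hgx⟩ := exists_dual_vector'' 𝕜 x
  exact ⟨g, hg, by rw [hgx]; simp⟩

theorem norm_sum_le_of_coeff_le
    (he : ∀ (ε : J → ℤˣ) (a : J → 𝕜), ‖∑ j, ε j • (a j • e j)‖ ≤ ‖∑ j, a j • e j‖)
    {a c : J → 𝕜} (h : ∀ j, ‖a j‖ ≤ ‖c j‖) : ‖∑ j, a j • e j‖ ≤ 2 * ‖∑ j, c j • e j‖ := by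
  obtain ⟨g, hg, hx⟩ := exists_functional_norm_eq (𝕜 := 𝕜) (∑ j, a j • e j)
  rw [hx, map_sum]
  refine (norm_sum_le _ _).trans (le_trans ?_ (sum_norm_functional_le he c g hg))
  refine sum_le_sum fun j _ => ?_
  rw [map_smul, norm_smul]
  exact mul_le_mul_of_nonneg_right (h j) (norm_nonneg _)

/-- In a `1`-unconditional system the norm of the square function is at most a multiple of the
Rademacher average. -/
theorem norm_squareFunction_le
    (he : ∀ (ε : J → ℤˣ) (a : J → 𝕜), ‖∑ j, ε j • (a j • e j)‖ ≤ ‖∑ j, a j • e j‖)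
    {L : Type} [Fintype L] [DecidableEq L] (a : L → J → 𝕜) :
    Fintype.card (L → ℤˣ) * ‖∑ j, ((Real.sqrt (∑ l, ‖a l j‖ ^ 2) : ℝ) : 𝕜) • e j‖ ≤
      khintchineConst * 2 * ∑ θ : L → ℤˣ, ‖∑ l, θ l • ∑ j, a l j • e j‖ := by
  obtain ⟨g, hg, hx⟩ := exists_functional_norm_eq (𝕜 := 𝕜)
    (∑ j, ((Real.sqrt (∑ l, ‖a l j‖ ^ 2) : ℝ) : 𝕜) • e j)
  have h1 : ‖∑ j, ((Real.sqrt (∑ l, ‖a l j‖ ^ 2) : ℝ) : 𝕜) • e j‖ ≤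
      ∑ j, Real.sqrt (∑ l, ‖a l j‖ ^ 2) * ‖g (e j)‖ := by
    rw [hx, map_sum]
    refine (norm_sum_le _ _).trans (sum_le_sum fun j _ => ?_)
    rw [map_smul, norm_smul, RCLike.norm_ofReal, abs_of_nonneg (Real.sqrt_nonneg _)]
  calc Fintype.card (L → ℤˣ) * ‖∑ j, ((Real.sqrt (∑ l, ‖a l j‖ ^ 2) : ℝ) : 𝕜) • e j‖
      ≤ Fintype.card (L → ℤˣ) * ∑ j, Real.sqrt (∑ l, ‖a l j‖ ^ 2) * ‖g (e j)‖ := by gcongr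
    _ = ∑ j, (Fintype.card (L → ℤˣ) * Real.sqrt (∑ l, ‖a l j‖ ^ 2)) * ‖g (e j)‖ := by
        rw [mul_sum]; exact sum_congr rfl fun j _ => by ring
    _ ≤ ∑ j, (khintchineConst * ∑ θ : L → ℤˣ, ‖∑ l, θ l • a l j‖) * ‖g (e j)‖ := by
        refine sum_le_sum fun j _ => mul_le_mul_of_nonneg_right ?_ (norm_nonneg _)
        exact khintchine_L1 fun l => a l j
    _ = khintchineConst * ∑ θ : L → ℤˣ, ∑ j, ‖∑ l, θ l • a l j‖ * ‖g (e j)‖ := by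
        rw [sum_comm, mul_sum]
        refine sum_congr rfl fun j _ => ?_
        rw [mul_assoc, sum_mul]
    _ ≤ khintchineConst * ∑ θ : L → ℤˣ, 2 * ‖∑ l, θ l • ∑ j, a l j • e j‖ := by
        refine mul_le_mul_of_nonneg_left (sum_le_sum fun θ _ => ?_) khintchineConst_pos.le
        have h := sum_norm_functional_le he (fun j => ∑ l, θ l • a l j) g hg
        have h' : ∑ j, (∑ l, θ l • a l j) • e j = ∑ l, θ l • ∑ j, a l j • e j := by
          simp_rw [sum_smul, smul_sum]
          rw [sum_comm]
          exact sum_congr rfl fun l _ => sum_congr rfl fun j _ => smul_assoc _ _ _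
        rwa [h'] at h
    _ = _ := by rw [← mul_sum]; ring

variable {X : Type*} [NormedAddCommGroup X] [NormedSpace 𝕜 X] {r C : ℝ}

/-- An operator into a space of finite cotype is bounded, on Rademacher averages, even after
independent changes of signs in the coordinates of a `1`-unconditional system. -/
theorem CotypeWith.sum_norm_signChange_le (hX : CotypeWith X r C) (hr : 1 ≤ r) (hC : 1 ≤ C)
    (he : ∀ (ε : J → ℤˣ) (a : J → 𝕜), ‖∑ j, ε j • (a j • e j)‖ ≤ ‖∑ j, a j • e j‖)
    (W : E →L[𝕜] X) {L : Type} [Fintype L] [DecidableEq L] (a : L → J → 𝕜) (ε : L → J → ℤˣ) :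
    ∑ θ : L → ℤˣ, ‖W (∑ l, θ l • ∑ j, ε l j • (a l j • e j))‖ ≤
      maureyConst r C * 4 * khintchineConst * ‖W‖ *
        ∑ θ : L → ℤˣ, ‖∑ l, θ l • ∑ j, a l j • e j‖ := by
  -- after division by the square function `q` the coefficients satisfy the hypothesis of Maurey's
  -- inequality for the operator `V`, whose norm is controlled by the norm of the square function
  set q : J → ℝ := fun j => Real.sqrt (∑ l, ‖a l j‖ ^ 2) with hq
  have hq0 : ∀ j, 0 ≤ q j := fun j => Real.sqrt_nonneg _
  set V : (J → 𝕜) →ₗ[𝕜] X := W.toLinearMap ∘ₗ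
    (∑ j, ((LinearMap.proj j : (J → 𝕜) →ₗ[𝕜] 𝕜).smulRight ((q j : 𝕜) • e j))) with hVd
  have hVa : ∀ φ, V φ = W (∑ j, φ j • ((q j : 𝕜) • e j)) := by
    intro φ; simp [hVd]
  set B := ‖W‖ * (2 * ‖∑ j, ((q j : ℝ) : 𝕜) • e j‖) with hB
  have hV : ∀ φ : J → 𝕜, ∀ t : ℝ, 0 ≤ t → (∀ j, ‖φ j‖ ≤ t) → ‖V φ‖ ≤ B * t := by
    intro φ t ht hφ
    have h1 := norm_sum_le_of_coeff_le he (a := fun j => φ j * (q j : 𝕜))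
      (c := fun j => (t : 𝕜) * (q j : 𝕜)) (fun j => by
        rw [norm_mul, norm_mul, RCLike.norm_ofReal, RCLike.norm_ofReal, abs_of_nonneg ht]
        gcongr; exact hφ j)
    simp_rw [mul_smul, ← smul_sum] at h1
    rw [norm_smul, RCLike.norm_ofReal, abs_of_nonneg ht] at h1
    rw [hVa]
    refine (W.le_opNorm _).trans ?_
    calc ‖W‖ * ‖∑ j, φ j • ((q j : 𝕜) • e j)‖
        ≤ ‖W‖ * (2 * (t * ‖∑ j, ((q j : ℝ) : 𝕜) • e j‖)) := by gcongr
      _ = B * t := by rw [hB]; ring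
  have hqz : ∀ l j, q j = 0 → a l j = 0 := by
    intro l j h
    rw [hq] at h
    have h0 : ∑ l, ‖a l j‖ ^ 2 = 0 := by
      rwa [Real.sqrt_eq_zero (sum_nonneg fun _ _ => by positivity)] at h
    have := (sum_eq_zero_iff_of_nonneg (fun _ _ => by positivity)).mp h0 l (mem_univ _)
    simpa using this
  set φ : L → J → 𝕜 := fun l j => ε l j • (a l j / (q j : 𝕜)) with hφd
  have hφ : ∀ j, ∑ l, ‖φ l j‖ ^ 2 ≤ 1 := by
    intro j
    simp only [hφd, signs_norm_smul, norm_div, RCLike.norm_ofReal, abs_of_nonneg (hq0 j), div_pow]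
    rw [← sum_div]
    have : q j ^ 2 = ∑ l, ‖a l j‖ ^ 2 := Real.sq_sqrt (sum_nonneg fun _ _ => by positivity)
    rw [this]
    exact div_self_le_one _
  have hmain := hX.sum_norm_signs_le hr hC (B := B) (by positivity) hV φ hφ
  have hVθ : ∀ θ : L → ℤˣ, V (∑ l, θ l • φ l) = W (∑ l, θ l • ∑ j, ε l j • (a l j • e j)) := by
    intro θ
    rw [hVa]
    congr 1
    simp_rw [Finset.sum_apply, Pi.smul_apply, sum_smul, smul_sum]
    rw [sum_comm]
    refine sum_congr rfl fun l _ => sum_congr rfl fun j _ => ?_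
    rw [smul_assoc]
    congr 1
    simp only [hφd]
    rw [smul_assoc]
    congr 1
    rw [smul_smul]
    rcases eq_or_ne (q j) 0 with h | h
    · rw [hqz l j h]; simp
    · rw [div_mul_cancel₀ _ (by exact_mod_cast h)]
  simp_rw [hVθ] at hmain
  refine hmain.trans ?_
  have hsq := norm_squareFunction_le he a
  have hm := maureyConst_pos hr hC
  calc (Fintype.card (L → ℤˣ) : ℝ) * (maureyConst r C * B)
      = maureyConst r C * 2 * ‖W‖ * (Fintype.card (L → ℤˣ) * ‖∑ j, ((q j : ℝ) : 𝕜) • e j‖) := by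
        rw [hB]; ring
    _ ≤ maureyConst r C * 2 * ‖W‖ *
        (khintchineConst * 2 * ∑ θ : L → ℤˣ, ‖∑ l, θ l • ∑ j, a l j • e j‖) := by gcongr
    _ = _ := by ring

end LatticeAverages

section OneUnconditional

variable {𝕜 : Type*} [RCLike 𝕜] {F : Type*} [NormedAddCommGroup F] [NormedSpace 𝕜 F] {β : Type}

theorem IsOneUnconditional.norm_signs_sum_le {b : UnconditionalSchauderBasis β 𝕜 F}
    (hb : IsOneUnconditional b) (J : Finset β) (ε : β → ℤˣ) (a : β → 𝕜) :
    ‖∑ j ∈ J, ε j • (a j • b j)‖ ≤ ‖∑ j ∈ J, a j • b j‖ := by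
  classical
  obtain ⟨y, hy, hn⟩ := hb ε (∑ j ∈ J, a j • b j)
  have hc : ∀ j, b.coord j (∑ j ∈ J, a j • b j) = if j ∈ J then a j else 0 := by
    intro j
    simp [map_sum, b.ortho, Pi.single_apply]
  have h2 : HasSum (fun j => ε j • (b.coord j (∑ j ∈ J, a j • b j) • b j))
      (∑ j ∈ J, ε j • (b.coord j (∑ j ∈ J, a j • b j) • b j)) :=
    hasSum_sum_of_ne_finset_zero fun j hj => by rw [hc, if_neg hj]; simp
  have h3 := hy.unique h2
  rw [h3] at hn
  refine le_trans (le_of_eq ?_) hn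
  congr 1
  refine sum_congr rfl fun j hj => ?_
  rw [hc, if_pos hj]

theorem IsOneUnconditional.norm_proj_le {b : UnconditionalSchauderBasis β 𝕜 F}
    (hb : IsOneUnconditional b) (J : Finset β) (x : F) :
    ‖∑ j ∈ J, b.coord j x • b j‖ ≤ ‖x‖ := by
  classical
  obtain ⟨y, hy, hn⟩ := hb (fun j => if j ∈ J then 1 else -1) x
  have h1 := (b.expansion x).add hy
  have h2 : HasSum (fun j => (b.coord j x • b j) +
      (if j ∈ J then (1 : ℤˣ) else -1) • (b.coord j x • b j))
      (∑ j ∈ J, (b.coord j x • b j + (if j ∈ J then (1 : ℤˣ) else -1) • (b.coord j x • b j))) :=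
    hasSum_sum_of_ne_finset_zero fun j hj => by rw [if_neg hj]; simp [Units.smul_def]
  have h3 := h1.unique h2
  have h4 : x + y = (2 : 𝕜) • ∑ j ∈ J, b.coord j x • b j := by
    rw [h3, smul_sum]
    refine sum_congr rfl fun j hj => ?_
    rw [if_pos hj, one_smul, two_smul]
  have h5 : ‖x + y‖ ≤ 2 * ‖x‖ := (norm_add_le _ _).trans (by linarith)
  rw [h4, norm_smul] at h5
  simp only [RCLike.norm_ofNat] at h5
  linarith

end OneUnconditional

section SchauderSpan

variable {𝕜 : Type*} [RCLike 𝕜] {X : Type*} [NormedAddCommGroup X] [NormedSpace 𝕜 X]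

/-- A sequence of nonzero vectors with uniformly bounded initial projections is a Schauder basis
of its closed linear span. -/
theorem exists_schauderBasis_closure_span {z : ℕ → X} (hz : ∀ n, z n ≠ 0) {K : ℝ}
    (hK : ∀ (a : ℕ → 𝕜) (n m : ℕ), n ≤ m →
      ‖∑ i ∈ range n, a i • z i‖ ≤ K * ‖∑ i ∈ range m, a i • z i‖) :
    ∃ b : SchauderBasis 𝕜 (Submodule.span 𝕜 (Set.range z)).topologicalClosure,
      ∀ n, (b n : X) = z n := by
  have hcoef : ∀ (a : ℕ → 𝕜) (n m : ℕ), n < m →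
      ‖a n‖ ≤ (2 * K / ‖z n‖) * ‖∑ i ∈ range m, a i • z i‖ := by
    intro a n m h
    have h1 := hK a n m h.le
    have h2 := hK a (n + 1) m h
    have h3 : a n • z n = ∑ i ∈ range (n + 1), a i • z i - ∑ i ∈ range n, a i • z i := by
      rw [sum_range_succ]; abel
    have h4 : ‖a n‖ * ‖z n‖ ≤ 2 * K * ‖∑ i ∈ range m, a i • z i‖ := by
      rw [← norm_smul, h3]
      exact (norm_sub_le _ _).trans (by linarith)
    have hp := norm_pos_iff.mpr (hz n)
    rw [div_mul_eq_mul_div, le_div_iff₀ hp]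
    exact h4
  have hrep : ∀ v ∈ Submodule.span 𝕜 (Set.range z), ∃ (a : ℕ → 𝕜) (m : ℕ),
      (∀ i, m ≤ i → a i = 0) ∧ v = ∑ i ∈ range m, a i • z i := by
    intro v hv
    obtain ⟨c, rfl⟩ := (Finsupp.mem_span_range_iff_exists_finsupp).mp hv
    obtain ⟨m, hm⟩ := c.support.exists_nat_subset_range
    refine ⟨c, m, fun i hi => ?_, ?_⟩
    · by_contra h
      have := hm (Finsupp.mem_support_iff.mpr h)
      rw [mem_range] at this; omega
    · exact Finsupp.sum_of_support_subset _ hm _ (by simp)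
  have hli : LinearIndependent 𝕜 z := by
    rw [linearIndependent_iff]
    intro c hc
    obtain ⟨m, hm⟩ := c.support.exists_nat_subset_range
    rw [Finsupp.linearCombination_apply, Finsupp.sum_of_support_subset _ hm _ (by simp)] at hc
    ext n
    by_cases hn : n ∈ range m
    · have := hcoef c n m (mem_range.mp hn)
      rw [hc, norm_zero, mul_zero] at this
      simpa using this
    · by_contra h
      exact hn (hm (Finsupp.mem_support_iff.mpr h))
  set S := Submodule.span 𝕜 (Set.range z) with hS
  set bs := Module.Basis.span hli with hbs
  have hbsz : ∀ i, (bs i : X) = z i := fun i => by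
    rw [hbs, Module.Basis.span_apply]
  have hmem : ∀ i, z i ∈ S := fun i => Submodule.subset_span ⟨i, rfl⟩
  have hcoord : ∀ (n : ℕ) (a : ℕ → 𝕜) (m : ℕ) (v : S), (v : X) = ∑ i ∈ range m, a i • z i →
      (∀ i, m ≤ i → a i = 0) → bs.coord n v = a n := by
    intro n a m v hv ha
    have : v = ∑ i ∈ range m, a i • bs i := by
      apply Subtype.ext
      rw [hv]
      simp [hbsz]
    rw [this, map_sum]
    simp only [map_smul, Module.Basis.coord_apply, Module.Basis.repr_self, Finsupp.single_apply,
      smul_eq_mul, mul_ite, mul_one, mul_zero, sum_ite_eq', mem_range]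
    split_ifs with h
    · rfl
    · rw [ha n (not_lt.mp h)]
  have hbd : ∀ n (v : S), ‖bs.coord n v‖ ≤ (2 * K / ‖z n‖) * ‖v‖ := by
    intro n v
    obtain ⟨a, m, ha, hv⟩ := hrep v v.2
    rw [hcoord n a m v hv ha]
    have h1 : (v : X) = ∑ i ∈ range (max m (n + 1)), a i • z i := by
      rw [hv]
      refine sum_subset (range_mono (le_max_left _ _)) fun i _ hi => ?_
      rw [ha i (by simpa using hi), zero_smul]
    have := hcoef a n (max m (n + 1)) (by omega)
    rw [← h1] at this
    exact this
  have hext : ∀ n, ∃ g : StrongDual 𝕜 X, ∀ v : S, g v = bs.coord n v := by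
    intro n
    obtain ⟨g, hg, -⟩ := exists_extension_norm_eq S ((bs.coord n).mkContinuous _ (hbd n))
    exact ⟨g, fun v => by rw [hg]; rfl⟩
  choose g hg using hext
  have hgz : ∀ i j, g i (z j) = (Pi.single j (1 : 𝕜) : ℕ → 𝕜) i := by
    intro i j
    have := hg i ⟨z j, hmem j⟩
    rw [show (⟨z j, hmem j⟩ : S) = bs j from Subtype.ext (hbsz j).symm] at this
    simp only [hbsz, Module.Basis.coord_apply, Module.Basis.repr_self, Finsupp.single_apply] at this
    rw [this, Pi.single_apply]
    simp [eq_comm]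
  have hgc : ∀ (a : ℕ → 𝕜) (m n : ℕ), (∀ i, m ≤ i → a i = 0) →
      g n (∑ i ∈ range m, a i • z i) = a n := by
    intro a m n ha
    have hm' : ∑ i ∈ range m, a i • z i ∈ S := S.sum_mem fun i _ => S.smul_mem _ (hmem i)
    rw [show (∑ i ∈ range m, a i • z i) = ((⟨_, hm'⟩ : S) : X) from rfl, hg]
    exact hcoord n a m _ rfl ha
  set P : ℕ → X →L[𝕜] X := fun n => ∑ i ∈ range n, (g i).smulRight (z i) with hP
  have hPa : ∀ n x, P n x = ∑ i ∈ range n, g i x • z i := by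
    intro n x; simp [hP]
  have hPS : ∀ n, ∀ v ∈ S, ‖P n v‖ ≤ |K| * ‖v‖ := by
    intro n v hv
    obtain ⟨a, m, ha, rfl⟩ := hrep v hv
    rw [hPa]
    simp_rw [fun n => hgc a m n ha]
    have h1 : ∑ i ∈ range m, a i • z i = ∑ i ∈ range (max m n), a i • z i := by
      refine sum_subset (range_mono (le_max_left _ _)) fun i _ hi => ?_
      rw [ha i (by simpa using hi), zero_smul]
    rw [h1]
    exact (hK a n _ (le_max_right _ _)).trans (by gcongr; exact le_abs_self K)
  have hPc : ∀ n, ∀ v ∈ S.topologicalClosure, ‖P n v‖ ≤ |K| * ‖v‖ := by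
    intro n v hv
    have hcl : IsClosed {v : X | ‖P n v‖ ≤ |K| * ‖v‖} :=
      isClosed_le (P n).continuous.norm (continuous_const.mul continuous_norm)
    exact closure_minimal (fun v hv => hPS n v hv) hcl hv
  have hlim : ∀ v ∈ S.topologicalClosure, Tendsto (fun n => P n v) atTop (𝓝 v) := by
    intro v hv
    rw [Metric.tendsto_atTop]
    intro ε hε
    have hv' : v ∈ closure (S : Set X) := hv
    obtain ⟨w, hw, hvw⟩ := Metric.mem_closure_iff.mp hv' (ε / (|K| + 2)) (by positivity)
    obtain ⟨a, m, ha, rfl⟩ := hrep w hw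
    refine ⟨m, fun n hn => ?_⟩
    have hPw : P n (∑ i ∈ range m, a i • z i) = ∑ i ∈ range m, a i • z i := by
      rw [hPa]
      simp_rw [fun n => hgc a m n ha]
      symm
      refine sum_subset (range_mono hn) fun i _ hi => ?_
      rw [ha i (by simpa using hi), zero_smul]
    have h1 : P n v - v = P n (v - ∑ i ∈ range m, a i • z i) - (v - ∑ i ∈ range m, a i • z i) := by
      rw [map_sub, hPw]; abel
    rw [dist_eq_norm, h1]
    have h2 := hPc n (v - ∑ i ∈ range m, a i • z i)
      (Submodule.sub_mem _ hv (S.le_topologicalClosure hw))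
    rw [dist_eq_norm] at hvw
    have h3 := norm_sub_le (P n (v - ∑ i ∈ range m, a i • z i)) (v - ∑ i ∈ range m, a i • z i)
    have hK0 := abs_nonneg K
    rw [lt_div_iff₀ (by positivity)] at hvw
    have h4 := norm_nonneg (v - ∑ i ∈ range m, a i • z i)
    nlinarith
  refine ⟨{ basis := fun n => ⟨z n, S.le_topologicalClosure (hmem n)⟩
            coord := fun n => (g n).comp S.topologicalClosure.subtypeL
            ortho := fun i j => by
              refine (hgz i j).trans ?_
              rcases eq_or_ne i j with h | h
              · subst h; simp
              · simp [h]
            expansion := fun x => ?_ }, fun n => rfl⟩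
  rw [HasSum, SummationFilter.conditional_filter_eq_map_range, tendsto_map'_iff]
  rw [tendsto_subtype_rng]
  refine (hlim x x.2).congr fun n => ?_
  simp [hPa]

end SchauderSpan

section BlockDiagonal

variable {𝕜 : Type*} [RCLike 𝕜]

theorem signs_sum_mul_sign {L : Type*} [Fintype L] [DecidableEq L] {E : Type*}
    [NormedAddCommGroup E] [NormedSpace 𝕜 E] (k l : L) (v : E) :
    ∑ θ : L → ℤˣ, θ k • θ l • v = if k = l then (Fintype.card (L → ℤˣ) : 𝕜) • v else 0 := by
  split_ifs with h
  · subst h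
    have : ∀ θ : L → ℤˣ, θ k • θ k • v = v := fun θ => by
      rw [smul_smul, Int.units_mul_self, one_smul]
    simp_rw [this]
    rw [sum_const, card_univ, Nat.cast_smul_eq_nsmul]
  · have h1 : ∑ θ : L → ℤˣ, θ k • θ l • v = ∑ θ : L → ℤˣ, -(θ k • θ l • v) := by
      refine Fintype.sum_equiv (Equiv.mulRight (Function.update (1 : L → ℤˣ) k (-1))) _ _ fun θ => ?_
      simp [Function.update_of_ne (Ne.symm h), Units.smul_def]
    rw [sum_neg_distrib] at h1
    have h2 : (2 : 𝕜) • ∑ θ : L → ℤˣ, θ k • θ l • v = 0 := by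
      rw [two_smul]; nth_rewrite 1 [h1]; simp
    exact (smul_eq_zero.mp h2).resolve_left two_ne_zero

theorem signs_sum_diagonal {L : Type*} [Fintype L] [DecidableEq L] {E G : Type*}
    [NormedAddCommGroup E] [NormedSpace 𝕜 E] [NormedAddCommGroup G] [NormedSpace 𝕜 G]
    (Φ : L → E →ₗ[𝕜] G) (g : L → E) :
    ∑ θ : L → ℤˣ, ∑ k, θ k • Φ k (∑ l, θ l • g l) =
      (Fintype.card (L → ℤˣ) : 𝕜) • ∑ k, Φ k (g k) := by
  rw [sum_comm, smul_sum]
  refine sum_congr rfl fun k _ => ?_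
  have h1 : ∀ θ : L → ℤˣ, θ k • Φ k (∑ l, θ l • g l) = ∑ l, θ k • θ l • Φ k (g l) := by
    intro θ
    rw [map_sum, smul_sum]
    refine sum_congr rfl fun l _ => ?_
    rcases Int.units_eq_one_or (θ l) with h | h <;> simp [h]
  simp_rw [h1]
  rw [sum_comm]
  simp_rw [signs_sum_mul_sign (𝕜 := 𝕜)]
  simp

/-- If the trace `∑ p c` of a family of `2 × 2` matrices `(p, r) ⊗ (c, d)` is not small, then some
choice of signs turns their sum into a matrix which is not close to a scalar one. -/
theorem exists_signs_offDiagonal {J : Type*} (s : Finset J) (p r c d : J → 𝕜)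
    (h : 1 / 2 ≤ ‖∑ j ∈ s, p j * c j‖) :
    ∃ ε : J → ℤˣ, 1 / 8 ≤ ‖∑ j ∈ s, ε j • (p j * d j)‖ ∨ 1 / 8 ≤ ‖∑ j ∈ s, ε j • (r j * c j)‖ ∨
      1 / 8 ≤ ‖∑ j ∈ s, ε j • (p j * c j - r j * d j)‖ := by
  have hj : ∀ j ∈ s, 2 * ‖p j * c j‖ ≤
      ‖p j * d j‖ + ‖r j * c j‖ + 2 * ‖p j * c j - r j * d j‖ := by
    intro j _
    have hy : ‖p j * c j‖ - ‖p j * c j - r j * d j‖ ≤ ‖r j * d j‖ := by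
      have := norm_sub_norm_le (p j * c j) (p j * c j - r j * d j)
      rwa [sub_sub_cancel] at this
    have he : ‖p j * d j‖ * ‖r j * c j‖ = ‖p j * c j‖ * ‖r j * d j‖ := by
      simp only [norm_mul]; ring
    set x := ‖p j * c j‖
    set z := ‖p j * c j - r j * d j‖
    have hz0 : 0 ≤ z := norm_nonneg _
    have hX := norm_nonneg (p j * d j)
    have hY := norm_nonneg (r j * c j)
    rcases le_or_gt x z with hxz | hxz
    · linarith
    · have h1 : (x - z) ^ 2 ≤ ‖p j * d j‖ * ‖r j * c j‖ := by
        rw [he]; nlinarith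
      have h2 : 2 * (x - z) ≤ ‖p j * d j‖ + ‖r j * c j‖ := by
        refine abs_le_of_sq_le_sq' ?_ (by positivity) |>.2
        nlinarith [sq_nonneg (‖p j * d j‖ - ‖r j * c j‖)]
      linarith
  have hs : 1 ≤ ∑ j ∈ s, ‖p j * d j‖ + ∑ j ∈ s, ‖r j * c j‖ +
      2 * ∑ j ∈ s, ‖p j * c j - r j * d j‖ := by
    have h1 := sum_le_sum hj
    rw [← mul_sum, sum_add_distrib, sum_add_distrib, ← mul_sum] at h1
    have h2 := norm_sum_le s fun j => p j * c j
    linarith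
  by_cases h1 : 1 / 4 ≤ ∑ j ∈ s, ‖p j * d j‖
  · obtain ⟨ε, hε⟩ := exists_signs_norm_sum s fun j => p j * d j
    exact ⟨ε, Or.inl (by linarith)⟩
  by_cases h2 : 1 / 4 ≤ ∑ j ∈ s, ‖r j * c j‖
  · obtain ⟨ε, hε⟩ := exists_signs_norm_sum s fun j => r j * c j
    exact ⟨ε, Or.inr (Or.inl (by linarith))⟩
  · obtain ⟨ε, hε⟩ := exists_signs_norm_sum s fun j => p j * c j - r j * d j
    exact ⟨ε, Or.inr (Or.inr (by linarith))⟩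

theorem map_signs_smul {E G : Type*} [NormedAddCommGroup E] [NormedSpace 𝕜 E]
    [NormedAddCommGroup G] [NormedSpace 𝕜 G] (f : E →ₗ[𝕜] G) (s : ℤˣ) (v : E) :
    f (s • v) = s • f v := by
  rcases Int.units_eq_one_or s with h | h <;> simp [h]

/-- Local unconditional structure of a space of finite cotype with an unconditional decomposition
into the spans of `x k, y k` yields uniformly bounded block-diagonal operators, none of whose
`2 × 2` blocks is close to a scalar matrix. The `k`-th block is the compression of `w ∘ M ∘ u`, with
`M` a change of signs in the `1`-unconditional basis that may depend on `k`. -/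
theorem HasLocalUnconditionalStructure.exists_blockDiagonal {Y : Type u} [NormedAddCommGroup Y]
    [NormedSpace 𝕜 Y] {r C : ℝ} (hY : CotypeWith Y r C) (hr : 1 ≤ r) (hC : 1 ≤ C)
    {x y : ℕ → Y} {s t : ℕ → StrongDual 𝕜 Y} {K : ℝ} (hK0 : 0 ≤ K) (hs : ∀ k, s k (x k) = 1)
    (hP : ∀ (S : Finset ℕ) (θ : ℕ → ℤˣ) (v : Y),
      ‖∑ k ∈ S, θ k • (s k v • x k + t k v • y k)‖ ≤ K * ‖v‖)
    (hK : ∀ (S : Finset ℕ) (θ : ℕ → ℤˣ) (α β : ℕ → 𝕜),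
      ‖∑ k ∈ S, θ k • (α k • x k + β k • y k)‖ ≤ K * ‖∑ k ∈ S, (α k • x k + β k • y k)‖)
    (hl : HasLocalUnconditionalStructure 𝕜 Y) :
    ∃ C' : ℝ, 0 ≤ C' ∧ ∀ S : Finset ℕ, ∃ A B D E : ℕ → 𝕜,
      (∀ k ∈ S, 1 / 8 ≤ ‖B k‖ ∨ 1 / 8 ≤ ‖D k‖ ∨ 1 / 8 ≤ ‖A k - E k‖) ∧
      ∀ α β : ℕ → 𝕜, ‖∑ k ∈ S, ((A k * α k + B k * β k) • x k + (D k * α k + E k * β k) • y k)‖ ≤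
        C' * ‖∑ k ∈ S, (α k • x k + β k • y k)‖ := by
  classical
  obtain ⟨C0, hC0, hl⟩ := hl
  have hm := maureyConst_pos hr hC
  have hkh := khintchineConst_pos
  refine ⟨K * (maureyConst r C * 4 * khintchineConst) * C0 * K, by positivity, fun S => ?_⟩
  set X₀ : Submodule 𝕜 Y := Submodule.span 𝕜 ((S.image x ∪ S.image y : Finset Y) : Set Y) with hX₀
  have hxm : ∀ k ∈ S, x k ∈ X₀ := fun k hk => Submodule.subset_span (by
    simp only [coe_union, coe_image, Set.mem_union]; exact Or.inl ⟨k, hk, rfl⟩)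
  have hym : ∀ k ∈ S, y k ∈ X₀ := fun k hk => Submodule.subset_span (by
    simp only [coe_union, coe_image, Set.mem_union]; exact Or.inr ⟨k, hk, rfl⟩)
  obtain ⟨F, _, _, _, β', _, b, u, w, hb, hwu, huw⟩ := hl X₀
    (FiniteDimensional.span_finset 𝕜 _)
  -- the finite part `J` of the basis of `F` carries half of `s k (x k) = 1` for all `k ∈ S`
  have hJ : ∀ k : S, ∃ J : Finset β', ∀ J', J ⊆ J' →
      1 / 2 ≤ ‖∑ j ∈ J', s k (w (b j)) * b.coord j (u ⟨x k, hxm k k.2⟩)‖ := by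
    intro k
    have h1 := (b.expansion (u ⟨x k, hxm k k.2⟩)).mapL ((s k).comp w)
    simp only [ContinuousLinearMap.comp_apply, map_smul, smul_eq_mul] at h1
    rw [hwu] at h1
    simp only [hs] at h1
    have h2 : ∀ᶠ J' : Finset β' in atTop,
        1 / 2 < ‖∑ j ∈ J', b.coord j (u ⟨x k, hxm k k.2⟩) * s k (w (b j))‖ := by
      have h3 := (show Tendsto (fun J' : Finset β' => ∑ j ∈ J', b.coord j (u ⟨x k, hxm k k.2⟩) * s k (w (b j)))
        atTop (𝓝 1) by simpa [HasSum] using h1).norm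
      rw [norm_one] at h3
      exact h3.eventually (lt_mem_nhds (by norm_num))
    obtain ⟨J, hJ⟩ := eventually_atTop.mp h2
    refine ⟨J, fun J' hJ' => ?_⟩
    simp_rw [mul_comm (s _ _)]
    exact (hJ J' hJ').le
  choose Jf hJf using hJ
  set J : Finset β' := univ.biUnion Jf with hJd
  have hJ : ∀ k : S, 1 / 2 ≤ ‖∑ j ∈ J, s k (w (b j)) * b.coord j (u ⟨x k, hxm k k.2⟩)‖ :=
    fun k => hJf k J (subset_biUnion_of_mem Jf (mem_univ k))
  choose ε hε using fun k : S => exists_signs_offDiagonal J (fun j => s k (w (b j)))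
    (fun j => t k (w (b j))) (fun j => b.coord j (u ⟨x k, hxm k k.2⟩))
    (fun j => b.coord j (u ⟨y k, hym k k.2⟩)) (hJ k)
  set A : ℕ → 𝕜 := fun k => if hk : k ∈ S then
    ∑ j ∈ J, ε ⟨k, hk⟩ j • (s k (w (b j)) * b.coord j (u ⟨x k, hxm k hk⟩)) else 0 with hA
  set B : ℕ → 𝕜 := fun k => if hk : k ∈ S then
    ∑ j ∈ J, ε ⟨k, hk⟩ j • (s k (w (b j)) * b.coord j (u ⟨y k, hym k hk⟩)) else 0 with hB
  set D : ℕ → 𝕜 := fun k => if hk : k ∈ S then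
    ∑ j ∈ J, ε ⟨k, hk⟩ j • (t k (w (b j)) * b.coord j (u ⟨x k, hxm k hk⟩)) else 0 with hD
  set E : ℕ → 𝕜 := fun k => if hk : k ∈ S then
    ∑ j ∈ J, ε ⟨k, hk⟩ j • (t k (w (b j)) * b.coord j (u ⟨y k, hym k hk⟩)) else 0 with hE
  refine ⟨A, B, D, E, fun k hk => ?_, fun α β => ?_⟩
  · simp only [hA, hB, hD, hE, dif_pos hk]
    rw [← sum_sub_distrib]
    simp_rw [← smul_sub]
    exact hε ⟨k, hk⟩
  · set z : S → X₀ := fun k => α k • ⟨x k, hxm k k.2⟩ + β k • ⟨y k, hym k k.2⟩ with hz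
    set g : S → F := fun k => ∑ j : J, ε k j • (b.coord j (u (z k)) • b j) with hg
    set Φ : S → Y →ₗ[𝕜] Y := fun k =>
      (s k).toLinearMap.smulRight (x k) + (t k).toLinearMap.smulRight (y k) with hΦ
    have hΦa : ∀ k v, Φ k v = s k v • x k + t k v • y k := fun k v => by simp [hΦ]
    have hgS : ∀ k : S, Φ k (w (g k)) =
        (A k * α k + B k * β k) • x k + (D k * α k + E k * β k) • y k := by
      intro k
      have hgs : ∀ f : StrongDual 𝕜 Y, f (w (g k)) =
          (∑ j ∈ J, ε k j • (f (w (b j)) * b.coord j (u ⟨x k, hxm k k.2⟩))) * α k +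
          (∑ j ∈ J, ε k j • (f (w (b j)) * b.coord j (u ⟨y k, hym k k.2⟩))) * β k := by
        intro f
        rw [← sum_coe_sort J, ← sum_coe_sort J, sum_mul, sum_mul, ← sum_add_distrib, hg]
        simp only [map_sum]
        refine sum_congr rfl fun j _ => ?_
        rw [hz]
        rcases Int.units_eq_one_or (ε k j) with h | h
        · simp only [h, one_smul, map_smul, map_add, smul_eq_mul]; ring
        · simp only [h, Units.smul_def, Units.val_neg, Units.val_one, neg_smul, one_smul, map_neg,
            map_smul, map_add, smul_eq_mul]; ring
      rw [hΦa, hgs, hgs]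
      simp only [hA, hB, hD, hE, dif_pos k.2]
    have hL : ∑ k ∈ S, ((A k * α k + B k * β k) • x k + (D k * α k + E k * β k) • y k) =
        ∑ k : S, Φ k (w (g k)) := by
      rw [← sum_coe_sort S]
      exact sum_congr rfl fun k _ => (hgS k).symm
    have hZ : ∑ k ∈ S, (α k • x k + β k • y k) = ∑ k : S, (z k : Y) := by
      rw [← sum_coe_sort S]
      exact sum_congr rfl fun k _ => by simp [hz]
    have hext : ∀ θ : S → ℤˣ, ∃ θ' : ℕ → ℤˣ, ∀ k : S, θ' k = θ k := fun θ =>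
      ⟨fun k => if hk : k ∈ S then θ ⟨k, hk⟩ else 1, fun k => by simp⟩
    have hdiag := signs_sum_diagonal (L := S) Φ fun k => w (g k)
    have hN : (0 : ℝ) < Fintype.card (S → ℤˣ) := by exact_mod_cast Fintype.card_pos
    -- the block diagonal part is an average over signs `θ` of the compressions of
    -- `∑ θ l • w (g l)`, in which the signs `ε l j` are then removed by Maurey's inequality
    have h1 : (Fintype.card (S → ℤˣ) : ℝ) * ‖∑ k : S, Φ k (w (g k))‖ ≤
        ∑ θ : S → ℤˣ, K * ‖w (∑ l, θ l • g l)‖ := by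
      have : (Fintype.card (S → ℤˣ) : ℝ) * ‖∑ k : S, Φ k (w (g k))‖ =
          ‖(Fintype.card (S → ℤˣ) : 𝕜) • ∑ k : S, Φ k (w (g k))‖ := by
        rw [norm_smul]; simp
      rw [this, ← hdiag]
      refine (norm_sum_le _ _).trans (sum_le_sum fun θ _ => ?_)
      obtain ⟨θ', hθ'⟩ := hext θ
      have h2 : ∑ l, θ l • w (g l) = w (∑ l, θ l • g l) := by
        rw [map_sum]
        exact sum_congr rfl fun l _ => (map_signs_smul (𝕜 := 𝕜) w.toLinearMap _ _).symm
      rw [h2]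
      have h3 := hP S θ' (w (∑ l, θ l • g l))
      rw [← sum_coe_sort S] at h3
      simpa only [hθ', hΦa] using h3
    have h2 : ∑ θ : S → ℤˣ, ‖w (∑ l, θ l • g l)‖ ≤
        maureyConst r C * 4 * khintchineConst * ‖w‖ *
        ∑ θ : S → ℤˣ, ‖∑ l, θ l • ∑ j : J, b.coord j (u (z l)) • b j‖ := by
      refine hY.sum_norm_signChange_le hr hC (e := fun j : J => b j) (fun ε' a => ?_) w
        (fun l j => b.coord j (u (z l))) (fun l j => ε l j)
      have h3 := hb.norm_signs_sum_le J (fun j => if hj : j ∈ J then ε' ⟨j, hj⟩ else 1)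
        (fun j => if hj : j ∈ J then a ⟨j, hj⟩ else 0)
      rw [← sum_coe_sort J, ← sum_coe_sort J] at h3
      simpa using h3
    have h3 : ∀ θ : S → ℤˣ, ‖∑ l, θ l • ∑ j : J, b.coord j (u (z l)) • b j‖ ≤
        ‖u‖ * (K * ‖∑ k : S, (z k : Y)‖) := by
      intro θ
      have h4 : ∑ l, θ l • ∑ j : J, b.coord j (u (z l)) • b j =
          ∑ j ∈ J, b.coord j (u (∑ l, θ l • z l)) • b j := by
        rw [← sum_coe_sort J]
        simp_rw [smul_sum]
        rw [sum_comm]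
        refine sum_congr rfl fun j _ => ?_
        rw [map_sum, map_sum, sum_smul]
        refine sum_congr rfl fun l _ => ?_
        rcases Int.units_eq_one_or (θ l) with h | h <;> simp [h]
      rw [h4]
      refine (hb.norm_proj_le J _).trans ((u.le_opNorm _).trans ?_)
      refine mul_le_mul_of_nonneg_left ?_ (norm_nonneg _)
      obtain ⟨θ', hθ'⟩ := hext θ
      have h5 := hK S θ' α β
      rw [hZ, ← sum_coe_sort S] at h5
      refine le_trans (le_of_eq ?_) h5
      change ‖((∑ l, θ l • z l : X₀) : Y)‖ = _
      rw [Submodule.coe_sum]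
      congr 1
      refine sum_congr rfl fun k _ => ?_
      rw [hθ']
      rcases Int.units_eq_one_or (θ k) with h | h <;> simp [h, hz]
    rw [hL, hZ, ← mul_le_mul_iff_right₀ hN]
    refine h1.trans ?_
    rw [← mul_sum]
    have h4 : ∑ θ : S → ℤˣ, ‖∑ l, θ l • ∑ j : J, b.coord j (u (z l)) • b j‖ ≤
        Fintype.card (S → ℤˣ) * (‖u‖ * (K * ‖∑ k : S, (z k : Y)‖)) := by
      refine (sum_le_sum fun θ _ => h3 θ).trans (le_of_eq ?_)
      rw [sum_const, card_univ, nsmul_eq_mul]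
    calc K * ∑ θ : S → ℤˣ, ‖w (∑ l, θ l • g l)‖
        ≤ K * (maureyConst r C * 4 * khintchineConst * ‖w‖ *
          (Fintype.card (S → ℤˣ) * (‖u‖ * (K * ‖∑ k : S, (z k : Y)‖)))) := by
          refine mul_le_mul_of_nonneg_left (h2.trans ?_) hK0
          gcongr
      _ = Fintype.card (S → ℤˣ) * (K * (maureyConst r C * 4 * khintchineConst) * (‖u‖ * ‖w‖) * K *
          ‖∑ k : S, (z k : Y)‖) := by ring
      _ ≤ _ := by gcongr

end BlockDiagonal

section ViolatingFamily

variable {𝕜 : Type*} [RCLike 𝕜] {X : Type u} [NormedAddCommGroup X] [NormedSpace 𝕜 X]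

/-- The family `F i k` is unconditional with constant `K`. -/
def IsUncondFamily (𝕜 : Type*) [RCLike 𝕜] {X : Type*} [NormedAddCommGroup X] [NormedSpace 𝕜 X]
    (F : Fin 3 → ℕ → X) (K : ℝ) : Prop :=
  ∀ (S : Finset ℕ) (c θ : Fin 3 → ℕ → 𝕜), (∀ i k, ‖θ i k‖ ≤ 1) →
    ‖∑ k ∈ S, ∑ i, (θ i k * c i k) • F i k‖ ≤ K * ‖∑ k ∈ S, ∑ i, c i k • F i k‖

/-- Three sequences which cannot be compared, in the following strong sense: for every `M` there is
a finite set of indices such that, however it is coloured with three colours, for some colour `i`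
some combination of vectors of the `i`-th sequence with indices of colour `i` has norm at least
`M` times the norm of the same combination of the two other sequences. -/
def IsViolatingFamily (𝕜 : Type*) [RCLike 𝕜] {X : Type*} [NormedAddCommGroup X] [NormedSpace 𝕜 X]
    (F : Fin 3 → ℕ → X) : Prop :=
  ∀ M : ℝ, ∃ S : Finset ℕ, ∀ col : ℕ → Fin 3, ∃ (i : Fin 3) (b : ℕ → 𝕜),
    (∀ k, b k ≠ 0 → k ∈ S ∧ col k = i) ∧
    ∀ j ≠ i, M * ‖∑ k ∈ S, b k • F j k‖ < ‖∑ k ∈ S, b k • F i k‖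

variable {F : Fin 3 → ℕ → X} {K A r C : ℝ}

theorem IsUncondFamily.norm_coord_le (hK : IsUncondFamily 𝕜 F K) (S : Finset ℕ)
    (c : Fin 3 → ℕ → 𝕜) (i : Fin 3) (τ : ℕ → 𝕜) (hτ : ∀ k, ‖τ k‖ ≤ 1) :
    ‖∑ k ∈ S, (τ k * c i k) • F i k‖ ≤ K * ‖∑ k ∈ S, ∑ j, c j k • F j k‖ := by
  have h := hK S c (fun j k => if j = i then τ k else 0) (fun j k => by
    split_ifs
    · exact hτ k
    · simp)
  refine le_trans (le_of_eq ?_) h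
  congr 1
  refine sum_congr rfl fun k _ => ?_
  rw [sum_eq_single i]
  · simp
  · intro j _ hj; simp [hj]
  · simp

theorem IsUncondFamily.mul_norm_coord_le (hK : IsUncondFamily 𝕜 F K) (S : Finset ℕ)
    (c : Fin 3 → ℕ → 𝕜) (i : Fin 3) (w b : ℕ → 𝕜) {c₀ : ℝ} (hc₀ : 0 < c₀)
    (hw : ∀ k, b k ≠ 0 → c₀ ≤ ‖w k‖) (hc : ∀ k, c i k = w k * b k) :
    c₀ * ‖∑ k ∈ S, b k • F i k‖ ≤ K * ‖∑ k ∈ S, ∑ j, c j k • F j k‖ := by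
  classical
  refine le_trans (le_of_eq ?_) (hK.norm_coord_le S c i
    (fun k => if c₀ ≤ ‖w k‖ then (c₀ : 𝕜) * (w k)⁻¹ else 0) fun k => ?_)
  · have hcn : ‖(c₀ : 𝕜)‖ = c₀ := by rw [RCLike.norm_ofReal, abs_of_pos hc₀]
    calc c₀ * ‖∑ k ∈ S, b k • F i k‖ = ‖(c₀ : 𝕜) • ∑ k ∈ S, b k • F i k‖ := by
          rw [norm_smul, hcn]
      _ = _ := ?_
    rw [smul_sum]
    congr 1
    refine sum_congr rfl fun k _ => ?_
    rw [smul_smul, hc]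
    congr 1
    by_cases hb : b k = 0
    · simp [hb]
    · have hwk := hw k hb
      rw [if_pos hwk]
      have : w k ≠ 0 := norm_pos_iff.mp (hc₀.trans_le hwk)
      field_simp
  · split_ifs with h
    · rw [norm_mul, norm_inv, RCLike.norm_ofReal, abs_of_pos hc₀, ← div_eq_mul_inv]
      exact div_le_one_of_le₀ h (norm_nonneg _)
    · simp

theorem sum_range_two_mul {E : Type*} [AddCommMonoid E] (f : ℕ → E) (N : ℕ) :
    ∑ i ∈ range (2 * N), f i = ∑ k ∈ range N, (f (2 * k) + f (2 * k + 1)) := by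
  induction N with
  | zero => simp
  | succ n ih => rw [mul_add, mul_one, sum_range_succ, sum_range_succ, ih, sum_range_succ, add_assoc]

theorem pair_combination_eq (F : Fin 3 → ℕ → X) (S : Finset ℕ) (α β : ℕ → 𝕜) :
    ∑ k ∈ S, (α k • (F 0 k + F 2 k) + β k • (F 1 k + F 2 k)) =
      ∑ k ∈ S, ∑ i, (![α, β, α + β] : Fin 3 → ℕ → 𝕜) i k • F i k := by
  refine sum_congr rfl fun k _ => ?_
  simp only [Fin.sum_univ_three, Matrix.cons_val_zero, Matrix.cons_val_one, Matrix.cons_val,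
    Pi.add_apply]
  module

theorem IsUncondFamily.norm_pair_mul_le (hK : IsUncondFamily 𝕜 F K) (S : Finset ℕ)
    (α β θ : ℕ → 𝕜) (hθ : ∀ k, ‖θ k‖ ≤ 1) :
    ‖∑ k ∈ S, θ k • (α k • (F 0 k + F 2 k) + β k • (F 1 k + F 2 k))‖ ≤
      K * ‖∑ k ∈ S, (α k • (F 0 k + F 2 k) + β k • (F 1 k + F 2 k))‖ := by
  have h := hK S ![α, β, α + β] (fun _ => θ) fun _ => hθ
  rw [← pair_combination_eq] at h
  refine le_trans (le_of_eq ?_) h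
  congr 1
  refine sum_congr rfl fun k _ => ?_
  simp only [Fin.sum_univ_three, Matrix.cons_val_zero, Matrix.cons_val_one, Matrix.cons_val,
    Pi.add_apply]
  module

theorem IsUncondFamily.exists_schauderBasis (hK : IsUncondFamily 𝕜 F K)
    (hF1 : ∀ i k, 1 ≤ ‖F i k‖) (hFA : ∀ i k, ‖F i k‖ ≤ A) (hK0 : 0 ≤ K) {z : ℕ → X}
    (hz0 : ∀ k, z (2 * k) = F 0 k + F 2 k) (hz1 : ∀ k, z (2 * k + 1) = F 1 k + F 2 k) :
    ∃ b : SchauderBasis 𝕜 (Submodule.span 𝕜 (Set.range z)).topologicalClosure,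
      ∀ n, (b n : X) = z n := by
  have hA0 : 0 ≤ A := (norm_nonneg _).trans (hFA 0 0)
  have hev : ∀ (a : ℕ → 𝕜) N, ∑ i ∈ range (2 * N), a i • z i =
      ∑ k ∈ range N, (a (2 * k) • (F 0 k + F 2 k) + a (2 * k + 1) • (F 1 k + F 2 k)) := by
    intro a N
    rw [sum_range_two_mul]
    simp_rw [hz0, hz1]
  have hne : ∀ n, z n ≠ 0 := by
    have key : ∀ (α β : 𝕜) (i : Fin 3) (k : ℕ), ![α, β, α + β] i = 1 →
        α • (F 0 k + F 2 k) + β • (F 1 k + F 2 k) ≠ 0 := by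
      intro α β i k h1 h0
      have h := hK.norm_coord_le {k} ![fun _ => α, fun _ => β, (fun _ => α) + fun _ => β] i
        (fun _ => 1) (by simp)
      rw [← pair_combination_eq] at h
      have h2 : (![fun _ => α, fun _ => β, (fun _ => α) + fun _ => β] : Fin 3 → ℕ → 𝕜) i k = 1 := by
        rw [← h1]; fin_cases i <;> rfl
      simp only [sum_singleton, h0, norm_zero, mul_zero, h2, one_mul, one_smul] at h
      linarith [hF1 i k]
    intro n
    rcases Nat.even_or_odd' n with ⟨k, rfl | rfl⟩
    · rw [hz0]
      simpa using key 1 0 0 k (by simp)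
    · rw [hz1]
      simpa using key 0 1 1 k (by simp)
  have heven : ∀ (a : ℕ → 𝕜) (N M : ℕ), N ≤ M →
      ‖∑ i ∈ range (2 * N), a i • z i‖ ≤ K * ‖∑ i ∈ range (2 * M), a i • z i‖ := by
    intro a N M h
    rw [hev, hev]
    refine le_trans (le_of_eq ?_) (hK.norm_pair_mul_le (range M) (fun k => a (2 * k))
      (fun k => a (2 * k + 1)) (fun k => if k < N then 1 else 0) fun k => ?_)
    · congr 1
      symm
      rw [← sum_subset (range_mono h)]
      · exact sum_congr rfl fun k hk => by simp [mem_range.mp hk]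
      · intro k _ hk
        simp [mem_range] at hk
        simp [not_lt.mpr hk]
    · split_ifs <;> simp
  refine exists_schauderBasis_closure_span hne (K := K + 2 * A * K) fun a n m hnm => ?_
  set a' : ℕ → 𝕜 := fun i => if i < m then a i else 0 with ha'
  have h1 : ∑ i ∈ range m, a i • z i = ∑ i ∈ range (2 * m), a' i • z i := by
    rw [← sum_subset (range_mono (show m ≤ 2 * m by omega))]
    · exact sum_congr rfl fun k hk => by simp [ha', mem_range.mp hk]
    · intro k _ hk
      simp [ha', mem_range] at hk ⊢
      simp [not_lt.mpr hk]
  have h2 : ∑ i ∈ range n, a i • z i = ∑ i ∈ range n, a' i • z i :=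
    sum_congr rfl fun k hk => by simp [ha', (mem_range.mp hk).trans_le hnm]
  rw [h1, h2]
  set v := ∑ i ∈ range (2 * m), a' i • z i with hv
  have hAK : 0 ≤ 2 * A * K * ‖v‖ := by positivity
  rcases Nat.even_or_odd' n with ⟨N, rfl | rfl⟩
  · have := heven a' N m (by omega)
    rw [add_mul]; linarith
  · rw [sum_range_succ]
    have h3 := heven a' N m (by omega)
    have h4 : ‖a' (2 * N)‖ ≤ K * ‖v‖ := by
      have h5 := hK.norm_coord_le (range m) ![fun k => a' (2 * k), fun k => a' (2 * k + 1),
        (fun k => a' (2 * k)) + fun k => a' (2 * k + 1)] 0 (fun k => if k = N then 1 else 0)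
        (fun k => by split_ifs <;> simp)
      rw [← pair_combination_eq, ← hev] at h5
      rw [sum_eq_single_of_mem N (mem_range.mpr (by omega))] at h5
      · simp only [if_true, one_mul, Matrix.cons_val_zero, norm_smul] at h5
        nlinarith [hF1 0 N, norm_nonneg (a' (2 * N))]
      · intro k _ hk; simp [hk]
    have h6 : ‖z (2 * N)‖ ≤ 2 * A := by
      rw [hz0]
      exact (norm_add_le _ _).trans (by linarith [hFA 0 N, hFA 2 N])
    calc _ ≤ ‖∑ i ∈ range (2 * N), a' i • z i‖ + ‖a' (2 * N) • z (2 * N)‖ := norm_add_le _ _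
      _ ≤ K * ‖v‖ + (K * ‖v‖) * (2 * A) := by
          rw [norm_smul]; gcongr
      _ = _ := by ring

theorem CotypeWith.submodule (hX : CotypeWith X r C) (Y : Submodule 𝕜 X) : CotypeWith Y r C := by
  intro n x
  refine (hX n fun i => (x i : X)).trans (le_of_eq ?_)
  congr 2
  refine sum_congr rfl fun ε _ => ?_
  change _ = ‖((∑ i, ε i • x i : Y) : X)‖
  rw [Submodule.coe_sum]
  congr 1

/-- An unconditional family `F` in a space of finite cotype which is violating gives rise to a
subspace with a Schauder basis and without local unconditional structure, spanned by the vectors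
`F 0 k + F 2 k` and `F 1 k + F 2 k`. A block-diagonal operator as in
`HasLocalUnconditionalStructure.exists_blockDiagonal` gives a colouring of the indices, according
to the entry of the block which is not small, and moves one of the vectors `y k`, `x k`, `x k - y k`
of the blocks to a vector with a component in the sequence `F 0`, `F 1`, `F 2` respectively which it
did not have. -/
theorem IsViolatingFamily.exists_subspace (hX : CotypeWith X r C) (hr : 1 ≤ r) (hC : 1 ≤ C)
    (hF1 : ∀ i k, 1 ≤ ‖F i k‖) (hFA : ∀ i k, ‖F i k‖ ≤ A) (hK : IsUncondFamily 𝕜 F K)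
    (hV : IsViolatingFamily 𝕜 F) :
    ∃ Y : Submodule 𝕜 X, IsClosed (Y : Set X) ∧ Nonempty (SchauderBasis 𝕜 Y) ∧
      ¬ HasLocalUnconditionalStructure 𝕜 Y := by
  classical
  have hK0 : 0 ≤ K := by
    have h := hK.norm_coord_le {0} (fun _ _ => 1) 0 (fun _ => 1) (by simp)
    by_contra hneg
    have h1 : K * ‖∑ k ∈ {0}, ∑ j : Fin 3, (1 : 𝕜) • F j k‖ ≤ 0 :=
      mul_nonpos_of_nonpos_of_nonneg (not_le.mp hneg).le (norm_nonneg _)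
    simp only [sum_singleton, one_mul, one_smul] at h h1
    linarith [hF1 0 0]
  set z : ℕ → X := fun n => if n % 2 = 0 then F 0 (n / 2) + F 2 (n / 2)
    else F 1 (n / 2) + F 2 (n / 2) with hz
  have hz0 : ∀ k, z (2 * k) = F 0 k + F 2 k := fun k => by simp [hz]
  have hz1 : ∀ k, z (2 * k + 1) = F 1 k + F 2 k := fun k => by
    have h1 : (2 * k + 1) % 2 = 1 := by omega
    have h2 : (2 * k + 1) / 2 = k := by omega
    simp [hz, h1, h2]
  obtain ⟨Y, hYc, b, hb⟩ : ∃ Y : Submodule 𝕜 X, IsClosed (Y : Set X) ∧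
      ∃ b : SchauderBasis 𝕜 Y, ∀ n, (b n : X) = z n :=
    ⟨_, Submodule.isClosed_topologicalClosure _, hK.exists_schauderBasis hF1 hFA hK0 hz0 hz1⟩
  refine ⟨Y, hYc, ⟨b⟩, fun hl => ?_⟩
  have hsum : ∀ (S : Finset ℕ) (α β : ℕ → 𝕜),
      ‖∑ k ∈ S, (α k • b (2 * k) + β k • b (2 * k + 1))‖ =
      ‖∑ k ∈ S, (α k • (F 0 k + F 2 k) + β k • (F 1 k + F 2 k))‖ := by
    intro S α β
    change ‖((∑ k ∈ S, (α k • b (2 * k) + β k • b (2 * k + 1)) : Y) : X)‖ = _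
    rw [Submodule.coe_sum]
    simp only [Submodule.coe_add, Submodule.coe_smul, hb, hz0, hz1]
  have hsumθ : ∀ (S : Finset ℕ) (θ α β : ℕ → 𝕜), (∀ k, ‖θ k‖ ≤ 1) →
      ‖∑ k ∈ S, θ k • (α k • b (2 * k) + β k • b (2 * k + 1))‖ ≤
      K * ‖∑ k ∈ S, (α k • b (2 * k) + β k • b (2 * k + 1))‖ := by
    intro S θ α β hθ
    have h := hK.norm_pair_mul_le S α β θ hθ
    simp_rw [smul_add (θ _), smul_smul] at h ⊢
    rwa [hsum S α β, hsum S (fun k => θ k * α k) (fun k => θ k * β k)]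
  have hsign : ∀ s : ℤˣ, ‖((s : ℤ) : 𝕜)‖ ≤ 1 := by
    intro s
    rcases Int.units_eq_one_or s with h | h <;> simp [h]
  obtain ⟨C', hC'0, hT⟩ := hl.exists_blockDiagonal (hX.submodule Y) hr hC (x := fun k => b (2 * k))
    (y := fun k => b (2 * k + 1)) (s := fun k => b.coord (2 * k))
    (t := fun k => b.coord (2 * k + 1)) hK0 (fun k => by
      have := b.ortho (2 * k) (2 * k)
      simpa using this) (fun S θ v => by
      have hlim : Tendsto (fun N => K * ‖∑ k ∈ range N, (b.coord (2 * k) v • b (2 * k) +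
          b.coord (2 * k + 1) v • b (2 * k + 1))‖) atTop (𝓝 (K * ‖v‖)) := by
        have h1 := (SchauderBasis.tendsto_proj b v).comp
          (tendsto_id.const_mul_atTop' (show 0 < 2 by norm_num))
        refine Tendsto.const_mul K (Tendsto.norm (h1.congr fun N => ?_))
        simp only [Function.comp, SchauderBasis.proj_apply, id]
        exact sum_range_two_mul (fun i => b.coord i v • b i) N
      obtain ⟨N₀, hN₀⟩ := S.exists_nat_subset_range
      refine ge_of_tendsto hlim (eventually_atTop.mpr ⟨N₀, fun N hN => ?_⟩)
      refine le_trans (le_of_eq ?_) (hsumθ (range N)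
        (fun k => if k ∈ S then ((θ k : ℤ) : 𝕜) else 0) (fun k => b.coord (2 * k) v)
        (fun k => b.coord (2 * k + 1) v) fun k => ?_)
      · congr 1
        rw [← sum_subset (hN₀.trans (range_mono hN))]
        · refine sum_congr rfl fun k hk => ?_
          rw [if_pos hk, signs_smul_eq_mul (𝕜 := 𝕜)]
        · intro k _ hk; simp [hk]
      · split_ifs
        · exact hsign _
        · simp) (fun S θ α β => by
      simp_rw [signs_smul_eq_mul (𝕜 := 𝕜)]
      exact hsumθ S _ α β fun k => hsign _)
  clear hl
  simp_rw [hsum] at hT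
  obtain ⟨S, hS⟩ := hV (64 * K * C' + 1)
  obtain ⟨A', B, D, E, hent, hT⟩ := hT S
  set M := 64 * K * C' + 1 with hM
  have hM0 : 0 < M := by positivity
  -- the colour of `k` tells which of `B k`, `D k`, `A' k - E k` is not small
  obtain ⟨i, β, hβ, hβM⟩ := hS fun k => if 1 / 32 ≤ ‖B k‖ then 0 else
    if 1 / 32 ≤ ‖D k‖ then 1 else 2
  set n : Fin 3 → ℝ := fun i => ‖∑ k ∈ S, β k • F i k‖ with hn
  have hn0 : ∀ i, 0 ≤ n i := fun i => norm_nonneg _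
  -- apply the block-diagonal operator to `∑ (α' k • x k + β' k • y k)`, whose norm involves the
  -- sequences `j₁, j₂ ≠ i` only, and compare the components in the sequence `i`
  have hfin : ∀ (w : ℕ → 𝕜) (α' β' : ℕ → 𝕜),
      (∀ k, ![fun k => A' k * α' k + B k * β' k, fun k => D k * α' k + E k * β' k,
        (fun k => A' k * α' k + B k * β' k) + fun k => D k * α' k + E k * β' k] i k = w k * β k) →
      (∀ k, β k ≠ 0 → 1 / 32 ≤ ‖w k‖) →
      (∃ j₁ ≠ i, ∃ j₂ ≠ i, ‖∑ k ∈ S, (α' k • (F 0 k + F 2 k) + β' k • (F 1 k + F 2 k))‖ ≤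
        n j₁ + n j₂) → False := by
    intro w α' β' hw hw' ⟨j₁, hj₁, j₂, hj₂, hle⟩
    have h1 := hK.mul_norm_coord_le S ![fun k => A' k * α' k + B k * β' k,
      fun k => D k * α' k + E k * β' k,
      (fun k => A' k * α' k + B k * β' k) + fun k => D k * α' k + E k * β' k] i w β
      (by norm_num : (0 : ℝ) < 1 / 32) hw' hw
    rw [← pair_combination_eq] at h1
    have h2 : 1 / 32 * n i ≤ K * (C' * (n j₁ + n j₂)) :=
      h1.trans (mul_le_mul_of_nonneg_left ((hT α' β').trans
        (mul_le_mul_of_nonneg_left hle hC'0)) hK0)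
    have h3 : M * n j₁ < n i := hβM j₁ hj₁
    have h4 : M * n j₂ < n i := hβM j₂ hj₂
    have h5 : 0 < n i := lt_of_le_of_lt (mul_nonneg hM0.le (hn0 j₁)) h3
    have hKC : 0 ≤ K * C' := mul_nonneg hK0 hC'0
    have h6 : M * (1 / 32 * n i) ≤ K * C' * (2 * n i) := by
      calc M * (1 / 32 * n i) ≤ M * (K * (C' * (n j₁ + n j₂))) := by gcongr
        _ = K * C' * (M * n j₁ + M * n j₂) := by ring
        _ ≤ K * C' * (2 * n i) := by gcongr; linarith
    have h7 : M * n i ≤ 64 * (K * C') * n i := by linarith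
    have h8 := le_of_mul_le_mul_right h7 h5
    rw [hM] at h8
    linarith
  have hcol : ∀ k, β k ≠ 0 → 1 / 8 ≤ ‖B k‖ ∨ 1 / 8 ≤ ‖D k‖ ∨ 1 / 8 ≤ ‖A' k - E k‖ :=
    fun k hk => hent k (hβ k hk).1
  fin_cases i
  · refine hfin B 0 β (fun k => by simp) (fun k hk => ?_) ⟨1, by decide, 2, by decide, ?_⟩
    · have h := (hβ k hk).2
      by_contra h1
      rw [if_neg h1] at h
      split_ifs at h <;> simp at h
    · simp only [Pi.zero_apply, zero_smul, zero_add, smul_add, sum_add_distrib, hn]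
      exact norm_add_le _ _
  · refine hfin D β 0 (fun k => by simp) (fun k hk => ?_) ⟨0, by decide, 2, by decide, ?_⟩
    · have h := (hβ k hk).2
      by_contra h1
      rw [if_neg h1] at h
      split_ifs at h <;> simp at h
    · simp only [Pi.zero_apply, zero_smul, add_zero, smul_add, sum_add_distrib, hn]
      exact norm_add_le _ _
  · refine hfin (fun k => A' k - B k + (D k - E k)) β (-β) (fun k => ?_) (fun k hk => ?_)
      ⟨0, by decide, 1, by decide, ?_⟩
    · simp; ring
    · have h := (hβ k hk).2
      have h1 : ¬ 1 / 32 ≤ ‖B k‖ := by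
        intro h1; rw [if_pos h1] at h; simp at h
      have h2 : ¬ 1 / 32 ≤ ‖D k‖ := by
        intro h2; rw [if_neg h1, if_pos h2] at h; simp at h
      rcases hcol k hk with h3 | h3 | h3
      · linarith
      · linarith
      · have h4 : A' k - E k = (A' k - B k + (D k - E k)) + (B k - D k) := by ring
        have h5 := norm_add_le (A' k - B k + (D k - E k)) (B k - D k)
        rw [← h4] at h5
        have h6 := norm_sub_le (B k) (D k)
        push Not at h1 h2
        linarith
    · have : ∑ k ∈ S, (β k • (F 0 k + F 2 k) + (-β) k • (F 1 k + F 2 k)) =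
          ∑ k ∈ S, β k • F 0 k - ∑ k ∈ S, β k • F 1 k := by
        rw [← sum_sub_distrib]
        refine sum_congr rfl fun k _ => ?_
        rw [Pi.neg_apply]
        module
      rw [this]
      exact norm_sub_le _ _

end ViolatingFamily

/-! ### Lattice norms on finitely supported sequences -/

/-- A lattice seminorm on the space `ℕ →₀ ℝ` of finitely supported sequences. -/
structure LNorm where
  toFun : (ℕ →₀ ℝ) → ℝ
  add_le' : ∀ a b, toFun (a + b) ≤ toFun a + toFun b
  smul' : ∀ (t : ℝ) a, toFun (t • a) = |t| * toFun a
  mono' : ∀ a b : ℕ →₀ ℝ, (∀ k, |a k| ≤ |b k|) → toFun a ≤ toFun b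

namespace LNorm

instance : CoeFun LNorm fun _ => (ℕ →₀ ℝ) → ℝ := ⟨LNorm.toFun⟩

variable (N : LNorm) {a b : ℕ →₀ ℝ}

theorem add_le (a b : ℕ →₀ ℝ) : N (a + b) ≤ N a + N b := N.add_le' a b

theorem smul (t : ℝ) (a : ℕ →₀ ℝ) : N (t • a) = |t| * N a := N.smul' t a

theorem mono (h : ∀ k, |a k| ≤ |b k|) : N a ≤ N b := N.mono' a b h

theorem zero : N 0 = 0 := by simpa using N.smul 0 0

theorem nonneg (a : ℕ →₀ ℝ) : 0 ≤ N a := by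
  rw [← N.zero]; exact N.mono fun k => by simp

theorem neg (a : ℕ →₀ ℝ) : N (-a) = N a := by simpa using N.smul (-1) a

theorem sum_le {ι : Type*} (s : Finset ι) (f : ι → ℕ →₀ ℝ) : N (∑ i ∈ s, f i) ≤ ∑ i ∈ s, N (f i) := by
  classical
  induction s using Finset.induction_on with
  | empty => simp [N.zero]
  | insert i s hi ih =>
    rw [sum_insert hi, sum_insert hi]
    exact (N.add_le _ _).trans (by linarith)

/-- The norm of each unit vector is one. -/
def Normalized : Prop := ∀ k, N (Finsupp.single k 1) = 1

variable {N}

theorem Normalized.single (h : N.Normalized) (k : ℕ) (t : ℝ) : N (Finsupp.single k t) = |t| := by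
  have := N.smul t (Finsupp.single k 1)
  rwa [Finsupp.smul_single, smul_eq_mul, mul_one, h, mul_one] at this

theorem Normalized.abs_le (h : N.Normalized) (a : ℕ →₀ ℝ) (k : ℕ) : |a k| ≤ N a := by
  rw [← h.single k]
  refine N.mono fun j => ?_
  rw [Finsupp.single_apply]
  split_ifs with hj
  · rw [hj]
  · simp

theorem Normalized.le_l1 (h : N.Normalized) (a : ℕ →₀ ℝ) : N a ≤ ∑ k ∈ a.support, |a k| := by
  conv_lhs => rw [← a.sum_single]
  rw [Finsupp.sum]
  exact (N.sum_le _ _).trans (sum_le_sum fun k _ => (h.single k _).le)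

theorem Normalized.pos (h : N.Normalized) {a : ℕ →₀ ℝ} (ha : a ≠ 0) : 0 < N a := by
  obtain ⟨k, hk⟩ := Finsupp.ne_iff.mp ha
  exact lt_of_lt_of_le (abs_pos.mpr hk) (h.abs_le a k)

theorem Normalized.ne_zero_of_pos (_h : N.Normalized) {a : ℕ →₀ ℝ} (ha : 0 < N a) : a ≠ 0 := by
  rintro rfl; rw [N.zero] at ha; exact lt_irrefl _ ha

end LNorm

/-- The linear combination `∑ b k • w k`. -/
noncomputable abbrev lcomb (w : ℕ → ℕ →₀ ℝ) (b : ℕ →₀ ℝ) : ℕ →₀ ℝ := Finsupp.linearCombination ℝ w b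

theorem lcomb_apply (w : ℕ → ℕ →₀ ℝ) (b : ℕ →₀ ℝ) (m : ℕ) :
    lcomb w b m = ∑ k ∈ b.support, b k * w k m := by
  rw [lcomb, Finsupp.linearCombination_apply, Finsupp.sum, Finsupp.finsetSum_apply]
  rfl

theorem lcomb_eq_sum (w : ℕ → ℕ →₀ ℝ) (b : ℕ →₀ ℝ) {s : Finset ℕ} (hs : b.support ⊆ s) :
    lcomb w b = ∑ k ∈ s, b k • w k := by
  rw [lcomb, Finsupp.linearCombination_apply]
  exact Finsupp.sum_of_support_subset _ hs _ (by simp)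

theorem lcomb_congr {w w' : ℕ → ℕ →₀ ℝ} {b : ℕ →₀ ℝ} (h : ∀ k ∈ b.support, w k = w' k) :
    lcomb w b = lcomb w' b := by
  rw [lcomb_eq_sum w b subset_rfl, lcomb_eq_sum w' b subset_rfl]
  exact sum_congr rfl fun k hk => by rw [h k hk]

theorem lcomb_single_eq_mapDomain (φ : ℕ → ℕ) (b : ℕ →₀ ℝ) :
    lcomb (fun k => Finsupp.single (φ k) 1) b = Finsupp.mapDomain φ b := by
  rw [lcomb, Finsupp.linearCombination_apply, Finsupp.mapDomain]
  simp

/-- The vectors `w k`, `k ∈ S`, have disjoint supports. -/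
def DisjSupp {ι : Type*} (S : Set ι) (w : ι → ℕ →₀ ℝ) : Prop :=
  ∀ k ∈ S, ∀ l ∈ S, ∀ m, w k m ≠ 0 → w l m ≠ 0 → k = l

theorem DisjSupp.lcomb_apply {S : Set ℕ} {w : ℕ → ℕ →₀ ℝ} (hw : DisjSupp S w) {b : ℕ →₀ ℝ}
    (hb : ∀ k ∈ b.support, k ∈ S) {k m : ℕ} (hk : k ∈ S) (hkm : w k m ≠ 0) :
    lcomb w b m = b k * w k m := by
  rw [_root_.lcomb_apply]
  refine (sum_subset (s₂ := insert k b.support) (subset_insert _ _) ?_).trans ?_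
  · intro l _ hl
    rw [Finsupp.notMem_support_iff.mp hl, zero_mul]
  · refine sum_eq_single_of_mem k (mem_insert_self _ _) fun l hl hlk => ?_
    rcases mem_insert.mp hl with rfl | hl
    · exact absurd rfl hlk
    · by_cases h : w l m = 0
      · rw [h, mul_zero]
      · exact absurd (hw l (hb l hl) k hk m h hkm) hlk

theorem DisjSupp.abs_lcomb_le {S : Set ℕ} {w : ℕ → ℕ →₀ ℝ} (hw : DisjSupp S w) {b c : ℕ →₀ ℝ}
    (hb : ∀ k ∈ b.support, k ∈ S) (hc : ∀ k ∈ c.support, k ∈ S) (h : ∀ k, |b k| ≤ |c k|) (m : ℕ) :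
    |lcomb w b m| ≤ |lcomb w c m| := by
  by_cases hm : ∃ k ∈ S, w k m ≠ 0
  · obtain ⟨k, hk, hkm⟩ := hm
    rw [hw.lcomb_apply hb hk hkm, hw.lcomb_apply hc hk hkm, abs_mul, abs_mul]
    exact mul_le_mul_of_nonneg_right (h k) (abs_nonneg _)
  · push Not at hm
    have : lcomb w b m = 0 := by
      rw [_root_.lcomb_apply]
      exact sum_eq_zero fun k hk => by rw [hm k (hb k hk), mul_zero]
    rw [this, abs_zero]
    exact abs_nonneg _

/-- The norm `b ↦ N (∑ b k • w k)` defined by a disjointly supported sequence. -/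
noncomputable def LNorm.comp (N : LNorm) (w : ℕ → ℕ →₀ ℝ) (hw : DisjSupp Set.univ w) : LNorm where
  toFun b := N (lcomb w b)
  add_le' a b := by rw [lcomb, map_add]; exact N.add_le _ _
  smul' t a := by rw [lcomb, map_smul]; exact N.smul _ _
  mono' a b h := N.mono fun m => hw.abs_lcomb_le (by simp) (by simp) h m

/-- Successive vectors: the support of `w k` lies to the left of that of `w l` for `k < l`. -/
def IsBlock (w : ℕ → ℕ →₀ ℝ) : Prop :=
  ∀ k l, k < l → ∀ m n, w k m ≠ 0 → w l n ≠ 0 → m < n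

theorem IsBlock.disjSupp {w : ℕ → ℕ →₀ ℝ} (hw : IsBlock w) : DisjSupp Set.univ w := by
  intro k _ l _ m hk hl
  rcases lt_trichotomy k l with h | h | h
  · exact absurd (hw k l h m m hk hl) (lt_irrefl _)
  · exact h
  · exact absurd (hw l k h m m hl hk) (lt_irrefl _)

theorem exists_ne_zero_of_lcomb_ne_zero {w : ℕ → ℕ →₀ ℝ} {b : ℕ →₀ ℝ} {m : ℕ}
    (h : lcomb w b m ≠ 0) : ∃ k, b k ≠ 0 ∧ w k m ≠ 0 := by
  rw [lcomb_apply] at h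
  obtain ⟨k, _, hk⟩ := exists_ne_zero_of_sum_ne_zero h
  exact ⟨k, left_ne_zero_of_mul hk, right_ne_zero_of_mul hk⟩

theorem IsBlock.lcomb {w z : ℕ → ℕ →₀ ℝ} (hw : IsBlock w) (hz : IsBlock z) :
    IsBlock fun k => lcomb w (z k) := by
  intro k l hkl m n hm hn
  obtain ⟨i, hi, him⟩ := exists_ne_zero_of_lcomb_ne_zero hm
  obtain ⟨j, hj, hjn⟩ := exists_ne_zero_of_lcomb_ne_zero hn
  exact hw i j (hz k l hkl i j hi hj) m n him hjn

theorem lcomb_lcomb (w z : ℕ → ℕ →₀ ℝ) (b : ℕ →₀ ℝ) :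
    lcomb w (lcomb z b) = lcomb (fun k => lcomb w (z k)) b := by
  rw [lcomb_eq_sum z b subset_rfl, lcomb_eq_sum (fun k => lcomb w (z k)) b subset_rfl]
  rw [lcomb, map_sum]
  exact sum_congr rfl fun k _ => map_smul _ _ _

/-- In a block sequence of nonzero vectors, `w k` is supported in `[k, ∞)`. -/
theorem IsBlock.le_of_ne_zero {w : ℕ → ℕ →₀ ℝ} (hw : IsBlock w) (h0 : ∀ k, w k ≠ 0) :
    ∀ k m, w k m ≠ 0 → k ≤ m := by
  intro k
  induction k with
  | zero => intro m _; exact Nat.zero_le _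
  | succ k ih =>
    intro m hm
    obtain ⟨n, hn⟩ := Finsupp.ne_iff.mp (h0 k)
    exact Nat.succ_le_of_lt ((ih n hn).trans_lt (hw k (k + 1) (Nat.lt_succ_self k) n m hn hm))

/-- The values of a spreading norm depend on the order pattern of the coordinates only. -/
def LNorm.Spread (e : LNorm) : Prop :=
  ∀ (φ : ℕ → ℕ) (b : ℕ →₀ ℝ), StrictMonoOn φ b.support → e (Finsupp.mapDomain φ b) = e b

theorem LNorm.Spread.mapDomain_eq {e : LNorm} (he : e.Spread) {Λ : Type*} (y : Λ →₀ ℝ)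
    (φ ψ : Λ → ℕ) (hφ : Set.InjOn φ y.support)
    (h : ∀ a ∈ y.support, ∀ b ∈ y.support, φ a < φ b → ψ a < ψ b) :
    e (Finsupp.mapDomain ψ y) = e (Finsupp.mapDomain φ y) := by
  classical
  by_cases hΛ : Nonempty Λ
  · set χ : ℕ → ℕ := fun n => ψ (Function.invFunOn φ y.support n) with hχ
    have hinv : ∀ a ∈ y.support, χ (φ a) = ψ a := by
      intro a ha
      have := hφ.leftInvOn_invFunOn (Finset.mem_coe.mpr ha)
      simp only [hχ, this]
    have h1 : Finsupp.mapDomain ψ y = Finsupp.mapDomain χ (Finsupp.mapDomain φ y) := by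
      rw [← Finsupp.mapDomain_comp]
      exact Finsupp.mapDomain_congr fun a ha => (hinv a ha).symm
    rw [h1]
    refine he χ _ ?_
    intro m hm n hn hmn
    obtain ⟨a, ha, rfl⟩ := mem_image.mp (Finsupp.mapDomain_support hm)
    obtain ⟨b, hb, rfl⟩ := mem_image.mp (Finsupp.mapDomain_support hn)
    rw [hinv a ha, hinv b hb]
    exact h a ha b hb hmn
  · have : y = 0 := by
      ext a; exact absurd ⟨a⟩ hΛ
    simp [this]

/-- The norm `e` is equivalent to the norm of a block sequence `w`, with constants `c` and `C`. -/
structure EmbBy (N e : LNorm) (w : ℕ → ℕ →₀ ℝ) (c C : ℝ) : Prop where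
  block : IsBlock w
  pos : 0 < c
  lower : ∀ b, c * e b ≤ N (lcomb w b)
  upper : ∀ b, N (lcomb w b) ≤ C * e b

/-- The norm `e` is equivalent to the norm of a block sequence of `N`. -/
def Emb (N e : LNorm) : Prop := ∃ w c C, EmbBy N e w c C

theorem EmbBy.trans {N e f : LNorm} {w z : ℕ → ℕ →₀ ℝ} {c C c' C' : ℝ} (h : EmbBy N e w c C)
    (hf : EmbBy e f z c' C') (hC : 0 ≤ C) :
    EmbBy N f (fun k => lcomb w (z k)) (c * c') (C * C') where
  block := h.block.lcomb hf.block
  pos := mul_pos h.pos hf.pos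
  lower b := by
    rw [← lcomb_lcomb, mul_assoc]
    exact (mul_le_mul_of_nonneg_left (hf.lower b) h.pos.le).trans (h.lower _)
  upper b := by
    rw [← lcomb_lcomb, mul_assoc]
    exact (h.upper _).trans (mul_le_mul_of_nonneg_left (hf.upper b) hC)

theorem EmbBy.nonneg {N e : LNorm} {w : ℕ → ℕ →₀ ℝ} {c C : ℝ} (h : EmbBy N e w c C)
    (he : e.Normalized) : c ≤ C := by
  have h1 := (h.lower (Finsupp.single 0 1)).trans (h.upper (Finsupp.single 0 1))
  rw [he, mul_one, mul_one] at h1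
  exact h1

theorem Emb.trans {N e f : LNorm} (he : e.Normalized) (h : Emb N e) (hf : Emb e f) : Emb N f := by
  obtain ⟨w, c, C, hw⟩ := h
  obtain ⟨z, c', C', hz⟩ := hf
  exact ⟨_, _, _, hw.trans hz (hw.pos.le.trans (hw.nonneg he))⟩

theorem EmbBy.ne_zero {N e : LNorm} {w : ℕ → ℕ →₀ ℝ} {c C : ℝ} (h : EmbBy N e w c C)
    (he : e.Normalized) (k : ℕ) : w k ≠ 0 := by
  intro h0
  have h1 := h.lower (Finsupp.single k 1)
  rw [he, mul_one, lcomb, Finsupp.linearCombination_single, h0, smul_zero, N.zero] at h1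
  exact absurd h.pos (not_lt.mpr h1)

/-- The norm `N` admits, arbitrarily far to the right, finite families of disjointly supported
vectors `F i k` which cannot be compared, in the sense of `IsViolatingFamily`. -/
def Violates (N : LNorm) : Prop :=
  ∃ A : ℝ, ∀ (M : ℝ) (s : ℕ), ∃ (S : Finset ℕ) (F : Fin 3 → ℕ → ℕ →₀ ℝ),
    (∀ i, ∀ k ∈ S, 1 ≤ N (F i k) ∧ N (F i k) ≤ A) ∧
    (∀ i, ∀ k ∈ S, ∀ m, F i k m ≠ 0 → s ≤ m) ∧
    (∀ i, ∀ k ∈ S, ∀ j, ∀ l ∈ S, ∀ m, F i k m ≠ 0 → F j l m ≠ 0 → i = j ∧ k = l) ∧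
    ∀ col : ℕ → Fin 3, ∃ (i : Fin 3) (b : ℕ →₀ ℝ), (∀ k ∈ b.support, k ∈ S ∧ col k = i) ∧
      ∀ j ≠ i, M * N (lcomb (F j) b) < N (lcomb (F i) b)

theorem Violates.of_emb {N e : LNorm} (he : e.Normalized) (hv : Violates e) (h : Emb N e) :
    Violates N := by
  obtain ⟨w, c, C, hw⟩ := h
  obtain ⟨A, hA⟩ := hv
  have hcC := hw.nonneg he
  have hc := hw.pos
  have hC : 0 < C := hc.trans_le hcC
  refine ⟨C / c * A, fun M s => ?_⟩
  obtain ⟨S, F, h1, h2, h3, h4⟩ := hA (C / c * |M|) s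
  refine ⟨S, fun i k => c⁻¹ • lcomb w (F i k), fun i k hk => ?_, fun i k hk m hm => ?_,
    fun i k hk j l hl m hm hm' => ?_, fun col => ?_⟩
  · rw [N.smul, abs_of_pos (inv_pos.mpr hc)]
    constructor
    · rw [le_inv_mul_iff₀ hc, mul_one]
      calc c ≤ c * e (F i k) := by nlinarith [(h1 i k hk).1]
        _ ≤ _ := hw.lower _
    · rw [inv_mul_le_iff₀ hc]
      calc N (lcomb w (F i k)) ≤ C * e (F i k) := hw.upper _
        _ ≤ C * A := by gcongr; exact (h1 i k hk).2
        _ = c * (C / c * A) := by field_simp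
  · have hm' : lcomb w (F i k) m ≠ 0 := by
      intro h; apply hm; simp [h]
    obtain ⟨n, hn, hnm⟩ := exists_ne_zero_of_lcomb_ne_zero hm'
    exact (h2 i k hk n hn).trans (hw.block.le_of_ne_zero (hw.ne_zero he) n m hnm)
  · have e1 : lcomb w (F i k) m ≠ 0 := by
      intro h; apply hm; simp [h]
    have e2 : lcomb w (F j l) m ≠ 0 := by
      intro h; apply hm'; simp [h]
    obtain ⟨n, hn, hnm⟩ := exists_ne_zero_of_lcomb_ne_zero e1
    obtain ⟨n', hn', hnm'⟩ := exists_ne_zero_of_lcomb_ne_zero e2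
    obtain rfl := hw.block.disjSupp n trivial n' trivial m hnm hnm'
    exact h3 i k hk j l hl n hn hn'
  · obtain ⟨i, b, hb, hM⟩ := h4 col
    have hl : ∀ j, lcomb (fun k => c⁻¹ • lcomb w (F j k)) b = c⁻¹ • lcomb w (lcomb (F j) b) := by
      intro j
      rw [lcomb_lcomb, lcomb_eq_sum _ b subset_rfl, lcomb_eq_sum _ b subset_rfl, smul_sum]
      exact sum_congr rfl fun k _ => smul_comm _ _ _
    refine ⟨i, b, hb, fun j hj => ?_⟩
    rw [hl, hl, N.smul, N.smul, abs_of_pos (inv_pos.mpr hc), mul_left_comm]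
    refine mul_lt_mul_of_pos_left ?_ (inv_pos.mpr hc)
    calc M * N (lcomb w (lcomb (F j) b)) ≤ |M| * (C * e (lcomb (F j) b)) := by
          refine (mul_le_mul_of_nonneg_right (le_abs_self M) (N.nonneg _)).trans ?_
          gcongr
          exact hw.upper _
      _ = c * (C / c * |M| * e (lcomb (F j) b)) := by field_simp
      _ < c * e (lcomb (F i) b) := mul_lt_mul_of_pos_left (hM j hj) hc
      _ ≤ _ := hw.lower _

/-! ### Spreading models -/

namespace LNorm

/-- The iterated limit along the ultrafilter `V`, over `k₁`, then `k₂`, and so on, of the norms of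
`a + ∑ cᵢ • single kᵢ 1`, for the list `c` of coefficients. -/
noncomputable def iterLim (N : LNorm) (V : Ultrafilter ℕ) : List ℝ → (ℕ →₀ ℝ) → ℝ
  | [], a => N a
  | c :: l, a => limUnder (V : Filter ℕ) fun k => iterLim N V l (a + Finsupp.single k c)

theorem tendsto_limUnder_of_bounded (V : Ultrafilter ℕ) {f : ℕ → ℝ} {B : ℝ}
    (hf : ∀ k, 0 ≤ f k ∧ f k ≤ B) :
    Tendsto f V (𝓝 (limUnder (V : Filter ℕ) f)) ∧ 0 ≤ limUnder (V : Filter ℕ) f ∧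
      limUnder (V : Filter ℕ) f ≤ B := by
  obtain ⟨x, hx, hlim⟩ := (isCompact_Icc (a := (0 : ℝ)) (b := B)).ultrafilter_le_nhds (V.map f)
    (by
      rw [le_principal_iff]
      change f ⁻¹' Set.Icc 0 B ∈ (V : Filter ℕ)
      exact Filter.univ_mem' hf)
  have h1 : Tendsto f V (𝓝 x) := hlim
  rw [h1.limUnder_eq]
  exact ⟨h1, hx⟩

variable {N : LNorm} (hN : N.Normalized) (V : Ultrafilter ℕ)

include hN

theorem iterLim_bounds (l : List ℝ) :
    ∀ a, 0 ≤ N.iterLim V l a ∧ N.iterLim V l a ≤ N a + (l.map fun c => |c|).sum := by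
  induction l with
  | nil => intro a; simp [iterLim, N.nonneg]
  | cons c l ih =>
    intro a
    refine (tendsto_limUnder_of_bounded V fun k => ⟨(ih _).1, (ih _).2.trans ?_⟩).2
    have := N.add_le a (Finsupp.single k c)
    rw [hN.single] at this
    simp only [List.map_cons, List.sum_cons]
    linarith

theorem tendsto_iterLim (c : ℝ) (l : List ℝ) (a : ℕ →₀ ℝ) :
    Tendsto (fun k => N.iterLim V l (a + Finsupp.single k c)) V (𝓝 (N.iterLim V (c :: l) a)) := by
  refine (tendsto_limUnder_of_bounded V (B := N a + (|c| + (l.map fun c => |c|).sum))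
    fun k => ⟨(iterLim_bounds hN V l _).1, (iterLim_bounds hN V l _).2.trans ?_⟩).1
  have := N.add_le a (Finsupp.single k c)
  rw [hN.single] at this
  linarith

theorem iterLim_zero_cons (l : List ℝ) (a : ℕ →₀ ℝ) :
    N.iterLim V (0 :: l) a = N.iterLim V l a := by
  have h := tendsto_iterLim hN V 0 l a
  simp only [Finsupp.single_zero, add_zero] at h
  exact tendsto_nhds_unique h tendsto_const_nhds

theorem iterLim_filter (l : List ℝ) :
    ∀ a, N.iterLim V (l.filter (fun c => decide (c ≠ 0))) a = N.iterLim V l a := by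
  induction l with
  | nil => intro a; rfl
  | cons c l ih =>
    intro a
    by_cases hc : c = 0
    · subst hc
      rw [iterLim_zero_cons hN, ← ih]
      simp
    · rw [List.filter_cons_of_pos (by simpa using hc)]
      refine tendsto_nhds_unique (tendsto_iterLim hN V c _ a) ?_
      simp_rw [ih]
      exact tendsto_iterLim hN V c l a

theorem iterLim_add_le (b c : ℕ →₀ ℝ) (s : List ℕ) :
    ∀ a a', N.iterLim V (s.map (b + c)) (a + a') ≤
      N.iterLim V (s.map b) a + N.iterLim V (s.map c) a' := by
  induction s with
  | nil => intro a a'; exact N.add_le _ _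
  | cons k s ih =>
    intro a a'
    refine le_of_tendsto_of_tendsto' (tendsto_iterLim hN V _ _ _)
      ((tendsto_iterLim hN V _ _ a).add (tendsto_iterLim hN V _ _ a')) fun j => ?_
    refine le_trans (le_of_eq ?_) (ih _ _)
    congr 1
    rw [Finsupp.add_apply, Finsupp.single_add]
    abel

theorem iterLim_smul (t : ℝ) (b : ℕ →₀ ℝ) (s : List ℕ) :
    ∀ a, N.iterLim V (s.map (t • b)) (t • a) = |t| * N.iterLim V (s.map b) a := by
  induction s with
  | nil => intro a; exact N.smul _ _
  | cons k s ih =>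
    intro a
    refine tendsto_nhds_unique (tendsto_iterLim hN V _ _ _) ?_
    refine ((tendsto_iterLim hN V (b k) (s.map b) a).const_mul |t|).congr fun j => ?_
    rw [← ih, smul_add, Finsupp.smul_single]
    rfl

theorem iterLim_mono (hV : (V : Filter ℕ) ≤ atTop) {b c : ℕ →₀ ℝ} (h : ∀ k, |b k| ≤ |c k|)
    (s : List ℕ) : ∀ a a' : ℕ →₀ ℝ, (∀ k, |a k| ≤ |a' k|) →
      N.iterLim V (s.map b) a ≤ N.iterLim V (s.map c) a' := by
  induction s with
  | nil => intro a a' ha; exact N.mono ha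
  | cons k s ih =>
    intro a a' ha
    refine le_of_tendsto_of_tendsto (tendsto_iterLim hN V _ _ _) (tendsto_iterLim hN V _ _ _) ?_
    obtain ⟨m, hm⟩ := a'.support.exists_nat_subset_range
    have h1 : ∀ᶠ j in (V : Filter ℕ), m ≤ j := hV (eventually_ge_atTop m)
    filter_upwards [h1] with j hj
    refine ih _ _ fun i => ?_
    rw [Finsupp.add_apply, Finsupp.add_apply, Finsupp.single_apply, Finsupp.single_apply]
    split_ifs with hi
    · subst hi
      have h2 : a' j = 0 := by
        by_contra h3
        have := mem_range.mp (hm (Finsupp.mem_support_iff.mpr h3))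
        omega
      have h3 : a j = 0 := by
        have := ha j
        rw [h2, abs_zero] at this
        exact abs_nonpos_iff.mp this
      rw [h2, h3, zero_add, zero_add]
      exact h k
    · rw [add_zero, add_zero]; exact ha i

omit hN in
theorem sort_map_filter (b : ℕ →₀ ℝ) {s : List ℕ} (hs : s.Pairwise (· < ·))
    (hb : ∀ k ∈ b.support, k ∈ s) :
    (s.map b).filter (fun c => decide (c ≠ 0)) = b.support.sort.map b := by
  rw [List.filter_map]
  congr 1
  have h1 : (s.filter ((fun c => decide (c ≠ 0)) ∘ b)).Pairwise (· < ·) := hs.filter _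
  have h2 : (s.filter ((fun c => decide (c ≠ 0)) ∘ b)).toFinset = b.support := by
    ext k
    simp only [List.mem_toFinset, List.mem_filter, Function.comp, decide_eq_true_eq,
      Finsupp.mem_support_iff]
    exact ⟨fun h => h.2, fun h => ⟨hb k (Finsupp.mem_support_iff.mpr h), h⟩⟩
  rw [← h2]
  exact (((List.toFinset_sort (r := fun a b : ℕ => a ≤ b) (h1.imp fun h => h.ne)).mpr
    (h1.imp fun h => h.le))).symm

theorem iterLim_sort_eq (b : ℕ →₀ ℝ) {s : List ℕ} (hs : s.Pairwise (· < ·))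
    (hb : ∀ k ∈ b.support, k ∈ s) :
    N.iterLim V (b.support.sort.map b) 0 = N.iterLim V (s.map b) 0 := by
  rw [← sort_map_filter b hs hb, iterLim_filter hN]

/-- The spreading model of `N` along the ultrafilter `V`. -/
noncomputable def spreadingModel (hV : (V : Filter ℕ) ≤ atTop) : LNorm where
  toFun b := N.iterLim V (b.support.sort.map b) 0
  add_le' a b := by
    obtain ⟨m, hm⟩ := (a.support ∪ b.support ∪ (a + b).support).exists_nat_subset_range
    have hs : (List.range m).Pairwise (· < ·) := List.pairwise_lt_range
    have hmem : ∀ c : ℕ →₀ ℝ, c.support ⊆ a.support ∪ b.support ∪ (a + b).support →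
        ∀ k ∈ c.support, k ∈ List.range m :=
      fun c hc k hk => List.mem_range.mpr (mem_range.mp (hm (hc hk)))
    rw [iterLim_sort_eq hN V a hs (hmem a fun k hk => by simp_all),
      iterLim_sort_eq hN V b hs (hmem b fun k hk => by simp_all),
      iterLim_sort_eq hN V (a + b) hs (hmem _ subset_union_right)]
    simpa using iterLim_add_le hN V a b (List.range m) 0 0
  smul' t a := by
    obtain ⟨m, hm⟩ := a.support.exists_nat_subset_range
    have hs : (List.range m).Pairwise (· < ·) := List.pairwise_lt_range
    have hmem : ∀ k ∈ a.support, k ∈ List.range m :=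
      fun k hk => List.mem_range.mpr (mem_range.mp (hm hk))
    rw [iterLim_sort_eq hN V a hs hmem,
      iterLim_sort_eq hN V (t • a) hs fun k hk => hmem k (Finsupp.support_smul hk)]
    simpa using iterLim_smul hN V t a (List.range m) 0
  mono' a b h := by
    obtain ⟨m, hm⟩ := (a.support ∪ b.support).exists_nat_subset_range
    have hs : (List.range m).Pairwise (· < ·) := List.pairwise_lt_range
    have hmem : ∀ c : ℕ →₀ ℝ, c.support ⊆ a.support ∪ b.support →
        ∀ k ∈ c.support, k ∈ List.range m :=
      fun c hc k hk => List.mem_range.mpr (mem_range.mp (hm (hc hk)))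
    rw [iterLim_sort_eq hN V a hs (hmem a subset_union_left),
      iterLim_sort_eq hN V b hs (hmem b subset_union_right)]
    exact iterLim_mono hN V hV h _ _ _ fun k => le_rfl

theorem spreadingModel_eq (hV : (V : Filter ℕ) ≤ atTop) (b : ℕ →₀ ℝ) {s : List ℕ}
    (hs : s.Pairwise (· < ·)) (hb : ∀ k ∈ b.support, k ∈ s) :
    spreadingModel hN V hV b = N.iterLim V (s.map b) 0 :=
  iterLim_sort_eq hN V b hs hb

theorem spreadingModel_normalized (hV : (V : Filter ℕ) ≤ atTop) :
    (spreadingModel hN V hV).Normalized := by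
  intro k
  rw [spreadingModel_eq hN V hV _ (List.pairwise_singleton _ k) (fun j hj => by
    have := Finsupp.support_single_subset hj
    simpa using this)]
  simp only [List.map_cons, List.map_nil, Finsupp.single_eq_same]
  refine tendsto_nhds_unique (tendsto_iterLim hN V 1 [] 0) ?_
  simp only [iterLim, zero_add, hN.single, abs_one]
  exact tendsto_const_nhds

theorem spreadingModel_spread (hV : (V : Filter ℕ) ≤ atTop) : (spreadingModel hN V hV).Spread := by
  intro φ b hφ
  have hsort : b.support.sort.Pairwise (· < ·) := (sortedLT_sort b.support).pairwise
  have h1 : (b.support.sort.map φ).Pairwise (· < ·) := by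
    rw [List.pairwise_map]
    refine hsort.imp_of_mem fun {i j} hi hj hij => ?_
    exact hφ ((mem_sort _).mp hi) ((mem_sort _).mp hj) hij
  rw [spreadingModel_eq hN V hV _ h1 fun k hk => ?_, spreadingModel_eq hN V hV b hsort
    fun k hk => (mem_sort _).mpr hk, List.map_map]
  · congr 1
    refine List.map_congr_left fun k hk => ?_
    exact Finsupp.mapDomain_apply' _ b subset_rfl hφ.injOn ((mem_sort _).mp hk)
  · obtain ⟨j, hj, rfl⟩ := mem_image.mp (Finsupp.mapDomain_support hk)
    exact List.mem_map.mpr ⟨j, (mem_sort _).mpr hj, rfl⟩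

/-- The iterated limit is approximated by choosing the positions from left to right. -/
theorem exists_generic_aux {Z : Set ℕ} (hZ : Z ∈ V) (hV : (V : Filter ℕ) ≤ atTop)
    (B : Finset (ℕ →₀ ℝ)) (n : ℕ) :
    ∀ (p s : ℕ) (ε : ℝ), 0 < ε → ∀ a : (ℕ →₀ ℝ) → ℕ →₀ ℝ, ∃ φ : ℕ → ℕ,
      StrictMonoOn φ (Set.Ico p (p + n)) ∧ (∀ k ∈ Set.Ico p (p + n), φ k ∈ Z ∧ s ≤ φ k) ∧
      ∀ b ∈ B, |N (a b + ∑ k ∈ Ico p (p + n), Finsupp.single (φ k) (b k)) -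
        N.iterLim V ((List.range' p n).map b) (a b)| ≤ ε := by
  induction n with
  | zero =>
    intro p s ε hε a
    refine ⟨id, fun _ h => by simp at h, fun _ h => by simp at h, fun b _ => ?_⟩
    simp [iterLim, hε.le]
  | succ n ih =>
    intro p s ε hε a
    have h1 : ∀ᶠ k in (V : Filter ℕ), ∀ b ∈ B,
        |N.iterLim V ((List.range' (p + 1) n).map b) (a b + Finsupp.single k (b p)) -
          N.iterLim V ((List.range' p (n + 1)).map b) (a b)| < ε / 2 := by
      rw [Filter.eventually_all_finset]
      intro b _
      have h2 := tendsto_iterLim hN V (b p) ((List.range' (p + 1) n).map b) (a b)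
      rw [Metric.tendsto_nhds] at h2
      exact h2 (ε / 2) (by positivity)
    have h2 : ∀ᶠ k in (V : Filter ℕ), s ≤ k := hV (eventually_ge_atTop s)
    have h3 : ∀ᶠ k in (V : Filter ℕ), k ∈ Z := hZ
    obtain ⟨k₀, hk₀, hs₀, hZ₀⟩ := (h1.and (h2.and h3)).exists
    obtain ⟨φ, hφ, hφZ, hφN⟩ := ih (p + 1) (k₀ + 1) (ε / 2) (by positivity)
      fun b => a b + Finsupp.single k₀ (b p)
    have hupd : ∀ k ∈ Set.Ico (p + 1) (p + 1 + n), Function.update φ p k₀ k = φ k := by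
      intro k hk
      rw [Function.update_of_ne]
      have := hk.1
      omega
    refine ⟨Function.update φ p k₀, ?_, ?_, fun b hb => ?_⟩
    · intro i hi j hj hij
      have hj' : j ∈ Set.Ico (p + 1) (p + 1 + n) := ⟨by have := hi.1; omega, by have := hj.2; omega⟩
      rw [hupd j hj']
      rcases eq_or_ne i p with rfl | hip
      · rw [Function.update_self]
        exact (hφZ j hj').2
      · have hi' : i ∈ Set.Ico (p + 1) (p + 1 + n) :=
          ⟨by have := hi.1; omega, by have := hi.2; omega⟩
        rw [hupd i hi']
        exact hφ hi' hj' hij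
    · intro k hk
      rcases eq_or_ne k p with rfl | hkp
      · rw [Function.update_self]; exact ⟨hZ₀, hs₀⟩
      · have hk' : k ∈ Set.Ico (p + 1) (p + 1 + n) :=
          ⟨by have := hk.1; omega, by have := hk.2; omega⟩
        rw [hupd k hk']
        exact ⟨(hφZ k hk').1, by have := (hφZ k hk').2; omega⟩
    · have h4 : ∑ k ∈ Ico p (p + (n + 1)), Finsupp.single (Function.update φ p k₀ k) (b k) =
          Finsupp.single k₀ (b p) + ∑ k ∈ Ico (p + 1) (p + 1 + n), Finsupp.single (φ k) (b k) := by
        rw [sum_eq_sum_Ico_succ_bot (by omega), Function.update_self]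
        congr 1
        refine sum_congr (by congr 1; omega) fun k hk => ?_
        rw [hupd k (by simpa using hk)]
      rw [h4, ← add_assoc]
      have h5 := hφN b hb
      have h6 := (hk₀ b hb).le
      have h7 := _root_.abs_sub_le (N (a b + Finsupp.single k₀ (b p) +
        ∑ k ∈ Ico (p + 1) (p + 1 + n), Finsupp.single (φ k) (b k)))
        (N.iterLim V ((List.range' (p + 1) n).map b) (a b + Finsupp.single k₀ (b p)))
        (N.iterLim V ((List.range' p (n + 1)).map b) (a b))
      linarith

/-- Finitely many values of a spreading model can be realised approximately, at positions which
belong to a prescribed set of the ultrafilter and lie far to the right. -/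
theorem exists_generic {Z : Set ℕ} (hZ : Z ∈ V) (hV : (V : Filter ℕ) ≤ atTop)
    (B : Finset (ℕ →₀ ℝ)) (p q s : ℕ) {ε : ℝ} (hε : 0 < ε) : ∃ φ : ℕ → ℕ,
      StrictMonoOn φ (Set.Ico p q) ∧ (∀ k ∈ Set.Ico p q, φ k ∈ Z ∧ s ≤ φ k) ∧
      ∀ b ∈ B, (∀ k ∈ b.support, k ∈ Set.Ico p q) →
        |N (lcomb (fun k => Finsupp.single (φ k) 1) b) - spreadingModel hN V hV b| ≤ ε := by
  obtain ⟨φ, h1, h2, h3⟩ := exists_generic_aux hN V hZ hV B (q - p) p s ε hε fun _ => 0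
  have hpq : Set.Ico p (p + (q - p)) = Set.Ico p q := by
    ext k; simp only [Set.mem_Ico]; omega
  rw [hpq] at h1 h2
  refine ⟨φ, h1, h2, fun b hb hbs => ?_⟩
  have hsup : b.support ⊆ Ico p (p + (q - p)) := by
    intro k hk
    have := hbs k hk
    rw [← hpq] at this
    simpa using this
  have h4 := h3 b hb
  rw [zero_add] at h4
  rw [spreadingModel_eq hN V hV b (s := List.range' p (q - p)) List.pairwise_lt_range' fun k hk => by
    have := mem_Ico.mp (hsup hk)
    rw [List.mem_range'_1]; exact this, lcomb_eq_sum _ b hsup]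
  simpa using h4

end LNorm

/-! ### Families built from spreading norms -/

/-- On finitely many test vectors the norm `g` is equivalent, up to the constant `A`, to the norm
of disjointly supported vectors of `N` which lie far to the right. -/
def RepT (N g : LNorm) (A : ℝ) : Prop :=
  ∀ (m s : ℕ) (B : Finset (ℕ →₀ ℝ)), (∀ b ∈ B, b.support ⊆ range m) →
    ∃ f : ℕ → ℕ →₀ ℝ, (∀ k < m, ∀ i, f k i ≠ 0 → s ≤ i) ∧ DisjSupp {k | k < m} f ∧
      ∀ b ∈ B, g b ≤ N (lcomb f b) ∧ N (lcomb f b) ≤ A * g b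

theorem RepT.mono {N g : LNorm} {A A' : ℝ} (h : RepT N g A) (hA : A ≤ A') : RepT N g A' := by
  intro m s B hB
  obtain ⟨f, h1, h2, h3⟩ := h m s B hB
  exact ⟨f, h1, h2, fun b hb => ⟨(h3 b hb).1, (h3 b hb).2.trans
    (mul_le_mul_of_nonneg_right hA (g.nonneg b))⟩⟩

theorem EmbBy.repT {N e : LNorm} {w : ℕ → ℕ →₀ ℝ} {c C : ℝ} (h : EmbBy N e w c C)
    (he : e.Normalized) (hs : e.Spread) : RepT N e (C / c) := by
  intro m s B hB
  have hc := h.pos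
  refine ⟨fun k => c⁻¹ • w (s + k), fun k _ i hi => ?_, fun k _ l _ i hk hl => ?_, fun b _ => ?_⟩
  · have hi' : w (s + k) i ≠ 0 := by intro h0; apply hi; simp [h0]
    exact (Nat.le_add_right s k).trans (h.block.le_of_ne_zero (h.ne_zero he) _ _ hi')
  · have hk' : w (s + k) i ≠ 0 := by intro h0; apply hk; simp [h0]
    have hl' : w (s + l) i ≠ 0 := by intro h0; apply hl; simp [h0]
    have := h.block.disjSupp (s + k) trivial (s + l) trivial i hk' hl'
    omega
  · have h1 : lcomb (fun k => c⁻¹ • w (s + k)) b =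
        c⁻¹ • lcomb w (Finsupp.mapDomain (fun k => s + k) b) := by
      rw [← lcomb_single_eq_mapDomain, lcomb_lcomb, lcomb_eq_sum _ b subset_rfl,
        lcomb_eq_sum _ b subset_rfl, smul_sum]
      refine sum_congr rfl fun k _ => ?_
      rw [lcomb, Finsupp.linearCombination_single, one_smul, smul_comm]
    have h2 : e (Finsupp.mapDomain (fun k => s + k) b) = e b :=
      hs _ b fun i _ j _ hij => Nat.add_lt_add_left hij s
    rw [h1, N.smul, abs_of_pos (inv_pos.mpr hc), le_inv_mul_iff₀ hc, inv_mul_le_iff₀ hc, ← h2]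
    refine ⟨h.lower _, (h.upper _).trans (le_of_eq ?_)⟩
    field_simp

theorem exists_strictMonoOn_maps (S T : Finset ℕ) (h : S.card ≤ T.card) :
    ∃ φ : ℕ → ℕ, StrictMonoOn φ S ∧ ∀ k ∈ S, φ k ∈ T := by
  classical
  have hS : (Set.ofPred (· ∈ S)).Finite := S.finite_toSet
  have hT : (Set.ofPred (· ∈ T)).Finite := T.finite_toSet
  have hcS : hS.toFinset.card = S.card := by congr 1; ext k; simp [Set.ofPred]
  have hcT : hT.toFinset.card = T.card := by congr 1; ext k; simp [Set.ofPred]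
  have hlt : ∀ k ∈ S, Nat.count (· ∈ S) k < hT.toFinset.card := by
    intro k hk
    have := Nat.count_lt_card hS hk
    rw [hcS] at this
    rw [hcT]
    exact this.trans_le h
  refine ⟨fun k => Nat.nth (· ∈ T) (Nat.count (· ∈ S) k), ?_, fun k hk => ?_⟩
  · intro i hi j hj hij
    exact Nat.nth_strictMonoOn hT (hlt i hi) (hlt j hj) (Nat.count_strict_mono hi hij)
  · exact Nat.nth_mem_of_lt_card hT (hlt k hk)

/-- Any copy of `b` in a set of the right size looks the same for spreading norms. -/
theorem exists_placement (b : ℕ →₀ ℝ) (T : Finset ℕ) (h : b.support.card ≤ T.card) :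
    ∃ c : ℕ →₀ ℝ, c.support ⊆ T ∧ ∀ e : LNorm, e.Spread → e c = e b := by
  classical
  obtain ⟨φ, hφ, hT⟩ := exists_strictMonoOn_maps b.support T h
  refine ⟨Finsupp.mapDomain φ b, fun k hk => ?_, fun e he => he φ b hφ⟩
  obtain ⟨j, hj, rfl⟩ := mem_image.mp (Finsupp.mapDomain_support hk)
  exact hT j hj

theorem exists_bound_support (m : ℕ) (f : ℕ → ℕ →₀ ℝ) :
    ∃ s, ∀ k < m, ∀ i, f k i ≠ 0 → i < s := by
  obtain ⟨s, hs⟩ := ((range m).biUnion fun k => (f k).support).exists_nat_subset_range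
  refine ⟨s, fun k hk i hi => mem_range.mp (hs ?_)⟩
  exact mem_biUnion.mpr ⟨k, mem_range.mpr hk, Finsupp.mem_support_iff.mpr hi⟩

/-- Three spreading norms, uniformly represented in `N`, with vectors `b i` on which the `i`-th norm
dominates the others. Since the norms are spreading, the place of the vectors `b i` among
sufficiently many indices does not matter, and the pigeonhole principle applies. -/
theorem violates_of_spreading_triples {N : LNorm} (A : ℝ)
    (H : ∀ M : ℝ, ∃ (G : Fin 3 → LNorm) (b : Fin 3 → ℕ →₀ ℝ),
      (∀ i, (G i).Spread ∧ RepT N (G i) A ∧ 1 ≤ G i (Finsupp.single 0 1) ∧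
        G i (Finsupp.single 0 1) ≤ A) ∧
      ∀ i, ∀ j ≠ i, M * G j (b i) < G i (b i)) : Violates N := by
  classical
  refine ⟨A * A, fun M s => ?_⟩
  obtain ⟨G, b, hG, hb⟩ := H (|M| * A)
  have hA : 1 ≤ A := (hG 0).2.2.1.trans (hG 0).2.2.2
  set n : ℕ := ∑ i, (b i).support.card with hn
  choose c hcT hcG using fun (i : Fin 3) (T : Finset ℕ) (h : (b i).support.card ≤ T.card) =>
    exists_placement (b i) T h
  set B : Finset (ℕ →₀ ℝ) := (univ : Finset (Fin 3)).biUnion (fun i =>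
    (range n).powerset.image fun T => if h : (b i).support.card ≤ T.card then c i T h else 0) ∪
    (range n).image fun k => Finsupp.single k 1 with hBd
  have hB : ∀ b ∈ B, b.support ⊆ range n := by
    intro v hv
    rcases mem_union.mp hv with hv | hv
    · obtain ⟨i, -, hv⟩ := mem_biUnion.mp hv
      obtain ⟨T, hT, rfl⟩ := mem_image.mp hv
      split_ifs with h
      · exact (hcT i T h).trans (mem_powerset.mp hT)
      · simp
    · obtain ⟨k, hk, rfl⟩ := mem_image.mp hv
      exact Finsupp.support_single_subset.trans (singleton_subset_iff.mpr hk)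
  obtain ⟨f0, h0s, h0d, h0⟩ := (hG 0).2.1 n s B hB
  obtain ⟨s1, hs1⟩ := exists_bound_support n f0
  obtain ⟨f1, h1s, h1d, h1⟩ := (hG 1).2.1 n (max s s1) B hB
  obtain ⟨s2, hs2⟩ := exists_bound_support n f1
  obtain ⟨f2, h2s, h2d, h2⟩ := (hG 2).2.1 n (max s (max s1 s2)) B hB
  set F : Fin 3 → ℕ → ℕ →₀ ℝ := ![f0, f1, f2] with hF
  have hFB : ∀ i, ∀ v ∈ B, G i v ≤ N (lcomb (F i) v) ∧ N (lcomb (F i) v) ≤ A * G i v := by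
    intro i
    fin_cases i
    · exact h0
    · exact h1
    · exact h2
  have hsingle : ∀ i k, G i (Finsupp.single k 1) = G i (Finsupp.single 0 1) := by
    intro i k
    have := (hG i).1 (fun _ => k) (Finsupp.single 0 1) (by
      intro x hx y hy hxy
      have hx' := Finset.mem_singleton.mp (Finsupp.support_single_subset hx)
      have hy' := Finset.mem_singleton.mp (Finsupp.support_single_subset hy)
      omega)
    rwa [Finsupp.mapDomain_single] at this
  refine ⟨range n, F, fun i k hk => ?_, fun i k hk m hm => ?_, fun i k hk j l hl m hm hm' => ?_,
    fun col => ?_⟩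
  · have hkB : Finsupp.single k 1 ∈ B := mem_union_right _ (mem_image_of_mem _ hk)
    have h3 := hFB i _ hkB
    rw [lcomb, Finsupp.linearCombination_single, one_smul, hsingle] at h3
    exact ⟨(hG i).2.2.1.trans h3.1, h3.2.trans
      (mul_le_mul_of_nonneg_left (hG i).2.2.2 (by linarith))⟩
  · have hk' := mem_range.mp hk
    fin_cases i
    · exact h0s k hk' m hm
    · exact (le_max_left _ _).trans (h1s k hk' m hm)
    · exact (le_max_left _ _).trans (h2s k hk' m hm)
  · have hk' := mem_range.mp hk
    have hl' := mem_range.mp hl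
    have key : ∀ k l, k < n → l < n → ∀ m, (f0 k m ≠ 0 → f1 l m ≠ 0 → False) ∧
        (f0 k m ≠ 0 → f2 l m ≠ 0 → False) ∧ (f1 k m ≠ 0 → f2 l m ≠ 0 → False) := by
      intro k l hk hl m
      refine ⟨fun h h' => ?_, fun h h' => ?_, fun h h' => ?_⟩
      · have e1 := hs1 k hk m h
        have e2 := h1s l hl m h'
        have := le_max_right s s1
        omega
      · have e1 := hs1 k hk m h
        have e2 := h2s l hl m h'
        have := le_max_right s (max s1 s2)
        have := le_max_left s1 s2
        omega
      · have e1 := hs2 k hk m h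
        have e2 := h2s l hl m h'
        have := le_max_right s (max s1 s2)
        have := le_max_right s1 s2
        omega
    fin_cases i <;> fin_cases j
    · exact ⟨rfl, h0d k hk' l hl' m hm hm'⟩
    · exact ((key k l hk' hl' m).1 hm hm').elim
    · exact ((key k l hk' hl' m).2.1 hm hm').elim
    · exact ((key l k hl' hk' m).1 hm' hm).elim
    · exact ⟨rfl, h1d k hk' l hl' m hm hm'⟩
    · exact ((key k l hk' hl' m).2.2 hm hm').elim
    · exact ((key l k hl' hk' m).2.1 hm' hm).elim
    · exact ((key l k hl' hk' m).2.2 hm' hm).elim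
    · exact ⟨rfl, h2d k hk' l hl' m hm hm'⟩
  · have hpig : ∃ i, (b i).support.card ≤ ((range n).filter fun k => col k = i).card := by
      by_contra hcon
      push Not at hcon
      have h4 : (range n).card = ∑ i, ((range n).filter fun k => col k = i).card :=
        card_eq_sum_card_fiberwise fun _ _ => mem_coe.mpr (mem_univ _)
      rw [card_range] at h4
      have h5 := sum_lt_sum_of_nonempty (univ_nonempty (α := Fin 3)) fun i _ => hcon i
      rw [← hn] at h5
      omega
    obtain ⟨i, hi⟩ := hpig
    set T := (range n).filter fun k => col k = i with hT
    refine ⟨i, c i T hi, fun k hk => ?_, fun j hj => ?_⟩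
    · have := hcT i T hi hk
      rw [hT, mem_filter] at this
      exact this
    · have hcB : c i T hi ∈ B := by
        refine mem_union_left _ (mem_biUnion.mpr ⟨i, mem_univ _, mem_image.mpr ⟨T, ?_, ?_⟩⟩)
        · exact mem_powerset.mpr (filter_subset _ _)
        · rw [dif_pos hi]
      have e1 := (hFB j _ hcB).2
      have e2 := (hFB i _ hcB).1
      rw [hcG i T hi _ (hG _).1] at e1 e2
      calc M * N (lcomb (F j) (c i T hi)) ≤ |M| * (A * G j (b i)) :=
            (mul_le_mul_of_nonneg_right (le_abs_self M) (N.nonneg _)).trans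
              (mul_le_mul_of_nonneg_left e1 (abs_nonneg M))
        _ = |M| * A * G j (b i) := by ring
        _ < G i (b i) := hb i j hj
        _ ≤ _ := e2

/-- The norm `h + δ g`. -/
def LNorm.addSmul (h g : LNorm) (δ : ℝ) (hδ : 0 ≤ δ) : LNorm where
  toFun b := h b + δ * g b
  add_le' a b := by nlinarith [h.add_le a b, g.add_le a b]
  smul' t a := by rw [h.smul, g.smul]; ring
  mono' a b hab := add_le_add (h.mono hab) (mul_le_mul_of_nonneg_left (g.mono hab) hδ)

theorem LNorm.addSmul_apply (h g : LNorm) (δ : ℝ) (hδ : 0 ≤ δ) (b : ℕ →₀ ℝ) :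
    h.addSmul g δ hδ b = h b + δ * g b := rfl

/-- The sum of two represented norms is represented by disjoint sums of the representing vectors. -/
theorem RepT.addSmul {N h g : LNorm} {A δ : ℝ} (hh : RepT N h A) (hg : RepT N g A)
    (hδ : 0 ≤ δ) : RepT N (h.addSmul g δ hδ) (2 * A) := by
  intro m s B hB
  obtain ⟨f, h1, h2, h3⟩ := hh m s B hB
  obtain ⟨s', hs'⟩ := exists_bound_support m f
  obtain ⟨f', h1', h2', h3'⟩ := hg m (max s s') B hB
  have hdis : ∀ k < m, ∀ l < m, ∀ i, f k i ≠ 0 → f' l i = 0 := by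
    intro k hk l hl i hi
    by_contra hi'
    have e1 := hs' k hk i hi
    have e2 := h1' l hl i hi'
    have := le_max_right s s'
    omega
  have hcases : ∀ k i, ((2 : ℝ) • (f k + δ • f' k)) i ≠ 0 → f k i ≠ 0 ∨ f' k i ≠ 0 := by
    intro k i hi
    by_contra hcon
    push Not at hcon
    apply hi
    simp [hcon.1, hcon.2]
  refine ⟨fun k => (2 : ℝ) • (f k + δ • f' k), fun k hk i hi => ?_, fun k hk l hl i hi hi' => ?_,
    fun b hb => ?_⟩
  · rcases hcases k i hi with h | h
    · exact h1 k hk i h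
    · exact (le_max_left _ _).trans (h1' k hk i h)
  · rcases hcases k i hi with h | h <;> rcases hcases l i hi' with h' | h'
    · exact h2 k hk l hl i h h'
    · exact absurd (hdis k hk l hl i h) h'
    · exact absurd (hdis l hl k hk i h') h
    · exact h2' k hk l hl i h h'
  · have hl : lcomb (fun k => (2 : ℝ) • (f k + δ • f' k)) b =
        (2 : ℝ) • (lcomb f b + δ • lcomb f' b) := by
      rw [lcomb_eq_sum _ b subset_rfl, lcomb_eq_sum _ b subset_rfl, lcomb_eq_sum _ b subset_rfl,
        smul_sum, ← sum_add_distrib, smul_sum]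
      refine sum_congr rfl fun k _ => ?_
      rw [smul_comm (b k), smul_add (b k), smul_comm (b k) δ]
    have hsup : ∀ k ∈ b.support, k < m := fun k hk => mem_range.mp (hB b hb hk)
    have hz : ∀ i, lcomb f b i = 0 ∨ lcomb f' b i = 0 := by
      intro i
      by_contra hcon
      push Not at hcon
      obtain ⟨k, hk, hki⟩ := exists_ne_zero_of_lcomb_ne_zero hcon.1
      obtain ⟨l, hl, hli⟩ := exists_ne_zero_of_lcomb_ne_zero hcon.2
      exact hli (hdis k (hsup k (Finsupp.mem_support_iff.mpr hk)) l
        (hsup l (Finsupp.mem_support_iff.mpr hl)) i hki)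
    have m1 : N (lcomb f b) ≤ N (lcomb f b + δ • lcomb f' b) := by
      refine N.mono fun i => ?_
      rcases hz i with h | h
      · rw [h, abs_zero]; exact abs_nonneg _
      · simp [h]
    have m2 : N (δ • lcomb f' b) ≤ N (lcomb f b + δ • lcomb f' b) := by
      refine N.mono fun i => ?_
      rcases hz i with h | h
      · simp [h]
      · simp [h]
    have m3 := N.add_le (lcomb f b) (δ • lcomb f' b)
    rw [N.smul, abs_of_nonneg hδ] at m2 m3
    have e1 := h3 b hb
    have e2 := h3' b hb
    have e3 := mul_le_mul_of_nonneg_left e2.1 hδ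
    have e4 := mul_le_mul_of_nonneg_left e2.2 hδ
    rw [hl, N.smul, abs_of_pos zero_lt_two, h.addSmul_apply]
    constructor
    · linarith
    · nlinarith

theorem LNorm.Spread.addSmul {h g : LNorm} (hh : h.Spread) (hg : g.Spread) {δ : ℝ} (hδ : 0 ≤ δ) :
    (h.addSmul g δ hδ).Spread := fun φ b hφ => by
  rw [h.addSmul_apply, h.addSmul_apply, hh φ b hφ, hg φ b hφ]

/-- A chain of spreading norms, each of which is not dominated by the sum of the previous ones: the
norms `h + δᵢ gᵢ`, for suitable `δᵢ`, are uniformly incomparable. -/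
theorem violates_of_chain {N h : LNorm} {A : ℝ} (hhS : h.Spread) (hhN : h.Normalized)
    (hhA : RepT N h A) (P : LNorm → Prop)
    (hP : ∀ g, P g → g.Spread ∧ g.Normalized ∧ RepT N g A)
    (H : ∀ R : ℝ, 0 < R → ∃ g₁ b₁, P g₁ ∧ R * h b₁ < g₁ b₁ ∧
      ∀ R : ℝ, 0 < R → ∃ g₂ b₂, P g₂ ∧ R * (h b₂ + g₁ b₂) < g₂ b₂ ∧
      ∀ R : ℝ, 0 < R → ∃ g₃ b₃, P g₃ ∧ R * (h b₃ + g₁ b₃ + g₂ b₃) < g₃ b₃) : Violates N := by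
  refine violates_of_spreading_triples (max (2 * A) 2) fun M₀ => ?_
  set M := max M₀ 1 with hM
  have hM1 : 1 ≤ M := le_max_right _ _
  obtain ⟨g₁, b₁, hg₁, hb₁, H⟩ := H (2 * M) (by linarith)
  -- a weight for which no normalized norm that is chosen later can exceed `h` at `b`
  have key : ∀ (g : LNorm) (b : ℕ →₀ ℝ) (R : ℝ), g.Normalized → 0 ≤ R → R < g b →
      ∃ δ : ℝ, 0 < δ ∧ δ ≤ 1 ∧ ∀ f : LNorm, f.Normalized → δ * f b ≤ h b := by
    intro g b R hg hR hgb
    have hb0 : b ≠ 0 := hg.ne_zero_of_pos (hR.trans_lt hgb)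
    have h1 := hhN.pos hb0
    have h2 := hhN.le_l1 b
    have h3 : 0 < ∑ k ∈ b.support, |b k| := h1.trans_le h2
    refine ⟨h b / ∑ k ∈ b.support, |b k|, by positivity, div_le_one_of_le₀ h2 h3.le,
      fun f hf => ?_⟩
    rw [div_mul_eq_mul_div, div_le_iff₀ h3]
    exact mul_le_mul_of_nonneg_left (hf.le_l1 b) h1.le
  obtain ⟨δ₂, hδ₂, hδ₂1, hδ₂b⟩ := key g₁ b₁ _ (hP g₁ hg₁).2.1
    (mul_nonneg (by linarith) (h.nonneg b₁)) hb₁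
  obtain ⟨g₂, b₂, hg₂, hb₂, H⟩ := H (2 * M / δ₂) (by positivity)
  obtain ⟨δ₃, hδ₃, hδ₃1, hδ₃b⟩ := key g₂ b₂ _ (hP g₂ hg₂).2.1
    (mul_nonneg (by positivity) (add_nonneg (h.nonneg b₂) (g₁.nonneg b₂))) hb₂
  obtain ⟨g₃, b₃, hg₃, hb₃⟩ := H (M / min δ₂ δ₃) (by positivity)
  have hN₁ := (hP g₁ hg₁).2.1
  have hN₂ := (hP g₂ hg₂).2.1
  have hN₃ := (hP g₃ hg₃).2.1
  set δ := min δ₂ δ₃ with hδd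
  have hδ : 0 < δ := lt_min hδ₂ hδ₃
  have f1 : δ * g₃ b₁ ≤ h b₁ :=
    (mul_le_mul_of_nonneg_right (min_le_left _ _) (g₃.nonneg _)).trans (hδ₂b g₃ hN₃)
  have f2 : δ * g₃ b₂ ≤ h b₂ :=
    (mul_le_mul_of_nonneg_right (min_le_right _ _) (g₃.nonneg _)).trans (hδ₃b g₃ hN₃)
  have f3 : δ₂ * g₂ b₁ ≤ h b₁ := hδ₂b g₂ hN₂
  have hb₂' : 2 * M * (h b₂ + g₁ b₂) < δ₂ * g₂ b₂ := by
    rw [div_mul_eq_mul_div, div_lt_iff₀ hδ₂] at hb₂; linarith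
  have hb₃' : M * (h b₃ + g₁ b₃ + g₂ b₃) < δ * g₃ b₃ := by
    rw [div_mul_eq_mul_div, div_lt_iff₀ hδ] at hb₃; linarith
  refine ⟨![h.addSmul g₁ 1 zero_le_one, h.addSmul g₂ δ₂ hδ₂.le, h.addSmul g₃ δ hδ.le],
    ![b₁, b₂, b₃], ?_, ?_⟩
  · have hgen : ∀ (g : LNorm) (δ : ℝ) (hδ : 0 < δ), δ ≤ 1 → P g →
        (h.addSmul g δ hδ.le).Spread ∧ RepT N (h.addSmul g δ hδ.le) (max (2 * A) 2) ∧
        1 ≤ h.addSmul g δ hδ.le (Finsupp.single 0 1) ∧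
        h.addSmul g δ hδ.le (Finsupp.single 0 1) ≤ max (2 * A) 2 := by
      intro g δ hδ hδ1 hg
      obtain ⟨a1, a2, a3⟩ := hP g hg
      refine ⟨hhS.addSmul a1 hδ.le, (hhA.addSmul a3 hδ.le).mono (le_max_left _ _), ?_, ?_⟩
      · rw [h.addSmul_apply, hhN, a2]; linarith
      · rw [h.addSmul_apply, hhN, a2]
        exact le_trans (by linarith) (le_max_right _ _)
    intro i
    fin_cases i
    · exact hgen g₁ 1 one_pos le_rfl hg₁
    · exact hgen g₂ δ₂ hδ₂ hδ₂1 hg₂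
    · exact hgen g₃ δ hδ ((min_le_left _ _).trans hδ₂1) hg₃
  · have hwlog : ∀ x y : ℝ, 0 ≤ x → M * x < y → M₀ * x < y := fun x y hx h =>
      (mul_le_mul_of_nonneg_right (le_max_left _ _) hx).trans_lt h
    have a1 := h.nonneg b₁
    have a2 := h.nonneg b₂
    have a3 := h.nonneg b₃
    have c1 := g₁.nonneg b₁
    have c2 := g₁.nonneg b₂
    have c3 := g₁.nonneg b₃
    have d3 := g₂.nonneg b₃
    intro i j hij
    refine hwlog _ _ (LNorm.nonneg _ _) ?_
    fin_cases i <;> fin_cases j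
    · exact absurd rfl hij
    · change M * (h b₁ + δ₂ * g₂ b₁) < h b₁ + 1 * g₁ b₁
      nlinarith
    · change M * (h b₁ + δ * g₃ b₁) < h b₁ + 1 * g₁ b₁
      nlinarith
    · change M * (h b₂ + 1 * g₁ b₂) < h b₂ + δ₂ * g₂ b₂
      nlinarith
    · exact absurd rfl hij
    · change M * (h b₂ + δ * g₃ b₂) < h b₂ + δ₂ * g₂ b₂
      nlinarith
    · change M * (h b₃ + 1 * g₁ b₃) < h b₃ + δ * g₃ b₃
      nlinarith
    · change M * (h b₃ + δ₂ * g₂ b₃) < h b₃ + δ * g₃ b₃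
      have : δ₂ * g₂ b₃ ≤ g₂ b₃ := by nlinarith
      nlinarith
    · exact absurd rfl hij

/-- If no incomparable families exist then among the spreading norms represented in `N` there is a
minimal one, since a strictly decreasing chain has at most three members. -/
theorem exists_minimal_of_not_violates {N : LNorm} (hv : ¬ Violates N) (P : LNorm → Prop)
    (hP : ∀ e, P e → e.Spread ∧ e.Normalized ∧ ∃ A, RepT N e A) (hne : ∃ e, P e) :
    ∃ e, P e ∧ ∀ f, P f → (∃ C : ℝ, ∀ b, f b ≤ C * e b) → ∃ C : ℝ, ∀ b, e b ≤ C * f b := by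
  by_contra hcon
  push Not at hcon
  obtain ⟨e₀, h₀⟩ := hne
  obtain ⟨e₁, h₁, -, l₁⟩ := hcon e₀ h₀
  obtain ⟨e₂, h₂, ⟨C₂, u₂⟩, l₂⟩ := hcon e₁ h₁
  obtain ⟨e₃, h₃, ⟨C₃, u₃⟩, l₃⟩ := hcon e₂ h₂
  obtain ⟨-, -, A₀, r₀⟩ := hP e₀ h₀
  obtain ⟨-, -, A₁, r₁⟩ := hP e₁ h₁
  obtain ⟨-, -, A₂, r₂⟩ := hP e₂ h₂
  obtain ⟨s₃, n₃, A₃, r₃⟩ := hP e₃ h₃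
  set A := max (max A₀ A₁) (max A₂ A₃) with hA
  refine hv (violates_of_chain s₃ n₃ (r₃.mono ((le_max_right _ _).trans (le_max_right _ _)))
    (A := A) (fun g => P g ∧ RepT N g A) (fun g hg => ⟨(hP g hg.1).1, (hP g hg.1).2.1, hg.2⟩)
    fun R hR => ?_)
  obtain ⟨b₁, hb₁⟩ := l₃ R
  refine ⟨e₂, b₁, ⟨h₂, r₂.mono ((le_max_left _ _).trans (le_max_right _ _))⟩, hb₁, fun R hR => ?_⟩
  obtain ⟨b₂, hb₂⟩ := l₂ (R * (|C₃| + 1))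
  refine ⟨e₁, b₂, ⟨h₁, r₁.mono ((le_max_right _ _).trans (le_max_left _ _))⟩, ?_, fun R hR => ?_⟩
  · refine lt_of_le_of_lt ?_ hb₂
    rw [mul_assoc]
    refine mul_le_mul_of_nonneg_left ?_ hR.le
    have := (u₃ b₂).trans (mul_le_mul_of_nonneg_right (le_abs_self C₃) (e₂.nonneg b₂))
    linarith
  · obtain ⟨b₃, hb₃⟩ := l₁ (R * ((|C₃| + 1) * |C₂| + 1))
    refine ⟨e₀, b₃, ⟨h₀, r₀.mono ((le_max_left _ _).trans (le_max_left _ _))⟩, ?_⟩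
    refine lt_of_le_of_lt ?_ hb₃
    rw [mul_assoc]
    refine mul_le_mul_of_nonneg_left ?_ hR.le
    have h5 := (u₃ b₃).trans (mul_le_mul_of_nonneg_right (le_abs_self C₃) (e₂.nonneg b₃))
    have h6 := (u₂ b₃).trans (mul_le_mul_of_nonneg_right (le_abs_self C₂) (e₁.nonneg b₃))
    have h7 := mul_le_mul_of_nonneg_left h6 (by positivity : 0 ≤ |C₃| + 1)
    nlinarith

/-- The spreading model is realised at generic positions; the factor `2` in the vectors absorbs the
error of the approximation, which gives the constant `3`. -/
theorem LNorm.repT_spreadingModel {N : LNorm} (hN : N.Normalized) (V : Ultrafilter ℕ)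
    (hV : (V : Filter ℕ) ≤ atTop) : RepT N (spreadingModel hN V hV) 3 := by
  classical
  intro m s B hB
  set e := spreadingModel hN V hV with he
  have hen : e.Normalized := spreadingModel_normalized hN V hV
  obtain ⟨ε, hε, hεb⟩ : ∃ ε : ℝ, 0 < ε ∧ ∀ b ∈ B, b ≠ 0 → ε ≤ e b / 2 := by
    induction B using Finset.induction_on with
    | empty => exact ⟨1, one_pos, by simp⟩
    | insert b B _ ih =>
      obtain ⟨ε, hε, h⟩ := ih fun b hb => hB b (mem_insert_of_mem hb)
      by_cases hb0 : b = 0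
      · refine ⟨ε, hε, fun c hc hc0 => ?_⟩
        rcases mem_insert.mp hc with rfl | hc
        · exact absurd hb0 hc0
        · exact h c hc hc0
      · refine ⟨min ε (e b / 2), lt_min hε (half_pos (hen.pos hb0)), fun c hc hc0 => ?_⟩
        rcases mem_insert.mp hc with rfl | hc
        · exact min_le_right _ _
        · exact (min_le_left _ _).trans (h c hc hc0)
  obtain ⟨φ, h1, h2, h3⟩ := exists_generic hN V (Filter.univ_mem (f := (V : Filter ℕ))) hV B 0 m s hε
  have hnz : ∀ k i, ((2 : ℝ) • Finsupp.single (φ k) (1 : ℝ)) i ≠ 0 → φ k = i := by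
    intro k i hi
    by_contra hcon
    apply hi
    simp [hcon]
  refine ⟨fun k => (2 : ℝ) • Finsupp.single (φ k) 1, fun k hk i hi => ?_,
    fun k hk l hl i hi hi' => ?_, fun b hb => ?_⟩
  · rw [← hnz k i hi]
    exact (h2 k ⟨Nat.zero_le _, hk⟩).2
  · exact h1.injOn ⟨Nat.zero_le _, hk⟩ ⟨Nat.zero_le _, hl⟩ ((hnz k i hi).trans (hnz l i hi').symm)
  · have hl : lcomb (fun k => (2 : ℝ) • Finsupp.single (φ k) 1) b =
        (2 : ℝ) • lcomb (fun k => Finsupp.single (φ k) 1) b := by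
      rw [lcomb_eq_sum _ b subset_rfl, lcomb_eq_sum _ b subset_rfl, smul_sum]
      exact sum_congr rfl fun k _ => smul_comm _ _ _
    rw [hl, N.smul, abs_of_pos zero_lt_two]
    by_cases hb0 : b = 0
    · subst hb0
      simp [N.zero, e.zero]
    · have h4 := h3 b hb fun k hk => ⟨Nat.zero_le _, mem_range.mp (hB b hb hk)⟩
      have h5 := hεb b hb hb0
      rw [abs_le] at h4
      constructor <;> linarith

/-! ### Finite families from infinite concatenations -/

/-- Infinite concatenation of pieces which live on intervals `[p, q)` of indices and on intervals
`[s, s')` of coordinates. -/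
theorem exists_concat {Δ : Type} (Q : ℕ → ℕ → ℕ → ℕ → ℕ → (ℕ → Δ) → Prop)
    (hloc : ∀ j p s q s' D D', (∀ k, p ≤ k → k < q → D k = D' k) →
      Q j p s q s' D → Q j p s q s' D')
    (h : ∀ j p s, ∃ q s' D, p < q ∧ s ≤ s' ∧ Q j p s q s' D) (p₀ s₀ : ℕ) :
    ∃ (P S : ℕ → ℕ) (D : ℕ → Δ), P 0 = p₀ ∧ S 0 = s₀ ∧ StrictMono P ∧ Monotone S ∧
      ∀ j, Q j (P j) (S j) (P (j + 1)) (S (j + 1)) D := by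
  choose q s' D hq hs hQ using h
  set st : ℕ → ℕ × ℕ := fun j => Nat.rec (p₀, s₀) (fun j x => (q j x.1 x.2, s' j x.1 x.2)) j with hst
  have hst1 : ∀ j, st (j + 1) = (q j (st j).1 (st j).2, s' j (st j).1 (st j).2) := fun j => rfl
  have hmono : StrictMono fun j => (st j).1 := strictMono_nat_of_lt_succ fun j => by
    rw [hst1]; exact hq _ _ _
  refine ⟨fun j => (st j).1, fun j => (st j).2,
    fun k => D (Nat.findGreatest (fun j => (st j).1 ≤ k) k) (st (Nat.findGreatest (fun j =>
      (st j).1 ≤ k) k)).1 (st (Nat.findGreatest (fun j => (st j).1 ≤ k) k)).2 k, rfl, rfl, hmono,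
    monotone_nat_of_le_succ fun j => by rw [hst1]; exact hs _ _ _, fun j => ?_⟩
  refine hloc _ _ _ _ _ _ _ (fun k hk1 hk2 => ?_) (hQ j (st j).1 (st j).2)
  have hfg : Nat.findGreatest (fun j => (st j).1 ≤ k) k = j := by
    rw [Nat.findGreatest_eq_iff]
    refine ⟨(hmono.id_le j).trans hk1, fun _ => hk1, fun n hn _ hle => ?_⟩
    have h1 : (st (j + 1)).1 ≤ (st n).1 := hmono.monotone hn
    rw [hst1] at h1
    exact absurd (hk2.trans_le h1) (not_lt.mpr hle)
  rw [hfg]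

/-- Compactness: if every transversal of a sequence of intervals carries a good test vector then
finitely many test vectors suffice, on finitely many of the intervals. -/
theorem exists_finite_transversal_tests {P : ℕ → ℕ} (hP : StrictMono P)
    (Good : (ℕ →₀ ℝ) → Prop)
    (h : ∀ τ : ℕ → ℕ, (∀ j, P j ≤ τ j ∧ τ j < P (j + 1)) →
      ∃ b, Good b ∧ ∀ k ∈ b.support, ∃ j, τ j = k) :
    ∃ (J : ℕ) (B : Finset (ℕ →₀ ℝ)), (∀ b ∈ B, Good b) ∧
      ∀ τ : ℕ → ℕ, (∀ j, P j ≤ τ j ∧ τ j < P (j + 1)) →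
        ∃ b ∈ B, ∀ k ∈ b.support, ∃ j < J, τ j = k := by
  classical
  obtain ⟨J, hJ⟩ : ∃ J : ℕ, ∀ τ : ℕ → ℕ, (∀ j, P j ≤ τ j ∧ τ j < P (j + 1)) →
      ∃ b, Good b ∧ ∀ k ∈ b.support, ∃ j < J, τ j = k := by
    by_contra hcon
    push Not at hcon
    choose τ hτ hbad using hcon
    have hlim : ∀ j, ∃ v, P j ≤ v ∧ v < P (j + 1) ∧ ∀ᶠ J in (hyperfilter ℕ : Filter ℕ), τ J j = v := by
      intro j
      have hmem : Set.Ico (P j) (P (j + 1)) ∈ (hyperfilter ℕ).map fun J => τ J j :=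
        Ultrafilter.mem_map.mpr (Filter.univ_mem' fun J => hτ J j)
      obtain ⟨v, hv, hpure⟩ := Ultrafilter.eq_pure_of_finite_mem (Set.finite_Ico _ _) hmem
      refine ⟨v, hv.1, hv.2, ?_⟩
      have : ({v} : Set ℕ) ∈ (hyperfilter ℕ).map fun J => τ J j := by
        rw [hpure]; exact Set.mem_singleton v
      exact this
    choose v hv1 hv2 hv using hlim
    obtain ⟨b, hb, hsupp⟩ := h v fun j => ⟨hv1 j, hv2 j⟩
    choose! jj hjj using hsupp
    have h1 : ∀ᶠ J in (hyperfilter ℕ : Filter ℕ), ∀ k ∈ b.support, τ J (jj k) = k ∧ jj k < J := by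
      rw [Filter.eventually_all_finset]
      intro k hk
      have h2 : ∀ᶠ J in (hyperfilter ℕ : Filter ℕ), jj k < J :=
        Nat.hyperfilter_le_atTop (eventually_gt_atTop (jj k))
      filter_upwards [hv (jj k), h2] with J hJ1 hJ2
      exact ⟨hJ1.trans (hjj k hk), hJ2⟩
    obtain ⟨J, hJ⟩ := h1.exists
    obtain ⟨k, hk, hk'⟩ := hbad J b hb
    exact hk' (jj k) (hJ k hk).2 (hJ k hk).1
  choose! β hβ hβs using hJ
  set ext : (Fin J → ℕ) → ℕ → ℕ := fun f j => if hj : j < J then f ⟨j, hj⟩ else P j with hext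
  set T := Fintype.piFinset fun j : Fin J => Ico (P j) (P (j + 1)) with hT
  have hextT : ∀ f ∈ T, ∀ j, P j ≤ ext f j ∧ ext f j < P (j + 1) := by
    intro f hf j
    rw [hT, Fintype.mem_piFinset] at hf
    simp only [hext]
    split_ifs with hj
    · simpa using hf ⟨j, hj⟩
    · exact ⟨le_rfl, hP (Nat.lt_succ_self j)⟩
  refine ⟨J, T.image fun f => β (ext f), fun b hb => ?_, fun τ hτ => ?_⟩
  · obtain ⟨f, hf, rfl⟩ := mem_image.mp hb
    exact hβ _ (hextT f hf)
  · have hf : (fun j : Fin J => τ j) ∈ T := by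
      rw [hT, Fintype.mem_piFinset]
      intro j
      simpa using hτ j
    refine ⟨_, mem_image_of_mem _ hf, fun k hk => ?_⟩
    obtain ⟨j, hj, hjk⟩ := hβs _ (hextT _ hf) k hk
    refine ⟨j, hj, ?_⟩
    rw [← hjk]
    simp [hext, hj]

theorem exists_eps_of_normalized {e : LNorm} (he : e.Normalized) (B : Finset (ℕ →₀ ℝ)) :
    ∃ ε : ℝ, 0 < ε ∧ ∀ b ∈ B, b ≠ 0 → ε ≤ e b / 2 := by
  classical
  induction B using Finset.induction_on with
  | empty => exact ⟨1, one_pos, by simp⟩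
  | insert b B _ ih =>
    obtain ⟨ε, hε, h⟩ := ih
    by_cases hb0 : b = 0
    · refine ⟨ε, hε, fun c hc hc0 => ?_⟩
      rcases mem_insert.mp hc with rfl | hc
      · exact absurd hb0 hc0
      · exact h c hc hc0
    · refine ⟨min ε (e b / 2), lt_min hε (half_pos (he.pos hb0)), fun c hc hc0 => ?_⟩
      rcases mem_insert.mp hc with rfl | hc
      · exact min_le_right _ _
      · exact (min_le_left _ _).trans (h c hc hc0)

theorem exists_mem_piece {P : ℕ → ℕ} (J : ℕ) {k : ℕ} (h0 : P 0 ≤ k)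
    (hk : k < P (J + 1)) : ∃ j ≤ J, P j ≤ k ∧ k < P (j + 1) := by
  induction J with
  | zero => exact ⟨0, le_rfl, h0, hk⟩
  | succ J ih =>
    by_cases hk' : k < P (J + 1)
    · obtain ⟨j, hj, h⟩ := ih hk'
      exact ⟨j, by omega, h⟩
    · exact ⟨J + 1, le_rfl, not_lt.mp hk', hk⟩

section Unbounded

variable (N e : LNorm)

/-- A finite piece of the construction for a norm which is not dominated, along any subsequence, by
the spreading norm `e`: there are `t` sequences, of vectors of norm at most `η`, such that for any
colouring with `t` colours some test vector `b` with `e b ≤ 1`, supported in one of the colours, is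
large for the sequence of this colour and small for the others. -/
def UnboundedPiece (t : ℕ) (η M : ℝ) (p s q s' : ℕ) (Φ : ℕ → Fin 3 → ℕ →₀ ℝ)
    (B : Finset (ℕ →₀ ℝ)) : Prop :=
  (∀ k, p ≤ k → k < q → ∀ i m, Φ k i m ≠ 0 → s ≤ m ∧ m < s') ∧
  (∀ k, p ≤ k → k < q → ∀ l, p ≤ l → l < q → ∀ i j m, Φ k i m ≠ 0 → Φ l j m ≠ 0 → i = j ∧ k = l) ∧
  (∀ k, p ≤ k → k < q → ∀ i, N (Φ k i) ≤ η) ∧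
  (∀ k, p ≤ k → k < q → ∀ i : Fin 3, t ≤ i → Φ k i = 0) ∧
  ∀ col : ℕ → ℕ, (∀ k, p ≤ k → k < q → col k < t) → ∃ b ∈ B, ∃ i : Fin 3, (i : ℕ) < t ∧
    (∀ k ∈ b.support, (p ≤ k ∧ k < q) ∧ col k = i) ∧ e b ≤ 1 ∧
    M ≤ N (lcomb (fun k => Φ k i) b) ∧ ∀ j ≠ i, N (lcomb (fun k => Φ k j) b) ≤ 2 * η

variable {N e}

theorem UnboundedPiece.congr {t : ℕ} {η M : ℝ} {p s q s' : ℕ} {Φ Φ' : ℕ → Fin 3 → ℕ →₀ ℝ}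
    {B : Finset (ℕ →₀ ℝ)} (h : UnboundedPiece N e t η M p s q s' Φ B)
    (hΦ : ∀ k, p ≤ k → k < q → Φ k = Φ' k) : UnboundedPiece N e t η M p s q s' Φ' B := by
  obtain ⟨h1, h2, h3, h4, h5⟩ := h
  refine ⟨fun k a b => hΦ k a b ▸ h1 k a b, fun k a b l c d => hΦ k a b ▸ hΦ l c d ▸ h2 k a b l c d,
    fun k a b => hΦ k a b ▸ h3 k a b, fun k a b => hΦ k a b ▸ h4 k a b, fun col hcol => ?_⟩
  obtain ⟨b, hb, i, hi, hs, he, hM, hj⟩ := h5 col hcol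
  have hc : ∀ i, lcomb (fun k => Φ' k i) b = lcomb (fun k => Φ k i) b := fun i =>
    lcomb_congr fun k hk => by rw [hΦ k (hs k hk).1.1 (hs k hk).1.2]
  exact ⟨b, hb, i, hi, hs, he, by rw [hc]; exact hM, fun j hj' => by rw [hc]; exact hj j hj'⟩

/-- Induction on the number `t` of colours. Pieces for `t` colours are put one after the other, together
with a further sequence which runs through positions generic for the pieces. In a colouring with
`t + 1` colours either some piece does not use the last colour, and its test vector is small for the
new sequence by genericity, or the last colour occurs in all pieces, on a transversal, along which
the new sequence is large for some test vector. -/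
theorem exists_unboundedPiece (hN : N.Normalized) (V : Ultrafilter ℕ)
    (hV : (V : Filter ℕ) ≤ atTop)
    (H : ∀ ℓ : ℕ → ℕ, StrictMono ℓ → ∀ C : ℝ, ∃ b,
      C * N.spreadingModel hN V hV b < N (Finsupp.mapDomain ℓ b)) (t : ℕ) (ht : t ≤ 3) :
    ∀ (η : ℝ), 0 < η → ∀ (M : ℝ) (p s : ℕ), ∃ q s' Φ B, p < q ∧ s ≤ s' ∧
      UnboundedPiece N (N.spreadingModel hN V hV) t η M p s q s' Φ B := by
  classical
  set e := N.spreadingModel hN V hV with he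
  have heN : e.Normalized := LNorm.spreadingModel_normalized hN V hV
  have heS : e.Spread := LNorm.spreadingModel_spread hN V hV
  induction t with
  | zero =>
    intro η hη M p s
    refine ⟨p + 1, s, 0, ∅, by omega, le_rfl, by simp, by simp, ?_, by simp, fun col hcol => ?_⟩
    · intro k _ _ i; simp [N.zero, hη.le]
    · exact absurd (hcol p le_rfl (by omega)) (Nat.not_lt_zero _)
  | succ t ih =>
    intro η hη M p s
    have ih := ih (by omega)
    set t' : Fin 3 := ⟨t, by omega⟩ with ht'
    -- the bounds for the norms in the pieces sum up to `η`, so that on a transversal the old sequences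
    -- are small
    set η' : ℕ → ℝ := fun j => (1 / 2) ^ j * (η / 2) with hη'
    have hη'0 : ∀ j, 0 < η' j := fun j => by positivity
    have hη'1 : ∀ j, η' j ≤ η := fun j => by
      have : (1 / 2 : ℝ) ^ j ≤ 1 := pow_le_one₀ (by norm_num) (by norm_num)
      simp only [hη']
      nlinarith
    obtain ⟨P, S, D, hP0, hS0, hP, hS, hQ⟩ := exists_concat (Δ := (Fin 3 → ℕ →₀ ℝ) × ℕ)
      (fun j p s q s' D => ∃ s₁ B, s ≤ s₁ ∧ s₁ ≤ s' ∧
        UnboundedPiece N e t (η' j) M p s q s₁ (fun k => (D k).1) B ∧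
        (∀ k l, p ≤ k → k < l → l < q → (D k).2 < (D l).2) ∧
        (∀ k, p ≤ k → k < q → s₁ ≤ (D k).2 ∧ (D k).2 < s') ∧
        ∀ b ∈ B, (∀ k ∈ b.support, p ≤ k ∧ k < q) → e b ≤ 1 →
          N (lcomb (fun k => Finsupp.single (D k).2 1) b) ≤ 2)
      (by
        rintro j p s q s' D D' hD ⟨s₁, B, h1, h2, h3, h4, h5, h6⟩
        refine ⟨s₁, B, h1, h2, h3.congr fun k a b => by rw [hD k a b], fun k l a b c => ?_,
          fun k a b => hD k a b ▸ h5 k a b, fun b hb hbs hb1 => ?_⟩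
        · rw [← hD k a (b.trans c), ← hD l (a.trans b.le) c]
          exact h4 k l a b c
        · have hc : lcomb (fun k => Finsupp.single (D' k).2 1) b =
              lcomb (fun k => Finsupp.single (D k).2 1) b :=
            lcomb_congr fun k hk => by rw [hD k (hbs k hk).1 (hbs k hk).2]
          rw [hc]
          exact h6 b hb hbs hb1)
      (by
        intro j p s
        obtain ⟨q, s₁, Φ, B, hpq, hss, hΦ⟩ := ih (η' j) (hη'0 j) M p s
        obtain ⟨φ, hφ1, hφ2, hφ3⟩ := LNorm.exists_generic hN V
          (Filter.univ_mem (f := (V : Filter ℕ))) hV B p q s₁ one_pos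
        obtain ⟨m, hm⟩ := ((Ico p q).image φ).exists_nat_subset_range
        refine ⟨q, max s₁ m, fun k => (Φ k, φ k), hpq, hss.trans (le_max_left _ _), s₁, B, hss,
          le_max_left _ _, hΦ, fun k l a b c => hφ1 ⟨a, b.trans c⟩ ⟨a.trans b.le, c⟩ b,
          fun k a b => ⟨(hφ2 k ⟨a, b⟩).2, ?_⟩, fun b hb hbs hb1 => ?_⟩
        · exact lt_of_lt_of_le (mem_range.mp (hm (mem_image_of_mem _ (mem_Ico.mpr ⟨a, b⟩))))
            (le_max_right _ _)
        · have := (abs_le.mp (hφ3 b hb fun k hk => hbs k hk)).2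
          change N (lcomb (fun k => Finsupp.single (φ k) 1) b) - e b ≤ 1 at this
          linarith) p s
    choose s₁ B hs₁ hs₁' hpc hz hzs hgen using hQ
    set z : ℕ → ℕ := fun k => (D k).2 with hzd
    set Φ : ℕ → Fin 3 → ℕ →₀ ℝ := fun k => (D k).1 with hΦd
    have hpiece : ∀ J k, p ≤ k → k < P (J + 1) → ∃ j ≤ J, P j ≤ k ∧ k < P (j + 1) :=
      fun J k h1 h2 => exists_mem_piece J (hP0.le.trans h1) h2
    -- positions of points of later pieces lie further to the right
    have hzmono : ∀ τ : ℕ → ℕ, (∀ j, P j ≤ τ j ∧ τ j < P (j + 1)) → StrictMono fun j => z (τ j) := by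
      intro τ hτ
      refine strictMono_nat_of_lt_succ fun j => ?_
      have h1 := (hzs j (τ j) (hτ j).1 (hτ j).2).2
      have h2 := (hzs (j + 1) (τ (j + 1)) (hτ (j + 1)).1 (hτ (j + 1)).2).1
      exact h1.trans_le ((hs₁ (j + 1)).trans h2)
    have hτmono : ∀ τ : ℕ → ℕ, (∀ j, P j ≤ τ j ∧ τ j < P (j + 1)) → StrictMono τ := fun τ hτ =>
      strictMono_nat_of_lt_succ fun j => (hτ j).2.trans_le (hτ (j + 1)).1
    obtain ⟨J, B₀, hB₀, htr⟩ := exists_finite_transversal_tests hP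
      (fun b => e b ≤ 1 ∧ M ≤ η * N (Finsupp.mapDomain z b)) (by
        intro τ hτ
        obtain ⟨b, hb⟩ := H _ (hzmono τ hτ) (M / η)
        have hb0 : b ≠ 0 := by
          rintro rfl
          simp [N.zero, LNorm.zero] at hb
        have heb := heN.pos hb0
        refine ⟨Finsupp.mapDomain τ ((e b)⁻¹ • b), ⟨?_, ?_⟩, fun k hk => ?_⟩
        · rw [heS _ _ ((hτmono τ hτ).strictMonoOn _), e.smul, abs_of_pos (inv_pos.mpr heb),
            inv_mul_cancel₀ heb.ne']
        · rw [← Finsupp.mapDomain_comp, Finsupp.mapDomain_smul, N.smul,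
            abs_of_pos (inv_pos.mpr heb)]
          have h1 : M / η * e b < N (Finsupp.mapDomain (z ∘ τ) b) := hb
          rw [div_mul_eq_mul_div, div_lt_iff₀ hη] at h1
          rw [← mul_assoc, mul_comm η, mul_assoc, le_inv_mul_iff₀ heb]
          linarith
        · obtain ⟨j, _, hj⟩ := mem_image.mp (Finsupp.mapDomain_support hk)
          exact ⟨j, hj⟩)
    -- the new sequence gets the number `t`; the factor `η` makes its vectors small, which is why it
    -- was required to be large by the factor `M / η`
    set Φ' : ℕ → Fin 3 → ℕ →₀ ℝ := fun k i => if i = t' then η • Finsupp.single (z k) 1 else Φ k i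
      with hΦ'
    have hΦ't : ∀ b, lcomb (fun k => Φ' k t') b = η • Finsupp.mapDomain z b := by
      intro b
      rw [← lcomb_single_eq_mapDomain, lcomb_eq_sum _ b subset_rfl, lcomb_eq_sum _ b subset_rfl,
        smul_sum]
      refine sum_congr rfl fun k _ => ?_
      simp only [hΦ', if_true]
      rw [smul_comm]
    have hΦ'i : ∀ i ≠ t', ∀ b, lcomb (fun k => Φ' k i) b = lcomb (fun k => Φ k i) b := by
      intro i hi b
      refine lcomb_congr fun k _ => ?_
      simp only [hΦ', if_neg hi]
    have hΦ'z : ∀ j k, P j ≤ k → k < P (j + 1) → ∀ i m, Φ' k i m ≠ 0 →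
        (i ≠ t' ∧ Φ k i m ≠ 0 ∧ S j ≤ m ∧ m < s₁ j) ∨
        (i = t' ∧ m = z k ∧ s₁ j ≤ m ∧ m < S (j + 1)) := by
      intro j k h1 h2 i m hm
      by_cases hi : i = t'
      · right
        simp only [hΦ', if_pos hi] at hm
        have hm' : m = z k := by
          by_contra hne
          apply hm
          simp [Ne.symm hne]
        subst hm'
        exact ⟨hi, rfl, hzs j k h1 h2⟩
      · left
        simp only [hΦ', if_neg hi] at hm
        exact ⟨hi, hm, (hpc j).1 k h1 h2 i m hm⟩
    have hΦ'S : ∀ j k, P j ≤ k → k < P (j + 1) → ∀ i m, Φ' k i m ≠ 0 → S j ≤ m ∧ m < S (j + 1) := by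
      intro j k h1 h2 i m hm
      have a1 := hs₁ j
      have a2 := hs₁' j
      rcases hΦ'z j k h1 h2 i m hm with h | h
      · exact ⟨h.2.2.1, h.2.2.2.trans_le a2⟩
      · exact ⟨a1.trans h.2.2.1, h.2.2.2⟩
    refine ⟨P (J + 1), S (J + 1), Φ', B₀ ∪ (range (J + 1)).biUnion B, ?_, ?_, ?_, ?_, ?_, ?_, ?_⟩
    · rw [← hP0]; exact hP (Nat.succ_pos J)
    · rw [← hS0]; exact hS (Nat.zero_le _)
    · intro k h1 h2 i m hm
      obtain ⟨j, hj, a, b⟩ := hpiece J k h1 h2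
      have := hΦ'S j k a b i m hm
      rw [← hS0]
      exact ⟨(hS (Nat.zero_le j)).trans this.1, this.2.trans_le (hS (by omega))⟩
    · intro k hk1 hk2 l hl1 hl2 i j m hm hm'
      obtain ⟨a, ha, ha1, ha2⟩ := hpiece J k hk1 hk2
      obtain ⟨c, hc, hc1, hc2⟩ := hpiece J l hl1 hl2
      have e1 := hΦ'S a k ha1 ha2 i m hm
      have e2 := hΦ'S c l hc1 hc2 j m hm'
      have hac : a = c := by
        rcases lt_trichotomy a c with h | h | h
        · exact absurd (e1.2.trans_le (hS h)) (not_lt.mpr e2.1)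
        · exact h
        · exact absurd (e2.2.trans_le (hS h)) (not_lt.mpr e1.1)
      subst hac
      rcases hΦ'z a k ha1 ha2 i m hm with h | h <;> rcases hΦ'z a l hc1 hc2 j m hm' with h' | h'
      · exact (hpc a).2.1 k ha1 ha2 l hc1 hc2 i j m h.2.1 h'.2.1
      · have := h.2.2.2; have := h'.2.2.1; omega
      · have := h.2.2.1; have := h'.2.2.2; omega
      · refine ⟨h.1.trans h'.1.symm, ?_⟩
        have hzz : z k = z l := h.2.1.symm.trans h'.2.1
        rcases lt_trichotomy k l with hkl | hkl | hkl
        · exact absurd hzz (hz a k l ha1 hkl hc2).ne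
        · exact hkl
        · exact absurd hzz (hz a l k hc1 hkl ha2).ne'
    · intro k h1 h2 i
      obtain ⟨j, hj, a, b⟩ := hpiece J k h1 h2
      simp only [hΦ']
      split_ifs
      · rw [N.smul, hN, abs_of_pos hη, mul_one]
      · exact ((hpc j).2.2.1 k a b i).trans (hη'1 j)
    · intro k h1 h2 i hi
      obtain ⟨j, hj, a, b⟩ := hpiece J k h1 h2
      have hit : i ≠ t' := by
        rintro rfl; simp [ht'] at hi
      simp only [hΦ', if_neg hit]
      exact (hpc j).2.2.2.1 k a b i (by omega)
    · intro col hcol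
      by_cases hcase : ∃ j ≤ J, ∀ k, P j ≤ k → k < P (j + 1) → col k < t
      · obtain ⟨j, hj, hcj⟩ := hcase
        obtain ⟨b, hb, i, hi, hbs, hb1, hbM, hbj⟩ := (hpc j).2.2.2.2 col hcj
        have hit : i ≠ t' := by
          rintro rfl; simp [ht'] at hi
        refine ⟨b, mem_union_right _ (mem_biUnion.mpr ⟨j, mem_range.mpr (by omega), hb⟩), i,
          by omega, fun k hk => ⟨⟨?_, ?_⟩, (hbs k hk).2⟩, hb1, ?_, fun j' hj' => ?_⟩
        · rw [← hP0]
          exact (hP.monotone (Nat.zero_le j)).trans (hbs k hk).1.1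
        · exact (hbs k hk).1.2.trans_le (hP.monotone (by omega))
        · rw [hΦ'i i hit]; exact hbM
        · by_cases hj't : j' = t'
          · rw [hj't, hΦ't, N.smul, abs_of_pos hη, ← lcomb_single_eq_mapDomain]
            have := hgen j b hb (fun k hk => (hbs k hk).1) hb1
            nlinarith
          · rw [hΦ'i j' hj't]
            exact (hbj j' hj').trans (by linarith [hη'1 j])
      · push Not at hcase
        have hex : ∀ j, ∃ k, (P j ≤ k ∧ k < P (j + 1)) ∧ (j ≤ J → col k = t) := by
          intro j
          by_cases hj : j ≤ J
          · obtain ⟨k, h1, h2, h3⟩ := hcase j hj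
            have h4 := hcol k (by rw [← hP0]; exact (hP.monotone (Nat.zero_le j)).trans h1)
              (h2.trans_le (hP.monotone (by omega)))
            exact ⟨k, ⟨h1, h2⟩, fun _ => by omega⟩
          · exact ⟨P j, ⟨le_rfl, hP (Nat.lt_succ_self j)⟩, fun h => absurd h hj⟩
        choose τ hτ hτc using hex
        obtain ⟨b, hb, hbs⟩ := htr τ hτ
        obtain ⟨hb1, hbM⟩ := hB₀ b hb
        refine ⟨b, mem_union_left _ hb, t', Nat.lt_succ_self t, fun k hk => ?_, hb1, ?_,
          fun i hi => ?_⟩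
        · obtain ⟨j, hj, rfl⟩ := hbs k hk
          refine ⟨⟨?_, ?_⟩, hτc j hj.le⟩
          · rw [← hP0]
            exact (hP.monotone (Nat.zero_le j)).trans (hτ j).1
          · exact (hτ j).2.trans_le (hP.monotone (by omega))
        · rw [hΦ't, N.smul, abs_of_pos hη]; exact hbM
        · rw [hΦ'i i hi, lcomb_eq_sum _ b subset_rfl]
          have hsub : b.support ⊆ (range J).image τ := by
            intro k hk
            obtain ⟨j, hj, rfl⟩ := hbs k hk
            exact mem_image_of_mem _ (mem_range.mpr hj)
          calc N (∑ k ∈ b.support, b k • Φ k i) ≤ ∑ k ∈ b.support, N (b k • Φ k i) := N.sum_le _ _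
            _ ≤ ∑ k ∈ b.support, N (Φ k i) := by
                refine sum_le_sum fun k _ => ?_
                rw [N.smul]
                exact mul_le_of_le_one_left (N.nonneg _) ((heN.abs_le b k).trans hb1)
            _ ≤ ∑ k ∈ (range J).image τ, N (Φ k i) :=
                sum_le_sum_of_subset_of_nonneg hsub fun k _ _ => N.nonneg _
            _ = ∑ j ∈ range J, N (Φ (τ j) i) :=
                sum_image fun _ _ _ _ h => (hτmono τ hτ).injective h
            _ ≤ ∑ j ∈ range J, η' j :=
                sum_le_sum fun j _ => (hpc j).2.2.1 _ (hτ j).1 (hτ j).2 i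
            _ = (∑ j ∈ range J, (1 / 2 : ℝ) ^ j) * (η / 2) := by rw [sum_mul]
            _ ≤ 2 * (η / 2) := by
                refine mul_le_mul_of_nonneg_right (sum_geometric_two_le J) (by linarith)
            _ ≤ 2 * η := by linarith

end Unbounded

/-! ### Norms without incomparable families dominate and are dominated by a spreading norm -/

theorem LNorm.exists_generic_triple {N : LNorm} (hN : N.Normalized) (V : Ultrafilter ℕ)
    (hV : (V : Filter ℕ) ≤ atTop) (B : Finset (ℕ →₀ ℝ)) (q s : ℕ) {ε : ℝ} (hε : 0 < ε) :
    ∃ g : Fin 3 → ℕ → ℕ, (∀ i, ∀ k < q, s ≤ g i k) ∧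
      (∀ i, ∀ k < q, ∀ j, ∀ l < q, g i k = g j l → i = j ∧ k = l) ∧
      ∀ i, ∀ b ∈ B, (∀ k ∈ b.support, k < q) →
        |N (lcomb (fun k => Finsupp.single (g i k) 1) b) - N.spreadingModel hN V hV b| ≤ ε := by
  classical
  set e := N.spreadingModel hN V hV
  have heS : e.Spread := LNorm.spreadingModel_spread hN V hV
  set σ : Fin 3 → ℕ → ℕ := fun i k => k + i * q with hσ
  have hσi : ∀ i, StrictMono (σ i) := fun i k l h => by simp only [hσ]; omega
  have hσq : ∀ i, ∀ k < q, σ i k < 3 * q := fun i k hk => by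
    have : (i : ℕ) * q ≤ 2 * q := Nat.mul_le_mul_right _ (by omega)
    simp only [hσ]; omega
  obtain ⟨φ, h1, h2, h3⟩ := LNorm.exists_generic hN V (Filter.univ_mem (f := (V : Filter ℕ))) hV
    ((univ : Finset (Fin 3)).biUnion fun i => B.image (Finsupp.mapDomain (σ i))) 0 (3 * q) s hε
  refine ⟨fun i k => φ (σ i k), fun i k hk => (h2 _ ⟨Nat.zero_le _, hσq i k hk⟩).2,
    fun i k hk j l hl h => ?_, fun i b hb hbs => ?_⟩
  · have h4 : σ i k = σ j l :=
      h1.injOn ⟨Nat.zero_le _, hσq i k hk⟩ ⟨Nat.zero_le _, hσq j l hl⟩ h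
    simp only [hσ] at h4
    have h5 : (i : ℕ) = j := by
      have e1 : (k + i * q) / q = i := by
        rw [Nat.add_mul_div_right _ _ (by omega), Nat.div_eq_of_lt hk, zero_add]
      have e2 : (l + j * q) / q = j := by
        rw [Nat.add_mul_div_right _ _ (by omega), Nat.div_eq_of_lt hl, zero_add]
      rw [← e1, h4, e2]
    refine ⟨Fin.ext h5, ?_⟩
    rw [h5] at h4
    omega
  · have h4 := h3 _ (mem_biUnion.mpr ⟨i, mem_univ _, mem_image_of_mem _ hb⟩) fun k hk => by
      obtain ⟨l, hl, rfl⟩ := mem_image.mp (Finsupp.mapDomain_support hk)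
      exact ⟨Nat.zero_le _, hσq i l (hbs l hl)⟩
    rw [heS _ _ ((hσi i).strictMonoOn _), lcomb_single_eq_mapDomain, ← Finsupp.mapDomain_comp] at h4
    rw [lcomb_single_eq_mapDomain]
    exact h4

theorem lcomb_add (w w' : ℕ → ℕ →₀ ℝ) (b : ℕ →₀ ℝ) :
    lcomb (fun k => w k + w' k) b = lcomb w b + lcomb w' b := by
  rw [lcomb_eq_sum _ b subset_rfl, lcomb_eq_sum _ b subset_rfl, lcomb_eq_sum _ b subset_rfl,
    ← sum_add_distrib]
  exact sum_congr rfl fun k _ => smul_add _ _ _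

theorem lcomb_smul (t : ℝ) (w : ℕ → ℕ →₀ ℝ) (b : ℕ →₀ ℝ) :
    lcomb (fun k => t • w k) b = t • lcomb w b := by
  rw [lcomb_eq_sum _ b subset_rfl, lcomb_eq_sum _ b subset_rfl, smul_sum]
  exact sum_congr rfl fun k _ => smul_comm _ _ _

/-- Along some subsequence the norm is dominated by its spreading model. -/
theorem exists_subseq_le_spreadingModel {N : LNorm} (hN : N.Normalized) (hv : ¬ Violates N)
    (V : Ultrafilter ℕ) (hV : (V : Filter ℕ) ≤ atTop) :
    ∃ ℓ : ℕ → ℕ, StrictMono ℓ ∧ ∃ C : ℝ, ∀ b,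
      N (Finsupp.mapDomain ℓ b) ≤ C * N.spreadingModel hN V hV b := by
  by_contra H
  push Not at H
  apply hv
  refine ⟨2, fun M₀ s => ?_⟩
  set e := N.spreadingModel hN V hV with he
  obtain ⟨q, s', Φ, B, -, -, hΦs, hΦd, hΦN, -, hcol⟩ :=
    exists_unboundedPiece hN V hV H 3 le_rfl 1 one_pos (4 * |M₀| + 3) 0 s
  obtain ⟨g, hgs, hgd, hg⟩ := LNorm.exists_generic_triple hN V hV B q (max s s') one_pos
  have hne : ∀ i k m, (Φ k i + Finsupp.single (g i k) 1 : ℕ →₀ ℝ) m ≠ 0 → Φ k i m ≠ 0 ∨ m = g i k := by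
    intro i k m h
    by_contra hcon
    push Not at hcon
    apply h
    rw [Finsupp.add_apply, hcon.1, Finsupp.single_apply, if_neg (Ne.symm hcon.2), add_zero]
  -- generic unit vectors, disjoint from everything else, raise the norms of the vectors to one and do
  -- not affect the test vectors by more than a bounded amount
  refine ⟨range q, fun i k => Φ k i + Finsupp.single (g i k) 1, fun i k hk => ⟨?_, ?_⟩,
    fun i k hk m hm => ?_, fun i k hk j l hl m hm hm' => ?_, fun col => ?_⟩
  · have hk := mem_range.mp hk
    calc (1 : ℝ) = N (Finsupp.single (g i k) 1) := (hN _).symm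
      _ ≤ _ := by
        refine N.mono fun m => ?_
        rw [Finsupp.add_apply, Finsupp.single_apply]
        split_ifs with h
        · subst h
          have : Φ k i (g i k) = 0 := by
            by_contra h0
            have := (hΦs k (Nat.zero_le _) hk i _ h0).2
            have := hgs i k hk
            omega
          rw [this, zero_add]
        · rw [abs_zero]; exact abs_nonneg _
  · have hk := mem_range.mp hk
    have := hΦN k (Nat.zero_le _) hk i
    have h1 := N.add_le (Φ k i) (Finsupp.single (g i k) 1)
    rw [hN] at h1
    linarith
  · have hk := mem_range.mp hk
    rcases hne i k m hm with h | rfl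
    · exact (hΦs k (Nat.zero_le _) hk i m h).1
    · exact (le_max_left _ _).trans (hgs i k hk)
  · have hk := mem_range.mp hk
    have hl := mem_range.mp hl
    rcases hne i k m hm with h | h <;> rcases hne j l m hm' with h' | h'
    · exact hΦd k (Nat.zero_le _) hk l (Nat.zero_le _) hl i j m h h'
    · have := (hΦs k (Nat.zero_le _) hk i m h).2
      have := hgs j l hl
      omega
    · have := (hΦs l (Nat.zero_le _) hl j m h').2
      have := hgs i k hk
      omega
    · exact hgd i k hk j l hl (h.symm.trans h')
  · obtain ⟨b, hb, i, -, hbs, hb1, hbM, hbj⟩ := hcol (fun k => col k) fun k _ _ => (col k).2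
    have hgb : ∀ j, N (lcomb (fun k => Finsupp.single (g j k) 1) b) ≤ 2 := fun j => by
      have := (abs_le.mp (hg j b hb fun k hk => (hbs k hk).1.2)).2
      linarith
    refine ⟨i, b, fun k hk => ⟨mem_range.mpr (hbs k hk).1.2, Fin.ext (hbs k hk).2⟩, fun j hj => ?_⟩
    rw [lcomb_add, lcomb_add]
    have h1 := N.add_le (lcomb (fun k => Φ k j) b) (lcomb (fun k => Finsupp.single (g j k) 1) b)
    have h2 := N.add_le (lcomb (fun k => Φ k i) b + lcomb (fun k => Finsupp.single (g i k) 1) b)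
      (-lcomb (fun k => Finsupp.single (g i k) 1) b)
    rw [N.neg, add_neg_cancel_right] at h2
    have h3 := hbj j hj
    have h4 := hgb j
    have h5 := hgb i
    have h6 := N.nonneg (lcomb (fun k => Φ k j) b + lcomb (fun k => Finsupp.single (g j k) 1) b)
    nlinarith [le_abs_self M₀, abs_nonneg M₀]

/-- A finite piece of the construction for a norm which is not bounded below, on any finite family
of subsequences, by the spreading norm `e`: `3 + t` sequences of distinct positions such that for
any colouring with `t` colours some test vector, supported in one of the colours `i`, is large on
the sequence with number `3 + i` and small on the preceding ones. -/
def VanishingPiece (N e : LNorm) (Z : Set ℕ) (t : ℕ) (θ : ℝ) (p s q s' : ℕ) (D : ℕ → ℕ → ℕ)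
    (B : Finset (ℕ →₀ ℝ)) : Prop :=
  (∀ k, p ≤ k → k < q → ∀ ρ < 3 + t, D k ρ ∈ Z ∧ s ≤ D k ρ ∧ D k ρ < s') ∧
  (∀ k, p ≤ k → k < q → ∀ ρ < 3 + t, ∀ l, p ≤ l → l < q → ∀ π < 3 + t,
    D k ρ = D l π → k = l ∧ ρ = π) ∧
  (∀ b ∈ B, b ≠ 0 ∧ ∀ k ∈ b.support, p ≤ k ∧ k < q) ∧
  ∀ col : ℕ → ℕ, (∀ k, p ≤ k → k < q → col k < t) → ∃ b ∈ B, ∃ i < t,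
    (∀ k ∈ b.support, col k = i) ∧
    (∀ ρ < 3 + i, N (Finsupp.mapDomain (fun k => D k ρ) b) ≤ θ ^ (i + 1) * e b) ∧
    e b / 2 ≤ N (Finsupp.mapDomain (fun k => D k (3 + i)) b) ∧
    ∀ ρ < 3 + t, 3 + i < ρ → N (Finsupp.mapDomain (fun k => D k ρ) b) ≤ 2 * e b

theorem VanishingPiece.congr {N e : LNorm} {Z : Set ℕ} {t : ℕ} {θ : ℝ} {p s q s' : ℕ}
    {D D' : ℕ → ℕ → ℕ} {B : Finset (ℕ →₀ ℝ)} (h : VanishingPiece N e Z t θ p s q s' D B)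
    (hD : ∀ k, p ≤ k → k < q → D k = D' k) : VanishingPiece N e Z t θ p s q s' D' B := by
  obtain ⟨h1, h2, h3, h4⟩ := h
  refine ⟨fun k a b => hD k a b ▸ h1 k a b, fun k a b ρ hρ l c d => ?_, h3, fun col hcol => ?_⟩
  · rw [← hD k a b, ← hD l c d]; exact h2 k a b ρ hρ l c d
  · obtain ⟨b, hb, i, hi, hs, hlow, hhi, hup⟩ := h4 col hcol
    have hc : ∀ ρ, Finsupp.mapDomain (fun k => D' k ρ) b = Finsupp.mapDomain (fun k => D k ρ) b :=
      fun ρ => Finsupp.mapDomain_congr fun k hk => by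
        rw [hD k ((h3 b hb).2 k hk).1 ((h3 b hb).2 k hk).2]
    exact ⟨b, hb, i, hi, hs, fun ρ hρ => by rw [hc]; exact hlow ρ hρ, by rw [hc]; exact hhi,
      fun ρ hρ h => by rw [hc]; exact hup ρ hρ h⟩

/-- Induction on the number `t` of colours, as for `exists_unboundedPiece`. The first three sequences
are arbitrary; the new sequence is generic for all test vectors, so that it is large on them, while
on a transversal in the last colour all the old sequences are small for some test vector. -/
theorem exists_vanishingPiece {N : LNorm} (hN : N.Normalized) (V : Ultrafilter ℕ)
    (hV : (V : Filter ℕ) ≤ atTop) {Z : Set ℕ} (hZ : Z ∈ V)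
    (H : ∀ p : ℕ → ℕ → ℕ, (∀ ρ < 6, StrictMono (p ρ) ∧ ∀ k, p ρ k ∈ Z) → ∀ ε : ℝ, 0 < ε →
      ∃ b ≠ 0, ∀ ρ < 6, N (Finsupp.mapDomain (p ρ) b) ≤ ε * N.spreadingModel hN V hV b)
    {θ : ℝ} (hθ : 0 < θ) (t : ℕ) (ht : t ≤ 3) :
    ∀ p s : ℕ, ∃ q s' D B, p < q ∧ s ≤ s' ∧
      VanishingPiece N (N.spreadingModel hN V hV) Z t θ p s q s' D B := by
  classical
  set e := N.spreadingModel hN V hV with he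
  have heN : e.Normalized := LNorm.spreadingModel_normalized hN V hV
  have heS : e.Spread := LNorm.spreadingModel_spread hN V hV
  induction t with
  | zero =>
    intro p s
    obtain ⟨φ, h1, h2, -⟩ := LNorm.exists_generic hN V hZ hV ∅ 0 3 s one_pos
    refine ⟨p + 1, max s (φ 2 + 1), fun _ => φ, ∅, by omega, le_max_left _ _,
      fun k _ _ ρ hρ => ⟨(h2 ρ ⟨Nat.zero_le _, hρ⟩).1, (h2 ρ ⟨Nat.zero_le _, hρ⟩).2, ?_⟩,
      fun k _ _ ρ hρ l _ _ π hπ h => ⟨by omega, h1.injOn ⟨Nat.zero_le _, hρ⟩ ⟨Nat.zero_le _, hπ⟩ h⟩,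
      by simp, fun col hcol => absurd (hcol p le_rfl (by omega)) (Nat.not_lt_zero _)⟩
    have := h1.monotoneOn (a := ρ) (b := 2) ⟨Nat.zero_le _, hρ⟩ ⟨Nat.zero_le _, by omega⟩ (by omega)
    exact lt_of_le_of_lt this ((Nat.lt_succ_self _).trans_le (le_max_right _ _))
  | succ t ih =>
    intro p s
    have ih := ih (by omega)
    obtain ⟨P, S, D, hP0, hS0, hP, hS, hQ⟩ := exists_concat
      (fun _ p s q s' D => ∃ B, VanishingPiece N e Z t θ p s q s' D B)
      (by
        rintro j p s q s' D D' hD ⟨B, h⟩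
        exact ⟨B, h.congr hD⟩)
      (fun _ p s => by
        obtain ⟨q, s', D, B, h1, h2, h3⟩ := ih p s
        exact ⟨q, s', D, h1, h2, B, h3⟩) p s
    choose B hpc using hQ
    have hpiece : ∀ J k, p ≤ k → k < P (J + 1) → ∃ j ≤ J, P j ≤ k ∧ k < P (j + 1) :=
      fun J k h1 h2 => exists_mem_piece J (hP0.le.trans h1) h2
    have hτmono : ∀ τ : ℕ → ℕ, (∀ j, P j ≤ τ j ∧ τ j < P (j + 1)) → StrictMono τ := fun τ hτ =>
      strictMono_nat_of_lt_succ fun j => (hτ j).2.trans_le (hτ (j + 1)).1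
    obtain ⟨J, B₀, hB₀, htr⟩ := exists_finite_transversal_tests hP
      (fun b => b ≠ 0 ∧ ∀ ρ < 3 + t, N (Finsupp.mapDomain (fun k => D k ρ) b) ≤ θ ^ (t + 1) * e b) (by
        intro τ hτ
        obtain ⟨b, hb0, hb⟩ := H (fun ρ j => D (τ j) (if ρ < 3 + t then ρ else 0)) (by
          intro ρ _
          have hρ : (if ρ < 3 + t then ρ else 0) < 3 + t := by split_ifs <;> omega
          refine ⟨strictMono_nat_of_lt_succ fun j => ?_, fun j =>
            ((hpc j).1 _ (hτ j).1 (hτ j).2 _ hρ).1⟩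
          exact ((hpc j).1 _ (hτ j).1 (hτ j).2 _ hρ).2.2.trans_le
            ((hpc (j + 1)).1 _ (hτ (j + 1)).1 (hτ (j + 1)).2 _ hρ).2.1) (θ ^ (t + 1)) (by positivity)
        have hinj := Finsupp.mapDomain_injective (M := ℝ) (hτmono τ hτ).injective
        refine ⟨Finsupp.mapDomain τ b, ⟨fun h0 => hb0 (hinj (h0.trans Finsupp.mapDomain_zero.symm)),
          fun ρ hρ => ?_⟩, fun k hk => ?_⟩
        · have := hb ρ (by omega)
          simp only [if_pos hρ] at this
          rw [heS _ _ ((hτmono τ hτ).strictMonoOn _), ← Finsupp.mapDomain_comp]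
          exact this
        · obtain ⟨j, _, hj⟩ := mem_image.mp (Finsupp.mapDomain_support hk)
          exact ⟨j, hj⟩)
    set B' := (B₀.filter fun b => ∀ k ∈ b.support, p ≤ k ∧ k < P (J + 1)) ∪
      (range (J + 1)).biUnion B with hB'
    have hPle : ∀ j ≤ J, ∀ k, P j ≤ k → k < P (j + 1) → p ≤ k ∧ k < P (J + 1) := by
      intro j hj k h1 h2
      refine ⟨?_, h2.trans_le (hP.monotone (by omega))⟩
      rw [← hP0]; exact (hP.monotone (Nat.zero_le j)).trans h1
    have hB's : ∀ b ∈ B', b ≠ 0 ∧ ∀ k ∈ b.support, p ≤ k ∧ k < P (J + 1) := by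
      intro b hb
      rcases mem_union.mp hb with hb | hb
      · obtain ⟨h1, h2⟩ := mem_filter.mp hb
        exact ⟨(hB₀ b h1).1, h2⟩
      · obtain ⟨j, hj, hb⟩ := mem_biUnion.mp hb
        have hj := mem_range.mp hj
        exact ⟨((hpc j).2.2.1 b hb).1, fun k hk => hPle j (by omega) k
          (((hpc j).2.2.1 b hb).2 k hk).1 (((hpc j).2.2.1 b hb).2 k hk).2⟩
    obtain ⟨ε, hε, hεb⟩ := exists_eps_of_normalized heN B'
    obtain ⟨φ, hφ1, hφ2, hφ3⟩ := LNorm.exists_generic hN V hZ hV B' p (P (J + 1)) (S (J + 1)) hε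
    obtain ⟨m, hm⟩ := ((Ico p (P (J + 1))).image φ).exists_nat_subset_range
    have hφ4 : ∀ b ∈ B', e b / 2 ≤ N (Finsupp.mapDomain φ b) ∧
        N (Finsupp.mapDomain φ b) ≤ 2 * e b := by
      intro b hb
      have h1 := abs_le.mp (hφ3 b hb (hB's b hb).2)
      have h2 := hεb b hb (hB's b hb).1
      have h3 := e.nonneg b
      rw [lcomb_single_eq_mapDomain] at h1
      constructor <;> linarith
    set D' : ℕ → ℕ → ℕ := fun k ρ => if ρ = 3 + t then φ k else D k ρ with hD'
    have hD't : (fun k => D' k (3 + t)) = φ := by funext k; simp [hD']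
    have hD'ρ : ∀ ρ < 3 + t, (fun k => D' k ρ) = fun k => D k ρ := fun ρ hρ => by
      funext k; simp only [hD']; rw [if_neg (by omega)]
    have hold : ∀ k, p ≤ k → k < P (J + 1) → ∀ ρ < 3 + t,
        D k ρ ∈ Z ∧ s ≤ D k ρ ∧ D k ρ < S (J + 1) := by
      intro k h1 h2 ρ hρ
      obtain ⟨j, hj, a, b⟩ := hpiece J k h1 h2
      obtain ⟨c1, c2, c3⟩ := (hpc j).1 k a b ρ hρ
      refine ⟨c1, ?_, c3.trans_le (hS (by omega))⟩
      rw [← hS0]; exact (hS (Nat.zero_le j)).trans c2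
    have hSs : s ≤ S (J + 1) := by rw [← hS0]; exact hS (Nat.zero_le _)
    refine ⟨P (J + 1), max (S (J + 1)) m, D', B', ?_, hSs.trans (le_max_left _ _), ?_, ?_, hB's, ?_⟩
    · rw [← hP0]; exact hP (Nat.succ_pos J)
    · intro k h1 h2 ρ hρ
      by_cases hρt : ρ = 3 + t
      · simp only [hD', if_pos hρt]
        refine ⟨(hφ2 k ⟨h1, h2⟩).1, hSs.trans (hφ2 k ⟨h1, h2⟩).2, ?_⟩
        exact lt_of_lt_of_le (mem_range.mp (hm (mem_image_of_mem _ (mem_Ico.mpr ⟨h1, h2⟩))))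
            (le_max_right _ _)
      · simp only [hD', if_neg hρt]
        obtain ⟨c1, c2, c3⟩ := hold k h1 h2 ρ (by omega)
        exact ⟨c1, c2, c3.trans_le (le_max_left _ _)⟩
    · intro k hk1 hk2 ρ hρ l hl1 hl2 π hπ h
      by_cases hρt : ρ = 3 + t <;> by_cases hπt : π = 3 + t
      · simp only [hD', if_pos hρt, if_pos hπt] at h
        exact ⟨hφ1.injOn ⟨hk1, hk2⟩ ⟨hl1, hl2⟩ h, hρt.trans hπt.symm⟩
      · simp only [hD', if_pos hρt, if_neg hπt] at h
        have := (hold l hl1 hl2 π (by omega)).2.2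
        have := (hφ2 k ⟨hk1, hk2⟩).2
        omega
      · simp only [hD', if_neg hρt, if_pos hπt] at h
        have := (hold k hk1 hk2 ρ (by omega)).2.2
        have := (hφ2 l ⟨hl1, hl2⟩).2
        omega
      · simp only [hD', if_neg hρt, if_neg hπt] at h
        obtain ⟨a, ha, ha1, ha2⟩ := hpiece J k hk1 hk2
        obtain ⟨c, hc, hc1, hc2⟩ := hpiece J l hl1 hl2
        have e1 := ((hpc a).1 k ha1 ha2 ρ (by omega)).2
        have e2 := ((hpc c).1 l hc1 hc2 π (by omega)).2
        have hac : a = c := by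
          rcases lt_trichotomy a c with hac | hac | hac
          · have : S (a + 1) ≤ S c := hS hac
            omega
          · exact hac
          · have : S (c + 1) ≤ S a := hS hac
            omega
        subst hac
        exact (hpc a).2.1 k ha1 ha2 ρ (by omega) l hc1 hc2 π (by omega) h
    · intro col hcol
      by_cases hcase : ∃ j ≤ J, ∀ k, P j ≤ k → k < P (j + 1) → col k < t
      · obtain ⟨j, hj, hcj⟩ := hcase
        obtain ⟨b, hb, i, hi, hbs, hlow, hhi, hup⟩ := (hpc j).2.2.2 col hcj
        have hbB : b ∈ B' := mem_union_right _ (mem_biUnion.mpr ⟨j, mem_range.mpr (by omega), hb⟩)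
        refine ⟨b, hbB, i, by omega, hbs, fun ρ hρ => ?_, ?_, fun ρ hρ hρi => ?_⟩
        · rw [hD'ρ ρ (by omega)]; exact hlow ρ hρ
        · rw [hD'ρ (3 + i) (by omega)]; exact hhi
        · by_cases hρt : ρ = 3 + t
          · rw [hρt, hD't]; exact (hφ4 b hbB).2
          · rw [hD'ρ ρ (by omega)]; exact hup ρ (by omega) hρi
      · push Not at hcase
        have hex : ∀ j, ∃ k, (P j ≤ k ∧ k < P (j + 1)) ∧ (j ≤ J → col k = t) := by
          intro j
          by_cases hj : j ≤ J
          · obtain ⟨k, h1, h2, h3⟩ := hcase j hj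
            have h4 := hcol k (hPle j hj k h1 h2).1 (hPle j hj k h1 h2).2
            exact ⟨k, ⟨h1, h2⟩, fun _ => by omega⟩
          · exact ⟨P j, ⟨le_rfl, hP (Nat.lt_succ_self j)⟩, fun h => absurd h hj⟩
        choose τ hτ hτc using hex
        obtain ⟨b, hb, hbs⟩ := htr τ hτ
        obtain ⟨hb0, hb1⟩ := hB₀ b hb
        have hbB : b ∈ B' := by
          refine mem_union_left _ (mem_filter.mpr ⟨hb, fun k hk => ?_⟩)
          obtain ⟨j, hj, rfl⟩ := hbs k hk
          exact hPle j hj.le _ (hτ j).1 (hτ j).2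
        refine ⟨b, hbB, t, Nat.lt_succ_self t, fun k hk => ?_, fun ρ hρ => ?_, ?_,
          fun ρ hρ hρt => by omega⟩
        · obtain ⟨j, hj, rfl⟩ := hbs k hk
          exact hτc j hj.le
        · rw [hD'ρ ρ hρ]; exact hb1 ρ hρ
        · rw [hD't]; exact (hφ4 b hbB).1

/-- Six subsequences suffice to bound the spreading model from above. -/
theorem exists_six_subseq_ge_spreadingModel {N : LNorm} (hN : N.Normalized) (hv : ¬ Violates N)
    (V : Ultrafilter ℕ) (hV : (V : Filter ℕ) ≤ atTop) {Z : Set ℕ} (hZ : Z ∈ V) :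
    ∃ p : ℕ → ℕ → ℕ, (∀ ρ < 6, StrictMono (p ρ) ∧ ∀ k, p ρ k ∈ Z) ∧ ∃ ε : ℝ, 0 < ε ∧
      ∀ b ≠ 0, ∃ ρ < 6, ε * N.spreadingModel hN V hV b < N (Finsupp.mapDomain (p ρ) b) := by
  by_contra H
  push Not at H
  apply hv
  refine ⟨2, fun M₀ s => ?_⟩
  set e := N.spreadingModel hN V hV with he
  have heN : e.Normalized := LNorm.spreadingModel_normalized hN V hV
  set θ : ℝ := (8 * |M₀| + 8)⁻¹ with hθ
  have hM0 := abs_nonneg M₀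
  have hθ0 : 0 < θ := by positivity
  have hθ1 : θ ≤ 1 := inv_le_one_of_one_le₀ (by linarith)
  obtain ⟨q, s', D, B, -, -, hDs, hDd, hB, hcol⟩ := exists_vanishingPiece hN V hV hZ H hθ0 3 le_rfl 0 s
  have hne : ∀ (i : Fin 3) k m, (Finsupp.single (D k i) 1 +
      θ ^ (i : ℕ) • Finsupp.single (D k (3 + i)) (1 : ℝ) : ℕ →₀ ℝ) m ≠ 0 →
      ∃ ρ < 3 + 3, m = D k ρ ∧ (ρ = i ∨ ρ = 3 + i) := by
    intro i k m h
    by_contra hcon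
    push Not at hcon
    have h1 : m ≠ D k i := fun h => (hcon i (by omega) h).1 rfl
    have h2 : m ≠ D k (3 + i) := fun h => (hcon (3 + i) (by omega) h).2 rfl
    apply h
    simp [h1.symm, h2.symm]
  -- the sequence with number `3 + i`, with weight `θ ^ i`, is added to the `i`-th sequence; on test
  -- vectors of colour `i` this summand dominates, since `θ ^ (i + 1)` is much smaller than `θ ^ i`
  refine ⟨range q, fun i k => Finsupp.single (D k i) 1 +
      θ ^ (i : ℕ) • Finsupp.single (D k (3 + i)) (1 : ℝ), fun i k hk => ⟨?_, ?_⟩,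
    fun i k hk m hm => ?_, fun i k hk j l hl m hm hm' => ?_, fun col => ?_⟩
  · calc (1 : ℝ) = N (Finsupp.single (D k i) 1) := (hN _).symm
      _ ≤ _ := by
        refine N.mono fun m => ?_
        rw [Finsupp.add_apply, Finsupp.smul_apply, Finsupp.single_apply, Finsupp.single_apply,
          smul_eq_mul]
        have : 0 ≤ θ ^ (i : ℕ) := by positivity
        refine abs_le_abs_of_nonneg (by split_ifs <;> norm_num) (le_add_of_nonneg_right ?_)
        split_ifs <;> simp [this]
  · have h1 := N.add_le (Finsupp.single (D k i) 1)
      (θ ^ (i : ℕ) • Finsupp.single (D k (3 + i)) (1 : ℝ))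
    rw [N.smul, hN, hN, abs_of_nonneg (by positivity)] at h1
    have : θ ^ (i : ℕ) ≤ 1 := pow_le_one₀ hθ0.le hθ1
    linarith
  · obtain ⟨ρ, hρ, rfl, -⟩ := hne i k m hm
    exact (hDs k (Nat.zero_le _) (mem_range.mp hk) ρ hρ).2.1
  · obtain ⟨ρ, hρ, rfl, h1⟩ := hne i k m hm
    obtain ⟨π, hπ, h, h2⟩ := hne j l _ hm'
    obtain ⟨h3, h4⟩ := hDd k (Nat.zero_le _) (mem_range.mp hk) ρ hρ l (Nat.zero_le _)
      (mem_range.mp hl) π hπ h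
    have hi := i.2
    have hj := j.2
    exact ⟨Fin.ext (by omega), h3⟩
  · obtain ⟨b, hb, i, hi, hbs, hlow, hhi, hup⟩ := hcol (fun k => col k) fun k _ _ => (col k).2
    have hb0 := heN.pos (hB b hb).1
    refine ⟨⟨i, hi⟩, b, fun k hk => ⟨mem_range.mpr ((hB b hb).2 k hk).2, Fin.ext (hbs k hk)⟩,
      fun j hj => ?_⟩
    have hsplit : ∀ j : ℕ, lcomb (fun k => Finsupp.single (D k j) 1 +
        θ ^ j • Finsupp.single (D k (3 + j)) (1 : ℝ)) b =
        Finsupp.mapDomain (fun k => D k j) b + θ ^ j • Finsupp.mapDomain (fun k => D k (3 + j)) b := by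
      intro j
      rw [lcomb_add, lcomb_smul, lcomb_single_eq_mapDomain, lcomb_single_eq_mapDomain]
    have hji : (j : ℕ) ≠ i := fun h => hj (Fin.ext h)
    have hj3 := j.2
    have hθi : 0 < θ ^ i := by positivity
    have hup' : N (Finsupp.mapDomain (fun k => D k j) b +
        θ ^ (j : ℕ) • Finsupp.mapDomain (fun k => D k (3 + j)) b) ≤ 3 * (θ ^ (i + 1) * e b) := by
      refine (N.add_le _ _).trans ?_
      rw [N.smul, abs_of_nonneg (by positivity)]
      have h1 := hlow j (by omega)
      rcases lt_or_gt_of_ne hji with h | h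
      · have h2 := hlow (3 + j) (by omega)
        have h3 : θ ^ (j : ℕ) ≤ 1 := pow_le_one₀ hθ0.le hθ1
        have h4 := mul_le_of_le_one_left (N.nonneg (Finsupp.mapDomain (fun k => D k (3 + j)) b)) h3
        have h5 : 0 ≤ θ ^ (i + 1) * e b := by positivity
        linarith
      · have h2 := hup (3 + j) (by omega) (by omega)
        have h3 : θ ^ (j : ℕ) ≤ θ ^ (i + 1) := pow_le_pow_of_le_one hθ0.le hθ1 h
        have h4 := mul_le_mul h3 h2 (N.nonneg _) (by positivity)
        linarith
    have hlo' : θ ^ i * (e b / 2) - θ ^ (i + 1) * e b ≤ N (Finsupp.mapDomain (fun k => D k i) b +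
        θ ^ i • Finsupp.mapDomain (fun k => D k (3 + i)) b) := by
      have h1 := N.add_le (Finsupp.mapDomain (fun k => D k i) b +
        θ ^ i • Finsupp.mapDomain (fun k => D k (3 + i)) b) (-Finsupp.mapDomain (fun k => D k i) b)
      rw [N.neg, add_neg_cancel_comm, N.smul, abs_of_pos hθi] at h1
      have h2 := hlow i (by omega)
      have h3 := mul_le_mul_of_nonneg_left hhi hθi.le
      linarith
    rw [hsplit j, hsplit i]
    refine lt_of_lt_of_le ?_ hlo'
    have h1 : M₀ * N (Finsupp.mapDomain (fun k => D k j) b +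
        θ ^ (j : ℕ) • Finsupp.mapDomain (fun k => D k (3 + j)) b) ≤
        |M₀| * (3 * (θ ^ (i + 1) * e b)) :=
      mul_le_mul (le_abs_self _) hup' (N.nonneg _) hM0
    refine h1.trans_lt ?_
    have h2 : θ * (8 * |M₀| + 8) = 1 := inv_mul_cancel₀ (by positivity)
    rw [pow_succ]
    have h3 : |M₀| * (3 * (θ ^ i * θ * e b)) = (θ ^ i * e b) * (3 * |M₀| * θ) := by ring
    have h4 : θ ^ i * (e b / 2) - θ ^ i * θ * e b = (θ ^ i * e b) * (1 / 2 - θ) := by ring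
    rw [h3, h4]
    refine mul_lt_mul_of_pos_left ?_ (mul_pos hθi hb0)
    nlinarith

/-- A normalized lattice norm without incomparable families has a block sequence, of vectors bounded
in `ℓ₁`, whose norm is equivalent to a spreading one. -/
theorem exists_spread_embBy {N : LNorm} (hN : N.Normalized) (hv : ¬ Violates N) :
    ∃ e z c C, e.Spread ∧ e.Normalized ∧ EmbBy N e z c C ∧
      ∀ k, ∑ m ∈ (z k).support, |z k m| ≤ 6 := by
  classical
  obtain ⟨e₀, ⟨V, hV, rfl⟩, hmin⟩ := exists_minimal_of_not_violates hv
    (fun e => ∃ V : Ultrafilter ℕ, ∃ hV : (V : Filter ℕ) ≤ atTop, e = N.spreadingModel hN V hV)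
    (by
      rintro e ⟨V, hV, rfl⟩
      exact ⟨LNorm.spreadingModel_spread hN V hV, LNorm.spreadingModel_normalized hN V hV, 3,
        LNorm.repT_spreadingModel hN V hV⟩)
    ⟨_, hyperfilter ℕ, Nat.hyperfilter_le_atTop, rfl⟩
  obtain ⟨ℓ, hℓ, C, hC⟩ := exists_subseq_le_spreadingModel hN hv V hV
  set V' : Ultrafilter ℕ := (hyperfilter ℕ).map ℓ with hV'
  have hV'T : (V' : Filter ℕ) ≤ atTop :=
    (Filter.map_mono Nat.hyperfilter_le_atTop).trans hℓ.tendsto_atTop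
  have hZ : Set.range ℓ ∈ V' := Ultrafilter.mem_map.mpr (Filter.univ_mem' fun k => ⟨k, rfl⟩)
  set e := N.spreadingModel hN V' hV'T with he
  have heS : e.Spread := LNorm.spreadingModel_spread hN V' hV'T
  have heN : e.Normalized := LNorm.spreadingModel_normalized hN V' hV'T
  have heS₀ := LNorm.spreadingModel_spread hN V hV
  -- sequences in the range of `ℓ`
  have hC' : ∀ (φ : ℕ → ℕ) (b : ℕ →₀ ℝ), StrictMonoOn φ b.support →
      (∀ k ∈ b.support, φ k ∈ Set.range ℓ) →
      N (Finsupp.mapDomain φ b) ≤ C * N.spreadingModel hN V hV b := by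
    intro φ b hφ hr
    choose! χ hχ using hr
    have h1 : Finsupp.mapDomain φ b = Finsupp.mapDomain ℓ (Finsupp.mapDomain χ b) := by
      rw [← Finsupp.mapDomain_comp]
      exact Finsupp.mapDomain_congr fun k hk => (hχ k hk).symm
    rw [h1, ← heS₀ χ b fun k hk l hl hkl => ?_]
    · exact hC _
    · have := hφ hk hl hkl
      rw [← hχ k hk, ← hχ l hl] at this
      exact hℓ.lt_iff_lt.mp this
  -- the new spreading model is dominated by the minimal one, so the two are equivalent
  have hle : ∀ b, e b ≤ C * N.spreadingModel hN V hV b := by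
    intro b
    obtain ⟨m, hm⟩ := b.support.exists_nat_subset_range
    have hm' : ∀ k ∈ b.support, k ∈ Set.Ico 0 m := fun k hk => ⟨Nat.zero_le _, mem_range.mp (hm hk)⟩
    refine le_of_forall_pos_le_add fun ε hε => ?_
    obtain ⟨φ, h1, h2, h3⟩ := LNorm.exists_generic hN V' hZ hV'T {b} 0 m 0 hε
    have h4 := (abs_le.mp (h3 b (mem_singleton_self b) hm')).1
    rw [lcomb_single_eq_mapDomain] at h4
    have h5 := hC' φ b (h1.mono hm') fun k hk => (h2 k (hm' k hk)).1
    linarith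
  obtain ⟨C₁, hC₁⟩ := hmin e ⟨V', hV'T, rfl⟩ ⟨C, hle⟩
  obtain ⟨p, hp, ε, hε, hlow⟩ := exists_six_subseq_ge_spreadingModel hN hv V' hV'T hZ
  -- thinning out makes the six positions with index `k` precede those with index `k + 1`
  set nxt : ℕ → ℕ := fun k => (∑ ρ ∈ range 6, p ρ k) + 1 with hnxt
  set κ : ℕ → ℕ := fun k => Nat.rec 0 (fun _ x => nxt x) k with hκ
  have hκ1 : ∀ k, κ (k + 1) = (∑ ρ ∈ range 6, p ρ (κ k)) + 1 := fun k => rfl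
  have hpκ : ∀ k, ∀ ρ < 6, ∀ π < 6, p ρ (κ k) < p π (κ (k + 1)) := by
    intro k ρ hρ π hπ
    have h1 : p ρ (κ k) ≤ ∑ ρ ∈ range 6, p ρ (κ k) :=
      single_le_sum (f := fun ρ => p ρ (κ k)) (fun _ _ => Nat.zero_le _) (mem_range.mpr hρ)
    have h2 := (hp π hπ).1.id_le (κ (k + 1))
    simp only [id] at h2
    rw [hκ1] at h2 ⊢
    omega
  have hκm : StrictMono κ := strictMono_nat_of_lt_succ fun k => by
    have h1 := (hp 0 (by norm_num)).1.id_le (κ k)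
    have h2 : p 0 (κ k) ≤ ∑ ρ ∈ range 6, p ρ (κ k) :=
      single_le_sum (f := fun ρ => p ρ (κ k)) (fun _ _ => Nat.zero_le _) (mem_range.mpr (by norm_num))
    simp only [id] at h1
    rw [hκ1]
    omega
  have hpκ' : ∀ k l, k < l → ∀ ρ < 6, ∀ π < 6, p ρ (κ k) < p π (κ l) := by
    intro k l hkl ρ hρ π hπ
    exact (hpκ k ρ hρ π hπ).trans_le ((hp π hπ).1.monotone (hκm.monotone hkl))
  -- each of the six subsequences is dominated by the spreading model, and together they dominate it
  set z : ℕ → ℕ →₀ ℝ := fun k => ∑ ρ ∈ range 6, Finsupp.single (p ρ (κ k)) 1 with hz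
  have hzne : ∀ k m, z k m ≠ 0 → ∃ ρ < 6, m = p ρ (κ k) := by
    intro k m h
    simp only [hz, Finsupp.finsetSum_apply] at h
    obtain ⟨ρ, hρ, h⟩ := exists_ne_zero_of_sum_ne_zero h
    refine ⟨ρ, mem_range.mp hρ, ?_⟩
    by_contra hne
    exact h (Finsupp.single_eq_of_ne hne)
  have hzblock : IsBlock z := by
    intro k l hkl m n hm hn
    obtain ⟨ρ, hρ, rfl⟩ := hzne k m hm
    obtain ⟨π, hπ, rfl⟩ := hzne l n hn
    exact hpκ' k l hkl ρ hρ π hπ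
  have hz0 : ∀ k m, 0 ≤ z k m := fun k m => by
    simp only [hz, Finsupp.finsetSum_apply]
    refine sum_nonneg fun ρ _ => ?_
    rw [Finsupp.single_apply]; split_ifs <;> norm_num
  have hz1 : ∀ k, ∀ ρ < 6, 1 ≤ z k (p ρ (κ k)) := fun k ρ hρ => by
    simp only [hz, Finsupp.finsetSum_apply]
    refine le_trans (by simp) (single_le_sum
      (f := fun π => (Finsupp.single (p π (κ k)) (1 : ℝ)) (p ρ (κ k))) (fun π _ => ?_)
      (mem_range.mpr hρ))
    rw [Finsupp.single_apply]; split_ifs <;> norm_num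
  have hzl : ∀ b, lcomb z b = ∑ ρ ∈ range 6, Finsupp.mapDomain (fun k => p ρ (κ k)) b := by
    intro b
    simp only [hz, ← lcomb_single_eq_mapDomain, lcomb_eq_sum _ b subset_rfl]
    rw [sum_comm]
    exact sum_congr rfl fun k _ => smul_sum
  refine ⟨e, z, ε, 6 * (C * C₁), heS, heN, ⟨hzblock, hε, fun b => ?_, fun b => ?_⟩, fun k => ?_⟩
  · by_cases hb0 : b = 0
    · subst hb0; simp [LNorm.zero]
    · have hinj := Finsupp.mapDomain_injective (M := ℝ) hκm.injective
      obtain ⟨ρ, hρ, h⟩ := hlow (Finsupp.mapDomain κ b) fun h0 =>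
        hb0 (hinj (h0.trans Finsupp.mapDomain_zero.symm))
      rw [← he, heS _ _ (hκm.strictMonoOn _), ← Finsupp.mapDomain_comp] at h
      refine h.le.trans (N.mono fun m => ?_)
      have hinj' : Function.Injective (p ρ ∘ κ) := (hp ρ hρ).1.injective.comp hκm.injective
      by_cases hm : ∃ k, (p ρ ∘ κ) k = m
      · obtain ⟨k, rfl⟩ := hm
        rw [Finsupp.mapDomain_apply hinj',
          hzblock.disjSupp.lcomb_apply (by simp) (k := k) trivial
            (by have := hz1 k ρ hρ; simp only [Function.comp]; linarith), abs_mul]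
        have h2 : 1 ≤ |z k ((p ρ ∘ κ) k)| := (hz1 k ρ hρ).trans (le_abs_self _)
        exact le_mul_of_one_le_right (abs_nonneg _) h2
      · rw [Finsupp.mapDomain_of_notMem_range _ _ (by rintro ⟨k, hk⟩; exact hm ⟨k, hk⟩), abs_zero]
        exact abs_nonneg _
  · rw [hzl]
    refine (N.sum_le _ _).trans ?_
    have h1 : ∀ ρ ∈ range 6, N (Finsupp.mapDomain (fun k => p ρ (κ k)) b) ≤ C * C₁ * e b := by
      intro ρ hρ
      have hρ := mem_range.mp hρ
      refine (hC' _ b (((hp ρ hρ).1.comp hκm).strictMonoOn _) fun k _ => (hp ρ hρ).2 _).trans ?_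
      have hC0 : 0 ≤ C := by
        have := (N.nonneg _).trans (hC (Finsupp.single 0 1))
        rwa [LNorm.spreadingModel_normalized hN V hV, mul_one] at this
      rw [mul_assoc]
      exact mul_le_mul_of_nonneg_left (hC₁ b) hC0
    refine (sum_le_sum h1).trans ?_
    simp [mul_assoc]
  · obtain ⟨n, hn⟩ := (z k).support.exists_nat_subset_range
    calc ∑ m ∈ (z k).support, |z k m| = ∑ m ∈ (z k).support, z k m :=
          sum_congr rfl fun m _ => abs_of_nonneg (hz0 k m)
      _ = Finsupp.linearCombination ℝ (fun _ => (1 : ℝ)) (z k) := by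
          simp [Finsupp.linearCombination_apply, Finsupp.sum]
      _ = 6 := by simp [hz]
      _ ≤ 6 := le_rfl

/-! ### Tensor products of finitely supported sequences -/

/-- The norm of `∑ b k • v k` in a spreading norm, where the `v k` are moved to successive
positions, does not depend on these positions. -/
theorem LNorm.Spread.lcomb_mapDomain_eq {e : LNorm} (he : e.Spread) (b : ℕ →₀ ℝ)
    (v : ℕ → ℕ →₀ ℝ) (σ τ : ℕ → ℕ → ℕ)
    (hσ : ∀ k ∈ b.support, ∀ l ∈ b.support, k < l → ∀ m ∈ (v k).support, ∀ n ∈ (v l).support,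
      σ k m < σ l n)
    (hσ' : ∀ k ∈ b.support, StrictMonoOn (σ k) (v k).support)
    (hτ : ∀ k ∈ b.support, ∀ l ∈ b.support, k < l → ∀ m ∈ (v k).support, ∀ n ∈ (v l).support,
      τ k m < τ l n)
    (hτ' : ∀ k ∈ b.support, StrictMonoOn (τ k) (v k).support) :
    e (lcomb (fun k => Finsupp.mapDomain (σ k) (v k)) b) =
      e (lcomb (fun k => Finsupp.mapDomain (τ k) (v k)) b) := by
  classical
  set y : ℕ × ℕ →₀ ℝ := ∑ k ∈ b.support, b k • Finsupp.mapDomain (fun m => (k, m)) (v k) with hy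
  have hmap : ∀ ρ : ℕ → ℕ → ℕ, Finsupp.mapDomain (fun a : ℕ × ℕ => ρ a.1 a.2) y =
      lcomb (fun k => Finsupp.mapDomain (ρ k) (v k)) b := by
    intro ρ
    rw [hy, Finsupp.mapDomain_finsetSum, lcomb_eq_sum _ b subset_rfl]
    refine sum_congr rfl fun k _ => ?_
    rw [Finsupp.mapDomain_smul, ← Finsupp.mapDomain_comp]
    rfl
  have hsupp : ∀ a ∈ y.support, a.1 ∈ b.support ∧ a.2 ∈ (v a.1).support := by
    intro a ha
    rw [hy] at ha
    obtain ⟨k, hk, ha⟩ := mem_biUnion.mp (Finsupp.support_finsetSum ha)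
    obtain ⟨m, hm, rfl⟩ := mem_image.mp (Finsupp.mapDomain_support (Finsupp.support_smul ha))
    exact ⟨hk, hm⟩
  rw [← hmap σ, ← hmap τ]
  have hlt : ∀ ρ : ℕ → ℕ → ℕ, (∀ k ∈ b.support, ∀ l ∈ b.support, k < l →
      ∀ m ∈ (v k).support, ∀ n ∈ (v l).support, ρ k m < ρ l n) →
      (∀ k ∈ b.support, StrictMonoOn (ρ k) (v k).support) → ∀ a ∈ y.support, ∀ c ∈ y.support,
      (ρ a.1 a.2 < ρ c.1 c.2 ↔ a.1 < c.1 ∨ (a.1 = c.1 ∧ a.2 < c.2)) := by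
    intro ρ h h' a ha c hc
    obtain ⟨a1, a2⟩ := hsupp a ha
    obtain ⟨c1, c2⟩ := hsupp c hc
    rcases lt_trichotomy a.1 c.1 with hac | hac | hac
    · simp [hac, h _ a1 _ c1 hac _ a2 _ c2]
    · rw [← hac] at c2 ⊢
      simp [(h' _ a1).lt_iff_lt a2 c2]
    · have := h _ c1 _ a1 hac _ c2 _ a2
      constructor
      · intro h; omega
      · rintro (h | h) <;> omega
  symm
  refine he.mapDomain_eq y _ _ (fun a ha c hc hac => ?_) fun a ha c hc hac => ?_
  · have h1 := hlt σ hσ hσ' a ha c hc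
    have h2 := hlt σ hσ hσ' c hc a ha
    rw [show σ a.1 a.2 = σ c.1 c.2 from hac] at h1 h2
    simp only [lt_irrefl, false_iff, not_or, not_and, not_lt] at h1 h2
    exact Prod.ext (le_antisymm h2.1 h1.1)
      (le_antisymm (h2.2 (le_antisymm h1.1 h2.1)) (h1.2 (le_antisymm h2.1 h1.1)))
  · exact (hlt τ hτ hτ' a ha c hc).mpr ((hlt σ hσ hσ' a ha c hc).mp hac)

/-- The tensor product `b ⊗ x`, with `D` places for each copy of `x`. -/
noncomputable def tens (D : ℕ) (b x : ℕ →₀ ℝ) : ℕ →₀ ℝ :=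
  Finsupp.ofSupportFinite (fun n => b (n / D) * x (n % D)) (by
    refine ((b.support ×ˢ x.support).image fun a => D * a.1 + a.2).finite_toSet.subset fun n hn => ?_
    have hn : b (n / D) * x (n % D) ≠ 0 := hn
    refine mem_coe.mpr (mem_image.mpr ⟨(n / D, n % D), mem_product.mpr
      ⟨Finsupp.mem_support_iff.mpr (left_ne_zero_of_mul hn),
        Finsupp.mem_support_iff.mpr (right_ne_zero_of_mul hn)⟩, Nat.div_add_mod n D⟩))

theorem tens_apply (D : ℕ) (b x : ℕ →₀ ℝ) (n : ℕ) : tens D b x n = b (n / D) * x (n % D) := rfl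

theorem tens_add_left (D : ℕ) (b c x : ℕ →₀ ℝ) : tens D (b + c) x = tens D b x + tens D c x := by
  ext n; simp [tens_apply, add_mul]

theorem tens_smul_left (D : ℕ) (t : ℝ) (b x : ℕ →₀ ℝ) : tens D (t • b) x = t • tens D b x := by
  ext n; simp [tens_apply, mul_assoc]

theorem tens_add_right (D : ℕ) (b x y : ℕ →₀ ℝ) : tens D b (x + y) = tens D b x + tens D b y := by
  ext n; simp [tens_apply, mul_add]

theorem tens_smul_right (D : ℕ) (t : ℝ) (b x : ℕ →₀ ℝ) : tens D b (t • x) = t • tens D b x := by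
  ext n; simp [tens_apply, mul_left_comm]

theorem tens_zero_right (D : ℕ) (b : ℕ →₀ ℝ) : tens D b 0 = 0 := by
  ext n; simp [tens_apply]

theorem tens_assoc (D D' : ℕ) (b x y : ℕ →₀ ℝ) :
    tens D' (tens D b x) y = tens (D' * D) b (tens D' x y) := by
  ext n
  simp only [tens_apply]
  rw [Nat.div_div_eq_div_mul, Nat.mod_mul_right_mod, Nat.mod_mul_right_div_self, mul_assoc]

/-- A length such that `x` is supported in `[0, len x)`. -/
def len (x : ℕ →₀ ℝ) : ℕ := x.support.sup id + 1

theorem lt_len {x : ℕ →₀ ℝ} {m : ℕ} (h : m ∈ x.support) : m < len x :=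
  Nat.lt_succ_of_le (le_sup (f := id) h)

theorem tens_eq_lcomb {D : ℕ} (b : ℕ →₀ ℝ) {x : ℕ →₀ ℝ} (hx : ∀ m ∈ x.support, m < D) :
    tens D b x = lcomb (fun k => Finsupp.mapDomain (fun m => k * D + m) x) b := by
  ext n
  rw [tens_apply, lcomb_apply]
  have hinj : ∀ k, Function.Injective fun m => k * D + m := fun k m n h => Nat.add_left_cancel h
  have hval : ∀ k, Finsupp.mapDomain (fun m => k * D + m) x n =
      if k = n / D then x (n % D) else 0 := by
    intro k
    split_ifs with h
    · have := Finsupp.mapDomain_apply (hinj k) x (n % D)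
      rwa [h, Nat.div_add_mod' n D, ← h] at this
    · by_contra hne
      obtain ⟨m, hm, hmn⟩ := mem_image.mp
        (Finsupp.mapDomain_support (Finsupp.mem_support_iff.mpr hne))
      have hm := hx m hm
      apply h
      rw [← hmn, Nat.mul_comm, Nat.mul_add_div (by omega), Nat.div_eq_of_lt hm, add_zero]
  simp only [hval, mul_ite, mul_zero]
  rw [sum_ite_eq']
  split_ifs with h
  · rfl
  · rw [Finsupp.notMem_support_iff.mp h, zero_mul]

theorem LNorm.tens_le_tens (e : LNorm) (D : ℕ) {b b' x x' : ℕ →₀ ℝ} (hb : ∀ k, |b k| ≤ |b' k|)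
    (hx : ∀ k, |x k| ≤ |x' k|) : e (tens D b x) ≤ e (tens D b' x') :=
  e.mono fun n => by
    rw [tens_apply, tens_apply, abs_mul, abs_mul]
    exact mul_le_mul (hb _) (hx _) (abs_nonneg _) (abs_nonneg _)

theorem LNorm.Spread.tens_mapDomain {e : LNorm} (he : e.Spread) {D D' : ℕ} {b x : ℕ →₀ ℝ}
    {φ ψ : ℕ → ℕ} (hφ : StrictMonoOn φ b.support) (hψ : StrictMonoOn ψ x.support)
    (hx : ∀ m ∈ x.support, m < D) (hx' : ∀ m ∈ x.support, ψ m < D') :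
    e (tens D' (Finsupp.mapDomain φ b) (Finsupp.mapDomain ψ x)) = e (tens D b x) := by
  have hx'' : ∀ m ∈ (Finsupp.mapDomain ψ x).support, m < D' := by
    classical
    intro m hm
    obtain ⟨n, hn, rfl⟩ := mem_image.mp (Finsupp.mapDomain_support hm)
    exact hx' n hn
  rw [tens_eq_lcomb _ hx, tens_eq_lcomb _ hx'', ← lcomb_single_eq_mapDomain φ b, lcomb_lcomb]
  simp only [lcomb, Finsupp.linearCombination_single, one_smul, ← Finsupp.mapDomain_comp]
  symm
  refine he.lcomb_mapDomain_eq b (fun _ => x) (fun k m => k * D + m) (fun k m => φ k * D' + ψ m)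
    ?_ ?_ ?_ ?_
  · intro k _ l _ hkl m hm n hn
    have h1 := hx m hm
    have h2 : (k + 1) * D ≤ l * D := Nat.mul_le_mul_right _ hkl
    rw [add_mul, one_mul] at h2
    omega
  · intro k _ m _ n _ hmn
    exact Nat.add_lt_add_left hmn _
  · intro k hk l hl hkl m hm n hn
    have h1 := hx' m hm
    have h2 : (φ k + 1) * D' ≤ φ l * D' := Nat.mul_le_mul_right _ (hφ hk hl hkl)
    rw [add_mul, one_mul] at h2
    omega
  · intro k _ m hm n hn hmn
    exact Nat.add_lt_add_left (hψ hm hn hmn) _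

theorem LNorm.Spread.tens_eq {e : LNorm} (he : e.Spread) {D D' : ℕ} {b x : ℕ →₀ ℝ}
    (hx : ∀ m ∈ x.support, m < D) (hx' : ∀ m ∈ x.support, m < D') :
    e (tens D' b x) = e (tens D b x) := by
  have := he.tens_mapDomain (b := b) (φ := id) (ψ := id) strictMonoOn_id strictMonoOn_id hx hx'
  rwa [Finsupp.mapDomain_id, Finsupp.mapDomain_id] at this

/-- The norm `b ↦ e (b ⊗ x)`. -/
noncomputable def LNorm.tensor (e : LNorm) (x : ℕ →₀ ℝ) : LNorm where
  toFun b := e (tens (len x) b x)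
  add_le' a b := by rw [tens_add_left]; exact e.add_le _ _
  smul' t a := by rw [tens_smul_left]; exact e.smul _ _
  mono' a b h := e.tens_le_tens _ h fun _ => le_rfl

theorem LNorm.Spread.tensor_eq {e : LNorm} (he : e.Spread) {D : ℕ} {b x : ℕ →₀ ℝ}
    (hx : ∀ m ∈ x.support, m < D) : e.tensor x b = e (tens D b x) :=
  he.tens_eq hx fun _ => lt_len

theorem LNorm.Spread.tensor {e : LNorm} (he : e.Spread) (x : ℕ →₀ ℝ) : (e.tensor x).Spread := by
  intro φ b hφ
  have := he.tens_mapDomain (b := b) (x := x) hφ strictMonoOn_id (fun _ => lt_len) fun _ => lt_len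
  rwa [Finsupp.mapDomain_id] at this

theorem LNorm.Spread.tensor_mapDomain {e : LNorm} (he : e.Spread) {x : ℕ →₀ ℝ} {ψ : ℕ → ℕ}
    (hψ : StrictMonoOn ψ x.support) (b : ℕ →₀ ℝ) :
    e.tensor (Finsupp.mapDomain ψ x) b = e.tensor x b := by
  classical
  have := he.tens_mapDomain (b := b) (x := x) strictMonoOn_id hψ (fun _ => lt_len)
    (D' := len (Finsupp.mapDomain ψ x)) fun m hm => lt_len (by
      rw [Finsupp.mapDomain_support_of_injOn _ hψ.injOn]
      exact mem_image_of_mem _ hm)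
  rwa [Finsupp.mapDomain_id] at this

theorem LNorm.Spread.tensor_tens {e : LNorm} (he : e.Spread) (b x y : ℕ →₀ ℝ) :
    e.tensor (tens (len y) x y) b = e.tensor y (tens (len x) b x) := by
  rw [he.tensor_eq (D := len y * len x) (x := tens (len y) x y), ← tens_assoc]
  · rfl
  · intro m hm
    rw [Finsupp.mem_support_iff, tens_apply] at hm
    have h1 := lt_len (Finsupp.mem_support_iff.mpr (left_ne_zero_of_mul hm))
    exact (Nat.div_lt_iff_lt_mul (Nat.succ_pos _)).mp h1 |>.trans_eq (Nat.mul_comm _ _)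

theorem LNorm.tensor_add_le (e : LNorm) (he : e.Spread) (x y b : ℕ →₀ ℝ) :
    e.tensor (x + y) b ≤ e.tensor x b + e.tensor y b := by
  classical
  set D := max (len x) (len y)
  have hx : ∀ m ∈ x.support, m < D := fun m hm => (lt_len hm).trans_le (le_max_left _ _)
  have hy : ∀ m ∈ y.support, m < D := fun m hm => (lt_len hm).trans_le (le_max_right _ _)
  rw [he.tensor_eq hx, he.tensor_eq hy, he.tensor_eq (D := D) (x := x + y) fun m hm => ?_,
    tens_add_right]
  · exact e.add_le _ _
  · rcases mem_union.mp (Finsupp.support_add hm) with h | h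
    exacts [hx m h, hy m h]

theorem LNorm.tensor_smul (e : LNorm) (he : e.Spread) (t : ℝ) (x b : ℕ →₀ ℝ) :
    e.tensor (t • x) b = |t| * e.tensor x b := by
  rw [he.tensor_eq (D := len x) (x := t • x) fun m hm => lt_len (Finsupp.support_smul hm),
    tens_smul_right, e.smul]
  rfl

theorem LNorm.tensor_zero (e : LNorm) (b : ℕ →₀ ℝ) : e.tensor 0 b = 0 := by
  change e (tens _ b 0) = 0
  rw [tens_zero_right, e.zero]

theorem LNorm.tensor_lcomb_le (e : LNorm) (he : e.Spread) (w : ℕ → ℕ →₀ ℝ) (z b : ℕ →₀ ℝ) :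
    e.tensor (lcomb w z) b ≤ ∑ k ∈ z.support, |z k| * e.tensor (w k) b := by
  classical
  rw [lcomb_eq_sum w z subset_rfl]
  generalize z.support = s
  induction s using Finset.induction_on with
  | empty => simp [e.tensor_zero]
  | insert k s hk ih =>
    rw [sum_insert hk, sum_insert hk, ← e.tensor_smul he]
    exact (e.tensor_add_le he _ _ _).trans (by linarith)

theorem LNorm.Spread.tensor_single {e : LNorm} (he : e.Spread) (m : ℕ) (b : ℕ →₀ ℝ) :
    e.tensor (Finsupp.single m 1) b = e b := by
  have hs : ∀ n ∈ (Finsupp.single m (1 : ℝ)).support, n < m + 1 := fun n hn => by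
    have := Finsupp.support_single_subset hn
    simp only [mem_singleton] at this
    omega
  rw [he.tensor_eq hs, tens_eq_lcomb _ hs]
  simp only [Finsupp.mapDomain_single, lcomb_single_eq_mapDomain]
  refine he _ _ (StrictMono.strictMonoOn (fun k l h => ?_) _)
  have h2 : (k + 1) * (m + 1) ≤ l * (m + 1) := Nat.mul_le_mul_right _ h
  rw [add_mul, one_mul] at h2
  change k * (m + 1) + m < l * (m + 1) + m
  omega

/-- The `ℓ₁` norm. -/
noncomputable def l1 (x : ℕ →₀ ℝ) : ℝ := ∑ m ∈ x.support, |x m|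

theorem LNorm.Spread.tensor_le {e : LNorm} (he : e.Spread) (x b : ℕ →₀ ℝ) :
    e.tensor x b ≤ l1 x * e b := by
  have h := e.tensor_lcomb_le he (fun m => Finsupp.single m 1) x b
  simp only [lcomb_single_eq_mapDomain, he.tensor_single] at h
  rw [l1, sum_mul]
  rwa [show Finsupp.mapDomain (fun k => k) x = x from Finsupp.mapDomain_id] at h

theorem LNorm.Spread.le_tensor {e : LNorm} (he : e.Spread) (x b : ℕ →₀ ℝ) (m : ℕ) :
    |x m| * e b ≤ e.tensor x b := by
  by_cases hm : m ∈ x.support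
  · rw [← he.tensor_single m, ← e.tensor_smul he,
      he.tensor_eq (D := len x) (x := x m • Finsupp.single m 1)]
    · refine e.tens_le_tens _ (fun _ => le_rfl) fun k => ?_
      rw [Finsupp.smul_single, smul_eq_mul, mul_one, Finsupp.single_apply]
      split_ifs with h
      · rw [h]
      · rw [abs_zero]; exact abs_nonneg _
    · intro n hn
      have := Finsupp.support_single_subset (Finsupp.support_smul hn)
      rw [mem_singleton.mp this]
      exact lt_len hm
  · rw [Finsupp.notMem_support_iff.mp hm, abs_zero, zero_mul]
    exact LNorm.nonneg _ _

theorem LNorm.Spread.tensor_single_left {e : LNorm} (he : e.Spread) (k : ℕ) (x : ℕ →₀ ℝ) :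
    e.tensor x (Finsupp.single k 1) = e x := by
  rw [he.tensor_eq fun _ => lt_len, tens_eq_lcomb _ fun _ => lt_len, lcomb,
    Finsupp.linearCombination_single, one_smul]
  exact he _ _ (StrictMono.strictMonoOn (fun m n h => Nat.add_lt_add_left h _) _)

/-- The norm `b ↦ e (b ⊗ x) / e x`. -/
noncomputable def LNorm.nu (e : LNorm) (x : ℕ →₀ ℝ) : LNorm where
  toFun b := e.tensor x b / e x
  add_le' a b := by
    rw [← add_div]
    exact div_le_div_of_nonneg_right (LNorm.add_le _ _ _) (e.nonneg _)
  smul' t a := by rw [LNorm.smul, mul_div_assoc]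
  mono' a b h := div_le_div_of_nonneg_right (LNorm.mono _ h) (e.nonneg _)

theorem LNorm.nu_apply (e : LNorm) (x b : ℕ →₀ ℝ) : e.nu x b = e.tensor x b / e x := rfl

theorem LNorm.Spread.nu {e : LNorm} (he : e.Spread) (x : ℕ →₀ ℝ) : (e.nu x).Spread :=
  fun φ b hφ => by rw [e.nu_apply, e.nu_apply, he.tensor x φ b hφ]

theorem LNorm.Spread.nu_normalized {e : LNorm} (he : e.Spread) (hn : e.Normalized) {x : ℕ →₀ ℝ}
    (hx : x ≠ 0) : (e.nu x).Normalized := fun k => by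
  rw [e.nu_apply, he.tensor_single_left, div_self (hn.pos hx).ne']

theorem LNorm.Spread.repT_nu {e : LNorm} (he : e.Spread) (hn : e.Normalized) {x : ℕ →₀ ℝ}
    (hx : x ≠ 0) : RepT e (e.nu x) 1 := by
  classical
  have hx0 := hn.pos hx
  have h : EmbBy e (e.nu x) (fun k => Finsupp.mapDomain (fun m => k * len x + m) x) (e x) (e x) := by
    have heq : ∀ b, e x * e.nu x b =
        e (lcomb (fun k => Finsupp.mapDomain (fun m => k * len x + m) x) b) := fun b => by
      rw [e.nu_apply, mul_div_cancel₀ _ hx0.ne', ← tens_eq_lcomb _ fun _ => lt_len]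
      rfl
    refine ⟨fun k l hkl m n hm hn => ?_, hx0, fun b => (heq b).le, fun b => (heq b).ge⟩
    obtain ⟨m', hm', rfl⟩ := mem_image.mp
      (Finsupp.mapDomain_support (Finsupp.mem_support_iff.mpr hm))
    obtain ⟨n', hn', rfl⟩ := mem_image.mp
      (Finsupp.mapDomain_support (Finsupp.mem_support_iff.mpr hn))
    have h1 := lt_len hm'
    have h2 : (k + 1) * len x ≤ l * len x := Nat.mul_le_mul_right _ hkl
    rw [add_mul, one_mul] at h2
    omega
  have := h.repT (he.nu_normalized hn hx) (he.nu x)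
  rwa [div_self hx0.ne'] at this

/-- A spreading norm without incomparable families is submultiplicative for tensor products, up to
a constant. -/
theorem exists_tensor_le {e : LNorm} (he : e.Spread) (hn : e.Normalized) (hv : ¬ Violates e) :
    ∃ C : ℝ, 1 ≤ C ∧ ∀ b x, e.tensor x b ≤ C * (e b * e x) := by
  by_contra H
  push Not at H
  apply hv
  have key : ∀ R : ℝ, ∃ x b, x ≠ 0 ∧ R * e b < e.nu x b := by
    intro R
    obtain ⟨b, x, h⟩ := H (max R 1) (le_max_right _ _)
    have hx : x ≠ 0 := by
      rintro rfl
      rw [e.zero, e.tensor_zero] at h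
      simp at h
    have hx0 := hn.pos hx
    refine ⟨x, b, hx, ?_⟩
    rw [e.nu_apply, lt_div_iff₀ hx0]
    refine lt_of_le_of_lt ?_ h
    rw [← mul_assoc]
    gcongr
    · exact e.nonneg _
    · exact le_max_left _ _
  have bound : ∀ x, x ≠ 0 → ∀ b, e.nu x b ≤ l1 x / e x * e b := fun x hx b => by
    rw [e.nu_apply, div_mul_eq_mul_div]
    exact div_le_div_of_nonneg_right (he.tensor_le x b) (e.nonneg _)
  refine violates_of_chain (h := e) (A := 1) he hn ?_ (fun g => ∃ x, x ≠ 0 ∧ g = e.nu x) ?_ ?_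
  · have h : EmbBy e e (fun k => Finsupp.single k 1) 1 1 := by
      refine ⟨fun k l hkl m n hm hn => ?_, one_pos, fun b => ?_, fun b => ?_⟩
      · have h1 : m = k := by by_contra h; exact hm (Finsupp.single_eq_of_ne h)
        have h2 : n = l := by by_contra h; exact hn (Finsupp.single_eq_of_ne h)
        omega
      all_goals
        rw [lcomb_single_eq_mapDomain, one_mul,
          show Finsupp.mapDomain (fun k => k) b = b from Finsupp.mapDomain_id]
    simpa using h.repT hn he
  · rintro g ⟨x, hx, rfl⟩
    exact ⟨he.nu x, he.nu_normalized hn hx, he.repT_nu hn hx⟩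
  · intro R hR
    obtain ⟨x₁, b₁, hx₁, h₁⟩ := key R
    refine ⟨_, b₁, ⟨x₁, hx₁, rfl⟩, h₁, fun R hR => ?_⟩
    obtain ⟨x₂, b₂, hx₂, h₂⟩ := key (R * (1 + l1 x₁ / e x₁))
    refine ⟨_, b₂, ⟨x₂, hx₂, rfl⟩, lt_of_le_of_lt ?_ h₂, fun R hR => ?_⟩
    · have := bound x₁ hx₁ b₂
      nlinarith
    obtain ⟨x₃, b₃, hx₃, h₃⟩ := key (R * (1 + l1 x₁ / e x₁ + l1 x₂ / e x₂))
    refine ⟨_, b₃, ⟨x₃, hx₃, rfl⟩, lt_of_le_of_lt ?_ h₃⟩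
    have h4 := bound x₁ hx₁ b₃
    have h5 := bound x₂ hx₂ b₃
    nlinarith

/-! ### Coloured lines in cubes -/

/-- If a cube of side `3 n` is coloured with the three directions, then some line contains `n`
points whose colour is its direction. -/
theorem exists_line_of_colouring {n : ℕ} (hn : 0 < n) (col : (Fin 3 → Fin (3 * n)) → Fin 3) :
    ∃ (i : Fin 3) (a : Fin 3 → Fin (3 * n)),
      n ≤ (univ.filter fun t => col (Function.update a i t) = i).card := by
  classical
  by_contra H
  push Not at H
  have hswap : ∀ i : Fin 3, ∑ a : Fin 3 → Fin (3 * n),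
      (univ.filter fun t => col (Function.update a i t) = i).card =
      ∑ a : Fin 3 → Fin (3 * n), if col a = i then 3 * n else 0 := by
    intro i
    have h1 : ∀ a : Fin 3 → Fin (3 * n), (if col a = i then 3 * n else 0) =
        ∑ _t : Fin (3 * n), if col a = i then 1 else 0 := fun a => by
      split_ifs <;> simp
    simp only [card_filter, h1]
    rw [← Fintype.sum_prod_type', ← Fintype.sum_prod_type']
    refine Fintype.sum_equiv (Function.Involutive.toPerm
      (fun x : (Fin 3 → Fin (3 * n)) × Fin (3 * n) => (Function.update x.1 i x.2, x.1 i)) ?_) _ _ ?_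
    · rintro ⟨a, t⟩
      simp
    · rintro ⟨a, t⟩
      rfl
  have hlow : ∑ i : Fin 3, ∑ a : Fin 3 → Fin (3 * n),
      (univ.filter fun t => col (Function.update a i t) = i).card =
      ∑ _a : Fin 3 → Fin (3 * n), 3 * n := by
    simp only [hswap]
    rw [sum_comm]
    exact sum_congr rfl fun a _ => by simp
  have hlt : ∑ i : Fin 3, ∑ a : Fin 3 → Fin (3 * n),
      (univ.filter fun t => col (Function.update a i t) = i).card <
      ∑ _a : Fin 3 → Fin (3 * n), 3 * n := by
    rw [sum_comm]
    refine sum_lt_sum_of_nonempty ⟨fun _ => ⟨0, by omega⟩, mem_univ _⟩ fun a _ => ?_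
    rw [Fin.sum_univ_three]
    have := H 0 a
    have := H 1 a
    have := H 2 a
    omega
  exact absurd hlow hlt.ne

theorem finFunctionFinEquiv_update_lt {m : ℕ} (a : Fin 3 → Fin m) (i : Fin 3) {t t' : Fin m}
    (h : t < t') : (finFunctionFinEquiv (Function.update a i t) : ℕ) <
      finFunctionFinEquiv (Function.update a i t') := by
  rw [finFunctionFinEquiv_apply, finFunctionFinEquiv_apply]
  have hm : 0 < m := t.pos
  refine sum_lt_sum (fun j _ => Nat.mul_le_mul_right _ ?_) ⟨i, mem_univ _, ?_⟩
  · by_cases hj : j = i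
    · subst hj; simpa using h.le
    · simp [hj]
  · simp only [Function.update_self]
    exact Nat.mul_lt_mul_of_pos_right h (pow_pos hm _)

/-! ### Comparing block sequences with tensor products -/

/-- If a block sequence `w` dominates the spreading norm `g` then so do, for each vector `b`, the
tensor products with all late `w k`: otherwise the vectors `w (κ (a i))`, indexed by the points `a`
of a cube, would be incomparable, as `w (κ (a j))` is constant on lines in direction `i ≠ j`. -/
theorem exists_le_tensor_of_block {e : LNorm} (he : e.Spread) (hv : ¬ Violates e)
    {g : LNorm} (hg : g.Spread) {w : ℕ → ℕ →₀ ℝ} {c A : ℝ} (hw : IsBlock w)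
    (hw1 : ∀ k, 1 ≤ e (w k) ∧ e (w k) ≤ A) (hc : 0 < c) (h : ∀ b, c * g b ≤ e (lcomb w b)) :
    ∃ M : ℝ, ∀ b, ∃ k₀, ∀ k, k₀ ≤ k → g b ≤ M * e.tensor (w k) b := by
  classical
  by_contra H
  push Not at H
  apply hv
  refine ⟨A, fun M s => ?_⟩
  obtain ⟨b, hb⟩ := H ((|M| + 1) / c)
  obtain ⟨κ, hκ, hκb⟩ := Filter.extraction_of_frequently_atTop (Filter.frequently_atTop.mpr hb)
  set n := b.support.card with hn
  have hn0 : 0 < n := by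
    rw [hn, Finset.card_pos, Finset.nonempty_iff_ne_empty, Ne, Finsupp.support_eq_empty]
    rintro rfl
    have := hκb 0
    rw [LNorm.zero, LNorm.zero, mul_zero] at this
    exact lt_irrefl _ this
  have hm0 : 0 < 3 * n := by omega
  obtain ⟨D, hD⟩ := exists_bound_support (3 * n) fun t => w (κ t)
  -- points of the cube are numbered increasingly along lines in each direction; the copies of the
  -- blocks are placed, in blocks of length `D`, in the order of the numbers
  set idx : (Fin 3 → Fin (3 * n)) → ℕ := fun a => finFunctionFinEquiv a with hidx
  set dec : ℕ → Fin 3 → Fin (3 * n) := fun k =>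
    if hk : k < (3 * n) ^ 3 then finFunctionFinEquiv.symm ⟨k, hk⟩ else fun _ => ⟨0, hm0⟩ with hdec
  have hdi : ∀ a, dec (idx a) = a := fun a => by
    simp only [hdec, hidx]
    rw [dif_pos (finFunctionFinEquiv a).2]
    exact finFunctionFinEquiv.symm_apply_apply a
  set pos : Fin 3 → ℕ → ℕ → ℕ := fun i k m => s + (i * (3 * n) ^ 3 + k) * D + m with hpos
  have hposi : ∀ i k, StrictMono (pos i k) := fun i k _ _ h => Nat.add_lt_add_left h _
  have hposlt : ∀ i k l, k < l → ∀ m m', m < D → pos i k m < pos i l m' := by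
    intro i k l hkl m m' hm
    have : (i * (3 * n) ^ 3 + k + 1) * D ≤ (i * (3 * n) ^ 3 + l) * D :=
      Nat.mul_le_mul_right _ (by omega)
    rw [add_mul _ 1, one_mul] at this
    simp only [hpos]
    omega
  have hwD : ∀ (t : Fin (3 * n)) m, m ∈ (w (κ t)).support → m < D := fun t m hm =>
    hD t t.2 m (Finsupp.mem_support_iff.mp hm)
  have hFm : ∀ (i : Fin 3) k m, Finsupp.mapDomain (pos i k) (w (κ (dec k i))) m ≠ 0 →
      ∃ r, r < D ∧ m = pos i k r := by
    intro i k m hm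
    obtain ⟨r, hr, rfl⟩ := mem_image.mp
      (Finsupp.mapDomain_support (Finsupp.mem_support_iff.mpr hm))
    exact ⟨r, hwD _ r hr, rfl⟩
  refine ⟨range ((3 * n) ^ 3), fun i k => Finsupp.mapDomain (pos i k) (w (κ (dec k i))),
    fun i k _ => ?_, fun i k _ m hm => ?_, fun i k hk j l hl m hm hm' => ?_, fun col => ?_⟩
  · rw [he _ _ ((hposi i k).strictMonoOn _)]
    exact hw1 _
  · obtain ⟨r, -, rfl⟩ := hFm i k m hm
    simp only [hpos]; omega
  · obtain ⟨r, hr, rfl⟩ := hFm i k m hm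
    obtain ⟨r', hr', hrr⟩ := hFm j l _ hm'
    have hk := mem_range.mp hk
    have hl := mem_range.mp hl
    have h1 : (i * (3 * n) ^ 3 + k) * D + r = (j * (3 * n) ^ 3 + l) * D + r' := by
      simp only [hpos] at hrr; omega
    have h2 : (i : ℕ) * (3 * n) ^ 3 + k = j * (3 * n) ^ 3 + l := by
      have e1 : ((i * (3 * n) ^ 3 + k) * D + r) / D = i * (3 * n) ^ 3 + k := by
        rw [Nat.mul_comm, Nat.mul_add_div (by omega), Nat.div_eq_of_lt hr, add_zero]
      have e2 : ((j * (3 * n) ^ 3 + l) * D + r') / D = j * (3 * n) ^ 3 + l := by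
        rw [Nat.mul_comm, Nat.mul_add_div (by omega), Nat.div_eq_of_lt hr', add_zero]
      rw [← e1, h1, e2]
    have h3 : (i : ℕ) = j := by
      have e1 : (i * (3 * n) ^ 3 + k) / (3 * n) ^ 3 = i := by
        rw [Nat.mul_comm, Nat.mul_add_div (by omega), Nat.div_eq_of_lt hk, add_zero]
      have e2 : (j * (3 * n) ^ 3 + l) / (3 * n) ^ 3 = j := by
        rw [Nat.mul_comm, Nat.mul_add_div (by omega), Nat.div_eq_of_lt hl, add_zero]
      rw [← e1, h2, e2]
    refine ⟨Fin.ext h3, ?_⟩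
    rw [h3] at h2
    omega
  · obtain ⟨i, a, hT⟩ := exists_line_of_colouring hn0 fun a => col (idx a)
    set T := univ.filter fun t => col (idx (Function.update a i t)) = i with hTd
    obtain ⟨φ, hφ, hφT⟩ := exists_strictMonoOn_maps b.support (T.image Fin.val) (by
      rwa [card_image_of_injective _ Fin.val_injective])
    set tf : ℕ → Fin (3 * n) := fun t => if ht : t < 3 * n then ⟨t, ht⟩ else ⟨0, hm0⟩ with htf
    have hφ' : ∀ k ∈ b.support, tf (φ k) ∈ T ∧ (tf (φ k) : ℕ) = φ k := by
      intro k hk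
      obtain ⟨t, ht, htk⟩ := mem_image.mp (hφT k hk)
      have : tf (φ k) = t := by
        simp only [htf, ← htk, t.2, dite_true]
      rw [this]
      exact ⟨ht, htk⟩
    set line : ℕ → ℕ := fun k => idx (Function.update a i (tf (φ k))) with hline
    have hlt : ∀ k ∈ b.support, ∀ l ∈ b.support, k < l → line k < line l := by
      intro k hk l hl hkl
      refine finFunctionFinEquiv_update_lt a i ?_
      rw [Fin.lt_def, (hφ' k hk).2, (hφ' l hl).2]
      exact hφ hk hl hkl
    have hF : ∀ j : Fin 3, lcomb (fun k => Finsupp.mapDomain (pos j k) (w (κ (dec k j))))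
        (Finsupp.mapDomain line b) = lcomb (fun k => Finsupp.mapDomain (pos j (line k))
          (w (κ (Function.update a i (tf (φ k)) j)))) b := by
      intro j
      rw [← lcomb_single_eq_mapDomain line, lcomb_lcomb]
      refine lcomb_congr fun k _ => ?_
      rw [lcomb, Finsupp.linearCombination_single, one_smul]
      simp only [hline, hdi]
    refine ⟨i, Finsupp.mapDomain line b, fun k hk => ?_, fun j hj => ?_⟩
    · obtain ⟨l, hl, rfl⟩ := mem_image.mp (Finsupp.mapDomain_support hk)
      exact ⟨mem_range.mpr (finFunctionFinEquiv _).2, (mem_filter.mp (hφ' l hl).1).2⟩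
    rw [hF, hF]
    -- on the line the vectors with number `i` are different blocks
    have hi : c * g b ≤ e (lcomb (fun k => Finsupp.mapDomain (pos i (line k))
        (w (κ (Function.update a i (tf (φ k)) i)))) b) := by
      have h1 := h (Finsupp.mapDomain (fun k => κ (φ k)) b)
      have hκφ : StrictMonoOn (fun k => κ (φ k)) b.support := fun k hk l hl hkl =>
        hκ (hφ hk hl hkl)
      rw [hg _ b hκφ, ← lcomb_single_eq_mapDomain, lcomb_lcomb] at h1
      refine h1.trans_eq ?_
      have h2 : lcomb (fun k => lcomb w (Finsupp.single (κ (φ k)) 1)) b =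
          lcomb (fun k => Finsupp.mapDomain (fun m => m)
            (w (κ (Function.update a i (tf (φ k)) i)))) b := by
        refine lcomb_congr fun k hk => ?_
        rw [lcomb, Finsupp.linearCombination_single, one_smul, Function.update_self, (hφ' k hk).2]
        exact Finsupp.mapDomain_id.symm
      rw [h2]
      refine he.lcomb_mapDomain_eq b _ (fun _ m => m) (fun k m => pos i (line k) m) ?_ ?_ ?_ ?_
      · intro k hk l hl hkl m hm m' hm'
        rw [Function.update_self, (hφ' k hk).2] at hm
        rw [Function.update_self, (hφ' l hl).2] at hm'
        exact hw _ _ (hκφ hk hl hkl) m m' (Finsupp.mem_support_iff.mp hm)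
          (Finsupp.mem_support_iff.mp hm')
      · intro k _ m _ m' _ hmm; exact hmm
      · intro k hk l hl hkl m hm m' _
        exact hposlt i _ _ (hlt k hk l hl hkl) m m' (hwD _ m hm)
      · intro k _
        exact (hposi i _).strictMonoOn _
    -- and those with number `j` are copies of the same block
    have hj' : e (lcomb (fun k => Finsupp.mapDomain (pos j (line k))
        (w (κ (Function.update a i (tf (φ k)) j)))) b) = e.tensor (w (κ (a j))) b := by
      simp only [Function.update_of_ne hj]
      rw [he.tensor_eq fun _ => lt_len, tens_eq_lcomb _ fun _ => lt_len]
      refine he.lcomb_mapDomain_eq b (fun _ => w (κ (a j))) (fun k m => pos j (line k) m)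
        (fun k m => k * len (w (κ (a j))) + m) ?_ ?_ ?_ ?_
      · intro k hk l hl hkl m hm m' _
        exact hposlt j _ _ (hlt k hk l hl hkl) m m' (hwD _ m hm)
      · intro k _
        exact (hposi j _).strictMonoOn _
      · intro k _ l _ hkl m hm m' _
        have h1 := lt_len hm
        have h2 : (k + 1) * len (w (κ (a j))) ≤ l * len (w (κ (a j))) := Nat.mul_le_mul_right _ hkl
        rw [add_mul, one_mul] at h2
        omega
      · intro k _
        exact StrictMono.strictMonoOn (fun m n h => Nat.add_lt_add_left h _) _
    rw [hj']
    refine lt_of_lt_of_le ?_ hi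
    have h1 := hκb (a j)
    rw [div_mul_eq_mul_div, div_lt_iff₀ hc] at h1
    have h2 := (e.tensor (w (κ (a j)))).nonneg b
    nlinarith [le_abs_self M]

/-! ### Multiplicativity of minimal spreading norms -/

/-- For a minimal spreading norm `e` without incomparable families there is no sequence of vectors
`y k` such that `e (b ⊗ y k)`, for `k → ∞`, is arbitrarily small compared with `e b`: the norm of a
block sequence of mixtures of the `y k` would be strictly smaller than `e`. -/
theorem not_vanishing_tensor {e : LNorm} (he : e.Spread) (hn : e.Normalized) (hv : ¬ Violates e)
    (hmin : ∀ f : LNorm, f.Spread → f.Normalized → Emb e f → (∃ C : ℝ, ∀ b, f b ≤ C * e b) →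
      ∃ C : ℝ, ∀ b, e b ≤ C * f b)
    (y : ℕ → ℕ →₀ ℝ) (hy : ∀ k, e (y k) = 1) (b : ℕ → ℕ →₀ ℝ)
    (h : ∀ m k : ℕ, m ≤ k → (m + 1) * e.tensor (y k) (b m) < e (b m)) : False := by
  classical
  set off : ℕ → ℕ := fun k => ∑ j ∈ range k, len (y j) with hoff
  set w : ℕ → ℕ →₀ ℝ := fun k => Finsupp.mapDomain (fun m => off k + m) (y k) with hw
  have hmono : ∀ k, StrictMono fun m => off k + m := fun k _ _ h => Nat.add_lt_add_left h _
  have hblock : IsBlock w := by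
    intro k l hkl m n hm hn
    obtain ⟨m', hm', rfl⟩ := mem_image.mp
      (Finsupp.mapDomain_support (Finsupp.mem_support_iff.mpr hm))
    obtain ⟨n', hn', rfl⟩ := mem_image.mp
      (Finsupp.mapDomain_support (Finsupp.mem_support_iff.mpr hn))
    have h1 := lt_len hm'
    have h2 : off (k + 1) ≤ off l :=
      sum_le_sum_of_subset (range_subset_range.mpr hkl)
    have h3 : off (k + 1) = off k + len (y k) := sum_range_succ _ _
    omega
  have hw1 : ∀ k, e (w k) = 1 := fun k => by
    rw [← hy k]
    exact he _ _ ((hmono k).strictMonoOn _)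
  have hwy : ∀ k b, e.tensor (w k) b = e.tensor (y k) b := fun k b =>
    he.tensor_mapDomain ((hmono k).strictMonoOn _) b
  set N := e.comp w hblock.disjSupp with hN
  have hNN : N.Normalized := fun k => by
    change e (lcomb w (Finsupp.single k 1)) = 1
    rw [lcomb, Finsupp.linearCombination_single, one_smul, hw1]
  have hNe : EmbBy e N w 1 1 :=
    ⟨hblock, one_pos, fun b => (one_mul _).le, fun b => (one_mul _).ge⟩
  -- the norm of the blocks `w k` has a spreading block sequence, given by mixtures of the `w k`
  obtain ⟨f, z, c, C, hf, hfn, hz, hz6⟩ :=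
    exists_spread_embBy hNN fun hvN => hv (hvN.of_emb hNN ⟨_, _, _, hNe⟩)
  have hc := hz.pos
  have hW := hNe.trans hz zero_le_one
  rw [one_mul, one_mul] at hW
  set W : ℕ → ℕ →₀ ℝ := fun k => lcomb w (z k) with hWd
  have hWn : ∀ k, c ≤ e (W k) ∧ e (W k) ≤ C := fun k => by
    have h1 := hW.lower (Finsupp.single k 1)
    have h2 := hW.upper (Finsupp.single k 1)
    rw [hfn, mul_one, lcomb, Finsupp.linearCombination_single, one_smul] at h1 h2
    exact ⟨h1, h2⟩
  obtain ⟨M₀, hM₀⟩ := exists_le_tensor_of_block he hv hf (w := fun k => c⁻¹ • W k) (c := 1)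
    (A := C / c) (fun k l hkl m n hm hn' => hW.block k l hkl m n
      (fun h0 => hm (by simp [h0])) (fun h0 => hn' (by simp [h0])))
    (fun k => by
      rw [e.smul, abs_of_pos (inv_pos.mpr hc), inv_mul_eq_div]
      exact ⟨(one_le_div hc).mpr (hWn k).1, div_le_div_of_nonneg_right (hWn k).2 hc.le⟩)
    one_pos (fun b => by
      rw [lcomb_smul, e.smul, abs_of_pos (inv_pos.mpr hc), one_mul, le_inv_mul_iff₀ hc]
      exact hW.lower b)
  have hup : ∀ b, ∃ k₀, ∀ k, k₀ ≤ k → f b ≤ |M₀| / c * e.tensor (W k) b := by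
    intro b
    obtain ⟨k₀, h⟩ := hM₀ b
    refine ⟨k₀, fun k hk => (h k hk).trans ?_⟩
    rw [e.tensor_smul he, abs_of_pos (inv_pos.mpr hc), div_mul_eq_mul_div, mul_div_assoc,
      inv_mul_eq_div]
    exact mul_le_mul_of_nonneg_right (le_abs_self _) (div_nonneg (LNorm.nonneg _ _) hc.le)
  have hMc : 0 ≤ |M₀| / c := div_nonneg (abs_nonneg _) hc.le
  obtain ⟨C₁, hC₁, hsub⟩ := exists_tensor_le he hn hv
  -- `f` is dominated by `e`, so the two norms are equivalent by minimality
  obtain ⟨C₂, hC₂⟩ := hmin f hf hfn ⟨_, _, _, hW⟩ ⟨|M₀| / c * (C₁ * C), fun b => by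
    obtain ⟨k, hk⟩ := hup b
    refine (hk k le_rfl).trans ?_
    rw [mul_assoc]
    refine mul_le_mul_of_nonneg_left ((hsub b (W k)).trans ?_) hMc
    rw [mul_assoc, mul_comm (e b)]
    exact mul_le_mul_of_nonneg_left (mul_le_mul_of_nonneg_right (hWn k).2 (e.nonneg _))
      (zero_le_one.trans hC₁)⟩
  -- on the other hand `f (b m)` is small, since late mixtures contain late vectors `y k` only
  have hfb : ∀ m : ℕ, (m + 1) * f (b m) ≤ |M₀| / c * (6 * e (b m)) := by
    intro m
    obtain ⟨k₀, hk₀⟩ := hup (b m)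
    have h1 := hk₀ (max k₀ m) (le_max_left _ _)
    have h2 : e.tensor (W (max k₀ m)) (b m) ≤ 6 * (e (b m) / (m + 1)) := by
      refine (e.tensor_lcomb_le he _ _ _).trans ?_
      calc ∑ j ∈ (z (max k₀ m)).support, |z (max k₀ m) j| * e.tensor (w j) (b m)
          ≤ ∑ j ∈ (z (max k₀ m)).support, |z (max k₀ m) j| * (e (b m) / (m + 1)) := by
            refine sum_le_sum fun j hj => mul_le_mul_of_nonneg_left ?_ (abs_nonneg _)
            have h3 := hz.block.le_of_ne_zero (hz.ne_zero hfn) _ j (Finsupp.mem_support_iff.mp hj)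
            rw [hwy, le_div_iff₀ (by positivity), mul_comm]
            exact (h m j ((le_max_right _ _).trans h3)).le
        _ ≤ 6 * (e (b m) / (m + 1)) := by
            rw [← sum_mul]
            exact mul_le_mul_of_nonneg_right (hz6 _) (div_nonneg (e.nonneg _) (by positivity))
    have h3 := h1.trans (mul_le_mul_of_nonneg_left h2 hMc)
    calc (m + 1) * f (b m) ≤ (m + 1) * (|M₀| / c * (6 * (e (b m) / (m + 1)))) := by
          gcongr
      _ = _ := by field_simp
  obtain ⟨m, hm⟩ := exists_nat_ge (|C₂| * (|M₀| / c * 6))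
  have h1 : 0 < e (b m) := by
    refine lt_of_le_of_lt ?_ (h m m le_rfl)
    have := (e.tensor (y m)).nonneg (b m)
    positivity
  have h2 := hC₂ (b m)
  have h3 := hfb m
  have h4 : e (b m) ≤ |C₂| * f (b m) :=
    h2.trans (mul_le_mul_of_nonneg_right (le_abs_self _) (f.nonneg _))
  have h5 : (m + 1) * e (b m) ≤ |C₂| * (|M₀| / c * 6) * e (b m) := by
    calc ((m : ℝ) + 1) * e (b m) ≤ (m + 1) * (|C₂| * f (b m)) := by gcongr
      _ = |C₂| * ((m + 1) * f (b m)) := by ring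
      _ ≤ |C₂| * (|M₀| / c * (6 * e (b m))) := by gcongr
      _ = _ := by ring
  have h6 := le_of_mul_le_mul_right h5 h1
  linarith

/-- If `e (b ⊗ y)` is small for some `b` depending on `y`, but not for each fixed `b`, then the norms
of the tensor products with `y₂ ⊗ y₃`, `y₁ ⊗ y₃` and `y₁ ⊗ y₂` are incomparable. -/
theorem violates_of_low_tensor {e : LNorm} (he : e.Spread) (hn : e.Normalized) (hv : ¬ Violates e)
    (y : ℕ → ℕ →₀ ℝ) (hy : ∀ k, e (y k) = 1)
    (hlow : ∀ k : ℕ, ∃ b, (k + 1) * e.tensor (y k) b < e b)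
    (V : Filter ℕ) [V.NeBot] (hV : V ≤ atTop) {c : ℝ} (hc : 0 < c)
    (hbelow : ∀ b, ∀ᶠ k in V, c * e b ≤ e.tensor (y k) b) : Violates e := by
  obtain ⟨C, hC1, hC⟩ := exists_tensor_le he hn hv
  have hC0 : 0 < C := one_pos.trans_le hC1
  choose b hb using hlow
  have hy0 : ∀ k, y k ≠ 0 := fun k => hn.ne_zero_of_pos (by rw [hy]; exact one_pos)
  have hlate : ∀ R : ℝ, ∀ᶠ k : ℕ in V, R ≤ k := fun R =>
    (tendsto_natCast_atTop_atTop.eventually (eventually_ge_atTop R)).filter_mono hV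
  have hl1 : ∀ x, 0 ≤ l1 x := fun x => sum_nonneg fun _ _ => abs_nonneg _
  refine violates_of_spreading_triples 1 fun M => ?_
  set M' := |M| + 1 with hM'
  have hM'0 : 0 < M' := by positivity
  -- each index is chosen so late that the loss for the vector `b k` outweighs the norms of the
  -- vectors chosen before, and the lower estimate holds for them
  obtain ⟨k₁, hk₁⟩ := (hlate (M' * C * C / (c * c * c))).exists
  set x₁ := y k₁ with hx₁
  set b₀ := b k₁ with hb₀
  obtain ⟨m₁, hm₁⟩ := Finsupp.ne_iff.mp (hy0 k₁)
  set a₁ := |x₁ m₁| with ha₁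
  have ha₁0 : 0 < a₁ := abs_pos.mpr hm₁
  obtain ⟨k₂, hk₂, t₂₁, t₂₀⟩ := ((hlate (M' * C * (C + l1 x₁) / (c * (c * a₁)))).and
    ((hbelow x₁).and (hbelow b₀))).exists
  set x₂ := y k₂ with hx₂
  set b₁ := b k₂ with hb₁
  have hy1 : e x₁ = 1 := hy k₁
  have hy2 : e x₂ = 1 := hy k₂
  rw [hy1, mul_one] at t₂₁
  set p := tens (len x₂) x₁ x₂ with hp
  have hep : e p = e.tensor x₂ x₁ := rfl
  have hp0 : p ≠ 0 := hn.ne_zero_of_pos (by rw [hep]; exact hc.trans_le t₂₁)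
  obtain ⟨m₂, hm₂⟩ := Finsupp.ne_iff.mp hp0
  set a₂ := |p m₂| with ha₂
  have ha₂0 : 0 < a₂ := abs_pos.mpr hm₂
  obtain ⟨k₃, hk₃, t₃₁, t₃₂, t₃₀, t₃₃⟩ :=
    ((hlate (M' * C * (l1 x₁ + l1 x₂) / (c * a₂))).and ((hbelow x₁).and ((hbelow x₂).and
    ((hbelow (tens (len x₂) b₀ x₂)).and (hbelow (tens (len x₁) b₁ x₁)))))).exists
  set x₃ := y k₃ with hx₃
  set b₂ := b k₃ with hb₂
  have hy3 : e x₃ = 1 := hy k₃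
  rw [hy1, mul_one] at t₃₁
  rw [hy2, mul_one] at t₃₂
  have low₁ : M' * C * C * e.tensor x₁ b₀ < c * c * c * e b₀ := by
    have h1 : M' * C * C / (c * c * c) * e.tensor x₁ b₀ < e b₀ := lt_of_le_of_lt
      (mul_le_mul_of_nonneg_right (hk₁.trans (le_add_of_nonneg_right zero_le_one))
        (LNorm.nonneg _ _)) (hb k₁)
    rwa [div_mul_eq_mul_div, div_lt_iff₀ (by positivity), mul_comm (e b₀)] at h1
  have low₂ : M' * C * (C + l1 x₁) * e.tensor x₂ b₁ < c * (c * a₁) * e b₁ := by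
    have h1 : M' * C * (C + l1 x₁) / (c * (c * a₁)) * e.tensor x₂ b₁ < e b₁ := lt_of_le_of_lt
      (mul_le_mul_of_nonneg_right (hk₂.trans (le_add_of_nonneg_right zero_le_one))
        (LNorm.nonneg _ _)) (hb k₂)
    rwa [div_mul_eq_mul_div, div_lt_iff₀ (by positivity), mul_comm (e b₁)] at h1
  have low₃ : M' * C * (l1 x₁ + l1 x₂) * e.tensor x₃ b₂ < c * a₂ * e b₂ := by
    have h1 : M' * C * (l1 x₁ + l1 x₂) / (c * a₂) * e.tensor x₃ b₂ < e b₂ := lt_of_le_of_lt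
      (mul_le_mul_of_nonneg_right (hk₃.trans (le_add_of_nonneg_right zero_le_one))
        (LNorm.nonneg _ _)) (hb k₃)
    rwa [div_mul_eq_mul_div, div_lt_iff₀ (by positivity), mul_comm (e b₂)] at h1
  set q₀ := tens (len x₃) x₂ x₃ with hq₀
  set q₁ := tens (len x₃) x₁ x₃ with hq₁
  have hq₀C : c ≤ e q₀ ∧ e q₀ ≤ C := ⟨t₃₂, by
    have := hC x₂ x₃
    rwa [hy2, hy3, mul_one, mul_one] at this⟩
  have hq₁C : c ≤ e q₁ ∧ e q₁ ≤ C := ⟨t₃₁, by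
    have := hC x₁ x₃
    rwa [hy1, hy3, mul_one, mul_one] at this⟩
  have hpC : c ≤ e p ∧ e p ≤ C := ⟨t₂₁, by
    have := hC x₁ x₂
    rwa [hy1, hy2, mul_one, mul_one] at this⟩
  -- the three norms, for `v = b₀, b₁, b₂`
  have T₀ : ∀ v, e.tensor q₀ v = e.tensor x₃ (tens (len x₂) v x₂) := fun v => he.tensor_tens v x₂ x₃
  have T₁ : ∀ v, e.tensor q₁ v = e.tensor x₃ (tens (len x₁) v x₁) := fun v => he.tensor_tens v x₁ x₃
  have T₂ : ∀ v, e.tensor p v = e.tensor x₂ (tens (len x₁) v x₁) := fun v => he.tensor_tens v x₁ x₂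
  have up : ∀ x x' v, e x' = 1 → e.tensor x' (tens (len x) v x) ≤ C * e.tensor x v :=
    fun x x' v hx' => by
      have := hC (tens (len x) v x) x'
      rwa [hx', mul_one] at this
  have up' : ∀ x x' v, e.tensor x' (tens (len x) v x) ≤ l1 x * e.tensor x' v :=
    fun x x' v => (he.tensor x').tensor_le x v
  have fin : ∀ (q q' v : ℕ →₀ ℝ) (t : ℝ), c ≤ e q' → 0 < e q → e q ≤ C → e.tensor q' v ≤ t →
      M' * C * t < c * e.tensor q v → M * e.nu q' v < e.nu q v := by
    intro q q' v t h1 h2 h3 h4 h5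
    have h6 : 0 ≤ e.tensor q' v := LNorm.nonneg _ _
    have h7 : M * e.nu q' v ≤ M' * (t / c) := by
      refine mul_le_mul ((le_abs_self M).trans (by linarith)) ?_ (LNorm.nonneg _ _) hM'0.le
      exact div_le_div₀ (h6.trans h4) h4 hc h1
    refine h7.trans_lt ?_
    rw [e.nu_apply, lt_div_iff₀ h2, mul_div_assoc', div_mul_eq_mul_div, div_lt_iff₀ hc]
    refine lt_of_le_of_lt ?_ (h5.trans_eq (mul_comm _ _))
    rw [mul_right_comm]
    exact mul_le_mul_of_nonneg_right (mul_le_mul_of_nonneg_left h3 hM'0.le) (h6.trans h4)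
  have hnu : ∀ q, q ≠ 0 → (e.nu q).Spread ∧ RepT e (e.nu q) 1 ∧
      1 ≤ e.nu q (Finsupp.single 0 1) ∧ e.nu q (Finsupp.single 0 1) ≤ 1 := fun q hq =>
    ⟨he.nu q, he.repT_nu hn hq, (he.nu_normalized hn hq 0).ge, (he.nu_normalized hn hq 0).le⟩
  have hq₀0 : q₀ ≠ 0 := hn.ne_zero_of_pos (hc.trans_le hq₀C.1)
  have hq₁0 : q₁ ≠ 0 := hn.ne_zero_of_pos (hc.trans_le hq₁C.1)
  have big₀ : c * (c * e b₀) ≤ e.tensor q₀ b₀ := by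
    rw [T₀]
    exact (mul_le_mul_of_nonneg_left t₂₀ hc.le).trans t₃₀
  have big₁ : c * (a₁ * e b₁) ≤ e.tensor q₁ b₁ := by
    rw [T₁]
    exact (mul_le_mul_of_nonneg_left (he.le_tensor x₁ b₁ m₁) hc.le).trans t₃₃
  have big₂ : a₂ * e b₂ ≤ e.tensor p b₂ := he.le_tensor p b₂ m₂
  have p₀ := hc.trans_le hq₀C.1
  have p₁ := hc.trans_le hq₁C.1
  have p₂ := hc.trans_le hpC.1
  have n₂ := (e.tensor x₂).nonneg b₁
  have n₃ := (e.tensor x₃).nonneg b₂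
  have low₂' : M' * C * (C * e.tensor x₂ b₁) ≤ M' * C * (C + l1 x₁) * e.tensor x₂ b₁ := by
    rw [mul_assoc (M' * C)]
    have := hl1 x₁
    gcongr
    linarith
  have low₂'' : M' * C * (l1 x₁ * e.tensor x₂ b₁) ≤ M' * C * (C + l1 x₁) * e.tensor x₂ b₁ := by
    rw [mul_assoc (M' * C)]
    gcongr
    linarith
  have low₃' : M' * C * (l1 x₁ * e.tensor x₃ b₂) ≤ M' * C * (l1 x₁ + l1 x₂) * e.tensor x₃ b₂ := by
    rw [mul_assoc (M' * C)]
    have := hl1 x₂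
    gcongr
    linarith
  have low₃'' : M' * C * (l1 x₂ * e.tensor x₃ b₂) ≤ M' * C * (l1 x₁ + l1 x₂) * e.tensor x₃ b₂ := by
    rw [mul_assoc (M' * C)]
    have := hl1 x₁
    gcongr
    linarith
  have big₀' := mul_le_mul_of_nonneg_left big₀ hc.le
  have big₁' := mul_le_mul_of_nonneg_left big₁ hc.le
  have big₂' := mul_le_mul_of_nonneg_left big₂ hc.le
  refine ⟨![e.nu q₀, e.nu q₁, e.nu p], ![b₀, b₁, b₂], fun i => ?_, fun i j hj => ?_⟩
  · fin_cases i
    exacts [hnu q₀ hq₀0, hnu q₁ hq₁0, hnu p hp0]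
  · fin_cases i <;> fin_cases j
    · exact absurd rfl hj
    · exact fin q₀ q₁ b₀ _ hq₁C.1 p₀ hq₀C.2 ((T₁ b₀).le.trans (up x₁ x₃ b₀ hy3)) (by linarith)
    · exact fin q₀ p b₀ _ hpC.1 p₀ hq₀C.2 ((T₂ b₀).le.trans (up x₁ x₂ b₀ hy2)) (by linarith)
    · exact fin q₁ q₀ b₁ _ hq₀C.1 p₁ hq₁C.2 ((T₀ b₁).le.trans (up x₂ x₃ b₁ hy3)) (by linarith)
    · exact absurd rfl hj
    · exact fin q₁ p b₁ _ hpC.1 p₁ hq₁C.2 ((T₂ b₁).le.trans (up' x₁ x₂ b₁)) (by linarith)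
    · exact fin p q₀ b₂ _ hq₀C.1 p₂ hpC.2 ((T₀ b₂).le.trans (up' x₂ x₃ b₂)) (by linarith)
    · exact fin p q₁ b₂ _ hq₁C.1 p₂ hpC.2 ((T₁ b₂).le.trans (up' x₁ x₃ b₂)) (by linarith)
    · exact absurd rfl hj

/-- A minimal spreading norm without incomparable families is multiplicative for tensor products, up
to constants. -/
theorem exists_multiplicative {e : LNorm} (he : e.Spread) (hn : e.Normalized) (hv : ¬ Violates e)
    (hmin : ∀ f : LNorm, f.Spread → f.Normalized → Emb e f → (∃ C : ℝ, ∀ b, f b ≤ C * e b) →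
      ∃ C : ℝ, ∀ b, e b ≤ C * f b) :
    ∃ C : ℝ, 1 ≤ C ∧ ∀ b x, e b * e x ≤ C * e.tensor x b ∧ e.tensor x b ≤ C * (e b * e x) := by
  obtain ⟨C, hC1, hC⟩ := exists_tensor_le he hn hv
  suffices h : ∃ C' : ℝ, 1 ≤ C' ∧ ∀ b x, e b * e x ≤ C' * e.tensor x b by
    obtain ⟨C', hC'1, hC'⟩ := h
    refine ⟨max C C', hC1.trans (le_max_left _ _), fun b x => ⟨(hC' b x).trans ?_, (hC b x).trans ?_⟩⟩
    · exact mul_le_mul_of_nonneg_right (le_max_right _ _) (LNorm.nonneg _ _)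
    · exact mul_le_mul_of_nonneg_right (le_max_left _ _) (mul_nonneg (e.nonneg _) (e.nonneg _))
  by_contra H
  push Not at H
  have hex : ∀ k : ℕ, ∃ y b, e y = 1 ∧ (k + 1) * e.tensor y b < e b := by
    intro k
    obtain ⟨b, x, h⟩ := H (k + 1) (by linarith [k.cast_nonneg (α := ℝ)])
    have hx : 0 < e x := by
      rcases (e.nonneg x).eq_or_lt with h0 | h0
      · rw [← h0, mul_zero] at h
        have := (e.tensor x).nonneg b
        have : 0 ≤ ((k : ℝ) + 1) * e.tensor x b := by positivity
        linarith
      · exact h0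
    refine ⟨(e x)⁻¹ • x, b, ?_, ?_⟩
    · rw [e.smul, abs_of_pos (inv_pos.mpr hx), inv_mul_cancel₀ hx.ne']
    · rw [e.tensor_smul he, abs_of_pos (inv_pos.mpr hx), mul_left_comm, inv_mul_lt_iff₀ hx,
        mul_comm (e x)]
      exact h
  choose y b hy hb using hex
  -- either the norms `e (v ⊗ y k)` are bounded below along an ultrafilter, for fixed `v`, by a
  -- multiple of `e v`, or for each `m` some `v m` violates this frequently, and a diagonal sequence
  -- of the `y k` works for all the `v m`
  by_cases hcase : ∃ m : ℕ, ∀ v, ∀ᶠ k in (hyperfilter ℕ : Filter ℕ),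
      e v ≤ (m + 1) * e.tensor (y k) v
  · obtain ⟨m, hm⟩ := hcase
    refine hv (violates_of_low_tensor he hn hv y hy (fun k => ⟨b k, hb k⟩) (hyperfilter ℕ)
      Nat.hyperfilter_le_atTop (c := ((m : ℝ) + 1)⁻¹) (by positivity) fun v => ?_)
    filter_upwards [hm v] with k hk
    rwa [inv_mul_le_iff₀ (by positivity)]
  · push Not at hcase
    choose v hv' using hcase
    obtain ⟨φ, hφ, hP⟩ := Filter.extraction_forall_of_frequently
      (P := fun n k => ∀ m ∈ range (n + 1), (m + 1) * e.tensor (y k) (v m) < e (v m)) (by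
        intro n
        have h1 : ∀ᶠ k in (hyperfilter ℕ : Filter ℕ), ∀ m ∈ range (n + 1),
            (m + 1) * e.tensor (y k) (v m) < e (v m) :=
          (Filter.eventually_all_finset _).mpr fun m _ => hv' m
        exact h1.frequently.filter_mono Nat.hyperfilter_le_atTop)
    exact not_vanishing_tensor he hn hv hmin (fun k => y (φ k)) (fun k => hy _) v
      fun m k hmk => hP k m (mem_range.mpr (by omega))

/-! ### Multiplicative spreading norms are `ℓ_p` norms -/

/-- The indicator of `{0, …, n - 1}`. -/
noncomputable def ones (n : ℕ) : ℕ →₀ ℝ :=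
  Finsupp.onFinset (range n) (fun k => if k < n then 1 else 0) fun k h => by
    rw [mem_range]; by_contra h'; exact h (if_neg h')

theorem ones_apply (n k : ℕ) : ones n k = if k < n then 1 else 0 := rfl

theorem support_ones_subset (n : ℕ) : (ones n).support ⊆ range n := fun k h => by
  rw [mem_range]; by_contra h'; exact Finsupp.mem_support_iff.mp h (if_neg h')

theorem tens_ones {n : ℕ} (hn : 0 < n) (m : ℕ) : tens n (ones m) (ones n) = ones (m * n) := by
  ext k
  simp only [tens_apply, ones_apply, Nat.mod_lt k hn, if_true, mul_one, Nat.div_lt_iff_lt_mul hn]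

theorem mapDomain_cases {φ : ℕ → ℕ} {y : ℕ →₀ ℝ} (hφ : Set.InjOn φ y.support) (m : ℕ) :
    Finsupp.mapDomain φ y m = 0 ∨
      ∃ k ∈ y.support, φ k = m ∧ Finsupp.mapDomain φ y m = y k := by
  classical
  by_cases h : Finsupp.mapDomain φ y m = 0
  · exact Or.inl h
  · obtain ⟨k, hk, rfl⟩ := mem_image.mp
      (Finsupp.mapDomain_support (Finsupp.mem_support_iff.mpr h))
    exact Or.inr ⟨k, hk, rfl, Finsupp.mapDomain_apply' _ _ subset_rfl hφ hk⟩

theorem one_le_ones {e : LNorm} (hn : e.Normalized) {n : ℕ} (h : 0 < n) : 1 ≤ e (ones n) := by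
  have := hn.abs_le (ones n) 0
  rwa [ones_apply, if_pos h, abs_one] at this

theorem ones_le {e : LNorm} (hn : e.Normalized) (n : ℕ) : e (ones n) ≤ n := by
  refine (hn.le_l1 _).trans ?_
  calc ∑ k ∈ (ones n).support, |ones n k| ≤ ∑ k ∈ range n, |ones n k| :=
        sum_le_sum_of_subset_of_nonneg (support_ones_subset n) fun _ _ _ => abs_nonneg _
    _ ≤ ∑ _k ∈ range n, (1 : ℝ) := sum_le_sum fun k _ => by
        rw [ones_apply]; split_ifs <;> simp
    _ = n := by simp

theorem ones_mono {e : LNorm} {m n : ℕ} (h : m ≤ n) : e (ones m) ≤ e (ones n) := e.mono fun k => by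
  simp only [ones_apply]
  split_ifs <;> first | omega | simp

theorem le_ones_of_const {e : LNorm} (he : e.Spread) (x : ℕ →₀ ℝ) (v : ℝ) (hx : ∀ k ∈ x.support, x k = v) :
    e x ≤ |v| * e (ones x.support.card) := by
  obtain ⟨φ, hφ, hT⟩ := exists_strictMonoOn_maps x.support (range x.support.card) (by simp)
  rw [← he φ x hφ, ← e.smul]
  refine e.mono fun m => ?_
  rcases mapDomain_cases hφ.injOn m with h | ⟨k, hk, rfl, h⟩
  · rw [h, abs_zero]; exact abs_nonneg _
  · rw [h, hx k hk, Finsupp.smul_apply, ones_apply, if_pos (mem_range.mp (hT k hk)), smul_eq_mul,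
      mul_one]

theorem ones_le_of_const {e : LNorm} (he : e.Spread) (x : ℕ →₀ ℝ) (v : ℝ) (A : Finset ℕ) (hx : ∀ k ∈ A, x k = v) :
    |v| * e (ones A.card) ≤ e x := by
  obtain ⟨φ, hφ, hT⟩ := exists_strictMonoOn_maps (range A.card) A (by simp)
  have hφ' := hφ.mono (coe_subset.mpr (support_ones_subset A.card))
  rw [← he φ _ hφ', ← e.smul]
  refine e.mono fun m => ?_
  rw [Finsupp.smul_apply, smul_eq_mul]
  rcases mapDomain_cases hφ'.injOn m with h | ⟨k, hk, rfl, h⟩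
  · rw [h, mul_zero, abs_zero]; exact abs_nonneg _
  · have hk' := support_ones_subset _ hk
    rw [h, hx _ (hT k hk'), ones_apply, if_pos (mem_range.mp hk'), mul_one]

theorem le_of_forall_nat_mul_le {a b c : ℝ} (h : ∀ k : ℕ, k * a ≤ k * b + c) : a ≤ b := by
  by_contra hab
  push Not at hab
  obtain ⟨k, hk⟩ := exists_nat_gt (c / (a - b))
  rw [div_lt_iff₀ (by linarith)] at hk
  linarith [h k]

/-- Sequences which are additive up to a bounded error are linear up to a bounded error. -/
theorem exists_linear_of_approx_additive (u : ℕ → ℝ) {c B : ℝ} (hc : 0 ≤ c)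
    (hB : ∀ k, |u k| ≤ k * B) (h : ∀ k l, |u (k + l) - u k - u l| ≤ c) :
    ∃ L : ℝ, ∀ k : ℕ, |u k - k * L| ≤ c := by
  have h1 : Subadditive fun k => u k + c := fun k l => by
    have := (abs_le.mp (h k l)).2
    simp only
    linarith
  have h2 : Subadditive fun k => -u k + c := fun k l => by
    have := (abs_le.mp (h k l)).1
    simp only
    linarith
  have hB0 : 0 ≤ B := by simpa using (abs_nonneg _).trans (hB 1)
  have bdd : ∀ w : ℕ → ℝ, (∀ k, |w k| ≤ k * B) →
      BddBelow (Set.range fun n : ℕ => (w n + c) / n) := by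
    intro w hw
    refine ⟨-B, ?_⟩
    rintro _ ⟨n, rfl⟩
    rcases Nat.eq_zero_or_pos n with rfl | hn
    · simp [hB0]
    · have hn' : (0 : ℝ) < n := by exact_mod_cast hn
      change -B ≤ (w n + c) / n
      rw [le_div_iff₀ hn']
      linarith [(abs_le.mp (hw n)).1]
  have b1 := bdd u hB
  have b2 := bdd (fun k => -u k) fun k => by rw [abs_neg]; exact hB k
  have t := (h1.tendsto_lim b1).add (h2.tendsto_lim b2)
  have t' : Tendsto (fun n : ℕ => (u n + c) / n + (-u n + c) / n) atTop (𝓝 0) := by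
    have := (tendsto_const_nhds (x := 2 * c) (f := (atTop : Filter ℕ))).div_atTop
      (tendsto_natCast_atTop_atTop (R := ℝ))
    refine this.congr fun n => ?_
    rw [← add_div]; congr 1; ring
  have hL := tendsto_nhds_unique t t'
  refine ⟨h1.lim, fun k => ?_⟩
  rcases Nat.eq_zero_or_pos k with rfl | hk
  · have := hB 0
    simp only [Nat.cast_zero, zero_mul] at this ⊢
    rw [sub_zero]
    exact this.trans hc
  · have hk' : (0 : ℝ) < k := by exact_mod_cast hk
    have l1 := h1.lim_le_div b1 hk.ne'
    have l2 := h2.lim_le_div b2 hk.ne'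
    rw [le_div_iff₀ hk'] at l1 l2
    have : h2.lim = -h1.lim := by linarith
    rw [this] at l2
    rw [abs_le]
    constructor <;> linarith

/-- If `e` is multiplicative up to a constant then the norms of the indicators are powers, up to a
constant. -/
theorem exists_ones_equiv_rpow {e : LNorm} (hn : e.Normalized) (he : e.Spread) {C : ℝ} (hC : 1 ≤ C)
    (hmul : ∀ b x, e b * e x ≤ C * e.tensor x b ∧ e.tensor x b ≤ C * (e b * e x)) {r : ℝ}
    (hr : 0 < r) {C' : ℝ} (hlow : ∀ n : ℕ, (n : ℝ) ^ (1 / r) ≤ C' * e (ones n)) :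
    ∃ α : ℝ, 0 < α ∧ α ≤ 1 ∧ ∃ K : ℝ, 1 ≤ K ∧ ∀ n : ℕ,
      (n : ℝ) ^ α ≤ K * e (ones n) ∧ e (ones n) ≤ K * (n : ℝ) ^ α := by
  have hlog2 : 0 < Real.log 2 := Real.log_pos (by norm_num)
  set u : ℕ → ℝ := fun k => Real.log (e (ones (2 ^ k))) with hu
  have hpos : ∀ k, 1 ≤ e (ones (2 ^ k)) := fun k => one_le_ones hn (by positivity)
  have hpos' : ∀ k, 0 < e (ones (2 ^ k)) := fun k => one_pos.trans_le (hpos k)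
  have hC0 : 0 < C := one_pos.trans_le hC
  have hexp : ∀ k, Real.exp (u k) = e (ones (2 ^ k)) := fun k => Real.exp_log (hpos' k)
  have hten : ∀ k l, e.tensor (ones (2 ^ l)) (ones (2 ^ k)) = e (ones (2 ^ (k + l))) := by
    intro k l
    rw [he.tensor_eq (D := 2 ^ l) fun m hm => mem_range.mp (support_ones_subset _ hm),
      tens_ones (by positivity), pow_add]
  have hub : ∀ k, u k ≤ k * Real.log 2 := fun k => by
    rw [← Real.log_pow]
    refine Real.log_le_log (hpos' k) ((ones_le hn _).trans_eq (by push_cast; rfl))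
  obtain ⟨L, hL⟩ := exists_linear_of_approx_additive u (c := Real.log C) (B := Real.log 2)
    (Real.log_nonneg hC) (fun k => by
      rw [abs_of_nonneg (Real.log_nonneg (hpos k))]; exact hub k) (fun k l => by
      obtain ⟨h1, h2⟩ := hmul (ones (2 ^ k)) (ones (2 ^ l))
      rw [hten] at h1 h2
      have h3 := Real.log_le_log (mul_pos (hpos' k) (hpos' l)) h1
      have h4 := Real.log_le_log (hpos' (k + l)) h2
      rw [Real.log_mul (hpos' k).ne' (hpos' l).ne', Real.log_mul hC0.ne' (hpos' _).ne'] at h3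
      rw [Real.log_mul hC0.ne' (mul_pos (hpos' k) (hpos' l)).ne',
        Real.log_mul (hpos' k).ne' (hpos' l).ne'] at h4
      rw [abs_le]
      constructor <;> simp only [hu] <;> linarith)
  have hL1 : L ≤ Real.log 2 := le_of_forall_nat_mul_le (c := Real.log C) fun k => by
    have := (abs_le.mp (hL k)).1
    linarith [hub k]
  have hC'0 : 0 < C' := by
    have := hlow 1
    rw [Nat.cast_one, Real.one_rpow] at this
    by_contra hcon
    nlinarith [one_le_ones hn (n := 1) one_pos]
  have hL0 : Real.log 2 / r ≤ L := le_of_forall_nat_mul_le (c := Real.log C + Real.log C') fun k => by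
    have h1 := (abs_le.mp (hL k)).2
    have h2 := Real.log_le_log (by positivity) (hlow (2 ^ k))
    rw [Real.log_mul hC'0.ne' (hpos' k).ne', Real.log_rpow (by positivity)] at h2
    push_cast at h2
    rw [Real.log_pow] at h2
    have h3 : (k : ℝ) * (Real.log 2 / r) = 1 / r * (k * Real.log 2) := by ring
    simp only [hu] at h1
    linarith
  have hLpos : 0 < L := (div_pos hlog2 hr).trans_le hL0
  set α := L / Real.log 2 with hα
  have hα0 : 0 < α := div_pos hLpos hlog2
  have hα1 : α ≤ 1 := (div_le_one hlog2).mpr hL1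
  have h2k : ∀ k : ℕ, ((2 : ℝ) ^ k) ^ α = Real.exp (k * L) := fun k => by
    rw [Real.rpow_def_of_pos (by positivity), Real.log_pow, hα]
    congr 1
    field_simp
  have hpow : ∀ k : ℕ, ((2 : ℝ) ^ k) ^ α ≤ C * e (ones (2 ^ k)) ∧
      e (ones (2 ^ k)) ≤ C * ((2 : ℝ) ^ k) ^ α := fun k => by
    have h1 := abs_le.mp (hL k)
    rw [h2k, ← hexp, ← Real.exp_log hC0, ← Real.exp_add, ← Real.exp_add]
    exact ⟨Real.exp_le_exp.mpr (by linarith), Real.exp_le_exp.mpr (by linarith)⟩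
  refine ⟨α, hα0, hα1, 2 * C, by linarith, fun n => ?_⟩
  rcases Nat.eq_zero_or_pos n with rfl | hn0
  · have h0 : e (ones 0) = 0 := le_antisymm (by simpa using ones_le hn 0) (e.nonneg _)
    rw [h0, Nat.cast_zero, Real.zero_rpow hα0.ne']
    simp
  set k := Nat.log 2 n
  have hk1 : 2 ^ k ≤ n := Nat.pow_log_le_self 2 hn0.ne'
  have hk2 : n < 2 ^ (k + 1) := Nat.lt_pow_succ_log_self (by norm_num) n
  have hk1' : (2 : ℝ) ^ k ≤ n := by exact_mod_cast hk1
  have hk2' : (n : ℝ) ≤ 2 ^ (k + 1) := by exact_mod_cast hk2.le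
  have hsucc : ((2 : ℝ) ^ (k + 1)) ^ α ≤ 2 * ((2 : ℝ) ^ k) ^ α := by
    rw [pow_succ', Real.mul_rpow (by norm_num) (by positivity)]
    refine mul_le_mul_of_nonneg_right ?_ (by positivity)
    calc (2 : ℝ) ^ α ≤ 2 ^ (1 : ℝ) := Real.rpow_le_rpow_of_exponent_le (by norm_num) hα1
      _ = 2 := Real.rpow_one 2
  constructor
  · calc (n : ℝ) ^ α ≤ ((2 : ℝ) ^ (k + 1)) ^ α := Real.rpow_le_rpow (by positivity) hk2' hα0.le
      _ ≤ 2 * ((2 : ℝ) ^ k) ^ α := hsucc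
      _ ≤ 2 * (C * e (ones (2 ^ k))) := by linarith [(hpow k).1]
      _ ≤ 2 * (C * e (ones n)) := by have := ones_mono (e := e) hk1; gcongr
      _ = _ := by ring
  · calc e (ones n) ≤ e (ones (2 ^ (k + 1))) := ones_mono hk2.le
      _ ≤ C * ((2 : ℝ) ^ (k + 1)) ^ α := (hpow (k + 1)).2
      _ ≤ C * (2 * ((2 : ℝ) ^ k) ^ α) := by gcongr
      _ ≤ C * (2 * (n : ℝ) ^ α) := by gcongr
      _ = _ := by ring

/-- The `p`-th power of the `ℓ_p` norm. -/
noncomputable def psum (p : ℝ) (x : ℕ →₀ ℝ) : ℝ := ∑ k ∈ x.support, |x k| ^ p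

theorem psum_nonneg (p : ℝ) (x : ℕ →₀ ℝ) : 0 ≤ psum p x :=
  sum_nonneg fun _ _ => Real.rpow_nonneg (abs_nonneg _) _

theorem psum_eq_sum {p : ℝ} (hp : 0 < p) {x : ℕ →₀ ℝ} {s : Finset ℕ} (h : x.support ⊆ s) :
    psum p x = ∑ k ∈ s, |x k| ^ p :=
  sum_subset h fun k _ hk => by
    rw [Finsupp.notMem_support_iff.mp hk, abs_zero, Real.zero_rpow hp.ne']

theorem sum_range_mul_div_mod (f : ℕ → ℕ → ℝ) (K D : ℕ) :
    ∑ n ∈ range (K * D), f (n / D) (n % D) = ∑ k ∈ range K, ∑ m ∈ range D, f k m := by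
  induction K with
  | zero => simp
  | succ K ih =>
    rw [sum_range_succ, add_mul, one_mul, ← ih, sum_range_add]
    congr 1
    refine sum_congr rfl fun m hm => ?_
    have hm := mem_range.mp hm
    rw [Nat.mul_comm, Nat.mul_add_div (by omega), Nat.div_eq_of_lt hm, add_zero,
      Nat.mul_add_mod, Nat.mod_eq_of_lt hm]

theorem psum_tens {p : ℝ} (hp : 0 < p) (b x : ℕ →₀ ℝ) :
    psum p (tens (len x) b x) = psum p b * psum p x := by
  have h1 : (tens (len x) b x).support ⊆ range (len b * len x) := fun n hn => by
    rw [Finsupp.mem_support_iff, tens_apply] at hn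
    have h1 := lt_len (Finsupp.mem_support_iff.mpr (left_ne_zero_of_mul hn))
    exact mem_range.mpr ((Nat.div_lt_iff_lt_mul (Nat.succ_pos _)).mp h1)
  rw [psum_eq_sum hp h1, psum_eq_sum hp (x := b) (s := range (len b))
    fun k hk => mem_range.mpr (lt_len hk), psum_eq_sum hp (x := x) (s := range (len x))
    fun k hk => mem_range.mpr (lt_len hk), sum_mul_sum, ← sum_range_mul_div_mod]
  refine sum_congr rfl fun n _ => ?_
  rw [tens_apply, abs_mul, Real.mul_rpow (abs_nonneg _) (abs_nonneg _)]

/-- Comparison with the `ℓ_p` norm for vectors with few values. -/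
theorem psum_equiv_of_values {e : LNorm} (he : e.Spread) {α K : ℝ} (hα : 0 < α) (hα1 : α ≤ 1)
    (hK : 1 ≤ K) (hones : ∀ n : ℕ, (n : ℝ) ^ α ≤ K * e (ones n) ∧ e (ones n) ≤ K * (n : ℝ) ^ α)
    (x : ℕ →₀ ℝ) (W : Finset ℝ) (hW : ∀ k ∈ x.support, x k ∈ W) (hW1 : 1 ≤ W.card) :
    e x ≤ K * W.card * psum (1 / α) x ^ α ∧ psum (1 / α) x ^ α ≤ K * W.card * e x := by
  classical
  set A : ℝ → Finset ℕ := fun v => x.support.filter fun k => x k = v with hA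
  have hp : 0 < 1 / α := by positivity
  have hK0 : 0 < K := one_pos.trans_le hK
  have hval : ∀ v : ℝ, (|v| * ((A v).card : ℝ) ^ α) ^ (1 / α) = ∑ k ∈ A v, |x k| ^ (1 / α) := by
    intro v
    rw [Real.mul_rpow (abs_nonneg _) (by positivity), ← Real.rpow_mul (by positivity),
      mul_one_div_cancel hα.ne', Real.rpow_one, sum_congr rfl (g := fun _ => |v| ^ (1 / α))
        fun k hk => by rw [(mem_filter.mp hk).2], sum_const, nsmul_eq_mul, mul_comm]
  have hsum : psum (1 / α) x = ∑ v ∈ W, ∑ k ∈ A v, |x k| ^ (1 / α) :=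
    (sum_fiberwise_of_maps_to hW _).symm
  constructor
  · have hx : x = ∑ v ∈ W, x.filter fun k => x k = v := by
      ext k
      rw [Finsupp.finsetSum_apply]
      simp only [Finsupp.filter_apply]
      by_cases hk : x k = 0
      · rw [hk]; exact (sum_eq_zero fun v _ => ite_self _).symm
      · rw [sum_ite_eq, if_pos (hW k (Finsupp.mem_support_iff.mpr hk))]
    conv_lhs => rw [hx]
    refine (e.sum_le _ _).trans ?_
    have h1 : ∀ v ∈ W, e (x.filter fun k => x k = v) ≤ K * psum (1 / α) x ^ α := by
      intro v hv
      have hs : (x.filter fun k => x k = v).support = A v := Finsupp.support_filter _ _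
      refine (le_ones_of_const he _ v fun k hk => ?_).trans ?_
      · rw [hs] at hk
        rw [Finsupp.filter_apply, if_pos (mem_filter.mp hk).2, (mem_filter.mp hk).2]
      · rw [hs]
        refine (mul_le_mul_of_nonneg_left (hones _).2 (abs_nonneg _)).trans ?_
        rw [mul_left_comm]
        refine mul_le_mul_of_nonneg_left ?_ hK0.le
        rw [← Real.rpow_le_rpow_iff (mul_nonneg (abs_nonneg _) (Real.rpow_nonneg (Nat.cast_nonneg _) _))
            (Real.rpow_nonneg (psum_nonneg _ _) _) hp,
          ← Real.rpow_mul (psum_nonneg _ _), mul_one_div_cancel hα.ne', Real.rpow_one, hval, hsum]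
        exact single_le_sum (f := fun v => ∑ k ∈ A v, |x k| ^ (1 / α))
          (fun v _ => sum_nonneg fun _ _ => Real.rpow_nonneg (abs_nonneg _) _) hv
    refine (sum_le_sum h1).trans_eq ?_
    rw [sum_const, nsmul_eq_mul]; ring
  · have h1 : psum (1 / α) x ≤ W.card * (K * e x) ^ (1 / α) := by
      rw [hsum, ← nsmul_eq_mul]
      refine sum_le_card_nsmul _ _ _ fun v _ => ?_
      rw [← hval]
      refine Real.rpow_le_rpow (by positivity) ?_ hp.le
      have h2 := ones_le_of_const he x v (A v) fun k hk => (mem_filter.mp hk).2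
      calc |v| * ((A v).card : ℝ) ^ α ≤ |v| * (K * e (ones (A v).card)) :=
            mul_le_mul_of_nonneg_left (hones _).1 (abs_nonneg _)
        _ = K * (|v| * e (ones (A v).card)) := by ring
        _ ≤ K * e x := mul_le_mul_of_nonneg_left h2 hK0.le
    have hKe : 0 ≤ K * e x := mul_nonneg hK0.le (e.nonneg _)
    have hc1 : (1 : ℝ) ≤ W.card := by exact_mod_cast hW1
    calc psum (1 / α) x ^ α ≤ (W.card * (K * e x) ^ (1 / α)) ^ α :=
          Real.rpow_le_rpow (psum_nonneg _ _) h1 hα.le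
      _ = (W.card : ℝ) ^ α * (K * e x) := by
          rw [Real.mul_rpow (by positivity) (by positivity), ← Real.rpow_mul hKe,
            one_div_mul_cancel hα.ne', Real.rpow_one]
      _ ≤ W.card * (K * e x) := by
          refine mul_le_mul_of_nonneg_right ?_ hKe
          calc (W.card : ℝ) ^ α ≤ (W.card : ℝ) ^ (1 : ℝ) := Real.rpow_le_rpow_of_exponent_le hc1 hα1
            _ = _ := Real.rpow_one _
      _ = _ := by ring

/-- The tensor power `b ⊗ ⋯ ⊗ b`. -/
noncomputable def tpow (b : ℕ →₀ ℝ) : ℕ → ℕ →₀ ℝ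
  | 0 => Finsupp.single 0 1
  | m + 1 => tens (len b) (tpow b m) b

theorem psum_tpow {p : ℝ} (hp : 0 < p) (b : ℕ →₀ ℝ) (m : ℕ) : psum p (tpow b m) = psum p b ^ m := by
  induction m with
  | zero =>
    rw [tpow, psum_eq_sum hp (s := {0}) Finsupp.support_single_subset]
    simp
  | succ m ih => rw [tpow, psum_tens hp, ih, pow_succ]

/-- A tensor power has few values: they are products of powers of the values of `b`. -/
theorem exists_values_tpow (b : ℕ →₀ ℝ) (m : ℕ) :
    ∃ W : Finset ℝ, (∀ k ∈ (tpow b m).support, tpow b m k ∈ W) ∧ 1 ≤ W.card ∧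
      W.card ≤ (m + 1) ^ b.support.card := by
  classical
  have key : ∀ m k, tpow b m k ≠ 0 → ∃ t : b.support → ℕ, (∀ i, t i ≤ m) ∧
      tpow b m k = ∏ i : b.support, b i ^ t i := by
    intro m
    induction m with
    | zero =>
      intro k hk
      refine ⟨fun _ => 0, fun _ => le_rfl, ?_⟩
      have hk0 : k = 0 := by
        by_contra h
        exact hk (Finsupp.single_eq_of_ne h)
      subst hk0
      simp [tpow]
    | succ m ih =>
      intro k hk
      rw [tpow, tens_apply] at hk
      obtain ⟨t, ht, hval⟩ := ih _ (left_ne_zero_of_mul hk)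
      set i₀ : b.support := ⟨k % len b, Finsupp.mem_support_iff.mpr (right_ne_zero_of_mul hk)⟩
      refine ⟨fun i => t i + if i = i₀ then 1 else 0, fun i => ?_, ?_⟩
      · have := ht i
        change t i + (if i = i₀ then 1 else 0) ≤ m + 1
        split_ifs <;> omega
      · rw [tpow, tens_apply, hval]
        simp only [pow_add, prod_mul_distrib]
        congr 1
        rw [prod_eq_single i₀ (fun i _ h => by simp [h]) (by simp)]
        simp [i₀]
  refine ⟨univ.image fun t : b.support → Fin (m + 1) => ∏ i : b.support, b i ^ (t i : ℕ),
    fun k hk => ?_, ?_, ?_⟩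
  · obtain ⟨t, ht, hval⟩ := key m k (Finsupp.mem_support_iff.mp hk)
    exact mem_image.mpr ⟨fun i => ⟨t i, Nat.lt_succ_of_le (ht i)⟩, mem_univ _, hval.symm⟩
  · exact Finset.card_pos.mpr (univ_nonempty.image _)
  · refine card_image_le.trans ?_
    simp

theorem le_of_pow_le_polynomial_mul_pow {a t K : ℝ} (s : ℕ) (ht : 0 ≤ t)
    (h : ∀ m : ℕ, a ^ m ≤ K * (m + 1) ^ s * t ^ m) : a ≤ t := by
  by_contra hat
  push Not at hat
  have ha : 0 < a := ht.trans_lt hat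
  rcases ht.eq_or_lt with h0 | ht0
  · have := h 1
    rw [← h0] at this
    simp at this
    linarith
  have hρ : t / a < 1 := (div_lt_one ha).mpr hat
  have hlim := ((tendsto_pow_const_mul_const_pow_of_lt_one s (div_nonneg ht ha.le) hρ).comp
    (tendsto_add_atTop_nat 1)).const_mul (K * (a / t))
  rw [mul_zero] at hlim
  refine absurd (ge_of_tendsto' hlim (b := 1) fun m => ?_) (by norm_num)
  have h1 := h m
  have h2 : K * (m + 1) ^ s * t ^ m / a ^ m = K * (a / t) * (((m + 1 : ℕ) : ℝ) ^ s * (t / a) ^ (m + 1)) := by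
    push_cast
    rw [div_pow, pow_succ, pow_succ]
    field_simp
  change 1 ≤ K * (a / t) * (((m + 1 : ℕ) : ℝ) ^ s * (t / a) ^ (m + 1))
  rw [← h2, le_div_iff₀ (pow_pos ha m), one_mul]
  exact h1

/-- A spreading norm which is multiplicative for tensor products, up to constants, and whose values
at indicators grow like a power at least, is equivalent to an `ℓ_p` norm: compare with the `ℓ_p` norm
on the tensor powers of a vector, which have few values compared with their length. -/
theorem exists_equiv_psum {e : LNorm} (hn : e.Normalized) (he : e.Spread) {C : ℝ} (hC : 1 ≤ C)
    (hmul : ∀ b x, e b * e x ≤ C * e.tensor x b ∧ e.tensor x b ≤ C * (e b * e x)) {r : ℝ}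
    (hr : 0 < r) {C' : ℝ} (hlow : ∀ n : ℕ, (n : ℝ) ^ (1 / r) ≤ C' * e (ones n)) :
    ∃ p : ℝ, 1 ≤ p ∧ ∀ b, e b ≤ C * psum p b ^ (1 / p) ∧ psum p b ^ (1 / p) ≤ C * e b := by
  obtain ⟨α, hα, hα1, K, hK, hones⟩ := exists_ones_equiv_rpow hn he hC hmul hr hlow
  have hC0 : 0 < C := one_pos.trans_le hC
  have hp : 0 < 1 / α := by positivity
  have hK0 : 0 < K := one_pos.trans_le hK
  have hup : ∀ b m, e (tpow b m) ≤ (C * e b) ^ m := by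
    intro b m
    induction m with
    | zero => rw [tpow, hn, pow_zero]
    | succ m ih =>
      have h1 : e (tpow b (m + 1)) ≤ C * (e (tpow b m) * e b) := (hmul (tpow b m) b).2
      rw [pow_succ]
      refine h1.trans ?_
      rw [mul_left_comm]
      exact mul_le_mul_of_nonneg_right ih (mul_nonneg hC0.le (e.nonneg _))
  have hdown : ∀ b m, e b ^ m ≤ C ^ m * e (tpow b m) := by
    intro b m
    induction m with
    | zero => rw [tpow, hn]; simp
    | succ m ih =>
      have h1 : e (tpow b m) * e b ≤ C * e (tpow b (m + 1)) := (hmul (tpow b m) b).1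
      calc e b ^ (m + 1) ≤ C ^ m * e (tpow b m) * e b := by
            rw [pow_succ]; exact mul_le_mul_of_nonneg_right ih (e.nonneg _)
        _ ≤ C ^ m * (C * e (tpow b (m + 1))) := by
            rw [mul_assoc]; exact mul_le_mul_of_nonneg_left h1 (by positivity)
        _ = _ := by ring
  refine ⟨1 / α, (one_le_div hα).mpr hα1, fun b => ?_⟩
  rw [one_div_one_div]
  have hps : ∀ m, psum (1 / α) (tpow b m) ^ α = (psum (1 / α) b ^ α) ^ m := fun m => by
    rw [psum_tpow hp, ← Real.rpow_natCast, ← Real.rpow_natCast, ← Real.rpow_mul (psum_nonneg _ _),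
      ← Real.rpow_mul (psum_nonneg _ _), mul_comm]
  have hps0 : 0 ≤ psum (1 / α) b ^ α := Real.rpow_nonneg (psum_nonneg _ _) _
  constructor
  · refine le_of_pow_le_polynomial_mul_pow (K := K) b.support.card (by positivity) fun m => ?_
    obtain ⟨W, hW, hW1, hWc⟩ := exists_values_tpow b m
    have hWc' : (W.card : ℝ) ≤ (m + 1) ^ b.support.card := by exact_mod_cast hWc
    have h1 := (psum_equiv_of_values he hα hα1 hK hones _ W hW hW1).1
    rw [hps] at h1
    calc e b ^ m ≤ C ^ m * e (tpow b m) := hdown b m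
      _ ≤ C ^ m * (K * (m + 1) ^ b.support.card * (psum (1 / α) b ^ α) ^ m) := by
          refine mul_le_mul_of_nonneg_left (h1.trans ?_) (by positivity)
          gcongr
      _ = _ := by rw [mul_pow]; ring
  · refine le_of_pow_le_polynomial_mul_pow (K := K) b.support.card
      (mul_nonneg hC0.le (e.nonneg _)) fun m => ?_
    obtain ⟨W, hW, hW1, hWc⟩ := exists_values_tpow b m
    have hWc' : (W.card : ℝ) ≤ (m + 1) ^ b.support.card := by exact_mod_cast hWc
    have h1 := (psum_equiv_of_values he hα hα1 hK hones _ W hW hW1).2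
    rw [hps] at h1
    refine h1.trans ?_
    have h2 := hup b m
    have h3 := e.nonneg (tpow b m)
    gcongr

/-! ### Sequences with bounded multipliers -/

section Multiplier

variable {𝕜 : Type*} [RCLike 𝕜] {X : Type*} [NormedAddCommGroup X] [NormedSpace 𝕜 X] {ι : Type*}

/-- Multiplying the coefficients of a finite combination of the `u i` by scalars of modulus at most
one increases its norm by a factor of at most `K`. -/
def IsMultiplierBounded (𝕜 : Type*) [RCLike 𝕜] {X : Type*} [NormedAddCommGroup X] [NormedSpace 𝕜 X]
    {ι : Type*} (u : ι → X) (K : ℝ) : Prop :=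
  ∀ (S : Finset ι) (c θ : ι → 𝕜), (∀ i, ‖θ i‖ ≤ 1) →
    ‖∑ i ∈ S, (θ i * c i) • u i‖ ≤ K * ‖∑ i ∈ S, c i • u i‖

/-- Norm the combination by a functional `g`; then multipliers of modulus one can be chosen to be signs,
up to a factor `2`, and a change of signs is the difference of two partial sums. -/
theorem isMultiplierBounded_of_subsums {u : ι → X} {C : ℝ}
    (h : ∀ (S A : Finset ι) (c : ι → 𝕜), A ⊆ S → ‖∑ i ∈ A, c i • u i‖ ≤ C * ‖∑ i ∈ S, c i • u i‖) :
    IsMultiplierBounded 𝕜 u (4 * C) := by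
  classical
  intro S c θ hθ
  obtain ⟨g, hg, hx⟩ := exists_functional_norm_eq (𝕜 := 𝕜) (∑ i ∈ S, (θ i * c i) • u i)
  obtain ⟨ε, hε⟩ := exists_signs_norm_sum S fun i => g (c i • u i)
  have h1 : ‖∑ i ∈ S, ε i • (c i • u i)‖ ≤ 2 * C * ‖∑ i ∈ S, c i • u i‖ := by
    have h2 : ∑ i ∈ S, ε i • (c i • u i) =
        ∑ i ∈ S with ε i = 1, c i • u i - ∑ i ∈ S with ¬ ε i = 1, c i • u i := by
      rw [← sum_filter_add_sum_filter_not S fun i => ε i = 1, sub_eq_add_neg, ← sum_neg_distrib]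
      congr 1
      · exact sum_congr rfl fun i hi => by rw [(mem_filter.mp hi).2, one_smul]
      · refine sum_congr rfl fun i hi => ?_
        rw [(Int.units_eq_one_or (ε i)).resolve_left (mem_filter.mp hi).2]
        simp [Units.smul_def]
    rw [h2]
    have e1 := h S (S.filter fun i => ε i = 1) c (filter_subset _ _)
    have e2 := h S (S.filter fun i => ¬ ε i = 1) c (filter_subset _ _)
    exact (norm_sub_le _ _).trans (by linarith)
  have h3 : ∑ i ∈ S, ε i • g (c i • u i) = g (∑ i ∈ S, ε i • (c i • u i)) := by
    rw [map_sum]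
    refine sum_congr rfl fun j _ => ?_
    rcases Int.units_eq_one_or (ε j) with h | h <;> simp [h]
  rw [h3] at hε
  calc ‖∑ i ∈ S, (θ i * c i) • u i‖ ≤ ∑ i ∈ S, ‖g (c i • u i)‖ := by
        rw [hx, map_sum]
        refine (norm_sum_le _ _).trans (sum_le_sum fun i _ => ?_)
        rw [mul_smul, map_smul, norm_smul]
        exact mul_le_of_le_one_left (norm_nonneg _) (hθ i)
    _ ≤ 2 * ‖g (∑ i ∈ S, ε i • (c i • u i))‖ := hε
    _ ≤ 2 * ‖∑ i ∈ S, ε i • (c i • u i)‖ := by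
        refine mul_le_mul_of_nonneg_left ((g.le_opNorm _).trans ?_) zero_le_two
        exact mul_le_of_le_one_left (norm_nonneg _) hg
    _ ≤ _ := by linarith

theorem exists_isMultiplierBounded_basis [CompleteSpace X] (b : UnconditionalSchauderBasis ι 𝕜 X) :
    ∃ K, IsMultiplierBounded 𝕜 b K := by
  classical
  obtain ⟨C, hC⟩ := UnconditionalSchauderBasis.exists_norm_proj_le b
  refine ⟨_, isMultiplierBounded_of_subsums (C := C) fun S A c hA => ?_⟩
  have h : b.proj A (∑ i ∈ S, c i • b i) = ∑ i ∈ A, c i • b i := by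
    rw [GeneralSchauderBasis.proj_apply]
    refine sum_congr rfl fun i hi => ?_
    rw [map_sum, sum_eq_single i]
    · simp [b.ortho]
    · intro j _ hj
      simp [b.ortho, Ne.symm hj]
    · exact fun h => absurd (hA hi) h
  rw [← h]
  exact ((b.proj A).le_opNorm _).trans (mul_le_mul_of_nonneg_right (hC A) (norm_nonneg _))

variable {u : ℕ → X} {K : ℝ}

theorem IsMultiplierBounded.smul {u : ι → X} (hu : IsMultiplierBounded 𝕜 u K) (t : ι → 𝕜) :
    IsMultiplierBounded 𝕜 (fun i => t i • u i) K := by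
  intro S c θ hθ
  have := hu S (fun i => c i * t i) θ hθ
  simpa only [smul_smul, mul_assoc] using this

/-- Disjointly supported combinations of a sequence with bounded multipliers have bounded
multipliers. -/
theorem IsMultiplierBounded.blocks (hu : IsMultiplierBounded 𝕜 u K) (G : ι → ℕ →₀ 𝕜)
    (hG : ∀ i j m, G i m ≠ 0 → G j m ≠ 0 → i = j) :
    IsMultiplierBounded 𝕜 (fun i => Finsupp.linearCombination 𝕜 u (G i)) K := by
  classical
  intro S c θ hθ
  set T := S.biUnion fun i => (G i).support with hT
  have hexp : ∀ d : ι → 𝕜, ∑ i ∈ S, d i • Finsupp.linearCombination 𝕜 u (G i) =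
      ∑ m ∈ T, (∑ i ∈ S, d i * G i m) • u m := by
    intro d
    have h1 : ∀ i ∈ S, Finsupp.linearCombination 𝕜 u (G i) = ∑ m ∈ T, G i m • u m := fun i hi => by
      rw [Finsupp.linearCombination_apply]
      exact Finsupp.sum_of_support_subset _ (fun m hm => mem_biUnion.mpr ⟨i, hi, hm⟩) _ (by simp)
    rw [sum_congr rfl fun i hi => by rw [h1 i hi, smul_sum], sum_comm]
    refine sum_congr rfl fun m _ => ?_
    rw [sum_smul]
    exact sum_congr rfl fun i _ => smul_smul _ _ _
  have hsel : ∀ m, ∃ t : 𝕜, ‖t‖ ≤ 1 ∧ ∀ i ∈ S, G i m ≠ 0 → t = θ i := by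
    intro m
    by_cases h : ∃ i ∈ S, G i m ≠ 0
    · obtain ⟨i, hi, him⟩ := h
      exact ⟨θ i, hθ i, fun j _ hj => by rw [hG i j m him hj]⟩
    · push Not at h
      exact ⟨0, by simp, fun i hi hne => absurd (h i hi) hne⟩
  choose t ht1 ht using hsel
  have := hu T (fun m => ∑ i ∈ S, c i * G i m) t ht1
  rw [← hexp] at this
  refine le_trans (le_of_eq ?_) this
  rw [hexp]
  congr 1
  refine sum_congr rfl fun m _ => ?_
  congr 1
  rw [mul_sum]
  refine sum_congr rfl fun i hi => ?_
  by_cases h : G i m = 0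
  · rw [h]; simp
  · rw [ht m i hi h, mul_assoc]

theorem IsMultiplierBounded.isUncondFamily {F : Fin 3 → ℕ → X}
    (h : IsMultiplierBounded 𝕜 (fun a : Fin 3 × ℕ => F a.1 a.2) K) : IsUncondFamily 𝕜 F K := by
  intro S c θ hθ
  have := h (univ ×ˢ S) (fun a => c a.1 a.2) (fun a => θ a.1 a.2) fun a => hθ _ _
  rwa [sum_product_right, sum_product_right] at this

/-! ### The lattice norm of a sequence with bounded multipliers -/

/-- The combination of the `u k` with real coefficients `a k`. -/
noncomputable def realComb (𝕜 : Type*) [RCLike 𝕜] {X : Type*} [NormedAddCommGroup X]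
    [NormedSpace 𝕜 X] (u : ℕ → X) (a : ℕ →₀ ℝ) : X := ∑ k ∈ a.support, (a k : 𝕜) • u k

theorem realComb_eq_sum (u : ℕ → X) {a : ℕ →₀ ℝ} {s : Finset ℕ} (h : a.support ⊆ s) :
    realComb 𝕜 u a = ∑ k ∈ s, (a k : 𝕜) • u k :=
  sum_subset h fun k _ hk => by rw [Finsupp.notMem_support_iff.mp hk]; simp

theorem realComb_lcomb (u : ℕ → X) (w : ℕ → ℕ →₀ ℝ) (b : ℕ →₀ ℝ) :
    realComb 𝕜 u (lcomb w b) = ∑ k ∈ b.support, (b k : 𝕜) • realComb 𝕜 u (w k) := by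
  classical
  set T := (lcomb w b).support ∪ b.support.biUnion fun k => (w k).support
  have h1 : ∀ k ∈ b.support, realComb 𝕜 u (w k) = ∑ m ∈ T, (w k m : 𝕜) • u m := fun k hk =>
    realComb_eq_sum u ((subset_biUnion_of_mem (fun k => (w k).support) hk).trans subset_union_right)
  have h2 : ∑ k ∈ b.support, (b k : 𝕜) • realComb 𝕜 u (w k) =
      ∑ k ∈ b.support, ∑ m ∈ T, (b k : 𝕜) • ((w k m : 𝕜) • u m) :=
    sum_congr rfl fun k hk => by rw [h1 k hk, smul_sum]
  rw [h2, realComb_eq_sum u (s := T) subset_union_left, sum_comm]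
  refine sum_congr rfl fun m _ => ?_
  rw [lcomb_apply, RCLike.ofReal_sum, sum_smul]
  refine sum_congr rfl fun k _ => ?_
  rw [smul_smul, RCLike.ofReal_mul]

/-- The largest norm of a combination of the `u k` with coefficients of modulus at most `|a k|`. -/
noncomputable def latticeNorm (𝕜 : Type*) [RCLike 𝕜] {X : Type*} [NormedAddCommGroup X]
    [NormedSpace 𝕜 X] (u : ℕ → X) (a : ℕ →₀ ℝ) : ℝ :=
  ⨆ θ : {θ : ℕ → 𝕜 // ∀ k, ‖θ k‖ ≤ 1}, ‖∑ k ∈ a.support, (θ.1 k * (a k : 𝕜)) • u k‖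

theorem latticeNorm_bddAbove (u : ℕ → X) (a : ℕ →₀ ℝ) :
    BddAbove (Set.range fun θ : {θ : ℕ → 𝕜 // ∀ k, ‖θ k‖ ≤ 1} =>
      ‖∑ k ∈ a.support, (θ.1 k * (a k : 𝕜)) • u k‖) := by
  refine ⟨∑ k ∈ a.support, |a k| * ‖u k‖, ?_⟩
  rintro _ ⟨θ, rfl⟩
  refine (norm_sum_le _ _).trans (sum_le_sum fun k _ => ?_)
  rw [norm_smul, norm_mul, RCLike.norm_ofReal]
  exact mul_le_mul_of_nonneg_right (mul_le_of_le_one_left (abs_nonneg _) (θ.2 k)) (norm_nonneg _)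

theorem norm_le_latticeNorm (u : ℕ → X) {a : ℕ →₀ ℝ} {s : Finset ℕ} (c : ℕ → 𝕜)
    (h : ∀ k, ‖c k‖ ≤ |a k|) (hs : ∀ k ∈ a.support, k ∈ s) :
    ‖∑ k ∈ s, c k • u k‖ ≤ latticeNorm 𝕜 u a := by
  have h1 : ‖∑ k ∈ a.support, ((c k / (a k : 𝕜)) * (a k : 𝕜)) • u k‖ ≤ latticeNorm 𝕜 u a :=
    le_ciSup (latticeNorm_bddAbove (𝕜 := 𝕜) u a) ⟨fun k => c k / (a k : 𝕜), fun k => by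
      rw [norm_div, RCLike.norm_ofReal]
      exact div_le_one_of_le₀ (h k) (abs_nonneg _)⟩
  refine le_trans (le_of_eq ?_) h1
  congr 1
  symm
  refine sum_subset_zero_on_sdiff hs (fun k hk => ?_) fun k hk => ?_
  · have h2 := h k
    rw [Finsupp.notMem_support_iff.mp (mem_sdiff.mp hk).2, abs_zero] at h2
    rw [norm_le_zero_iff.mp h2, zero_smul]
  · rw [div_mul_cancel₀]
    exact_mod_cast Finsupp.mem_support_iff.mp hk

/-- The lattice norm on finitely supported sequences defined by `u`. -/
noncomputable def latticeLNorm (𝕜 : Type*) [RCLike 𝕜] {X : Type*} [NormedAddCommGroup X]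
    [NormedSpace 𝕜 X] (u : ℕ → X) : LNorm where
  toFun := latticeNorm 𝕜 u
  add_le' a b := by
    classical
    have : Nonempty {θ : ℕ → 𝕜 // ∀ k, ‖θ k‖ ≤ 1} := ⟨⟨0, by simp⟩⟩
    refine ciSup_le fun θ => ?_
    set T := (a + b).support ∪ a.support ∪ b.support with hT
    have h0 : ∑ k ∈ (a + b).support, (θ.1 k * ((a + b) k : 𝕜)) • u k =
        ∑ k ∈ T, (θ.1 k * (a k : 𝕜)) • u k + ∑ k ∈ T, (θ.1 k * (b k : 𝕜)) • u k := by
      rw [← sum_add_distrib, ← sum_subset (s₁ := (a + b).support) (s₂ := T)]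
      · refine sum_congr rfl fun k _ => ?_
        rw [Finsupp.add_apply, RCLike.ofReal_add, mul_add, add_smul]
      · exact subset_union_left.trans subset_union_left
      · intro k _ hk
        rw [← add_smul, ← mul_add, ← RCLike.ofReal_add, ← Finsupp.add_apply,
          Finsupp.notMem_support_iff.mp hk]
        simp
    have hθ : ∀ (c : ℕ →₀ ℝ) k, ‖θ.1 k * (c k : 𝕜)‖ ≤ |c k| := fun c k => by
      rw [norm_mul, RCLike.norm_ofReal]
      exact mul_le_of_le_one_left (abs_nonneg _) (θ.2 k)
    rw [h0]
    refine (norm_add_le _ _).trans (add_le_add ?_ ?_)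
    · exact norm_le_latticeNorm u _ (hθ a) fun k hk =>
        mem_union_left _ (mem_union_right _ hk)
    · exact norm_le_latticeNorm u _ (hθ b) fun k hk => mem_union_right _ hk
  smul' t a := by
    by_cases ht : t = 0
    · subst ht
      simp [latticeNorm]
    · rw [latticeNorm, latticeNorm, Real.mul_iSup_of_nonneg (abs_nonneg t)]
      refine iSup_congr fun θ => ?_
      rw [Finsupp.support_smul_eq ht, ← RCLike.norm_ofReal (K := 𝕜), ← norm_smul, smul_sum]
      congr 1
      refine sum_congr rfl fun k _ => ?_
      rw [smul_smul, Finsupp.smul_apply, smul_eq_mul, RCLike.ofReal_mul, mul_left_comm]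
  mono' a b h := by
    have : Nonempty {θ : ℕ → 𝕜 // ∀ k, ‖θ k‖ ≤ 1} := ⟨⟨0, by simp⟩⟩
    classical
    refine ciSup_le fun θ => ?_
    have hsub : a.support ⊆ b.support := fun k hk => by
      rw [Finsupp.mem_support_iff] at hk ⊢
      intro h0
      have := h k
      rw [h0, abs_zero] at this
      exact hk (abs_nonpos_iff.mp this)
    rw [sum_subset hsub fun k _ hk => by rw [Finsupp.notMem_support_iff.mp hk]; simp]
    refine norm_le_latticeNorm u _ (fun k => ?_) fun k hk => hk
    rw [norm_mul, RCLike.norm_ofReal]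
    exact (mul_le_of_le_one_left (abs_nonneg _) (θ.2 k)).trans (h k)

theorem latticeLNorm_normalized (hu1 : ∀ k, ‖u k‖ = 1) : (latticeLNorm 𝕜 u).Normalized := by
  intro k
  have : Nonempty {θ : ℕ → 𝕜 // ∀ k, ‖θ k‖ ≤ 1} := ⟨⟨0, by simp⟩⟩
  change latticeNorm 𝕜 u (Finsupp.single k 1) = 1
  refine le_antisymm (ciSup_le fun θ => ?_) ?_
  · rw [Finsupp.support_single _ one_ne_zero, sum_singleton, norm_smul, hu1, mul_one,
      Finsupp.single_eq_same]
    simpa using θ.2 k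
  · have := norm_le_latticeNorm (𝕜 := 𝕜) u (a := Finsupp.single k 1) (s := {k})
      (fun j => ((Finsupp.single k (1 : ℝ) j : ℝ) : 𝕜)) (fun j => by rw [RCLike.norm_ofReal])
      fun j hj => Finsupp.support_single_subset hj
    simpa [hu1] using this

theorem norm_realComb_le (u : ℕ → X) (a : ℕ →₀ ℝ) :
    ‖realComb 𝕜 u a‖ ≤ latticeLNorm 𝕜 u a :=
  norm_le_latticeNorm u _ (fun k => by rw [RCLike.norm_ofReal]) fun _ hk => hk

theorem IsMultiplierBounded.latticeLNorm_le (hu : IsMultiplierBounded 𝕜 u K) (a : ℕ →₀ ℝ) :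
    latticeLNorm 𝕜 u a ≤ K * ‖realComb 𝕜 u a‖ := by
  have : Nonempty {θ : ℕ → 𝕜 // ∀ k, ‖θ k‖ ≤ 1} := ⟨⟨0, by simp⟩⟩
  exact ciSup_le fun θ => hu _ _ _ θ.2

theorem realComb_eq_linearCombination (u : ℕ → X) (a : ℕ →₀ ℝ) :
    realComb 𝕜 u a =
      Finsupp.linearCombination 𝕜 u (a.mapRange (fun t : ℝ => (t : 𝕜)) RCLike.ofReal_zero) := by
  rw [Finsupp.linearCombination_apply, Finsupp.sum_mapRange_index (by simp)]
  rfl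

theorem IsMultiplierBounded.realComb (hu : IsMultiplierBounded 𝕜 u K) (G : ι → ℕ →₀ ℝ)
    (hG : ∀ i j m, G i m ≠ 0 → G j m ≠ 0 → i = j) :
    IsMultiplierBounded 𝕜 (fun i => _root_.realComb 𝕜 u (G i)) K := by
  simp only [realComb_eq_linearCombination]
  refine hu.blocks _ fun i j m hi hj => hG i j m ?_ ?_
  · intro h; apply hi; simp [h]
  · intro h; apply hj; simp [h]

end Multiplier

/-! ### From lattice norms to subspaces -/

section Dichotomy

variable {𝕜 : Type*} [RCLike 𝕜] {X : Type u} [NormedAddCommGroup X] [NormedSpace 𝕜 X]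
  {u : ℕ → X} {K r C : ℝ}

theorem one_le_of_isMultiplierBounded (hu : IsMultiplierBounded 𝕜 u K) (hu1 : ∀ k, ‖u k‖ = 1) :
    1 ≤ K := by
  have := hu {0} (fun _ => 1) (fun _ => 1) (by simp)
  simpa [hu1] using this

/-- The finite families of `Violates`, for larger and larger constants and further and further to
the right, are joined to one violating family. -/
theorem exists_subspace_of_violates (hX : CotypeWith X r C) (hr : 1 ≤ r) (hC : 1 ≤ C)
    (hu : IsMultiplierBounded 𝕜 u K) (hu1 : ∀ k, ‖u k‖ = 1)
    (hv : Violates (latticeLNorm 𝕜 u)) :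
    ∃ Y : Submodule 𝕜 X, IsClosed (Y : Set X) ∧ Nonempty (SchauderBasis 𝕜 Y) ∧
      ¬ HasLocalUnconditionalStructure 𝕜 Y := by
  classical
  set N := latticeLNorm 𝕜 u with hN
  have hNN : N.Normalized := latticeLNorm_normalized hu1
  have hK1 : 1 ≤ K := one_le_of_isMultiplierBounded hu hu1
  have hK0 : 0 < K := one_pos.trans_le hK1
  obtain ⟨A, hA⟩ := hv
  choose S F h1 h2 h3 h4 using fun n s : ℕ => hA n s
  -- the `n`-th family lives on the interval `(t n, t (n + 1))`
  have hb : ∀ n s, ∃ s', s < s' ∧ ∀ i, ∀ k ∈ S n s, ∀ m, F n s i k m ≠ 0 → m < s' := by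
    intro n s
    obtain ⟨s', hs'⟩ := (univ.biUnion fun i => (S n s).biUnion fun k =>
      (F n s i k).support).exists_nat_subset_range
    refine ⟨max s' (s + 1), by omega, fun i k hk m hm => lt_of_lt_of_le (mem_range.mp (hs' ?_))
      (le_max_left _ _)⟩
    exact mem_biUnion.mpr ⟨i, mem_univ _, mem_biUnion.mpr ⟨k, hk, Finsupp.mem_support_iff.mpr hm⟩⟩
  choose nx hnx1 hnx2 using hb
  set t : ℕ → ℕ := fun n => Nat.rec 0 (fun n x => nx n (x + 1)) n with ht
  have ht1 : ∀ n, t (n + 1) = nx n (t n + 1) := fun n => rfl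
  have htm : StrictMono t := strictMono_nat_of_lt_succ fun n => by
    rw [ht1]; exact (Nat.lt_succ_self _).trans (hnx1 n _)
  set S' : ℕ → Finset ℕ := fun n => S n (t n + 1) with hS'
  set F' : ℕ → Fin 3 → ℕ → ℕ →₀ ℝ := fun n => F n (t n + 1) with hF'
  set G : Fin 3 × ℕ → ℕ →₀ ℝ := fun a =>
    if (Nat.unpair a.2).2 ∈ S' (Nat.unpair a.2).1 then F' (Nat.unpair a.2).1 a.1 (Nat.unpair a.2).2
    else Finsupp.single (t (3 * a.2 + a.1)) 1 with hG
  have hGm : ∀ (a : Fin 3 × ℕ) m, G a m ≠ 0 →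
      ((Nat.unpair a.2).2 ∈ S' (Nat.unpair a.2).1 ∧
        F' (Nat.unpair a.2).1 a.1 (Nat.unpair a.2).2 m ≠ 0 ∧
        t (Nat.unpair a.2).1 < m ∧ m < t ((Nat.unpair a.2).1 + 1)) ∨
      m = t (3 * a.2 + a.1) := by
    intro a m hm
    by_cases ha : (Nat.unpair a.2).2 ∈ S' (Nat.unpair a.2).1
    · left
      simp only [hG, if_pos ha] at hm
      exact ⟨ha, hm, h2 _ _ a.1 _ ha m hm, by rw [ht1]; exact hnx2 _ _ a.1 _ ha m hm⟩
    · right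
      simp only [hG, if_neg ha] at hm
      by_contra hne
      exact hm (Finsupp.single_eq_of_ne hne)
  have hGd : ∀ a c m, G a m ≠ 0 → G c m ≠ 0 → a = c := by
    intro a c m ha hc
    have hsep : ∀ n l, t n < m → m < t (n + 1) → m ≠ t l := by
      rintro n l h1 h2 rfl
      have h5 : n < l := (htm.lt_iff_lt (a := n) (b := l)).mp h1
      have h6 : l < n + 1 := (htm.lt_iff_lt (a := l) (b := n + 1)).mp h2
      omega
    rcases hGm a m ha with ⟨a1, a2, a3, a4⟩ | ha' <;> rcases hGm c m hc with ⟨c1, c2, c3, c4⟩ | hc'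
    · have hn : (Nat.unpair a.2).1 = (Nat.unpair c.2).1 := by
        rcases lt_trichotomy (Nat.unpair a.2).1 (Nat.unpair c.2).1 with h | h | h
        · exact absurd (a4.trans_le (htm.monotone h)) (not_lt.mpr c3.le)
        · exact h
        · exact absurd (c4.trans_le (htm.monotone h)) (not_lt.mpr a3.le)
      rw [← hn] at c1 c2
      obtain ⟨h5, h6⟩ := h3 _ _ a.1 _ a1 c.1 _ c1 m a2 c2
      have h7 : a.2 = c.2 := by
        rw [← Nat.pair_unpair a.2, ← Nat.pair_unpair c.2, hn, h6]
      exact Prod.ext h5 h7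
    · exact absurd hc' (hsep _ _ a3 a4)
    · exact absurd ha' (hsep _ _ c3 c4)
    · have h5 : 3 * a.2 + a.1 = 3 * c.2 + c.1 := htm.injective (ha'.symm.trans hc')
      have := a.1.2
      have := c.1.2
      exact Prod.ext (Fin.ext (by omega)) (by omega)
  have hGN : ∀ a, 1 ≤ N (G a) ∧ N (G a) ≤ max A 1 := by
    intro a
    simp only [hG]
    split_ifs with ha
    · exact ⟨(h1 _ _ a.1 _ ha).1, (h1 _ _ a.1 _ ha).2.trans (le_max_left _ _)⟩
    · rw [hNN]
      exact ⟨le_rfl, le_max_right _ _⟩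
  set Φ : Fin 3 → ℕ → X := fun i p => (K : 𝕜) • realComb 𝕜 u (G (i, p)) with hΦ
  have hΦm : IsMultiplierBounded 𝕜 (fun a : Fin 3 × ℕ => Φ a.1 a.2) K :=
    (hu.realComb G hGd).smul fun _ => (K : 𝕜)
  refine IsViolatingFamily.exists_subspace (F := Φ) (A := K * max A 1) hX hr hC (fun i p => ?_)
    (fun i p => ?_) hΦm.isUncondFamily fun M => ?_
  · rw [norm_smul, RCLike.norm_ofReal, abs_of_pos hK0]
    exact (hGN (i, p)).1.trans (hu.latticeLNorm_le _)
  · rw [norm_smul, RCLike.norm_ofReal, abs_of_pos hK0]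
    exact mul_le_mul_of_nonneg_left ((norm_realComb_le u _).trans (hGN (i, p)).2) hK0.le
  · obtain ⟨n, hn⟩ := exists_nat_ge (K * |M|)
    refine ⟨(S' n).image (Nat.pair n), fun col => ?_⟩
    obtain ⟨i, b, hb, hlt⟩ := h4 n (t n + 1) fun k => col (Nat.pair n k)
    have hinj : Set.InjOn (Nat.pair n) (S' n) := fun k _ l _ h => (Nat.pair_eq_pair.mp h).2
    have hsum : ∀ j, ∑ p ∈ (S' n).image (Nat.pair n),
        ((b (Nat.unpair p).2 : ℝ) : 𝕜) • Φ j p = (K : 𝕜) • realComb 𝕜 u (lcomb (F' n j) b) := by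
      intro j
      rw [sum_image hinj, realComb_lcomb, smul_sum,
        ← sum_subset (s₁ := b.support) (s₂ := S' n) fun k hk => (hb k hk).1]
      · refine sum_congr rfl fun k hk => ?_
        rw [Nat.unpair_pair, smul_comm (K : 𝕜)]
        simp only [hΦ, hG, Nat.unpair_pair]
        rw [if_pos (show k ∈ S' n from (hb k hk).1)]
      · intro k _ hk
        rw [Nat.unpair_pair, Finsupp.notMem_support_iff.mp hk]
        simp
    refine ⟨i, fun p => if p ∈ (S' n).image (Nat.pair n) then ((b (Nat.unpair p).2 : ℝ) : 𝕜) else 0,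
      fun p hp => ?_, fun j hj => ?_⟩
    · have hp1 : p ∈ (S' n).image (Nat.pair n) := by
        by_contra h
        exact hp (if_neg h)
      simp only [if_pos hp1] at hp
      obtain ⟨k, hk, rfl⟩ := mem_image.mp hp1
      rw [Nat.unpair_pair] at hp
      refine ⟨hp1, (hb k (Finsupp.mem_support_iff.mpr fun h => hp ?_)).2⟩
      rw [h]; simp
    · have hs : ∀ j, ∑ p ∈ (S' n).image (Nat.pair n), (if p ∈ (S' n).image (Nat.pair n) then
          ((b (Nat.unpair p).2 : ℝ) : 𝕜) else 0) • Φ j p =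
          (K : 𝕜) • realComb 𝕜 u (lcomb (F' n j) b) := fun j => by
        rw [← hsum j]
        exact sum_congr rfl fun p hp => by rw [if_pos hp]
      rw [hs, hs, norm_smul, norm_smul, RCLike.norm_ofReal, abs_of_pos hK0]
      have h5 := norm_realComb_le (𝕜 := 𝕜) u (lcomb (F' n j) b)
      have h6 := hu.latticeLNorm_le (lcomb (F' n i) b)
      have h7 : n * N (lcomb (F' n j) b) < N (lcomb (F' n i) b) := hlt j hj
      calc M * (K * ‖realComb 𝕜 u (lcomb (F' n j) b)‖)
          ≤ |M| * (K * N (lcomb (F' n j) b)) := by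
            refine mul_le_mul (le_abs_self M) ?_ (by positivity) (abs_nonneg _)
            exact mul_le_mul_of_nonneg_left h5 hK0.le
        _ = K * |M| * N (lcomb (F' n j) b) := by ring
        _ ≤ n * N (lcomb (F' n j) b) := mul_le_mul_of_nonneg_right hn (N.nonneg _)
        _ < N (lcomb (F' n i) b) := h7
        _ ≤ _ := h6

/-- The sequence `v` is equivalent to the unit vector basis of `ℓ_p`. -/
def IsEllSeq (𝕜 : Type*) [RCLike 𝕜] {X : Type*} [NormedAddCommGroup X] [NormedSpace 𝕜 X]
    (v : ℕ → X) (p K : ℝ) : Prop :=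
  ∀ (S : Finset ℕ) (c : ℕ → 𝕜), (∑ k ∈ S, ‖c k‖ ^ p) ^ (1 / p) ≤ K * ‖∑ k ∈ S, c k • v k‖ ∧
    ‖∑ k ∈ S, c k • v k‖ ≤ K * (∑ k ∈ S, ‖c k‖ ^ p) ^ (1 / p)

/-- The norm of a combination of realisations of successive vectors, in terms of the lattice norm. -/
theorem norm_sum_realComb_equiv (hu : IsMultiplierBounded 𝕜 u K) (hK : 0 ≤ K)
    {w : ℕ → ℕ →₀ ℝ} (hw : DisjSupp Set.univ w) (S : Finset ℕ) (c : ℕ → 𝕜) :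
    ‖∑ k ∈ S, c k • realComb 𝕜 u (w k)‖ ≤ K * latticeLNorm 𝕜 u (lcomb w (∑ k ∈ S, Finsupp.single k ‖c k‖)) ∧
    latticeLNorm 𝕜 u (lcomb w (∑ k ∈ S, Finsupp.single k ‖c k‖)) ≤
      K * K * ‖∑ k ∈ S, c k • realComb 𝕜 u (w k)‖ := by
  classical
  have hv : IsMultiplierBounded 𝕜 (fun k => realComb 𝕜 u (w k)) K :=
    hu.realComb w fun i j m hi hj => hw i trivial j trivial m hi hj
  have happ : ∀ k, (∑ k ∈ S, Finsupp.single k ‖c k‖ : ℕ →₀ ℝ) k = if k ∈ S then ‖c k‖ else 0 := by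
    intro k
    rw [Finsupp.finsetSum_apply]
    simp [Finsupp.single_apply]
  have hsub : (∑ k ∈ S, Finsupp.single k ‖c k‖ : ℕ →₀ ℝ).support ⊆ S := fun k hk => by
    by_contra h
    rw [Finsupp.mem_support_iff, happ, if_neg h] at hk
    exact hk rfl
  have hreal : realComb 𝕜 u (lcomb w (∑ k ∈ S, Finsupp.single k ‖c k‖)) =
      ∑ k ∈ S, (‖c k‖ : 𝕜) • realComb 𝕜 u (w k) := by
    rw [realComb_lcomb, sum_subset hsub]
    · exact sum_congr rfl fun k hk => by rw [happ, if_pos hk]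
    · intro k _ hk
      rw [Finsupp.notMem_support_iff.mp hk]; simp
  have hdiv1 : ∀ k, ‖c k / (‖c k‖ : 𝕜)‖ ≤ 1 := fun k => by
    rw [norm_div, RCLike.norm_ofReal, abs_norm]
    exact div_self_le_one _
  have hdiv2 : ∀ k, ‖(‖c k‖ : 𝕜) / c k‖ ≤ 1 := fun k => by
    rw [norm_div, RCLike.norm_ofReal, abs_norm]
    exact div_self_le_one _
  have e1 := hv S (fun k => (‖c k‖ : 𝕜)) (fun k => c k / (‖c k‖ : 𝕜)) hdiv1
  have e2 := hv S c (fun k => (‖c k‖ : 𝕜) / c k) hdiv2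
  have f1 : ∀ k, c k / (‖c k‖ : 𝕜) * (‖c k‖ : 𝕜) = c k := fun k => by
    by_cases h : c k = 0
    · simp [h]
    · exact div_mul_cancel₀ _ (by simpa using h)
  have f2 : ∀ k, (‖c k‖ : 𝕜) / c k * c k = (‖c k‖ : 𝕜) := fun k => by
    by_cases h : c k = 0
    · simp [h]
    · exact div_mul_cancel₀ _ h
  simp only [f1] at e1
  simp only [f2] at e2
  rw [← hreal] at e1 e2
  constructor
  · exact e1.trans (mul_le_mul_of_nonneg_left (norm_realComb_le u _) hK)
  · rw [mul_assoc]
    exact (hu.latticeLNorm_le _).trans (mul_le_mul_of_nonneg_left e2 hK)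

/-- In a space of finite cotype, a normalised sequence with bounded multipliers yields a subspace
without local unconditional structure unless it has a block sequence equivalent to the unit vector
basis of some `ℓ_p`. -/
theorem exists_subspace_or_isEllSeq (hX : CotypeWith X r C) (hr : 1 ≤ r) (hC : 1 ≤ C)
    (hu : IsMultiplierBounded 𝕜 u K) (hu1 : ∀ k, ‖u k‖ = 1) :
    (∃ Y : Submodule 𝕜 X, IsClosed (Y : Set X) ∧ Nonempty (SchauderBasis 𝕜 Y) ∧
      ¬ HasLocalUnconditionalStructure 𝕜 Y) ∨
    ∃ (v : ℕ → X) (p L : ℝ), 1 ≤ p ∧ 1 ≤ L ∧ IsEllSeq 𝕜 v p L := by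
  classical
  set N := latticeLNorm 𝕜 u with hN
  have hNN : N.Normalized := latticeLNorm_normalized hu1
  have hK1 : 1 ≤ K := one_le_of_isMultiplierBounded hu hu1
  have hK0 : 0 < K := one_pos.trans_le hK1
  by_cases hv : Violates N
  · exact Or.inl (exists_subspace_of_violates hX hr hC hu hu1 hv)
  right
  obtain ⟨e₀, z₀, c₀, C₀, h₀s, h₀n, h₀, -⟩ := exists_spread_embBy hNN hv
  obtain ⟨e, ⟨hes, hen, heN⟩, hmin⟩ := exists_minimal_of_not_violates hv
    (fun e => e.Spread ∧ e.Normalized ∧ Emb N e)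
    (by
      rintro e ⟨h1, h2, w, c, C, hw⟩
      exact ⟨h1, h2, _, hw.repT h2 h1⟩)
    ⟨e₀, h₀s, h₀n, _, _, _, h₀⟩
  have hev : ¬ Violates e := fun h => hv (h.of_emb hen heN)
  obtain ⟨D, hD1, hmul⟩ := exists_multiplicative hes hen hev fun f hf1 hf2 hf3 hf4 =>
    hmin f ⟨hf1, hf2, heN.trans hen hf3⟩ hf4
  obtain ⟨w, c, C', hw⟩ := heN
  have hc := hw.pos
  have hC'0 : 0 < C' := hc.trans_le (hw.nonneg hen)
  have hwd := hw.block.disjSupp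
  -- the lower estimate for `e` on indicators comes from the cotype of `X`
  have hlow : ∀ n : ℕ, (n : ℝ) ^ (1 / r) ≤ K / c * (C * (K * C')) * e (ones n) := by
    intro n
    have hr0 : 0 < r := by linarith
    have h1 := hX n fun i => realComb 𝕜 u (w i)
    have hnorm : ∀ k, c / K ≤ ‖realComb 𝕜 u (w k)‖ := fun k => by
      have h2 := hw.lower (Finsupp.single k 1)
      rw [hen, mul_one, lcomb, Finsupp.linearCombination_single, one_smul] at h2
      rw [div_le_iff₀ hK0, mul_comm]
      exact h2.trans (hu.latticeLNorm_le _)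
    have h3 : (n : ℝ) ^ (1 / r) * (c / K) ≤ (∑ i : Fin n, ‖realComb 𝕜 u (w i)‖ ^ r) ^ (1 / r) := by
      calc (n : ℝ) ^ (1 / r) * (c / K) = (n * (c / K) ^ r) ^ (1 / r) := by
            rw [Real.mul_rpow (by positivity) (by positivity), ← Real.rpow_mul (by positivity),
              mul_one_div_cancel hr0.ne', Real.rpow_one]
        _ ≤ _ := by
            refine Real.rpow_le_rpow (by positivity) ?_ (by positivity)
            calc n * (c / K) ^ r = ∑ _i : Fin n, (c / K) ^ r := by simp
              _ ≤ _ := sum_le_sum fun i _ => Real.rpow_le_rpow (by positivity) (hnorm i) hr0.le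
    have h4 : ∀ ε : Fin n → ℤˣ, ‖∑ i, ε i • realComb 𝕜 u (w i)‖ ≤ K * (C' * e (ones n)) := by
      intro ε
      set d : ℕ → 𝕜 := fun k => if h : k < n then (((ε ⟨k, h⟩ : ℤˣ) : ℤ) : 𝕜) else 0 with hd
      have h5 := (norm_sum_realComb_equiv hu hK0.le hwd (range n) d).1
      have h6 : ∑ k ∈ range n, d k • realComb 𝕜 u (w k) = ∑ i, ε i • realComb 𝕜 u (w i) := by
        rw [← Fin.sum_univ_eq_sum_range (fun k => d k • realComb 𝕜 u (w k))]
        refine sum_congr rfl fun i _ => ?_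
        rw [signs_smul_eq_mul (𝕜 := 𝕜)]
        simp only [hd, i.2, dite_true]
      have h7 : (∑ k ∈ range n, Finsupp.single k ‖d k‖ : ℕ →₀ ℝ) = ones n := by
        ext k
        rw [Finsupp.finsetSum_apply, ones_apply]
        simp only [Finsupp.single_apply, sum_ite_eq', mem_range]
        split_ifs with h
        · simp only [hd, h, dite_true]
          rcases Int.units_eq_one_or (ε ⟨k, h⟩) with h | h <;> simp [h]
        · rfl
      rw [h6, h7] at h5
      exact h5.trans (mul_le_mul_of_nonneg_left (hw.upper _) hK0.le)
    have h8 : ((2 : ℝ) ^ n)⁻¹ * ∑ ε : Fin n → ℤˣ, ‖∑ i, ε i • realComb 𝕜 u (w i)‖ ≤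
        K * (C' * e (ones n)) := by
      rw [inv_mul_le_iff₀ (by positivity)]
      refine (sum_le_sum fun ε _ => h4 ε).trans_eq ?_
      simp
    have h9 := h3.trans (h1.trans (mul_le_mul_of_nonneg_left h8 (by linarith)))
    rw [mul_div_assoc', div_le_iff₀ hK0] at h9
    rw [div_mul_eq_mul_div, div_mul_eq_mul_div, le_div_iff₀ hc]
    linarith
  obtain ⟨p, hp, hps⟩ := exists_equiv_psum hen hes hD1 hmul (r := r) (by linarith) hlow
  have hp0 : 0 < p := by linarith
  have hD0 : 0 < D := by linarith
  set L := max (D / c * (K * K)) (K * (C' * D)) with hL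
  have hKKcC : 1 ≤ K * (C' * D) ∨ 1 ≤ D / c * (K * K) := by
    rcases le_total c 1 with h | h
    · right
      have : 1 ≤ D / c := (one_le_div hc).mpr (h.trans hD1)
      nlinarith [mul_le_mul hK1 hK1 zero_le_one hK0.le]
    · left
      have h1 : 1 ≤ C' := h.trans (hw.nonneg hen)
      have h2 : 1 ≤ C' * D := by nlinarith
      nlinarith
  refine ⟨fun k => realComb 𝕜 u (w k), p, L, hp, ?_, fun S d => ?_⟩
  · rcases hKKcC with h | h
    · exact h.trans (le_max_right _ _)
    · exact h.trans (le_max_left _ _)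
  obtain ⟨h1, h2⟩ := norm_sum_realComb_equiv hu hK0.le hwd S d
  set a : ℕ →₀ ℝ := ∑ k ∈ S, Finsupp.single k ‖d k‖ with ha
  have happ : ∀ k, a k = if k ∈ S then ‖d k‖ else 0 := by
    intro k
    rw [ha, Finsupp.finsetSum_apply]
    simp [Finsupp.single_apply]
  have hpa : psum p a = ∑ k ∈ S, ‖d k‖ ^ p := by
    rw [psum_eq_sum hp0 (s := S)]
    · exact sum_congr rfl fun k hk => by rw [happ, if_pos hk, abs_norm]
    · intro k hk
      by_contra h
      rw [Finsupp.mem_support_iff, happ, if_neg h] at hk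
      exact hk rfl
  rw [← hpa]
  have hpa0 : 0 ≤ psum p a ^ (1 / p) := Real.rpow_nonneg (psum_nonneg _ _) _
  obtain ⟨h3, h4⟩ := hps a
  constructor
  · calc psum p a ^ (1 / p) ≤ D * e a := h4
      _ ≤ D * ((K * K * ‖∑ k ∈ S, d k • realComb 𝕜 u (w k)‖) / c) := by
          refine mul_le_mul_of_nonneg_left ?_ hD0.le
          rw [le_div_iff₀ hc, mul_comm]
          exact (hw.lower a).trans h2
      _ = D / c * (K * K) * ‖∑ k ∈ S, d k • realComb 𝕜 u (w k)‖ := by ring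
      _ ≤ _ := mul_le_mul_of_nonneg_right (le_max_left _ _) (norm_nonneg _)
  · calc ‖∑ k ∈ S, d k • realComb 𝕜 u (w k)‖ ≤ K * (C' * (D * psum p a ^ (1 / p))) := by
          refine h1.trans (mul_le_mul_of_nonneg_left ((hw.upper a).trans ?_) hK0.le)
          exact mul_le_mul_of_nonneg_left h3 hC'0.le
      _ = K * (C' * D) * psum p a ^ (1 / p) := by ring
      _ ≤ _ := mul_le_mul_of_nonneg_right (le_max_right _ _) hpa0

end Dichotomy

/-! ### Rademacher functions in `ℓ_p` -/

section Rademacher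

variable {𝕜 : Type*} [RCLike 𝕜]

/-- The `p`-th moment of a Rademacher sum is comparable with the `p`-th power of its second
moment. -/
theorem exists_signs_rpow_moment {p : ℝ} (hp : 1 ≤ p) :
    ∃ κ : ℝ, 1 ≤ κ ∧ ∀ (ι : Type) [Fintype ι] [DecidableEq ι] (a : ι → 𝕜),
      Fintype.card (ι → ℤˣ) * (∑ l, ‖a l‖ ^ 2) ^ (p / 2) ≤
        κ * ∑ ε : ι → ℤˣ, ‖∑ l, ε l • a l‖ ^ p ∧
      ∑ ε : ι → ℤˣ, ‖∑ l, ε l • a l‖ ^ p ≤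
        κ * (Fintype.card (ι → ℤˣ) * (∑ l, ‖a l‖ ^ 2) ^ (p / 2)) := by
  have hp0 : 0 < p := by linarith
  set n := ⌈p⌉₊ with hn
  have hpn : p ≤ n := Nat.le_ceil p
  refine ⟨max (khintchineConst ^ p) (1 + momentConst n), ?_, fun ι _ _ a => ?_⟩
  · exact le_max_of_le_right (by linarith [momentConst_pos n])
  set q : ℝ := ∑ l, ‖a l‖ ^ 2 with hq
  have hq0 : 0 ≤ q := sum_nonneg fun l _ => by positivity
  set N : ℝ := (Fintype.card (ι → ℤˣ) : ℝ) with hN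
  have hN0 : 0 < N := by rw [hN]; exact_mod_cast Fintype.card_pos
  have hsp : ∀ t : ℝ, 0 ≤ t → Real.sqrt t ^ p = t ^ (p / 2) := fun t ht => by
    rw [Real.sqrt_eq_rpow, ← Real.rpow_mul ht]; congr 1; ring
  constructor
  · have h1 := khintchine_L1 a
    have h2 : (N * Real.sqrt q) ^ p ≤ (khintchineConst * ∑ ε : ι → ℤˣ, ‖∑ l, ε l • a l‖) ^ p :=
      Real.rpow_le_rpow (by positivity) h1 hp0.le
    have h3 : (∑ ε : ι → ℤˣ, ‖∑ l, ε l • a l‖) ^ p ≤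
        N ^ (p - 1) * ∑ ε : ι → ℤˣ, ‖∑ l, ε l • a l‖ ^ p := by
      have h := Real.rpow_sum_le_const_mul_sum_rpow (univ : Finset (ι → ℤˣ))
        (fun ε => ‖∑ l, ε l • a l‖) hp
      simpa [hN] using h
    have hs0 : 0 ≤ ∑ ε : ι → ℤˣ, ‖∑ l, ε l • a l‖ := sum_nonneg fun _ _ => norm_nonneg _
    have hs1 : 0 ≤ ∑ ε : ι → ℤˣ, ‖∑ l, ε l • a l‖ ^ p :=
      sum_nonneg fun _ _ => Real.rpow_nonneg (norm_nonneg _) _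
    rw [Real.mul_rpow hN0.le (Real.sqrt_nonneg _), hsp q hq0,
      Real.mul_rpow khintchineConst_pos.le hs0] at h2
    have h4 : N ^ (p - 1) * (N * q ^ (p / 2)) ≤
        N ^ (p - 1) * (khintchineConst ^ p * ∑ ε : ι → ℤˣ, ‖∑ l, ε l • a l‖ ^ p) := by
      calc N ^ (p - 1) * (N * q ^ (p / 2)) = N ^ p * q ^ (p / 2) := by
            rw [← mul_assoc, ← Real.rpow_add_one hN0.ne', sub_add_cancel]
        _ ≤ khintchineConst ^ p * (N ^ (p - 1) * ∑ ε : ι → ℤˣ, ‖∑ l, ε l • a l‖ ^ p) :=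
            h2.trans (mul_le_mul_of_nonneg_left h3 (Real.rpow_nonneg khintchineConst_pos.le _))
        _ = _ := by ring
    exact (le_of_mul_le_mul_left h4 (Real.rpow_pos_of_pos hN0 _)).trans
      (mul_le_mul_of_nonneg_right (le_max_left _ _) hs1)
  · rcases hq0.eq_or_lt with h0 | hqpos
    · have ha : ∀ l, a l = 0 := fun l => by
        have := (sum_eq_zero_iff_of_nonneg (fun l _ => by positivity)).mp h0.symm l (mem_univ l)
        simpa using this
      rw [← h0]
      simp [ha, Real.zero_rpow hp0.ne', Real.zero_rpow (half_pos hp0).ne']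
    set σ := Real.sqrt q with hσ
    have hσ0 : 0 < σ := Real.sqrt_pos.mpr hqpos
    have hmom := signs_moment (fun l => ((σ⁻¹ : ℝ) : 𝕜) * a l) (by
      simp only [norm_mul, RCLike.norm_ofReal, abs_of_pos (inv_pos.mpr hσ0), mul_pow]
      rw [← mul_sum, ← hq, inv_pow, hσ, Real.sq_sqrt hq0, inv_mul_cancel₀ hqpos.ne']) n
    have hsc : ∀ ε : ι → ℤˣ, ‖∑ l, ε l • (((σ⁻¹ : ℝ) : 𝕜) * a l)‖ = σ⁻¹ * ‖∑ l, ε l • a l‖ := by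
      intro ε
      have : ∑ l, ε l • (((σ⁻¹ : ℝ) : 𝕜) * a l) = ((σ⁻¹ : ℝ) : 𝕜) * ∑ l, ε l • a l := by
        rw [mul_sum]
        exact sum_congr rfl fun l _ => (mul_smul_comm _ _ _).symm
      rw [this, norm_mul, RCLike.norm_ofReal, abs_of_pos (inv_pos.mpr hσ0)]
    simp only [hsc] at hmom
    have hle : ∀ t : ℝ, 0 ≤ t → t ^ p ≤ 1 + t ^ n := fun t ht => by
      rcases le_total t 1 with h | h
      · exact (Real.rpow_le_one ht h hp0.le).trans (by linarith [pow_nonneg ht n])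
      · have := Real.rpow_le_rpow_of_exponent_le h hpn
        rw [Real.rpow_natCast] at this
        linarith
    have h5 : ∑ ε : ι → ℤˣ, (σ⁻¹ * ‖∑ l, ε l • a l‖) ^ p ≤ (1 + momentConst n) * N := by
      refine (sum_le_sum fun ε _ => hle _ (by positivity)).trans ?_
      rw [sum_add_distrib]
      have : ∑ _ε : ι → ℤˣ, (1 : ℝ) = N := by simp [hN]
      rw [this]
      linarith
    have h6 : ∑ ε : ι → ℤˣ, ‖∑ l, ε l • a l‖ ^ p =
        σ ^ p * ∑ ε : ι → ℤˣ, (σ⁻¹ * ‖∑ l, ε l • a l‖) ^ p := by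
      rw [mul_sum]
      refine sum_congr rfl fun ε _ => ?_
      rw [← Real.mul_rpow hσ0.le (by positivity), mul_inv_cancel_left₀ hσ0.ne']
    rw [h6, hsp q hq0]
    calc q ^ (p / 2) * ∑ ε : ι → ℤˣ, (σ⁻¹ * ‖∑ l, ε l • a l‖) ^ p
        ≤ q ^ (p / 2) * ((1 + momentConst n) * N) := mul_le_mul_of_nonneg_left h5 (by positivity)
      _ = (1 + momentConst n) * (N * q ^ (p / 2)) := by ring
      _ ≤ _ := mul_le_mul_of_nonneg_right (le_max_right _ _) (by positivity)

variable {X : Type*} [NormedAddCommGroup X] [NormedSpace 𝕜 X] {v : ℕ → X} {p L : ℝ}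

theorem IsEllSeq.comp_injective (hv : IsEllSeq 𝕜 v p L) {ι : Type*} {ψ : ι → ℕ}
    (hψ : Function.Injective ψ) (S : Finset ι) (c : ι → 𝕜) :
    (∑ k ∈ S, ‖c k‖ ^ p) ^ (1 / p) ≤ L * ‖∑ k ∈ S, c k • v (ψ k)‖ ∧
    ‖∑ k ∈ S, c k • v (ψ k)‖ ≤ L * (∑ k ∈ S, ‖c k‖ ^ p) ^ (1 / p) := by
  have h := hv (S.map ⟨ψ, hψ⟩) (Function.extend ψ c 0)
  simpa only [sum_map, Function.Embedding.coeFn_mk, hψ.extend_apply] using h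

/-- The norm of `ℓ_p(ℓ_2)` of the coefficients `c j`, `j ∈ S`, where `γ` assigns to each index the
copy of `ℓ_2` in which it lives. -/
noncomputable def mixedNorm {J Γ : Type*} [DecidableEq Γ] (γ : J → Γ) (p : ℝ) (S : Finset J)
    (c : J → 𝕜) : ℝ :=
  (∑ g ∈ S.image γ, (∑ j ∈ S with γ j = g, ‖c j‖ ^ 2) ^ (p / 2)) ^ (1 / p)

theorem sum_filter_eq_sum_subtype {J Γ E : Type*} [DecidableEq Γ] [AddCommMonoid E] {γ : J → Γ}
    (g : Γ) [Fintype {j // γ j = g}] {S : Finset J} (f : J → E) (hf : ∀ j ∉ S, f j = 0) :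
    ∑ j ∈ S with γ j = g, f j = ∑ j : {j // γ j = g}, f j := by
  have h1 : ∑ j : {j // γ j = g}, f j =
      ∑ j ∈ (univ : Finset {j // γ j = g}).map (Function.Embedding.subtype _), f j := by
    rw [sum_map]; rfl
  rw [h1]
  refine sum_subset (fun j hj => ?_) fun j hj hjS => ?_
  · rw [mem_filter] at hj
    exact mem_map.mpr ⟨⟨j, hj.2⟩, mem_univ _, rfl⟩
  · obtain ⟨i, -, rfl⟩ := mem_map.mp hj
    refine hf _ fun h => hjS (mem_filter.mpr ⟨h, i.2⟩)

/-- Replacing the unit vectors of each copy of `ℓ_2` by Rademacher functions embeds finite parts of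
`ℓ_p(ℓ_2)` into `ℓ_p`. -/
theorem IsEllSeq.exists_mixedNorm (hv : IsEllSeq 𝕜 v p L) (hp : 1 ≤ p) (hL : 1 ≤ L)
    {J Γ : Type} [Countable J] [Countable Γ] [DecidableEq Γ] (γ : J → Γ)
    (hγ : ∀ g, Finite {j // γ j = g}) :
    ∃ (F : J → X) (K : ℝ), 1 ≤ K ∧ ∀ (S : Finset J) (c : J → 𝕜),
      mixedNorm γ p S c ≤ K * ‖∑ j ∈ S, c j • F j‖ ∧
      ‖∑ j ∈ S, c j • F j‖ ≤ K * mixedNorm γ p S c := by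
  classical
  have hp0 : 0 < p := by linarith
  obtain ⟨κ, hκ, hmom⟩ := exists_signs_rpow_moment (𝕜 := 𝕜) hp
  have hκ0 : 0 < κ := by linarith
  have : ∀ g, Fintype {j // γ j = g} := fun g => Fintype.ofFinite _
  have hcnt : Countable (Σ g, {j // γ j = g} → ℤˣ) := inferInstance
  obtain ⟨ψ, hψ⟩ := Countable.exists_injective_nat (Σ g, {j // γ j = g} → ℤˣ)
  -- each copy `g` of `ℓ_2` uses one position for each choice of signs of its indices, and the
  -- factor `s g` normalises the Rademacher functions in `ℓ_p`
  set N : Γ → ℝ := fun g => Fintype.card ({j // γ j = g} → ℤˣ) with hN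
  have hN0 : ∀ g, 0 < N g := fun g => by simp only [hN]; exact_mod_cast Fintype.card_pos
  set s : Γ → ℝ := fun g => N g ^ (-(1 / p)) with hs
  have hs0 : ∀ g, 0 < s g := fun g => Real.rpow_pos_of_pos (hN0 g) _
  have hsp : ∀ g, s g ^ p * N g = 1 := fun g => by
    rw [hs]
    simp only
    rw [← Real.rpow_mul (hN0 g).le, neg_mul, one_div_mul_cancel hp0.ne', Real.rpow_neg_one,
      inv_mul_cancel₀ (hN0 g).ne']
  set F : J → X := fun j => ∑ ω : {i // γ i = γ j} → ℤˣ, ((s (γ j) : ℝ) : 𝕜) •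
    (ω ⟨j, rfl⟩ • v (ψ ⟨γ j, ω⟩)) with hF
  have hFg : ∀ (g : Γ) (j : {j // γ j = g}), F j = ∑ ω : {j // γ j = g} → ℤˣ,
      ((s g : ℝ) : 𝕜) • (ω j • v (ψ ⟨g, ω⟩)) := by
    rintro g ⟨j, rfl⟩
    rfl
  refine ⟨F, L * κ ^ (1 / p), ?_, fun S c => ?_⟩
  · exact one_le_mul_of_one_le_of_one_le hL (Real.one_le_rpow hκ (by positivity))
  set d : J → 𝕜 := fun j => if j ∈ S then c j else 0 with hd
  have hd0 : ∀ j ∉ S, d j = 0 := fun j hj => if_neg hj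
  set x : (Σ g, {j // γ j = g} → ℤˣ) → 𝕜 := fun y =>
    ((s y.1 : ℝ) : 𝕜) * ∑ j : {j // γ j = y.1}, y.2 j • d j with hx
  have hsum : ∑ j ∈ S, c j • F j = ∑ y ∈ (S.image γ).sigma fun _ => univ, x y • v (ψ y) := by
    rw [← sum_fiberwise_of_maps_to (fun j hj => mem_image_of_mem γ hj), sum_sigma]
    refine sum_congr rfl fun g _ => ?_
    have h1 : ∑ j ∈ S with γ j = g, c j • F j = ∑ j ∈ S with γ j = g, d j • F j :=
      sum_congr rfl fun j hj => by simp only [hd, if_pos (mem_filter.mp hj).1]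
    rw [h1, sum_filter_eq_sum_subtype g (S := S) (fun j => d j • F j)
      fun j hj => by rw [hd0 j hj, zero_smul]]
    simp only [hFg, smul_sum]
    rw [sum_comm]
    refine sum_congr rfl fun ω _ => ?_
    simp only [hx]
    rw [mul_sum, sum_smul]
    refine sum_congr rfl fun j _ => ?_
    rw [signs_smul_eq_mul (𝕜 := 𝕜), signs_smul_eq_mul (𝕜 := 𝕜), smul_eq_mul, smul_smul, smul_smul]
    congr 1
    ring
  have hxp : ∑ y ∈ (S.image γ).sigma fun _ => univ, ‖x y‖ ^ p =
      ∑ g ∈ S.image γ, s g ^ p * ∑ ω : {j // γ j = g} → ℤˣ, ‖∑ j, ω j • d j‖ ^ p := by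
    rw [sum_sigma]
    refine sum_congr rfl fun g _ => ?_
    rw [mul_sum]
    refine sum_congr rfl fun ω _ => ?_
    simp only [hx]
    rw [norm_mul, RCLike.norm_ofReal, abs_of_pos (hs0 g), Real.mul_rpow (hs0 g).le (norm_nonneg _)]
  have hdc : ∀ g, ∑ j : {j // γ j = g}, ‖d j‖ ^ 2 = ∑ j ∈ S with γ j = g, ‖c j‖ ^ 2 := by
    intro g
    rw [← sum_filter_eq_sum_subtype g (S := S) (fun j => ‖d j‖ ^ 2) fun j hj => by
      rw [hd0 j hj, norm_zero, zero_pow two_ne_zero]]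
    exact sum_congr rfl fun j hj => by simp only [hd, if_pos (mem_filter.mp hj).1]
  have hq0 : 0 ≤ ∑ g ∈ S.image γ, (∑ j ∈ S with γ j = g, ‖c j‖ ^ 2) ^ (p / 2) :=
    sum_nonneg fun g _ => Real.rpow_nonneg (sum_nonneg fun j _ => by positivity) _
  have hx0 : 0 ≤ ∑ y ∈ (S.image γ).sigma fun _ => univ, ‖x y‖ ^ p :=
    sum_nonneg fun y _ => Real.rpow_nonneg (norm_nonneg _) _
  have hlo : ∑ g ∈ S.image γ, (∑ j ∈ S with γ j = g, ‖c j‖ ^ 2) ^ (p / 2) ≤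
      κ * ∑ y ∈ (S.image γ).sigma fun _ => univ, ‖x y‖ ^ p := by
    rw [hxp, mul_sum]
    refine sum_le_sum fun g _ => ?_
    have h1 := mul_le_mul_of_nonneg_left (hmom _ fun j : {j // γ j = g} => d j).1
      (Real.rpow_nonneg (hs0 g).le p)
    rw [← mul_assoc, show (Fintype.card ({j // γ j = g} → ℤˣ) : ℝ) = N g from rfl, hsp, one_mul,
      hdc] at h1
    linarith
  have hup : ∑ y ∈ (S.image γ).sigma fun _ => univ, ‖x y‖ ^ p ≤
      κ * ∑ g ∈ S.image γ, (∑ j ∈ S with γ j = g, ‖c j‖ ^ 2) ^ (p / 2) := by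
    rw [hxp, mul_sum]
    refine sum_le_sum fun g _ => ?_
    have h1 := mul_le_mul_of_nonneg_left (hmom _ fun j : {j // γ j = g} => d j).2
      (Real.rpow_nonneg (hs0 g).le p)
    rw [show (Fintype.card ({j // γ j = g} → ℤˣ) : ℝ) = N g from rfl, hdc] at h1
    refine h1.trans_eq ?_
    linear_combination κ * (∑ j ∈ S with γ j = g, ‖c j‖ ^ 2) ^ (p / 2) * hsp g
  obtain ⟨e1, e2⟩ := hv.comp_injective hψ ((S.image γ).sigma fun _ => univ) x
  rw [hsum, mixedNorm]
  constructor
  · calc _ ≤ (κ * ∑ y ∈ (S.image γ).sigma fun _ => univ, ‖x y‖ ^ p) ^ (1 / p) :=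
          Real.rpow_le_rpow hq0 hlo (by positivity)
      _ = κ ^ (1 / p) * (∑ y ∈ (S.image γ).sigma fun _ => univ, ‖x y‖ ^ p) ^ (1 / p) :=
          Real.mul_rpow hκ0.le hx0
      _ ≤ κ ^ (1 / p) * (L * ‖∑ y ∈ (S.image γ).sigma fun _ => univ, x y • v (ψ y)‖) :=
          mul_le_mul_of_nonneg_left e1 (by positivity)
      _ = _ := by ring
  · calc _ ≤ L * (∑ y ∈ (S.image γ).sigma fun _ => univ, ‖x y‖ ^ p) ^ (1 / p) := e2
      _ ≤ L * (κ * ∑ g ∈ S.image γ, (∑ j ∈ S with γ j = g, ‖c j‖ ^ 2) ^ (p / 2)) ^ (1 / p) := by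
          refine mul_le_mul_of_nonneg_left ?_ (by linarith)
          exact Real.rpow_le_rpow hx0 hup (by positivity)
      _ = _ := by rw [Real.mul_rpow hκ0.le hq0]; ring

theorem mixedNorm_mono {J Γ : Type*} [DecidableEq Γ] (γ : J → Γ) (hp : 0 < p) (S : Finset J)
    {c d : J → 𝕜} (h : ∀ j, ‖c j‖ ≤ ‖d j‖) : mixedNorm γ p S c ≤ mixedNorm γ p S d := by
  refine Real.rpow_le_rpow
    (sum_nonneg fun g _ => Real.rpow_nonneg (sum_nonneg fun j _ => by positivity) _) ?_
    (by positivity)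
  refine sum_le_sum fun g _ => Real.rpow_le_rpow (sum_nonneg fun j _ => by positivity) ?_
    (by positivity)
  exact sum_le_sum fun j _ => pow_le_pow_left₀ (norm_nonneg _) (h j) 2

/-- If the indices lie in different copies of `ℓ_2` the mixed norm is that of `ℓ_p`. -/
theorem mixedNorm_one_of_injOn {J Γ : Type*} [DecidableEq Γ] {γ : J → Γ} {S : Finset J}
    (h : Set.InjOn γ S) : mixedNorm γ p S (fun _ => (1 : 𝕜)) = (S.card : ℝ) ^ (1 / p) := by
  classical
  rw [mixedNorm, sum_image h]
  congr 1
  rw [sum_congr rfl (g := fun _ => (1 : ℝ)) fun j hj => ?_]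
  · simp
  · have : (S.filter fun i => γ i = γ j) = {j} := by
      ext i
      simp only [mem_filter, mem_singleton]
      exact ⟨fun hi => h hi.1 hj hi.2, fun hi => by rw [hi]; exact ⟨hj, rfl⟩⟩
    simp [this]

/-- If all indices lie in the same copy of `ℓ_2` the mixed norm is that of `ℓ_2`. -/
theorem mixedNorm_one_of_const {J Γ : Type*} [DecidableEq Γ] {γ : J → Γ} {S : Finset J} {g : Γ}
    (hp : 0 < p) (hS : S.Nonempty) (h : ∀ j ∈ S, γ j = g) :
    mixedNorm γ p S (fun _ => (1 : 𝕜)) = (S.card : ℝ) ^ (1 / 2 : ℝ) := by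
  have h1 : S.image γ = {g} := by
    ext x
    simp only [mem_image, mem_singleton]
    constructor
    · rintro ⟨j, hj, rfl⟩; exact h j hj
    · rintro rfl
      obtain ⟨j, hj⟩ := hS
      exact ⟨j, hj, h j hj⟩
  have h2 : S.filter (fun j => γ j = g) = S := filter_true_of_mem h
  rw [mixedNorm, h1, sum_singleton, h2, ← Real.rpow_mul (sum_nonneg fun j _ => by positivity)]
  have h3 : p / 2 * (1 / p) = 1 / 2 := by field_simp
  rw [h3]
  simp

end Rademacher

/-! ### Subspaces of spaces containing `ℓ_p` -/

section EllP

variable {𝕜 : Type*} [RCLike 𝕜]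

theorem IsMultiplierBounded.comp_equiv {X : Type*} [NormedAddCommGroup X] [NormedSpace 𝕜 X]
    {ι ι' : Type*} {u : ι → X} {K : ℝ} (hu : IsMultiplierBounded 𝕜 u K) (e : ι' ≃ ι) :
    IsMultiplierBounded 𝕜 (fun i => u (e i)) K := by
  intro S c θ hθ
  have := hu (S.map e.toEmbedding) (fun i => c (e.symm i)) (fun i => θ (e.symm i)) fun i => hθ _
  simpa [sum_map] using this

/-- The points of cubical grids of all sizes divisible by three. -/
abbrev GridPoint : Type := Σ n : ℕ, Fin 3 → Fin (3 * (n + 1))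

/-- The map assigning to the `k`-th vector of the `i`-th sequence, where `k` is a grid point, the
copy of `ℓ_2` in which it lives, namely the point `π i k` of the `i`-th family of copies. -/
def gridGroup (π : Fin 3 → ∀ n : ℕ, (Fin 3 → Fin (3 * (n + 1))) → Fin 3 → Fin (3 * (n + 1)))
    (x : Fin 3 × GridPoint) : Fin 3 × GridPoint :=
  (x.1, ⟨x.2.1, π x.1 x.2.1 x.2.2⟩)

variable {X : Type u} [NormedAddCommGroup X] [NormedSpace 𝕜 X] {v : ℕ → X} {p L r C : ℝ}

/-- If on lines of the grid in the direction `i` the mixed norm behaves like `n ^ α` for the `i`-th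
sequence and like `n ^ β` for the other two, with `β < α`, then the three sequences form a violating
family, since in every colouring of a large grid some line in a direction `i` has many points of
colour `i`. -/
theorem IsEllSeq.exists_subspace_of_grid (hX : CotypeWith X r C) (hr : 1 ≤ r) (hC : 1 ≤ C)
    (hv : IsEllSeq 𝕜 v p L) (hp : 1 ≤ p) (hL : 1 ≤ L)
    (π : Fin 3 → ∀ n : ℕ, (Fin 3 → Fin (3 * (n + 1))) → Fin 3 → Fin (3 * (n + 1)))
    {α β : ℝ} (hαβ : β < α)
    (hα : ∀ n i a (D : Finset (Fin (3 * (n + 1)))), D.Nonempty →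
      mixedNorm (gridGroup π) p (D.image fun t => (i, ⟨n, Function.update a i t⟩))
        (fun _ => (1 : 𝕜)) = (D.card : ℝ) ^ α)
    (hβ : ∀ n i a (D : Finset (Fin (3 * (n + 1)))), D.Nonempty → ∀ j ≠ i,
      mixedNorm (gridGroup π) p (D.image fun t => (j, ⟨n, Function.update a i t⟩))
        (fun _ => (1 : 𝕜)) = (D.card : ℝ) ^ β) :
    ∃ Y : Submodule 𝕜 X, IsClosed (Y : Set X) ∧ Nonempty (SchauderBasis 𝕜 Y) ∧
      ¬ HasLocalUnconditionalStructure 𝕜 Y := by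
  classical
  have hp0 : 0 < p := by linarith
  obtain ⟨F, K, hK, hF⟩ := hv.exists_mixedNorm hp hL (gridGroup π) (by
    rintro ⟨i, n, g⟩
    refine Set.Finite.subset (Set.finite_range fun a : Fin 3 → Fin (3 * (n + 1)) =>
      ((i, ⟨n, a⟩) : Fin 3 × GridPoint)) ?_
    rintro ⟨j, m, a⟩ h
    have h1 := congrArg Prod.fst h
    have h2 := congrArg (fun x => x.2.1) h
    simp only [gridGroup] at h1 h2
    subst h1 h2
    exact ⟨a, rfl⟩)
  have hK0 : 0 < K := by linarith
  have hmult : IsMultiplierBounded 𝕜 F (K * K) := by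
    intro S c θ hθ
    refine (hF S _).2.trans ?_
    rw [mul_assoc]
    refine mul_le_mul_of_nonneg_left (le_trans ?_ (hF S c).1) hK0.le
    refine mixedNorm_mono _ hp0 S fun j => ?_
    rw [norm_mul]
    exact mul_le_of_le_one_left (norm_nonneg _) (hθ j)
  have hFn : ∀ x, 1 ≤ K * ‖F x‖ ∧ ‖F x‖ ≤ K := by
    intro x
    have h := hF {x} fun _ => 1
    rw [mixedNorm_one_of_injOn (by simp)] at h
    simpa using h
  have hinf : Infinite GridPoint := Infinite.of_injective
    (fun n => (⟨n, fun _ => 0⟩ : GridPoint)) fun m n h => congrArg Sigma.fst h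
  obtain ⟨e⟩ : Nonempty (ℕ ≃ GridPoint) := nonempty_equiv_of_countable
  set Φ : Fin 3 → ℕ → X := fun i k => (K : 𝕜) • F (i, e k) with hΦ
  have hn : ∀ x : X, ‖(K : 𝕜) • x‖ = K * ‖x‖ := fun x => by
    rw [norm_smul, RCLike.norm_ofReal, abs_of_pos hK0]
  have hΦm : IsMultiplierBounded 𝕜 (fun a : Fin 3 × ℕ => Φ a.1 a.2) (K * K) :=
    (hmult.comp_equiv ((Equiv.refl (Fin 3)).prodCongr e)).smul fun _ => (K : 𝕜)
  refine IsViolatingFamily.exists_subspace (F := Φ) (A := K * K) hX hr hC (fun i k => ?_)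
    (fun i k => ?_) hΦm.isUncondFamily fun M => ?_
  · rw [hn]; exact (hFn _).1
  · rw [hn]; exact mul_le_mul_of_nonneg_left (hFn _).2 hK0.le
  -- the size of the grid
  obtain ⟨n, hnM⟩ : ∃ n : ℕ, ∀ d : ℕ, n ≤ d → |M| * K * K < (d : ℝ) ^ (α - β) := by
    have h := (tendsto_rpow_atTop (sub_pos.mpr hαβ)).comp
      (tendsto_natCast_atTop_atTop (R := ℝ))
    obtain ⟨n, hn⟩ := eventually_atTop.mp (h.eventually_gt_atTop (|M| * K * K))
    exact ⟨n, hn⟩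
  refine ⟨univ.image fun a => e.symm ⟨n, a⟩, fun col => ?_⟩
  obtain ⟨i, a, hia⟩ := exists_line_of_colouring n.succ_pos fun a => col (e.symm ⟨n, a⟩)
  set D : Finset (Fin (3 * (n + 1))) :=
    univ.filter fun t => col (e.symm ⟨n, Function.update a i t⟩) = i with hD
  have hDn : n + 1 ≤ D.card := hia
  have hDne : D.Nonempty := card_pos.mp (by omega)
  set ℓ : Fin (3 * (n + 1)) → ℕ := fun t => e.symm ⟨n, Function.update a i t⟩ with hℓ
  have hinj0 : Function.Injective fun t => (⟨n, Function.update a i t⟩ : GridPoint) := fun s t h => by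
    have h1 : Function.update a i s = Function.update a i t := by simpa using h
    exact Function.update_injective a i h1
  have hℓi : Function.Injective ℓ := e.symm.injective.comp hinj0
  have hsub : D.image ℓ ⊆ univ.image fun a => e.symm ⟨n, a⟩ := by
    intro k hk
    obtain ⟨t, -, rfl⟩ := mem_image.mp hk
    exact mem_image.mpr ⟨_, mem_univ _, rfl⟩
  have hsum : ∀ j, ∑ k ∈ univ.image fun a => e.symm ⟨n, a⟩,
      (if k ∈ D.image ℓ then (1 : 𝕜) else 0) • Φ j k = (K : 𝕜) •
        ∑ x ∈ D.image fun t => ((j, ⟨n, Function.update a i t⟩) : Fin 3 × GridPoint),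
          (1 : 𝕜) • F x := by
    intro j
    rw [← sum_subset hsub fun k _ hk => by rw [if_neg hk, zero_smul], sum_image hℓi.injOn,
      sum_image (fun s _ t _ h => hinj0 (congrArg Prod.snd h)), smul_sum]
    refine sum_congr rfl fun t ht => ?_
    rw [if_pos (mem_image_of_mem ℓ ht), one_smul, one_smul]
    simp only [hΦ, hℓ, Equiv.apply_symm_apply]
  refine ⟨i, fun k => if k ∈ D.image ℓ then 1 else 0, fun k hk => ?_, fun j hj => ?_⟩
  · have hk' : k ∈ D.image ℓ := by
      by_contra h
      exact hk (if_neg h)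
    refine ⟨hsub hk', ?_⟩
    obtain ⟨t, ht, rfl⟩ := mem_image.mp hk'
    exact (mem_filter.mp ht).2
  · rw [hsum, hsum, hn, hn]
    have h1 := (hF (D.image fun t => (i, ⟨n, Function.update a i t⟩)) fun _ => 1).1
    have h2 := (hF (D.image fun t => (j, ⟨n, Function.update a i t⟩)) fun _ => 1).2
    rw [hα n i a D hDne] at h1
    rw [hβ n i a D hDne j hj] at h2
    have hd0 : (0 : ℝ) < D.card := by exact_mod_cast card_pos.mpr hDne
    have h3 := hnM D.card (by omega)
    rw [Real.rpow_sub hd0, lt_div_iff₀ (Real.rpow_pos_of_pos hd0 _)] at h3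
    set x := ∑ x ∈ D.image fun t => ((i, ⟨n, Function.update a i t⟩) : Fin 3 × GridPoint),
          (1 : 𝕜) • F x
    set y := ∑ x ∈ D.image fun t => ((j, ⟨n, Function.update a i t⟩) : Fin 3 × GridPoint),
          (1 : 𝕜) • F x
    calc M * (K * ‖y‖) ≤ |M| * (K * (K * (D.card : ℝ) ^ β)) := by
          refine mul_le_mul (le_abs_self M) ?_ (by positivity) (abs_nonneg _)
          exact mul_le_mul_of_nonneg_left h2 hK0.le
      _ = |M| * K * K * (D.card : ℝ) ^ β := by ring
      _ < (D.card : ℝ) ^ α := h3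
      _ ≤ K * ‖x‖ := h1

/-- If `p < 2` the points of the grid with the same `i`-th coordinate are put into one copy of
`ℓ_2`, if `p > 2` those which agree off the `i`-th coordinate. -/
theorem IsEllSeq.exists_subspace (hX : CotypeWith X r C) (hr : 1 ≤ r) (hC : 1 ≤ C)
    (hv : IsEllSeq 𝕜 v p L) (hp : 1 ≤ p) (hL : 1 ≤ L) (hp2 : p ≠ 2) :
    ∃ Y : Submodule 𝕜 X, IsClosed (Y : Set X) ∧ Nonempty (SchauderBasis 𝕜 Y) ∧
      ¬ HasLocalUnconditionalStructure 𝕜 Y := by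
  classical
  have hp0 : 0 < p := by linarith
  have hinj0 : ∀ n (i j : Fin 3) (a : Fin 3 → Fin (3 * (n + 1))), Function.Injective fun t =>
      ((j, ⟨n, Function.update a i t⟩) : Fin 3 × GridPoint) := fun n i j a s t h => by
    have h1 : Function.update a i s = Function.update a i t := by simpa using h
    exact Function.update_injective a i h1
  -- a map which is injective on a line gives the norm of `ℓ_p`, a constant one that of `ℓ_2`
  have hinj : ∀ (π : Fin 3 → ∀ n : ℕ, (Fin 3 → Fin (3 * (n + 1))) → Fin 3 → Fin (3 * (n + 1)))
      n i j a (D : Finset (Fin (3 * (n + 1)))),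
      (Function.Injective fun t => π j n (Function.update a i t)) →
      mixedNorm (gridGroup π) p (D.image fun t => (j, ⟨n, Function.update a i t⟩))
        (fun _ => (1 : 𝕜)) = (D.card : ℝ) ^ (1 / p) := by
    intro π n i j a D h
    rw [mixedNorm_one_of_injOn, card_image_of_injective _ (hinj0 n i j a)]
    intro x hx y hy hxy
    simp only [coe_image, Set.mem_image] at hx hy
    obtain ⟨s, -, rfl⟩ := hx
    obtain ⟨t, -, rfl⟩ := hy
    have h1 : π j n (Function.update a i s) = π j n (Function.update a i t) := by
      simpa [gridGroup] using hxy
    rw [h h1]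
  have hconst : ∀ (π : Fin 3 → ∀ n : ℕ, (Fin 3 → Fin (3 * (n + 1))) → Fin 3 → Fin (3 * (n + 1)))
      n i j a (D : Finset (Fin (3 * (n + 1)))), D.Nonempty →
      (∀ t, π j n (Function.update a i t) = π j n a) →
      mixedNorm (gridGroup π) p (D.image fun t => (j, ⟨n, Function.update a i t⟩))
        (fun _ => (1 : 𝕜)) = (D.card : ℝ) ^ (1 / 2 : ℝ) := by
    intro π n i j a D hD h
    rw [mixedNorm_one_of_const (g := (j, ⟨n, π j n a⟩)) hp0 (hD.image _),
      card_image_of_injective _ (hinj0 n i j a)]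
    intro x hx
    obtain ⟨t, -, rfl⟩ := mem_image.mp hx
    simp only [gridGroup, h]
  rcases hp2.lt_or_gt with hp2 | hp2
  · refine hv.exists_subspace_of_grid hX hr hC hp hL
      (fun i n a => Function.update (fun _ => 0) i (a i)) (α := 1 / p) (β := 1 / 2)
      (one_div_lt_one_div_of_lt hp0 hp2) (fun n i a D hD => ?_) fun n i a D hD j hj => ?_
    · refine hinj _ n i i a D fun s t h => ?_
      simpa using congrFun h i
    · refine hconst _ n i j a D hD fun t => ?_
      rw [Function.update_of_ne hj]
  · refine hv.exists_subspace_of_grid hX hr hC hp hL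
      (fun i n a => Function.update a i 0) (α := 1 / 2) (β := 1 / p)
      (one_div_lt_one_div_of_lt two_pos hp2) (fun n i a D hD => ?_) fun n i a D hD j hj => ?_
    · refine hconst _ n i i a D hD fun t => ?_
      rw [Function.update_idem]
    · refine hinj _ n i j a D fun s t h => ?_
      have := congrFun h i
      simpa [Function.update_of_ne hj.symm] using this

/-- The map which sends the unit vectors of `ℓ_2` to the `v k` is an isomorphism onto its range. -/
theorem IsEllSeq.containsEllTwo [CompleteSpace X] (hv : IsEllSeq 𝕜 v 2 L) (hL : 1 ≤ L) :
    ContainsEllTwo 𝕜 X := by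
  classical
  have h2 : (2 : ENNReal).toReal = 2 := by norm_num
  have hsq : ∀ f : lp (fun _ : ℕ => 𝕜) 2, HasSum (fun k => ‖f k‖ ^ (2 : ℝ)) (‖f‖ ^ (2 : ℝ)) := by
    intro f
    have := lp.hasSum_norm (p := 2) (by rw [h2]; norm_num) f
    rwa [h2] at this
  have hL0 : 0 < L := by linarith
  have hsum : ∀ f : lp (fun _ : ℕ => 𝕜) 2, Summable fun k => f k • v k := by
    intro f
    rw [summable_iff_vanishing_norm]
    intro ε hε
    obtain ⟨s, hs⟩ := summable_iff_vanishing_norm.mp (hsq f).summable ((ε / L) ^ (2 : ℝ))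
      (by positivity)
    refine ⟨s, fun t ht => lt_of_le_of_lt (hv t f).2 ?_⟩
    have h3 := hs t ht
    have h4 : 0 ≤ ∑ k ∈ t, ‖f k‖ ^ (2 : ℝ) := sum_nonneg fun _ _ => by positivity
    rw [Real.norm_of_nonneg h4] at h3
    have h5 := Real.rpow_lt_rpow h4 h3 (z := 1 / 2) (by norm_num)
    rw [← Real.rpow_mul (by positivity), mul_one_div_cancel two_ne_zero, Real.rpow_one,
      lt_div_iff₀ hL0, mul_comm] at h5
    exact h5
  have hroot : ∀ f : lp (fun _ : ℕ => 𝕜) 2,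
      Tendsto (fun s => (∑ k ∈ s, ‖f k‖ ^ (2 : ℝ)) ^ (1 / 2 : ℝ)) atTop (𝓝 ‖f‖) := by
    intro f
    have h := (hsq f).rpow_const (p := 1 / 2) (Or.inr (by norm_num))
    rwa [← Real.rpow_mul (norm_nonneg _), mul_one_div_cancel two_ne_zero, Real.rpow_one] at h
  let T : lp (fun _ : ℕ => 𝕜) 2 →ₗ[𝕜] X :=
    { toFun := fun f => ∑' k, f k • v k
      map_add' := fun f g => by
        rw [← (hsum f).tsum_add (hsum g)]
        exact tsum_congr fun k => by rw [lp.coeFn_add, Pi.add_apply, add_smul]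
      map_smul' := fun c f => by
        rw [RingHom.id_apply, ← (hsum f).tsum_const_smul c]
        exact tsum_congr fun k => by rw [lp.coeFn_smul, Pi.smul_apply, smul_assoc] }
  have hT : ∀ f, Tendsto (fun s => ‖∑ k ∈ s, f k • v k‖) atTop (𝓝 ‖T f‖) := fun f =>
    (hsum f).hasSum.norm
  have hup : ∀ f, ‖T f‖ ≤ L * ‖f‖ := fun f =>
    le_of_tendsto_of_tendsto' (hT f) ((hroot f).const_mul L) fun s => (hv s f).2
  have hlo : ∀ f, ‖f‖ ≤ L * ‖T f‖ := fun f =>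
    le_of_tendsto_of_tendsto' (hroot f) ((hT f).const_mul L) fun s => (hv s f).1
  have hTi : Function.Injective T := by
    refine (injective_iff_map_eq_zero T).mpr fun f hf => ?_
    have := hlo f
    rw [hf, norm_zero, mul_zero] at this
    exact norm_le_zero_iff.mp this
  refine ⟨LinearMap.range T, ⟨((LinearEquiv.ofInjective T hTi).toContinuousLinearEquivOfBounds L L
    (fun f => hup f) fun y => ?_).symm⟩⟩
  obtain ⟨f, rfl⟩ := (LinearEquiv.ofInjective T hTi).surjective y
  rw [LinearEquiv.symm_apply_apply]
  exact hlo f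

end EllP

/-! ### Spaces with an unconditional basis -/

section UnconditionalBasis

variable {𝕜 : Type*} [RCLike 𝕜] {Y : Type u} [NormedAddCommGroup Y] [NormedSpace 𝕜 Y]

/-- The space `Y`, to be endowed with the norm `q` instead of its own. -/
def Renormed (_q : Seminorm 𝕜 Y) : Type u := Y

instance (q : Seminorm 𝕜 Y) : AddCommGroup (Renormed q) := inferInstanceAs (AddCommGroup Y)

instance (q : Seminorm 𝕜 Y) : Module 𝕜 (Renormed q) := inferInstanceAs (Module 𝕜 Y)

/-- An equivalent norm on `Y` is the norm of a space isomorphic to `Y`. -/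
theorem exists_renorm (q : Seminorm 𝕜 Y) {K : ℝ} (h1 : ∀ x, ‖x‖ ≤ q x) (h2 : ∀ x, q x ≤ K * ‖x‖) :
    ∃ (F : Type u) (_ : NormedAddCommGroup F) (_ : NormedSpace 𝕜 F) (e : Y ≃L[𝕜] F),
      ∀ x, ‖e x‖ = q x := by
  let _ : Norm (Renormed q) := ⟨fun x => q x⟩
  have core : NormedSpace.Core 𝕜 (Renormed q) :=
    { norm_nonneg := fun x => apply_nonneg q x
      norm_smul := fun c x => map_smul_eq_mul q c x
      norm_triangle := fun x y => map_add_le_add q x y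
      norm_eq_zero_iff := fun x => by
        constructor
        · intro h
          exact norm_le_zero_iff.mp ((h1 x).trans_eq h)
        · rintro rfl
          exact map_zero q }
  let _ : NormedAddCommGroup (Renormed q) := NormedAddCommGroup.ofCore core
  let _ : NormedSpace 𝕜 (Renormed q) := NormedSpace.ofCore core
  let e₀ : Y ≃ₗ[𝕜] Renormed q := LinearEquiv.refl 𝕜 Y
  refine ⟨Renormed q, inferInstance, inferInstance,
    e₀.toContinuousLinearEquivOfBounds K 1 (fun x => h2 x) (fun x => ?_), fun x => rfl⟩
  rw [one_mul]
  exact h1 x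

/-- The image of an unconditional basis under an isomorphism. -/
noncomputable def unconditionalBasisMap {F : Type*} [NormedAddCommGroup F] [NormedSpace 𝕜 F]
    (e : Y ≃L[𝕜] F) {β : Type*} (b : UnconditionalSchauderBasis β 𝕜 Y) :
    UnconditionalSchauderBasis β 𝕜 F where
  basis j := e (b j)
  coord j := (b.coord j).comp (e.symm : F →L[𝕜] Y)
  ortho i j := by simpa using b.ortho i j
  expansion x := by
    have := (b.expansion (e.symm x)).mapL (e : Y →L[𝕜] F)
    simpa using this

theorem HasUnconditionalBasis.map {F : Type*} [NormedAddCommGroup F] [NormedSpace 𝕜 F]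
    (e : Y ≃L[𝕜] F) (h : HasUnconditionalBasis 𝕜 Y) : HasUnconditionalBasis 𝕜 F :=
  Nonempty.map (unconditionalBasisMap e) h

/-- The supremum of the norms of the finite parts of the expansion of a vector, with arbitrary
changes of signs, is an equivalent norm for which the basis is `1`-unconditional. -/
theorem HasUnconditionalBasis.hasLocalUnconditionalStructure [CompleteSpace Y]
    (h : HasUnconditionalBasis 𝕜 Y) : HasLocalUnconditionalStructure 𝕜 Y := by
  classical
  obtain ⟨b⟩ := h
  obtain ⟨K, hK⟩ := exists_isMultiplierBounded_basis b
  set f : Finset ℕ × (ℕ → ℤˣ) → Y → ℝ := fun s x => ‖∑ j ∈ s.1, s.2 j • (b.coord j x • b j)‖ with hf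
  have htend : ∀ x : Y, Tendsto (fun T => ∑ j ∈ T, b.coord j x • b j) atTop (𝓝 x) := fun x => by
    simpa [HasSum] using b.expansion x
  have hfK : ∀ s x, f s x ≤ K * ‖x‖ := by
    intro s x
    refine ge_of_tendsto ((htend x).norm.const_mul K) ?_
    filter_upwards [eventually_ge_atTop s.1] with T hT
    have h1 := hK T (fun j => b.coord j x) (fun j => if j ∈ s.1 then ((s.2 j : ℤ) : 𝕜) else 0)
      fun j => by
        split_ifs
        · rcases Int.units_eq_one_or (s.2 j) with h | h <;> simp [h]
        · simp
    refine le_trans (le_of_eq ?_) h1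
    simp only [hf]
    congr 1
    rw [← sum_subset hT fun j _ hj => by rw [if_neg hj, zero_mul, zero_smul]]
    exact sum_congr rfl fun j hj => by
      rw [if_pos hj, mul_smul, signs_smul_eq_mul (𝕜 := 𝕜)]
  have hbdd : ∀ x, BddAbove (Set.range fun s => f s x) := fun x => ⟨K * ‖x‖, by
    rintro _ ⟨s, rfl⟩; exact hfK s x⟩
  have hf0 : ∀ s x, 0 ≤ f s x := fun s x => norm_nonneg _
  have hfadd : ∀ s x y, f s (x + y) ≤ f s x + f s y := fun s x y => by
    simp only [hf]
    refine le_trans (le_of_eq ?_) (norm_add_le _ _)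
    rw [← sum_add_distrib]
    congr 1
    exact sum_congr rfl fun j _ => by rw [map_add, add_smul, smul_add]
  have hfsmul : ∀ s (c : 𝕜) x, f s (c • x) = ‖c‖ * f s x := fun s c x => by
    simp only [hf]
    rw [← norm_smul, smul_sum]
    congr 1
    exact sum_congr rfl fun j _ => by
      rw [map_smul, smul_eq_mul, mul_smul]
      exact smul_comm _ _ _
  set q : Seminorm 𝕜 Y := Seminorm.of (fun x => ⨆ s, f s x)
    (fun x y => ciSup_le fun s => (hfadd s x y).trans
      (add_le_add (le_ciSup (hbdd x) s) (le_ciSup (hbdd y) s)))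
    (fun c x => by simp only [hfsmul]; rw [Real.mul_iSup_of_nonneg (norm_nonneg c)]) with hq
  have hqx : ∀ x, q x = ⨆ s, f s x := fun x => rfl
  have h1 : ∀ x, ‖x‖ ≤ q x := fun x => by
    refine le_of_tendsto (htend x).norm (Eventually.of_forall fun T => ?_)
    refine le_trans (le_of_eq ?_) (le_ciSup (hbdd x) (T, fun _ => 1))
    simp [hf]
  have h2 : ∀ x, q x ≤ K * ‖x‖ := fun x => ciSup_le fun s => hfK s x
  obtain ⟨F, _, _, e, he⟩ := exists_renorm q h1 h2
  have hF : CompleteSpace F :=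
    (completeSpace_congr (e := e.toEquiv) e.isUniformEmbedding).1 inferInstance
  refine ⟨max K 1, le_max_right _ _, fun X₀ _ => ⟨F, inferInstance, inferInstance, hF, ℕ,
    inferInstance, unconditionalBasisMap e b, (e : Y →L[𝕜] F).comp X₀.subtypeL,
    (e.symm : F →L[𝕜] Y), ?_, fun x => by simp, ?_⟩⟩
  · intro ε x
    obtain ⟨y, rfl⟩ := e.surjective x
    have hsum : Summable fun j => ε j • (b.coord j y • b j) := by
      rw [summable_iff_vanishing_norm]
      intro δ hδ
      have hs := (show HasSum (fun j => b.coord j y • b j) y from htend y).summable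
      obtain ⟨s, hs⟩ := summable_iff_vanishing_norm.mp hs (δ / (|K| + 1)) (by positivity)
      refine ⟨s, fun t ht => ?_⟩
      have h3 := hK t (fun j => b.coord j y) (fun j => ((ε j : ℤ) : 𝕜)) fun j => by
        rcases Int.units_eq_one_or (ε j) with h | h <;> simp [h]
      have h4 := hs t ht
      rw [lt_div_iff₀ (by positivity)] at h4
      calc ‖∑ j ∈ t, ε j • (b.coord j y • b j)‖
          = ‖∑ j ∈ t, (((ε j : ℤ) : 𝕜) * b.coord j y) • b j‖ := by
            congr 1
            exact sum_congr rfl fun j _ => by rw [mul_smul, signs_smul_eq_mul (𝕜 := 𝕜)]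
        _ ≤ (|K| + 1) * ‖∑ j ∈ t, b.coord j y • b j‖ := h3.trans
            (mul_le_mul_of_nonneg_right (by linarith [le_abs_self K]) (norm_nonneg _))
        _ < δ := by linarith
    obtain ⟨z, hz⟩ := hsum
    have hcz : ∀ i, b.coord i z = ε i • b.coord i y := fun i => by
      have h3 := hz.mapL (b.coord i)
      have h4 : HasSum (fun j => b.coord i (ε j • (b.coord j y • b j))) (ε i • b.coord i y) := by
        have h5 : b.coord i (ε i • (b.coord i y • b i)) = ε i • b.coord i y := by
          rw [signs_smul_eq_mul (𝕜 := 𝕜), map_smul, map_smul, b.ortho,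
            signs_smul_eq_mul (𝕜 := 𝕜)]
          simp
        rw [← h5]
        refine hasSum_single i fun j hj => ?_
        rw [signs_smul_eq_mul (𝕜 := 𝕜), map_smul, map_smul, b.ortho]
        simp [hj.symm]
      exact h3.unique h4
    refine ⟨e z, ?_, ?_⟩
    · have h3 := hz.mapL (e : Y →L[𝕜] F)
      convert h3 using 2 with j
      · simp [unconditionalBasisMap, signs_smul_eq_mul (𝕜 := 𝕜)]
      · rfl
    · rw [he, he]
      refine ciSup_le fun s => ?_
      have h3 := le_ciSup (hbdd y) (s.1, fun j => s.2 j * ε j)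
      refine le_trans (le_of_eq ?_) h3
      simp only [hf]
      congr 1
      exact sum_congr rfl fun j _ => by rw [hcz, smul_assoc, mul_smul]
  · have h3 : ‖(e.symm : F →L[𝕜] Y)‖ ≤ 1 := ContinuousLinearMap.opNorm_le_bound _ zero_le_one
      fun x => by
        obtain ⟨y, rfl⟩ := e.surjective x
        rw [one_mul, he]
        simpa using h1 y
    have h4 : ‖(e : Y →L[𝕜] F).comp X₀.subtypeL‖ ≤ max K 1 :=
      ContinuousLinearMap.opNorm_le_bound _ (zero_le_one.trans (le_max_right _ _)) fun x => by
        have h5 : ‖e (x : Y)‖ ≤ K * ‖(x : Y)‖ := (he _).trans_le (h2 _)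
        exact h5.trans (mul_le_mul_of_nonneg_right (le_max_left _ _) (norm_nonneg _))
    calc _ ≤ max K 1 * 1 := mul_le_mul h4 h3 (norm_nonneg _) (zero_le_one.trans (le_max_right _ _))
      _ = _ := mul_one _

end UnconditionalBasis

/-! ### The dichotomy -/

section Main

variable {𝕜 : Type*} [RCLike 𝕜] {X : Type u} [NormedAddCommGroup X] [NormedSpace 𝕜 X]
  [CompleteSpace X] {r : ℝ}

/-- The normalised basis yields the subspace directly, or a sequence equivalent to the unit vector basis
of some `ℓ_p`, where `p ≠ 2` since `X` does not contain `ℓ_2`, and which then yields it. -/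
theorem exists_subspace_of_hasUnconditionalBasis (hr : 2 ≤ r) (hX : HasCotype X r)
    (hb : HasUnconditionalBasis 𝕜 X) (h2 : ¬ ContainsEllTwo 𝕜 X) :
    ∃ Y : Submodule 𝕜 X, IsClosed (Y : Set X) ∧ Nonempty (SchauderBasis 𝕜 Y) ∧
      ¬ HasLocalUnconditionalStructure 𝕜 Y := by
  obtain ⟨b⟩ := hb
  obtain ⟨C, hC, hXC⟩ := hX.exists_one_le
  obtain ⟨K, hK⟩ := exists_isMultiplierBounded_basis b
  have hr1 : 1 ≤ r := by linarith
  have hu1 : ∀ k, ‖((‖b k‖⁻¹ : ℝ) : 𝕜) • b k‖ = 1 := fun k => by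
    rw [norm_smul, RCLike.norm_ofReal, abs_inv, abs_norm,
      inv_mul_cancel₀ (norm_ne_zero_iff.mpr (b.linearIndependent.ne_zero k))]
  rcases exists_subspace_or_isEllSeq hXC hr1 hC (hK.smul fun k => ((‖b k‖⁻¹ : ℝ) : 𝕜)) hu1 with
    h | ⟨v, p, L, hp, hL, hv⟩
  · exact h
  · by_cases hp2 : p = 2
    · subst hp2
      exact absurd (hv.containsEllTwo hL) h2
    · exact hv.exists_subspace hXC hr1 hC hp hL hp2

end Main
theorem theorem3p1 {𝕜 : Type v} [RCLike 𝕜] {X : Type u} [NormedAddCommGroup X]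
    [NormedSpace 𝕜 X] [CompleteSpace X] (r : ℝ) (hr : 2 ≤ r) (hX : HasCotype X r) :
    (HasUnconditionalBasis 𝕜 X → ¬ ContainsEllTwo 𝕜 X →
      ∃ Y : Submodule 𝕜 X, IsClosed (Y : Set X) ∧ Nonempty (SchauderBasis 𝕜 Y) ∧
        ¬ HasLocalUnconditionalStructure 𝕜 Y) ∧
    (¬ FiniteDimensional 𝕜 X →
      ContainsEllTwo 𝕜 X ∨
        ∃ Y : Submodule 𝕜 X, IsClosed (Y : Set X) ∧ ¬ FiniteDimensional 𝕜 Y ∧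
          ¬ HasUnconditionalBasis 𝕜 Y) := by
  refine ⟨exists_subspace_of_hasUnconditionalBasis hr hX, fun hfin => ?_⟩
  by_cases h2 : ContainsEllTwo 𝕜 X
  · exact Or.inl h2
  right
  by_cases hb : HasUnconditionalBasis 𝕜 X
  · obtain ⟨Y, hY, ⟨b⟩, hl⟩ := exists_subspace_of_hasUnconditionalBasis hr hX hb h2
    have : CompleteSpace Y := hY.completeSpace_coe
    refine ⟨Y, hY, fun _ => ?_, fun h => hl h.hasLocalUnconditionalStructure⟩
    have := b.linearIndependent.finite
    exact not_finite ℕ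
  · refine ⟨⊤, isClosed_univ, fun h => hfin ?_, fun h => hb (h.map ?_)⟩
    · exact Submodule.topEquiv.finiteDimensional
    · exact Submodule.topEquiv.toContinuousLinearEquivOfBounds 1 1 (fun x => (one_mul ‖x‖).ge)
        fun x => (one_mul ‖x‖).ge
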